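/- **Setting.** Let $(k,n)$ be $(3,9)$ or $(4,8)$ and $d=\gcd(k,n)$. $\mathrm{SSYT}(k,[n])$ is the set of rectangular semistandard tableaux with $k$ rows, any number of columns and entries in $\{1,\dots,n\}$; $S\cup T$ is the tableau whose $i$-th row is the multiset union of the $i$-th rows of $S$ and $T$. The initial quiver of $\mathbb C[\mathrm{Gr}(k,n)]$ has vertices $(0,0)$ and $(a,b)$, $1\le a\le n-k$, $1\le b\le k$, arrows $(0,0)\to(1,1)$, $(a-1,b)\to(a,b)$, $(a,b-1)\to(a,b)$, $(a+1,b+1)\to(a,b)$ (whenever both ends are vertices other than $(0,0)$), and at $(a,b)$ the Plücker coordinate $x_{a,b}$ with index set $\{1,\dots,k-b\}\cup\{k-b+a+1,\dots,k+a\}$, at $(0,0)$ the coordinate $P_{1\cdots k}$. The vertices $(a,b)$ with $a\le n-k-1$, $b\le k-1$ (and $a,b\ge1$) are active, the others frozen; there are $m=(n-k-1)(k-1)$ active ones. For an active vertex $v$ put $\hat y_v=\prod_u x_u^{b_{uv}}$, with $b_{uv}=\#\{u\to v\}-\#\{v\to u\}$. Writing $T=\bigcup_u S_u^{e_u}$ with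 $e_u\in\mathbb Z$, where $S_u$ is the one-column tableau of $x_u$, the restriction of $(e_u)$ to the active vertices is the truncated g-vector $\mathbf g_T\in\mathbb Z^m$ of $T$. $T$ has no frozen factor if it is not of the form $S_u\cup T''$ with $u$ frozen and $T''\in \mathrm{SSYT}(k,[n])$. For $\mathbf g\in\mathbb Z^m$, $T_{\mathbf g}$ denotes the tableau without frozen factors with truncated g-vector $\mathbf g$. On $k\times n$ matrices with columns $z_1,\dots,z_n$ (column indices modulo $n$), for $1\le i\le d-1$, the map $\sigma_i$ replaces $z_l$ by $z_{l+1}$ if $l\equiv i$ (mod $d$), by $$\frac{\det(z_{l-1},z_{l+1},\dots,z_{l-1+k})}{\det(z_{l},z_{l+1},\dots,z_{l-1+k})}\,z_{l}-z_{l-1}$$ if $l\equiv i+1$ (mod $d$), and keeps the other columns; these maps generate Fraser's action of the braid group $\mathrm{Br}_d$, and $\sigma_i^{-1}$ is given by the analogous formula. Let $\rho(z_1,\dots,z_n)=(z_2,\dots,z_n,(-1)^{k-1}z_1)$ and $\sigma_d=\rho^{-1}\sigma_{d-1}\rho$. Let $W=(\mathbf 1_k\mid M)$ be the web matrix, $$M_{ij}=(-1)^{k+i}\sum_{0\le\lambda_{k-i}\le\cdots\le\lambda_1\le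 j-1}\ \prod_{b=1}^{k-i}\prod_{a=1}^{\lambda_b}\chi_{a,b},$$ on which $\hat y_{(a,b)}=\chi_{a,b}$. For $f=\sigma_i^{\pm1}$ the tropical map $Q_f:\mathbb Z^m\to\mathbb Z^m$ is the max-tropicalisation of the subtraction-free rational map $\chi\mapsto \hat y(f^{-1}(W))$. It acts on truncated g-vectors, and on tableaux without frozen factors by $f(T)=T_{Q_f(\mathbf g_T)}$. A vector $\mathbf g\in \mathbb Z^m$ is a stable fixed point of $f$ if $Q_f(\mathbf g)=\mathbf g$ and there are $r\ge1$ and a primitive vector $\mathbf l \in\mathbb Z^m$ (gcd of the entries equal to $1$) with $\mathbf g=r\,\mathbf l$ such that for every generic $\mathbf g'\in\mathbb Z^m$ (outside the zero set of some nonzero polynomial) there are $c_j>0$ with $c_j\,Q_f^j(\mathbf g')\to\mathbf l$. By *the stable fixed points in $\mathrm{SSYT}(k,[n])$* we mean the tableaux without frozen factors whose truncated g-vector is a primitive stable fixed point of one of $\sigma_1,\dots,\sigma_d$. **Theorem.** Let $\varphi$ be Euler's totient function. 1. For every $r\ge1$, the number of tableaux with $r$ columns in $\mathrm{SSYT}(3,[9])$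 obtained by applying the braid group $\mathrm{Br}_3=\langle\sigma_1,\sigma_2\rangle$ to the stable fixed points in $\mathrm{SSYT}(3,[9])$ is $3\varphi(r/3)$ if $3\mid r$, and $0$ otherwise. 2. For every $r\ge1$, the number of tableaux with $r$ columns in $\mathrm{SSYT}(4,[8])$ obtained by applying the braid group $\mathrm{Br}_4=\langle\sigma_1,\sigma_2,\sigma_3\rangle$ to the stable fixed points in $\mathrm{SSYT}(4,[8])$ is $2\varphi(r/2)$ if $r$ is even, and $0$ if $r$ is odd. -/

import Mathlib

noncomputable section

namespace GrTrop

open Filter Topology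

/-! ### Tropicalisation (max convention) of subtraction-free rational functions -/

section Tropicalisation

variable {ι : Type*} [Fintype ι]

/-- `Trop⁺` of a polynomial with coefficients in `ℕ`: sums become maxima, products become sums,
the variable `X i` becomes the tropical variable `v i`. -/
def tropPoly (P : MvPolynomial ι ℕ) (v : ι → ℤ) : ℤ :=
  if h : P.support.Nonempty then P.support.sup' h (fun m => ∑ i, (m i : ℤ) * v i) else 0

/-- The field of rational functions in the variables indexed by `ι`. -/
abbrev RatFun (ι : Type*) : Type _ := FractionRing (MvPolynomial ι ℚ)

/-- A polynomial with natural number coefficients, seen as a rational function. -/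
def toRatFun (P : MvPolynomial ι ℕ) : RatFun ι :=
  algebraMap (MvPolynomial ι ℚ) (RatFun ι) (MvPolynomial.map (Nat.castRingHom ℚ) P)

/-- `P / Q` is a subtraction-free expression of the rational function `R`. -/
def IsSubtractionFreeExpr (R : RatFun ι) (P Q : MvPolynomial ι ℕ) : Prop :=
  P ≠ 0 ∧ Q ≠ 0 ∧ R = toRatFun P / toRatFun Q

open scoped Classical in
/-- `Trop⁺ R = Trop⁺ P - Trop⁺ Q` for a subtraction-free expression `R = P / Q`
(independent of the expression, see `tropRat_eq`). -/
def tropRat (R : RatFun ι) (v : ι → ℤ) : ℤ :=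
  if h : ∃ PQ : MvPolynomial ι ℕ × MvPolynomial ι ℕ, IsSubtractionFreeExpr R PQ.1 PQ.2 then
    tropPoly h.choose.1 v - tropPoly h.choose.2 v
  else 0

lemma toRatFun_injective {ι : Type*} : Function.Injective (toRatFun (ι := ι)) := by
  intro P Q h
  have h1 := IsFractionRing.injective (MvPolynomial ι ℚ) (RatFun ι) h
  exact MvPolynomial.map_injective _ (fun a b hab => by simpa using hab) h1

lemma toRatFun_mul {ι : Type*} (P Q : MvPolynomial ι ℕ) :
    toRatFun (P * Q) = toRatFun P * toRatFun Q := by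
  simp [toRatFun]

lemma toRatFun_ne_zero {ι : Type*} {P : MvPolynomial ι ℕ} (hP : P ≠ 0) : toRatFun P ≠ 0 := by
  intro h
  apply hP
  apply toRatFun_injective
  rw [h]
  simp [toRatFun]

lemma tropPoly_mul {P Q : MvPolynomial ι ℕ} (hP : P ≠ 0) (hQ : Q ≠ 0) (v : ι → ℤ) :
    P * Q ≠ 0 ∧ tropPoly (P * Q) v = tropPoly P v + tropPoly Q v := by
  classical
  have hP' : P.support.Nonempty := MvPolynomial.support_nonempty.mpr hP
  have hQ' : Q.support.Nonempty := MvPolynomial.support_nonempty.mpr hQ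
  set w : (ι →₀ ℕ) → ℤ := fun m => ∑ i, (m i : ℤ) * v i with hw
  have hadd : ∀ a b, w (a + b) = w a + w b := by
    intro a b
    simp [hw, add_mul, Finset.sum_add_distrib]
  obtain ⟨a, ha, hae⟩ := Finset.exists_mem_eq_sup' hP' w
  obtain ⟨b, hb, hbe⟩ := Finset.exists_mem_eq_sup' hQ' w
  have hmem : a + b ∈ (P * Q).support := by
    rw [MvPolynomial.mem_support_iff, MvPolynomial.coeff_mul]
    have h1 : P.coeff a * Q.coeff b ≤
        ∑ x ∈ Finset.HasAntidiagonal.antidiagonal (a + b), P.coeff x.1 * Q.coeff x.2 :=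
      Finset.single_le_sum (f := fun x : (ι →₀ ℕ) × (ι →₀ ℕ) => P.coeff x.1 * Q.coeff x.2)
        (fun _ _ => Nat.zero_le _)
        (Finset.HasAntidiagonal.mem_antidiagonal.mpr (rfl : (a, b).1 + (a, b).2 = a + b))
    have h2 : 0 < P.coeff a * Q.coeff b :=
      Nat.mul_pos (Nat.pos_of_ne_zero (MvPolynomial.mem_support_iff.mp ha))
        (Nat.pos_of_ne_zero (MvPolynomial.mem_support_iff.mp hb))
    omega
  have hne : (P * Q).support.Nonempty := ⟨_, hmem⟩
  refine ⟨MvPolynomial.support_nonempty.mp hne, ?_⟩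
  simp only [tropPoly, hP', hQ', hne, dif_pos]
  change (P * Q).support.sup' hne w = P.support.sup' hP' w + Q.support.sup' hQ' w
  apply le_antisymm
  · apply Finset.sup'_le
    intro m hm
    obtain ⟨c, hc, d, hd, rfl⟩ := Finset.mem_add.mp (MvPolynomial.support_mul P Q hm)
    rw [hadd]
    exact add_le_add (Finset.le_sup' w hc) (Finset.le_sup' w hd)
  · rw [hae, hbe, ← hadd]
    exact Finset.le_sup' w hmem

/-- The tropicalisation does not depend on the subtraction-free expression. -/
lemma tropRat_eq {R : RatFun ι} {P Q : MvPolynomial ι ℕ} (h : IsSubtractionFreeExpr R P Q)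
    (v : ι → ℤ) : tropRat R v = tropPoly P v - tropPoly Q v := by
  classical
  have hex : ∃ PQ : MvPolynomial ι ℕ × MvPolynomial ι ℕ,
      IsSubtractionFreeExpr R PQ.1 PQ.2 := ⟨(P, Q), h⟩
  obtain ⟨h1, h2, h3⟩ := hex.choose_spec
  obtain ⟨hP, hQ, hR⟩ := h
  have key : hex.choose.1 * Q = P * hex.choose.2 := by
    apply toRatFun_injective
    rw [toRatFun_mul, toRatFun_mul]
    have h4 := hR.symm.trans h3
    rw [div_eq_div_iff (toRatFun_ne_zero hQ) (toRatFun_ne_zero h2)] at h4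
    exact h4.symm
  have e1 := (tropPoly_mul h1 hQ v).2
  have e2 := (tropPoly_mul hP h2 v).2
  rw [key] at e1
  rw [tropRat, dif_pos hex]
  linarith

end Tropicalisation

/-! ### The initial seed -/

/-- Vertices `(0,0)` and `(a,b)`, `1 ≤ a ≤ n-k`, `1 ≤ b ≤ k`, of the initial quiver. -/
def vertices (k n : ℕ) : Finset (ℕ × ℕ) :=
  insert (0, 0) (Finset.Icc 1 (n - k) ×ˢ Finset.Icc 1 k)

/-- The vertices carrying active (non-frozen) variables: `1 ≤ a ≤ n-k-1`, `1 ≤ b ≤ k-1`. -/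
def activeVertices (k n : ℕ) : Finset (ℕ × ℕ) :=
  Finset.Icc 1 (n - k - 1) ×ˢ Finset.Icc 1 (k - 1)

def frozenVertices (k n : ℕ) : Finset (ℕ × ℕ) := vertices k n \ activeVertices k n

/-- Index set for truncated g-vectors: `(p, q)` stands for the active vertex `(p+1, q+1)`. -/
abbrev Idx (k n : ℕ) : Type := Fin (n - k - 1) × Fin (k - 1)

def Idx.vertex {k n : ℕ} (p : Idx k n) : ℕ × ℕ := (p.1.val + 1, p.2.val + 1)

/-- The variable at `(a,b)` is the Plücker coordinate with index set
`{1, …, k-b} ∪ {k-b+a+1, …, k+a}`; this is the `i`-th (from `i = 0`) smallest element of that set.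
At `(0,0)` the set is `{1, …, k}`. -/
def vertexEntry (k : ℕ) (u : ℕ × ℕ) (i : ℕ) : ℕ :=
  if i < k - u.2 then i + 1 else i + 1 + u.1

/-- The arrows `u → v` of the initial quiver. -/
def Arrow (k n : ℕ) (u v : ℕ × ℕ) : Prop :=
  u ∈ vertices k n ∧ v ∈ vertices k n ∧
    ((u = (0, 0) ∧ v = (1, 1)) ∨
      (u ≠ (0, 0) ∧ v ≠ (0, 0) ∧
        (v = (u.1 + 1, u.2) ∨ v = (u.1, u.2 + 1) ∨ u = (v.1 + 1, v.2 + 1))))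

open scoped Classical in
/-- Entry `b_{uv}` of the extended exchange matrix: arrows `u → v` minus arrows `v → u`. -/
def exchange (k n : ℕ) (u v : ℕ × ℕ) : ℤ :=
  (if Arrow k n u v then 1 else 0) - (if Arrow k n v u then 1 else 0)

section Matrices

variable {k n : ℕ} {K : Type*} [Field K]

/-- A `k × n` matrix given by its columns `z_1, …, z_n`; column indices are read modulo `n`
(so `z_n` is the column with index `0 : ZMod n`). -/
abbrev Cols (k n : ℕ) (K : Type*) : Type _ := ZMod n → Fin k → K

/-- `det (z_{c 0}, z_{c 1}, …, z_{c (k-1)})`. -/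
def minor (z : Cols k n K) (c : Fin k → ZMod n) : K :=
  Matrix.det (Matrix.of fun r s => z (c s) r)

/-- The Plücker coordinate at a vertex of the initial quiver. -/
def vertexPlucker (z : Cols k n K) (u : ℕ × ℕ) : K :=
  minor z (fun s => ((vertexEntry k u s.val : ℕ) : ZMod n))

/-- The variable `ŷ_v = ∏_u x_u ^ b_{uv}` of the initial seed. -/
def yHat (z : Cols k n K) (v : ℕ × ℕ) : K :=
  ∏ u ∈ vertices k n, vertexPlucker z u ^ exchange k n u v

/-! ### Cyclic rotation and Fraser's braid group generators on matrices -/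

/-- `(z_1, …, z_n) ↦ (z_2, …, z_n, (-1)^(k-1) z_1)`. -/
def rho (z : Cols k n K) : Cols k n K := fun l =>
  if l = 0 then (-1 : K) ^ (k - 1) • z 1 else z (l + 1)

/-- `(z_1, …, z_n) ↦ ((-1)^(k-1) z_n, z_1, …, z_{n-1})`. -/
def rhoInv (z : Cols k n K) : Cols k n K := fun l =>
  if l = 1 then (-1 : K) ^ (k - 1) • z 0 else z (l - 1)

/-- `det(z_a, z_{a+2}, …, z_{a+k}) / det(z_{a+1}, …, z_{a+k}) • z_{a+1} - z_a`. -/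
def zeta (z : Cols k n K) (a : ZMod n) : Fin k → K :=
  (minor z (fun s => if s.val = 0 then a else a + (s.val : ZMod n) + 1) /
    minor z (fun s => a + (s.val : ZMod n) + 1)) • z (a + 1) - z a

/-- `det(z_{a-k+1}, …, z_{a-1}, z_{a+1}) / det(z_{a-k+1}, …, z_a) • z_a - z_{a+1}`. -/
def zetaTilde (z : Cols k n K) (a : ZMod n) : Fin k → K :=
  (minor z (fun s => if s.val + 1 = k then a + 1 else a - (k : ZMod n) + 1 + (s.val : ZMod n)) /
    minor z (fun s => a - (k : ZMod n) + 1 + (s.val : ZMod n))) • z a - z (a + 1)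

/-- The braid generator `σ_i`, `1 ≤ i ≤ d - 1`, `d = gcd(k,n)`. -/
def sigma (i : ℕ) (z : Cols k n K) : Cols k n K := fun l =>
  if l.val ≡ i [MOD k.gcd n] then z (l + 1)
  else if l.val ≡ i + 1 [MOD k.gcd n] then zeta z (l - 1)
  else z l

/-- The inverse braid generator `σ_i⁻¹`, `1 ≤ i ≤ d - 1`. -/
def sigmaInv (i : ℕ) (z : Cols k n K) : Cols k n K := fun l =>
  if l.val ≡ i [MOD k.gcd n] then zetaTilde z l
  else if l.val ≡ i + 1 [MOD k.gcd n] then z (l - 1)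
  else z l

/-- `σ_i⁻¹` for `1 ≤ i ≤ d`, where `σ_d = ρ⁻¹ ∘ σ_{d-1} ∘ ρ` (as maps on matrices). -/
def cyclicSigmaInv (i : ℕ) (z : Cols k n K) : Cols k n K :=
  if i = k.gcd n then rhoInv (sigmaInv (k.gcd n - 1) (rho z)) else sigmaInv i z

end Matrices

/-! ### The web matrix and the tropical action on truncated g-vectors -/

/-- The variable `χ_{a,b}`, `1 ≤ a ≤ n-k-1`, `1 ≤ b ≤ k-1`. -/
def chi (k n a b : ℕ) : RatFun (Idx k n) :=
  if h : a - 1 < n - k - 1 ∧ b - 1 < k - 1 then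
    algebraMap (MvPolynomial (Idx k n) ℚ) _ (MvPolynomial.X (⟨a - 1, h.1⟩, ⟨b - 1, h.2⟩))
  else 0

open scoped Classical in
/-- `M_{ij} = (-1)^{k+i} ∑_{0 ≤ λ_{k-i} ≤ ⋯ ≤ λ_1 ≤ j-1} ∏_{b=1}^{k-i} ∏_{a=1}^{λ_b} χ_{a,b}`,
for `1 ≤ i ≤ k`, `1 ≤ j ≤ n-k`. Here `lam b'` is `λ_{b'+1}`. -/
def webEntry (k n i j : ℕ) : RatFun (Idx k n) :=
  (-1) ^ (k + i) *
    ∑ lam ∈ (Finset.univ : Finset (Fin (k - i) → Fin j)).filter Antitone,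
      ∏ b : Fin (k - i), ∏ a ∈ Finset.Icc 1 (lam b).val, chi k n a (b.val + 1)

/-- The `l`-th column, `1 ≤ l ≤ n`, of the web matrix `W = (1_k ∣ M)`. -/
def webColumn (k n l : ℕ) : Fin k → RatFun (Idx k n) := fun r =>
  if l ≤ k then (if l = r.val + 1 then 1 else 0) else webEntry k n (r.val + 1) (l - k)

/-- The web matrix; the column with index `0 : ZMod n` is column `n`. -/
def web (k n : ℕ) : Cols k n (RatFun (Idx k n)) := fun l =>
  webColumn k n (if l = 0 then n else l.val)

/-- For a quasi-automorphism `f` given by a map on matrices with inverse `finv`, the piecewise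
linear map `Q_f⁺` on truncated g-vectors: the max-tropicalisation of the images under the inverse
of the `ŷ`-variables of the initial seed, evaluated on the web matrix. -/
def tropMap {k n : ℕ} (finv : Cols k n (RatFun (Idx k n)) → Cols k n (RatFun (Idx k n)))
    (g : Idx k n → ℤ) : Idx k n → ℤ := fun p =>
  tropRat (yHat (finv (web k n)) p.vertex) g

/-! ### Semistandard tableaux and their g-vectors -/

/-- The `k × r` rectangle. -/
def rect (k r : ℕ) : YoungDiagram where
  cells := Finset.range k ×ˢ Finset.range r
  isLowerSet := by
    rintro ⟨a, b⟩ ⟨c, d⟩ ⟨h1, h2⟩ h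
    simp only [Finset.coe_product, Finset.coe_range, Set.mem_prod, Set.mem_Iio] at h ⊢
    exact ⟨lt_of_le_of_lt h1 h.1, lt_of_le_of_lt h2 h.2⟩

/-- `SSYT(k,[n])`: rectangular semistandard tableaux with `k` rows, any number of columns, and
entries in `{1, …, n}`. Rows and columns are numbered from `0`. -/
structure Tableau (k n : ℕ) where
  cols : ℕ
  tab : SemistandardYoungTableau (rect k cols)
  entries_mem : ∀ i j, (i, j) ∈ rect k cols → tab i j ∈ Finset.Icc 1 n

namespace Tableau

variable {k n : ℕ}

/-- Multiplicity of `x` in the `i`-th row. -/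
def rowMult (T : Tableau k n) (i x : ℕ) : ℕ :=
  ((Finset.range T.cols).filter fun j => T.tab i j = x).card

/-- `T = S ∪ U`: each row of `T` is the multiset union of the rows of `S` and `U`. -/
def IsUnion (T S U : Tableau k n) : Prop :=
  ∀ i < k, ∀ x, T.rowMult i x = S.rowMult i x + U.rowMult i x

/-- `S` is the one-column tableau of the Plücker coordinate at the vertex `u`. -/
def IsVertexTableau (S : Tableau k n) (u : ℕ × ℕ) : Prop :=
  S.cols = 1 ∧ ∀ i < k, S.tab i 0 = vertexEntry k u i

/-- `T` has no frozen factor. -/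
def NoFrozenFactor (T : Tableau k n) : Prop :=
  ¬ ∃ u ∈ frozenVertices k n, ∃ S U : Tableau k n, S.IsVertexTableau u ∧ T.IsUnion S U

/-- `e` is the g-vector of `T`: `T = ⋃_u S_u^{e_u}`, with `S_u` the one-column tableau at the
vertex `u`, i.e. row multiplicities add up with (possibly negative) weights `e_u`. -/
def IsGVector (T : Tableau k n) (e : ℕ × ℕ → ℤ) : Prop :=
  ∀ i < k, ∀ x, (T.rowMult i x : ℤ) =
    ∑ u ∈ vertices k n, e u * (if vertexEntry k u i = x then 1 else 0)

/-- `g` is the truncated g-vector of `T`. -/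
def IsTruncatedGVector (T : Tableau k n) (g : Idx k n → ℤ) : Prop :=
  ∃ e : ℕ × ℕ → ℤ, T.IsGVector e ∧ ∀ p : Idx k n, g p = e p.vertex

/-- `T' = f(T)` where `f` acts on truncated g-vectors by `F`: `T'` is the tableau without frozen
factors whose truncated g-vector is the image under `F` of that of `T`. -/
def IsImage (F : (Idx k n → ℤ) → (Idx k n → ℤ)) (T T' : Tableau k n) : Prop :=
  T'.NoFrozenFactor ∧ ∃ g, T.IsTruncatedGVector g ∧ T'.IsTruncatedGVector (F g)

end Tableau

/-! ### Stable fixed points -/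

section Stable

variable {ι : Type*} [Fintype ι]

/-- A property holds for every generic integer vector, i.e. off the zero set of some nonzero
polynomial. -/
def ForGeneric (p : (ι → ℤ) → Prop) : Prop :=
  ∃ F : MvPolynomial ι ℤ, F ≠ 0 ∧ ∀ v : ι → ℤ, MvPolynomial.eval v F ≠ 0 → p v

/-- The sequence of integer vectors `u` has limit `l`: `l` is primitive and the rays spanned by
the `u j` converge to the ray spanned by `l`. -/
def HasLimit (u : ℕ → ι → ℤ) (l : ι → ℤ) : Prop :=
  Finset.univ.gcd l = 1 ∧ ∃ c : ℕ → ℝ, (∀ j, 0 < c j) ∧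
    Tendsto (fun j i => c j * (u j i : ℝ)) atTop (𝓝 fun i => (l i : ℝ))

/-- `g` is a stable fixed point of `f`: it is fixed, and there is `r ≥ 1` such that for generic
`g'` the sequence `f^j(g')` has limit `g / r`. -/
def IsStableFixedPoint (f : (ι → ℤ) → (ι → ℤ)) (g : ι → ℤ) : Prop :=
  f g = g ∧ ∃ r : ℕ, 1 ≤ r ∧ ∃ l : ι → ℤ, g = (r : ℤ) • l ∧
    ForGeneric fun g' => HasLimit (fun j => f^[j] g') l

end Stable

namespace Tableau

variable {k n : ℕ}

/-- `T` has no frozen factor and its truncated g-vector is a primitive stable fixed point of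
one of `σ_1, …, σ_d`. -/
def IsStableFixed (T : Tableau k n) : Prop :=
  T.NoFrozenFactor ∧ ∃ g, T.IsTruncatedGVector g ∧ Finset.univ.gcd g = 1 ∧
    ∃ i, 1 ≤ i ∧ i ≤ k.gcd n ∧ IsStableFixedPoint (tropMap (cyclicSigmaInv i)) g

/-- The tableaux obtained from the stable fixed points by the action of the braid group `Br_d`,
which is generated by `σ_1, …, σ_{d-1}`. -/
inductive InBraidOrbit : Tableau k n → Prop
  | base {T : Tableau k n} : T.IsStableFixed → InBraidOrbit T
  | sigma {T T' : Tableau k n} (i : ℕ) : 1 ≤ i → i < k.gcd n → InBraidOrbit T →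
      T.IsImage (tropMap (GrTrop.sigmaInv i)) T' → InBraidOrbit T'
  | sigmaInv {T T' : Tableau k n} (i : ℕ) : 1 ≤ i → i < k.gcd n → InBraidOrbit T →
      T.IsImage (tropMap (GrTrop.sigma i)) T' → InBraidOrbit T'

end Tableau

end GrTrop

end

/-! The braid group acts on the relevant g-vectors as a group of unimodular matrices acts on slopes.
There is a family of vectors G(a,b) (`slopeVecFour`, `slopeVecThree`), linear on finitely many cones
of the (a,b)-plane and satisfying G(-a,-b) = G(a,b). The tropical maps of σ_1 and σ_2 send G(a,b) to
G(a+b,b) and G(a,b-a), and the remaining generators act by matrices of the same kind. The attractor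
of σ_2 is G(0,1), and the attractors of the other σ_i are its images under symmetries, so every
primitive stable fixed point is G at a coprime pair. Euclid's algorithm
(`SlopeModel.inBraidOrbit_of_isCoprime`) shows that the orbit consists of all G(a,b) with a, b
coprime. The tableau of G(a,b) has 2(|a|+|b|) columns for Gr(4,8) and 3 max(|a|,|b|,|a-b|) columns
for Gr(3,9), and G is injective up to sign. What remains is to count primitive lattice points, up to
sign, on the boundary of a square or a hexagon: φ(s) for each of two, respectively three, sides.

The tropical maps are computed at a point with algebraically independent positive real coordinates,
where evaluation of rational functions is injective; `HasTrop` is the resulting calculus. Matrices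
are taken modulo row operations and rescaling of columns. The ŷ-variables are invariant under this
equivalence and are coordinates on the web matrices, which are normal forms (`YHatSpec`); hence
tropical maps compose (`Acts.comp`). All σ_i and their inverses are conjugates of σ_2⁻¹ by products
of two reversals of the columns, so only three matrix maps have to be tropicalised for each
Grassmannian.

The attractor of σ_2 is found by changing the seed: after a few mutations the generator becomes one
mutation followed by a relabelling (`braid4_eq`, `braid3_eq`). In that seed the vertices on a cycle
behave like a shift register with one nonlinear entry. The sum over the cycle is non-decreasing, and
for generic starting vectors it becomes a positive constant, after which the orbit moves by
translation along a fixed direction (`exists_eventually_translate`).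

A tableau is encoded by the array `low` of the numbers of small entries in each row. The truncated
g-vector is the mixed second difference of this array, and absence of frozen factors says that every
first difference attains the value zero. Therefore each integer vector comes from exactly one
tableau without frozen factors, and its number of columns is a sum of maxima of partial sums
(`Tableau.NoFrozenFactor.low_eq`, `Tableau.exists_noFrozenFactor`, `size_eq`). -/

noncomputable section

set_option linter.unusedSimpArgs false

namespace GrTrop

open Filter Topology

/-! ### Evaluation of rational functions at a generic positive real point -/

section GenericPoint

open Cardinal in
/-- There are algebraically independent positive real numbers. -/
lemma exists_pos_algebraicIndependent (ι : Type) [Finite ι] :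
    ∃ c : ι → ℝ, (∀ i, 0 < c i) ∧ AlgebraicIndependent ℚ c := by
  have htop : Algebra.adjoin ℚ (Set.Ioi (0 : ℝ)) = ⊤ := by
    rw [eq_top_iff]
    -- Every real is a difference of two positive reals, so the positive reals generate ℝ and
    -- contain a transcendence basis.
    intro x _
    have h1 : |x| + 1 ∈ Algebra.adjoin ℚ (Set.Ioi (0 : ℝ)) :=
      Algebra.subset_adjoin (Set.mem_Ioi.mpr (by positivity))
    have h2 : |x| + 1 + x ∈ Algebra.adjoin ℚ (Set.Ioi (0 : ℝ)) :=
      Algebra.subset_adjoin (Set.mem_Ioi.mpr (by linarith [neg_abs_le x]))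
    have := sub_mem h2 h1
    simpa using this
  have : Algebra.IsAlgebraic (Algebra.adjoin ℚ (Set.Ioi (0 : ℝ))) ℝ := by
    refine ⟨fun x => ?_⟩
    exact isAlgebraic_algebraMap (⟨x, by rw [htop]; trivial⟩ : Algebra.adjoin ℚ (Set.Ioi (0 : ℝ)))
  obtain ⟨t, ht, hb⟩ := exists_isTranscendenceBasis_subset (R := ℚ) (Set.Ioi (0 : ℝ))
  -- A finite basis would make ℝ algebraic over a countable ring, hence countable.
  have hinf : Infinite t := by
    by_contra hfin
    rw [not_infinite_iff_finite] at hfin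
    have h1 := hb.isAlgebraic
    have h2 := Algebra.IsAlgebraic.cardinalMk_le_max
      (Algebra.adjoin ℚ (Set.range ((↑) : t → ℝ))) ℝ
    have h3 : #(Algebra.adjoin ℚ (Set.range ((↑) : t → ℝ))) ≤ ℵ₀ := by
      rw [← Cardinal.mk_congr hb.1.aevalEquiv.toEquiv]
      have := MvPolynomial.cardinalMk_le_max (σ := t) (R := ℚ)
      refine this.trans ?_
      simp [Cardinal.mk_le_aleph0]
    rw [Cardinal.mk_real] at h2
    have h4 := h2.trans (max_le h3 le_rfl)
    exact absurd h4 (not_le.mpr Cardinal.aleph0_lt_continuum)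
  obtain ⟨n, ⟨e⟩⟩ := Finite.exists_equiv_fin ι
  let f : ι ↪ t := e.toEmbedding.trans (Fin.valEmbedding.trans (Infinite.natEmbedding t))
  exact ⟨fun i => (f i : ℝ), fun i => ht (f i).2, hb.1.comp f f.injective⟩

variable (ι : Type) [Finite ι]

/-- A fixed generic positive real point. -/
def genPt (i : ι) : ℝ := (exists_pos_algebraicIndependent ι).choose i

lemma genPt_pos (i : ι) : 0 < genPt ι i := (exists_pos_algebraicIndependent ι).choose_spec.1 i

lemma genPt_injective : Function.Injective (MvPolynomial.aeval (R := ℚ) (genPt ι)) :=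
  (exists_pos_algebraicIndependent ι).choose_spec.2

/-- Evaluation of rational functions at the generic point. -/
def evalGen : RatFun ι →+* ℝ :=
  IsFractionRing.lift (A := MvPolynomial ι ℚ) (g := (MvPolynomial.aeval (genPt ι)).toRingHom)
    (genPt_injective ι)

@[simp] lemma evalGen_algebraMap (p : MvPolynomial ι ℚ) :
    evalGen ι (algebraMap _ _ p) = MvPolynomial.aeval (genPt ι) p := by
  simp [evalGen]

/-- Evaluation of a polynomial with natural coefficients at the generic point. -/
def natEval (P : MvPolynomial ι ℕ) : ℝ := MvPolynomial.aeval (genPt ι) P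

lemma evalGen_toRatFun (P : MvPolynomial ι ℕ) : evalGen ι (toRatFun P) = natEval ι P := by
  rw [toRatFun, evalGen_algebraMap, natEval, MvPolynomial.aeval_def, MvPolynomial.eval₂_map,
    MvPolynomial.aeval_def]
  congr 1

end GenericPoint

/-! ### Tropical values of positive real numbers -/

section HasTrop

variable {ι : Type} [Fintype ι]

/-- Natural number coefficients cannot cancel, so the support of a sum is the union of the supports.
-/
lemma tropPoly_add {P Q : MvPolynomial ι ℕ} (hP : P ≠ 0) (hQ : Q ≠ 0) (v : ι → ℤ) :
    P + Q ≠ 0 ∧ tropPoly (P + Q) v = max (tropPoly P v) (tropPoly Q v) := by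
  classical
  have hP' : P.support.Nonempty := MvPolynomial.support_nonempty.mpr hP
  have hQ' : Q.support.Nonempty := MvPolynomial.support_nonempty.mpr hQ
  have hs : (P + Q).support = P.support ∪ Q.support := by
    ext m
    simp only [MvPolynomial.mem_support_iff, MvPolynomial.coeff_add, Finset.mem_union]
    omega
  have hne : (P + Q).support.Nonempty := by rw [hs]; exact hP'.mono Finset.subset_union_left
  refine ⟨MvPolynomial.support_nonempty.mp hne, ?_⟩
  simp only [tropPoly, hP', hQ', hne, dif_pos]
  rw [← Finset.sup'_union hP' hQ']
  exact Finset.sup'_congr _ hs fun _ _ => rfl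

lemma tropPoly_one (v : ι → ℤ) : tropPoly (1 : MvPolynomial ι ℕ) v = 0 := by
  classical
  have h : (1 : MvPolynomial ι ℕ).support = {0} := by
    rw [← MvPolynomial.C_1, MvPolynomial.support_C]; simp
  simp [tropPoly, h]

lemma tropPoly_X (i : ι) (v : ι → ℤ) : tropPoly (MvPolynomial.X i : MvPolynomial ι ℕ) v = v i := by
  classical
  simp [tropPoly, MvPolynomial.support_X, Finsupp.single_apply]

/-- `x = P / Q` at the generic point, for nonzero `P`, `Q` with natural coefficients, and `t` is
the tropical value of `P / Q` at `v`. -/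
def HasTrop (v : ι → ℤ) (x : ℝ) (t : ℤ) : Prop :=
  ∃ P Q : MvPolynomial ι ℕ, P ≠ 0 ∧ Q ≠ 0 ∧ x = natEval ι P / natEval ι Q ∧
    t = tropPoly P v - tropPoly Q v

lemma natEval_pos {P : MvPolynomial ι ℕ} (hP : P ≠ 0) : 0 < natEval ι P := by
  rw [natEval, MvPolynomial.aeval_def, MvPolynomial.eval₂_eq']
  apply Finset.sum_pos
  · intro m hm
    apply mul_pos
    · simpa using Nat.pos_of_ne_zero (MvPolynomial.mem_support_iff.mp hm)
    · exact Finset.prod_pos fun i _ => pow_pos (genPt_pos ι i) _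
  · exact MvPolynomial.support_nonempty.mpr hP

variable {v : ι → ℤ} {x y : ℝ} {s t : ℤ}

lemma HasTrop.pos (h : HasTrop v x t) : 0 < x := by
  obtain ⟨P, Q, hP, hQ, rfl, -⟩ := h
  exact div_pos (natEval_pos hP) (natEval_pos hQ)

lemma HasTrop.one : HasTrop v 1 0 :=
  ⟨1, 1, one_ne_zero, one_ne_zero, by simp [natEval], by simp⟩

lemma HasTrop.genPt (i : ι) : HasTrop v (genPt ι i) (v i) :=
  ⟨MvPolynomial.X i, 1, MvPolynomial.X_ne_zero i, one_ne_zero, by simp [natEval],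
    by simp [tropPoly_X, tropPoly_one]⟩

lemma HasTrop.mul (hx : HasTrop v x s) (hy : HasTrop v y t) : HasTrop v (x * y) (s + t) := by
  obtain ⟨P, Q, hP, hQ, rfl, rfl⟩ := hx
  obtain ⟨P', Q', hP', hQ', rfl, rfl⟩ := hy
  refine ⟨P * P', Q * Q', (tropPoly_mul hP hP' v).1, (tropPoly_mul hQ hQ' v).1, ?_, ?_⟩
  · simp [natEval, div_mul_div_comm]
  · rw [(tropPoly_mul hP hP' v).2, (tropPoly_mul hQ hQ' v).2]; ring

lemma HasTrop.inv (hx : HasTrop v x s) : HasTrop v x⁻¹ (-s) := by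
  obtain ⟨P, Q, hP, hQ, rfl, rfl⟩ := hx
  exact ⟨Q, P, hQ, hP, by simp, by ring⟩

lemma HasTrop.div (hx : HasTrop v x s) (hy : HasTrop v y t) : HasTrop v (x / y) (s - t) := by
  simpa [div_eq_mul_inv, sub_eq_add_neg] using hx.mul hy.inv

lemma HasTrop.add (hx : HasTrop v x s) (hy : HasTrop v y t) : HasTrop v (x + y) (max s t) := by
  obtain ⟨P, Q, hP, hQ, rfl, rfl⟩ := hx
  obtain ⟨P', Q', hP', hQ', rfl, rfl⟩ := hy
  have h1 := tropPoly_mul hP hQ' v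
  have h2 := tropPoly_mul hP' hQ v
  have h3 := tropPoly_mul hQ hQ' v
  have h4 := tropPoly_add h1.1 h2.1 v
  refine ⟨P * Q' + P' * Q, Q * Q', h4.1, h3.1, ?_, ?_⟩
  · have := (natEval_pos hQ).ne'
    have := (natEval_pos hQ').ne'
    rw [div_add_div _ _ ‹_› ‹_›]
    simp [natEval, mul_comm]
  · rw [h4.2, h1.2, h2.2, h3.2]; omega

/-- Evaluation at the generic point is injective, so two fractions representing the same real
satisfy the polynomial identity `P * Q' = P' * Q`; multiplicativity of `tropPoly` then equates the
tropical values. An identity between tropical maps can thus be proved by computing with positive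
real numbers. -/
lemma HasTrop.unique (hs : HasTrop v x s) (ht : HasTrop v x t) : s = t := by
  obtain ⟨P, Q, hP, hQ, rfl, rfl⟩ := hs
  obtain ⟨P', Q', hP', hQ', h, rfl⟩ := ht
  have hne := (natEval_pos hQ).ne'
  have hne' := (natEval_pos hQ').ne'
  rw [div_eq_div_iff hne hne'] at h
  have key : P * Q' = P' * Q := by
    apply toRatFun_injective
    apply (evalGen ι).injective
    rw [evalGen_toRatFun, evalGen_toRatFun]
    simpa [natEval] using h
  have e1 := (tropPoly_mul hP hQ' v).2
  have e2 := (tropPoly_mul hP' hQ v).2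
  rw [key] at e1
  omega

/-- The tropicalisation of a rational function can be read off at the generic point. -/
lemma tropRat_eq_of_hasTrop {R : RatFun ι} (h : HasTrop v (evalGen ι R) t) : tropRat R v = t := by
  obtain ⟨P, Q, hP, hQ, hx, rfl⟩ := h
  refine tropRat_eq ⟨hP, hQ, ?_⟩ v
  apply (evalGen ι).injective
  rw [hx, map_div₀, evalGen_toRatFun, evalGen_toRatFun]

end HasTrop

/-! ### The `ŷ`-variables as products of six Plücker coordinates -/

section YHat

variable {k n : ℕ} {K : Type*} [Field K]

/-- The index set formula gives {1, …, k} whenever a = 0 or b = 0. With this convention the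
six-factor formula for ŷ also holds at the border of the quiver. -/
lemma vertexPlucker_zero_left (z : Cols k n K) (b : ℕ) :
    vertexPlucker z (0, b) = vertexPlucker z (0, 0) := by
  unfold vertexPlucker
  congr 1
  funext s
  simp [vertexEntry]

lemma vertexPlucker_zero_right (z : Cols k n K) (a : ℕ) :
    vertexPlucker z (a, 0) = vertexPlucker z (0, 0) := by
  unfold vertexPlucker
  congr 1
  funext s
  simp [vertexEntry]

/-- The quiver has no 2-cycles, so the exponents of ŷ are 1, -1 or 0. -/
lemma not_arrow_symm {u v : ℕ × ℕ} (h : Arrow k n u v) : ¬ Arrow k n v u := by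
  obtain ⟨u1, u2⟩ := u
  obtain ⟨v1, v2⟩ := v
  rintro ⟨-, -, h2⟩
  obtain ⟨-, -, h1⟩ := h
  simp only [Prod.mk.injEq, ne_eq] at h1 h2
  omega

open scoped Classical in
lemma yHat_eq_prod_div (z : Cols k n K) (v : ℕ × ℕ) :
    yHat z v = (∏ u ∈ (vertices k n).filter fun u => Arrow k n u v, vertexPlucker z u) /
      ∏ u ∈ (vertices k n).filter fun u => Arrow k n v u, vertexPlucker z u := by
  rw [yHat, Finset.prod_filter, Finset.prod_filter, ← Finset.prod_div_distrib]
  refine Finset.prod_congr rfl fun u _ => ?_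
  by_cases h1 : Arrow k n u v
  · simp [exchange, h1, not_arrow_symm h1]
  · by_cases h2 : Arrow k n v u <;> simp [exchange, h1, h2]

-- At the border the missing neighbours are replaced by vertices (0,b) or (a,0), whose coordinate is
-- that of (0,0). The surplus copies of this coordinate cancel between numerator and denominator.
open scoped Classical in
lemma yHat_eq (z : Cols k n K) {a b : ℕ} (ha : 1 ≤ a) (ha' : a ≤ n - k - 1) (hb : 1 ≤ b)
    (hb' : b ≤ k - 1) (h0 : vertexPlucker z (0, 0) ≠ 0) :
    yHat z (a, b) = vertexPlucker z (a - 1, b) * vertexPlucker z (a, b - 1) *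
        vertexPlucker z (a + 1, b + 1) /
      (vertexPlucker z (a + 1, b) * vertexPlucker z (a, b + 1) *
        vertexPlucker z (a - 1, b - 1)) := by
  have hin : ∀ S : Finset (ℕ × ℕ), (∀ x y, (x, y) ∈ S ↔ (x, y) ∈ vertices k n ∧
      Arrow k n (x, y) (a, b)) → (vertices k n).filter (fun u => Arrow k n u (a, b)) = S := by
    intro S hS
    ext ⟨x, y⟩
    rw [hS, Finset.mem_filter]
  have hout : ∀ S : Finset (ℕ × ℕ), (∀ x y, (x, y) ∈ S ↔ (x, y) ∈ vertices k n ∧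
      Arrow k n (a, b) (x, y)) → (vertices k n).filter (fun u => Arrow k n (a, b) u) = S := by
    intro S hS
    ext ⟨x, y⟩
    rw [hS, Finset.mem_filter]
  -- The only arrow at (0,0) goes to (1,1), so the diagonal outgoing arrow exists only if both
  -- coordinates are at least 2.
  have ho : (vertices k n).filter (fun u => Arrow k n (a, b) u) =
      if 2 ≤ a ∧ 2 ≤ b then {(a + 1, b), (a, b + 1), (a - 1, b - 1)}
      else {(a + 1, b), (a, b + 1)} := by
    apply hout
    intro x y
    split_ifs <;> simp [Arrow, vertices] <;> omega
  rw [yHat_eq_prod_div, ho]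
  have e1 : (a + 1, b) ≠ (a, b + 1) := by simp
  have e2 : (a + 1, b) ≠ (a - 1, b - 1) := by simp; omega
  have e3 : (a, b + 1) ≠ (a - 1, b - 1) := by simp; omega
  have e4 : (a - 1, b) ≠ (a, b - 1) := by simp; omega
  have e5 : (a - 1, b) ≠ (a + 1, b + 1) := by simp
  have e6 : (a, b - 1) ≠ (a + 1, b + 1) := by simp
  rcases Nat.lt_or_ge 1 a with h1 | h1 <;> rcases Nat.lt_or_ge 1 b with h2 | h2
  · rw [hin {(a - 1, b), (a, b - 1), (a + 1, b + 1)}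
      (by intro x y; simp [Arrow, vertices]; omega), if_pos (by omega)]
    rw [Finset.prod_insert (by simp [e4, e5]), Finset.prod_insert (by simp),
      Finset.prod_singleton, Finset.prod_insert (by simp [e2]), Finset.prod_insert (by simp [e3]),
      Finset.prod_singleton]
    simp only [mul_assoc]
  · obtain rfl : b = 1 := by omega
    rw [hin {(a - 1, 1), (a + 1, 2)} (by intro x y; simp [Arrow, vertices]; omega),
      if_neg (by omega), Finset.prod_pair (by simp), Finset.prod_pair (by simp)]
    simp only [Nat.sub_self, vertexPlucker_zero_right]
    rw [mul_right_comm, mul_div_mul_right _ _ h0]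
  · obtain rfl : a = 1 := by omega
    rw [hin {(1, b - 1), (2, b + 1)} (by intro x y; simp [Arrow, vertices]; omega),
      if_neg (by omega), Finset.prod_pair (by simp), Finset.prod_pair (by simp)]
    simp only [Nat.sub_self, vertexPlucker_zero_left]
    rw [mul_assoc, mul_comm (vertexPlucker z (0, 0)), mul_div_mul_right _ _ h0]
  · obtain rfl : a = 1 := by omega
    obtain rfl : b = 1 := by omega
    rw [hin {(0, 0), (2, 2)} (by intro x y; simp [Arrow, vertices]; omega),
      if_neg (by omega), Finset.prod_pair (by simp), Finset.prod_pair (by simp)]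
    simp only [Nat.sub_self, vertexPlucker_zero_left, vertexPlucker_zero_right]
    rw [mul_right_comm, mul_div_mul_right _ _ h0]

end YHat

/-! ### Matrices up to row operations and rescaling of columns -/

section MatEquiv

variable {k n : ℕ}

/-- `z'` is obtained from `z` by an invertible linear map and a rescaling of the columns. -/
def MatEquiv (z z' : Cols k n ℝ) : Prop :=
  ∃ (A : Matrix (Fin k) (Fin k) ℝ) (t : ZMod n → ℝ), A.det ≠ 0 ∧ (∀ l, t l ≠ 0) ∧
    ∀ l, z' l = t l • A.mulVec (z l)

lemma MatEquiv.of_smul {z z' : Cols k n ℝ} (t : ZMod n → ℝ) (ht : ∀ l, t l ≠ 0)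
    (h : ∀ l, z' l = t l • z l) : MatEquiv z z' :=
  ⟨1, t, by simp, ht, by simpa using h⟩

lemma MatEquiv.refl (z : Cols k n ℝ) : MatEquiv z z := .of_smul 1 (by simp) (by simp)

lemma MatEquiv.trans {z z' z'' : Cols k n ℝ} (h : MatEquiv z z') (h' : MatEquiv z' z'') :
    MatEquiv z z'' := by
  obtain ⟨A, t, hA, ht, h⟩ := h
  obtain ⟨A', t', hA', ht', h'⟩ := h'
  refine ⟨A' * A, fun l => t' l * t l, by simp [hA, hA'], fun l => mul_ne_zero (ht' l) (ht l),
    fun l => ?_⟩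
  rw [h', h, Matrix.mulVec_smul, smul_smul, Matrix.mulVec_mulVec]

/-- The submatrix of z' is A times the submatrix of z times a diagonal matrix, and determinants
multiply. -/
lemma minor_of_matEquiv {z z' : Cols k n ℝ} {A : Matrix (Fin k) (Fin k) ℝ} {t : ZMod n → ℝ}
    (h : ∀ l, z' l = t l • A.mulVec (z l)) (c : Fin k → ZMod n) :
    minor z' c = A.det * (∏ s, t (c s)) * minor z c := by
  have : (Matrix.of fun r s => z' (c s) r) =
      A * (Matrix.of fun r s => z (c s) r) * Matrix.diagonal fun s => t (c s) := by
    ext r s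
    rw [Matrix.mul_diagonal, Matrix.of_apply, h]
    simp [Matrix.mulVec, dotProduct, Matrix.mul_apply, mul_comm]
  rw [minor, this, Matrix.det_mul, Matrix.det_mul, Matrix.det_diagonal, minor]
  ring

lemma MatEquiv.reindex {z z' : Cols k n ℝ} (h : MatEquiv z z') (f : ZMod n → ZMod n) :
    MatEquiv (fun l => z (f l)) (fun l => z' (f l)) := by
  obtain ⟨A, t, hA, ht, h⟩ := h
  exact ⟨A, fun l => t (f l), hA, fun l => ht _, fun l => h _⟩

end MatEquiv

/-! ### The web matrix over the real numbers -/

section Web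

variable {K : Type*} [CommRing K]

/-- The sum over `m > λ_1 ≥ ⋯ ≥ λ_r ≥ 0` of `∏_{i ≤ r} ∏_{1 ≤ a ≤ λ_i} χ_{a,b+i}`. -/
def webSum (χ : ℕ → ℕ → K) : ℕ → ℕ → ℕ → K
  | 0, _, _ => 1
  | r + 1, b, m => ∑ x ∈ Finset.range m, (∏ a ∈ Finset.Icc 1 x, χ a (b + 1)) *
      webSum χ r (b + 1) (x + 1)

lemma antitone_cons {j r : ℕ} (x : Fin j) (y : Fin r → Fin j) :
    Antitone (Fin.cons x y : Fin (r + 1) → Fin j) ↔ Antitone y ∧ ∀ i, y i ≤ x := by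
  constructor
  · intro h
    refine ⟨fun i i' hi => ?_, fun i => ?_⟩
    · simpa using h (Fin.succ_le_succ_iff.mpr hi)
    · simpa using h (Fin.zero_le i.succ)
  · rintro ⟨h1, h2⟩ i i' hi
    induction i' using Fin.cases with
    | zero =>
      obtain rfl : i = 0 := by simpa using hi
      rfl
    | succ i' =>
      induction i using Fin.cases with
      | zero => simpa using h2 i'
      | succ i => simpa using h1 (Fin.succ_le_succ_iff.mp hi)

-- Induction on the number of parts, splitting off the largest part λ_1 = x; the other parts are
-- then bounded by x. The bound m and the shift b vary because the recursion changes both.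
open scoped Classical in
lemma sum_antitone_eq_webSum (χ : ℕ → ℕ → K) (j : ℕ) (r : ℕ) : ∀ (b m : ℕ), m ≤ j →
    (∑ lam : Fin r → Fin j, if Antitone lam ∧ ∀ i, (lam i).val < m then
      ∏ i, ∏ a ∈ Finset.Icc 1 (lam i).val, χ a (b + i.val + 1) else 0) = webSum χ r b m := by
  induction r with
  | zero =>
    intro b m hm
    simp [webSum, Subsingleton.antitone]
  | succ r ih =>
    intro b m hm
    rw [← (Fin.consEquiv fun _ => Fin j).sum_comp, Fintype.sum_prod_type, webSum]
    have hstep : ∀ x : Fin j, (∑ y : Fin r → Fin j,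
        if Antitone ((Fin.consEquiv fun _ => Fin j) (x, y)) ∧
            ∀ i, ((Fin.consEquiv fun _ => Fin j) (x, y) i).val < m then
          ∏ i, ∏ a ∈ Finset.Icc 1 ((Fin.consEquiv fun _ => Fin j) (x, y) i).val,
            χ a (b + i.val + 1) else 0) =
        if x.val < m then (∏ a ∈ Finset.Icc 1 x.val, χ a (b + 1)) *
          webSum χ r (b + 1) (x.val + 1) else 0 := by
      intro x
      split_ifs with hx
      · rw [← ih (b + 1) (x.val + 1) x.2, Finset.mul_sum]
        refine Finset.sum_congr rfl fun y _ => ?_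
        have hiff : (Antitone ((Fin.consEquiv fun _ => Fin j) (x, y)) ∧
            ∀ i, ((Fin.consEquiv fun _ => Fin j) (x, y) i).val < m) ↔
            (Antitone y ∧ ∀ i, (y i).val < x.val + 1) := by
          change (Antitone (Fin.cons x y : Fin (r + 1) → Fin j) ∧
            ∀ i, ((Fin.cons x y : Fin (r + 1) → Fin j) i).val < m) ↔ _
          rw [antitone_cons]
          constructor
          · rintro ⟨⟨h1, h2⟩, -⟩
            exact ⟨h1, fun i => Nat.lt_succ_of_le (h2 i)⟩
          · rintro ⟨h1, h2⟩
            refine ⟨⟨h1, fun i => Nat.le_of_lt_succ (h2 i)⟩, fun i => ?_⟩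
            induction i using Fin.cases with
            | zero => simpa using hx
            | succ i => have := h2 i; simp; omega
        rw [mul_ite, mul_zero]
        refine if_congr hiff ?_ rfl
        rw [Fin.prod_univ_succ]
        simp [add_comm, add_left_comm]
      · refine Finset.sum_eq_zero fun y _ => if_neg ?_
        rintro ⟨-, h⟩
        exact hx (by simpa using h 0)
    simp_rw [hstep]
    rw [Fin.sum_univ_eq_sum_range (fun x => if x < m then (∏ a ∈ Finset.Icc 1 x, χ a (b + 1)) *
          webSum χ r (b + 1) (x + 1) else 0), ← Finset.sum_filter]
    congr 1
    ext x
    simp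
    omega

/-- The web matrix with entries in a commutative ring. -/
def webMat (k n : ℕ) (χ : ℕ → ℕ → K) (l : ZMod n) (r : Fin k) : K :=
  if (if l = 0 then n else l.val) ≤ k then
    (if (if l = 0 then n else l.val) = r.val + 1 then 1 else 0)
  else (-1) ^ (k + (r.val + 1)) *
    webSum χ (k - (r.val + 1)) 0 ((if l = 0 then n else l.val) - k)

lemma webSum_map {K' : Type*} [CommRing K'] (φ : K →+* K') (χ : ℕ → ℕ → K) (r b m : ℕ) :
    φ (webSum χ r b m) = webSum (fun a b => φ (χ a b)) r b m := by
  induction r generalizing b m with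
  | zero => simp [webSum]
  | succ r ih => simp [webSum, ih]

lemma webEntry_eq (k n i j : ℕ) :
    webEntry k n i j = (-1) ^ (k + i) * webSum (chi k n) (k - i) 0 j := by
  classical
  rw [webEntry, ← sum_antitone_eq_webSum _ j _ 0 j le_rfl, Finset.sum_filter]
  simp

lemma evalGen_web (k n : ℕ) (l : ZMod n) (r : Fin k) :
    evalGen (Idx k n) (web k n l r) = webMat k n (fun a b => evalGen _ (chi k n a b)) l r := by
  rw [web, webColumn, webMat, webEntry_eq]
  split_ifs <;> simp [webSum_map]

end Web

/-! ### Compatibility of the constructions with field homomorphisms -/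

section Naturality

variable {k n : ℕ} {K K' : Type*} [Field K] [Field K'] (φ : K →+* K')

/-- Apply a field homomorphism to all entries of a matrix. -/
def mapCols (z : Cols k n K) : Cols k n K' := fun l r => φ (z l r)

lemma minor_mapCols (z : Cols k n K) (c : Fin k → ZMod n) :
    minor (mapCols φ z) c = φ (minor z c) := by
  rw [minor, minor, RingHom.map_det]
  rfl

lemma yHat_mapCols (z : Cols k n K) (v : ℕ × ℕ) : yHat (mapCols φ z) v = φ (yHat z v) := by
  simp [yHat, vertexPlucker, minor_mapCols]

lemma zeta_mapCols (z : Cols k n K) (a : ZMod n) (r : Fin k) :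
    zeta (mapCols φ z) a r = φ (zeta z a r) := by
  simp [zeta, minor_mapCols, mapCols]

lemma zetaTilde_mapCols (z : Cols k n K) (a : ZMod n) (r : Fin k) :
    zetaTilde (mapCols φ z) a r = φ (zetaTilde z a r) := by
  simp [zetaTilde, minor_mapCols, mapCols]

lemma sigma_mapCols (i : ℕ) (z : Cols k n K) : sigma i (mapCols φ z) = mapCols φ (sigma i z) := by
  funext l r
  simp only [sigma]
  split_ifs <;> simp [mapCols, zeta_mapCols, sigma, *]

lemma sigmaInv_mapCols (i : ℕ) (z : Cols k n K) :
    sigmaInv i (mapCols φ z) = mapCols φ (sigmaInv i z) := by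
  funext l r
  simp only [sigmaInv]
  split_ifs <;> simp [mapCols, zetaTilde_mapCols, sigmaInv, *]

lemma rho_mapCols (z : Cols k n K) : rho (mapCols φ z) = mapCols φ (rho z) := by
  funext l r
  simp only [rho]
  split_ifs <;> simp [mapCols, rho, *]

lemma rhoInv_mapCols (z : Cols k n K) : rhoInv (mapCols φ z) = mapCols φ (rhoInv z) := by
  funext l r
  simp only [rhoInv]
  split_ifs <;> simp [mapCols, rhoInv, *]

lemma cyclicSigmaInv_mapCols (i : ℕ) (z : Cols k n K) :
    cyclicSigmaInv i (mapCols φ z) = mapCols φ (cyclicSigmaInv i z) := by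
  simp only [cyclicSigmaInv]
  split_ifs <;> simp [rho_mapCols, sigmaInv_mapCols, rhoInv_mapCols]

end Naturality

/-! ### Maps on matrices and their tropicalisations -/

section Good

variable {k n : ℕ}

/-- The point `χ` has tropical coordinates `g` (in the active range). -/
def HasTropPt (k n : ℕ) (v : Idx k n → ℤ) (χ : ℕ → ℕ → ℝ) (g : ℕ → ℕ → ℤ) : Prop :=
  ∀ a b, 1 ≤ a → a ≤ n - k - 1 → 1 ≤ b → b ≤ k - 1 → HasTrop v (χ a b) (g a b)

/-- `f` acts on matrices modulo equivalence, and its effect on the tropical coordinates of web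
matrices is given by `q`. -/
structure Tropicalises (f : Cols k n ℝ → Cols k n ℝ) (q : (ℕ → ℕ → ℤ) → ℕ → ℕ → ℤ) : Prop where
  equiv : ∀ {z z'}, MatEquiv z z' → MatEquiv (f z) (f z')
  web : ∀ {v χ g}, HasTropPt k n v χ g →
    ∃ χ', HasTropPt k n v χ' (q g) ∧ MatEquiv (webMat k n χ') (f (webMat k n χ))

/-- The image of a web matrix is only equivalent to a web matrix; compatibility with equivalence is
what allows the next map to be applied to the normal form. -/
lemma Tropicalises.comp {f f' : Cols k n ℝ → Cols k n ℝ} {q q' : (ℕ → ℕ → ℤ) → ℕ → ℕ → ℤ}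
    (h : Tropicalises f q) (h' : Tropicalises f' q') : Tropicalises (f ∘ f') (q ∘ q') where
  equiv hz := h.equiv (h'.equiv hz)
  web hg := by
    obtain ⟨χ', h1, h2⟩ := h'.web hg
    obtain ⟨χ'', h3, h4⟩ := h.web h1
    exact ⟨χ'', h3, h4.trans (h.equiv h2)⟩

lemma Tropicalises.congr {f f' : Cols k n ℝ → Cols k n ℝ} {q : (ℕ → ℕ → ℤ) → ℕ → ℕ → ℤ}
    (h : Tropicalises f q) (hf : ∀ z, f' z = f z) : Tropicalises f' q := by
  obtain rfl : f' = f := funext hf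
  exact h

/-- Extend a vector indexed by the active vertices by zero. -/
def extend (g : Idx k n → ℤ) (a b : ℕ) : ℤ :=
  if h : a - 1 < n - k - 1 ∧ b - 1 < k - 1 then g (⟨a - 1, h.1⟩, ⟨b - 1, h.2⟩) else 0

/-- Restrict a function of `(a, b)` to the active vertices. -/
def restrict (k n : ℕ) (g : ℕ → ℕ → ℤ) (p : Idx k n) : ℤ := g (p.1.val + 1) (p.2.val + 1)

@[simp] lemma restrict_extend (g : Idx k n → ℤ) : restrict k n (extend g) = g := by
  funext p
  simp [restrict, extend]

lemma extend_restrict (g : ℕ → ℕ → ℤ) {a b : ℕ} (ha : 1 ≤ a) (ha' : a ≤ n - k - 1) (hb : 1 ≤ b)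
    (hb' : b ≤ k - 1) : extend (restrict k n g) a b = g a b := by
  rw [extend, dif_pos (by omega)]
  simp [restrict, Nat.sub_add_cancel ha, Nat.sub_add_cancel hb]

/-- The `ŷ`-variables are invariant under equivalence, and are the coordinates of web matrices. -/
structure YHatSpec (k n : ℕ) : Prop where
  invariant : ∀ {z z' : Cols k n ℝ}, MatEquiv z z' → (∀ u, u ∈ vertices k n →
    vertexPlucker z u ≠ 0) → ∀ {a b}, 1 ≤ a → a ≤ n - k - 1 → 1 ≤ b → b ≤ k - 1 →
      yHat z' (a, b) = yHat z (a, b)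
  ne_zero : ∀ {χ : ℕ → ℕ → ℝ}, (∀ a b, 1 ≤ a → a ≤ n - k - 1 → 1 ≤ b → b ≤ k - 1 → χ a b ≠ 0) →
    ∀ u, u ∈ vertices k n → vertexPlucker (webMat k n χ) u ≠ 0
  web : ∀ {χ : ℕ → ℕ → ℝ}, (∀ a b, 1 ≤ a → a ≤ n - k - 1 → 1 ≤ b → b ≤ k - 1 → χ a b ≠ 0) →
    ∀ {a b}, 1 ≤ a → a ≤ n - k - 1 → 1 ≤ b → b ≤ k - 1 → yHat (webMat k n χ) (a, b) = χ a b
  normalForm : ∀ {z : Cols k n ℝ}, (∀ u, u ∈ vertices k n → vertexPlucker z u ≠ 0) →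
    ∃ χ : ℕ → ℕ → ℝ, (∀ a b, 1 ≤ a → a ≤ n - k - 1 → 1 ≤ b → b ≤ k - 1 → χ a b ≠ 0) ∧
      MatEquiv (webMat k n χ) z

lemma evalGen_chi {a b : ℕ} (ha : 1 ≤ a) (ha' : a ≤ n - k - 1) (hb : 1 ≤ b) (hb' : b ≤ k - 1) :
    evalGen (Idx k n) (chi k n a b) =
      genPt (Idx k n) (⟨a - 1, by omega⟩, ⟨b - 1, by omega⟩) := by
  rw [chi, dif_pos (by omega), evalGen_algebraMap, MvPolynomial.aeval_X]

/-- The tropical action of a map on matrices. -/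
lemma YHatSpec.tropMap_eq (H : YHatSpec k n) {f : Cols k n ℝ → Cols k n ℝ}
    {q : (ℕ → ℕ → ℤ) → ℕ → ℕ → ℤ} (hf : Tropicalises f q)
    {finv : Cols k n (RatFun (Idx k n)) → Cols k n (RatFun (Idx k n))}
    (hnat : ∀ z, f (mapCols (evalGen (Idx k n)) z) = mapCols (evalGen (Idx k n)) (finv z))
    (g : Idx k n → ℤ) : tropMap finv g = restrict k n (q (extend g)) := by
  funext p
  obtain ⟨⟨a, ha⟩, ⟨b, hb⟩⟩ := p
  rw [tropMap]
  apply tropRat_eq_of_hasTrop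
  -- The web matrix over the field of rational functions becomes, under evaluation, the real web
  -- matrix at the generic point, whose tropical coordinates are g itself.
  have hpt : HasTropPt k n g (fun a b => evalGen _ (chi k n a b)) (extend g) := by
    intro a b ha ha' hb hb'
    simp only
    rw [evalGen_chi ha ha' hb hb', extend, dif_pos (by omega)]
    exact .genPt _
  obtain ⟨χ', h1, h2⟩ := hf.web hpt
  have hne : ∀ a b, 1 ≤ a → a ≤ n - k - 1 → 1 ≤ b → b ≤ k - 1 → χ' a b ≠ 0 :=
    fun a b ha ha' hb hb' => (h1 a b ha ha' hb hb').pos.ne'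
  have e1 : mapCols (evalGen (Idx k n)) (GrTrop.web k n) =
      webMat k n (fun a b => evalGen _ (chi k n a b)) := by
    funext l r
    exact evalGen_web k n l r
  rw [← yHat_mapCols, ← hnat, e1]
  simp only [Idx.vertex]
  rw [H.invariant h2 (H.ne_zero hne) (by omega) (by omega) (by omega) (by omega),
    H.web hne (by omega) (by omega) (by omega) (by omega)]
  exact h1 _ _ (by omega) (by omega) (by omega) (by omega)

end Good

/-! ### Reflections, rotations and the braid generators -/

section Dihedral

variable {k n : ℕ} {K : Type*}

/-- Reversal of the order of the columns. -/
def reflect (c : ZMod n) (z : Cols k n K) : Cols k n K := fun l => z (c - l)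

/-- Cyclic rotation of the columns. -/
def rotate (z : Cols k n K) : Cols k n K := fun l => z (l + 1)

/-- Inverse cyclic rotation of the columns. -/
def rotateInv (z : Cols k n K) : Cols k n K := fun l => z (l - 1)

lemma reflect_reflect (c c' : ZMod n) (z : Cols k n K) (l : ZMod n) :
    reflect c (reflect c' z) l = z (l + (c' - c)) := by
  simp only [reflect]
  congr 1
  ring

lemma MatEquiv.reflect {z z' : Cols k n ℝ} (h : MatEquiv z z') (c : ZMod n) :
    MatEquiv (reflect c z) (GrTrop.reflect c z') := h.reindex _

variable [Field K]

lemma zetaTilde_rotate (z : Cols k n K) (a : ZMod n) :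
    zetaTilde (rotate z) a = zetaTilde z (a + 1) := by
  simp only [zetaTilde, rotate, minor]
  congr 4
  all_goals (funext r s)
  · simp only [Matrix.of_apply]
    split_ifs <;> congr 1 <;> ring
  · simp only [Matrix.of_apply]
    congr 1
    ring

/-- Adding 1 to a residue modulo n may wrap around, but residue classes modulo a divisor of n do not
notice. -/
lemma cast_val_add_one (n d : ℕ) [NeZero n] (hd : d ∣ n) (l : ZMod n) :
    (l + 1).val ≡ l.val + 1 [MOD d] := by
  have : (l + 1).val ≡ l.val + 1 [MOD n] := by
    rw [← ZMod.natCast_eq_natCast_iff]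
    simp
  exact this.of_dvd hd

/-- A shift of the columns by one moves the residue classes i and i+1 modulo d to the next ones.
Consecutive generators are therefore conjugate under rotation. -/
lemma sigmaInv_rotate [NeZero n] (i : ℕ) (z : Cols k n K) :
    sigmaInv i (rotate z) = rotate (sigmaInv (i + 1) z) := by
  funext l
  have h := cast_val_add_one n _ (Nat.gcd_dvd_right k n) l
  have h1 : ((l + 1).val ≡ i + 1 [MOD k.gcd n]) ↔ (l.val ≡ i [MOD k.gcd n]) :=
    ⟨fun h' => Nat.ModEq.add_right_cancel' 1 (h.symm.trans h'),
      fun h' => h.trans (h'.add_right 1)⟩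
  have h2 : ((l + 1).val ≡ i + 1 + 1 [MOD k.gcd n]) ↔ (l.val ≡ i + 1 [MOD k.gcd n]) :=
    ⟨fun h' => Nat.ModEq.add_right_cancel' 1 (h.symm.trans h'),
      fun h' => h.trans (h'.add_right 1)⟩
  simp only [sigmaInv, rotate, h1, h2]
  rw [← zetaTilde_rotate, show l - 1 + 1 = l + 1 - 1 by ring]

lemma sigmaInv_succ [NeZero n] (i : ℕ) (z : Cols k n K) :
    sigmaInv (i + 1) z = rotateInv (sigmaInv i (rotate z)) := by
  rw [sigmaInv_rotate]
  funext l
  simp [rotate, rotateInv]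

lemma sigmaInv_eq_succ [NeZero n] (i : ℕ) (z : Cols k n K) :
    sigmaInv i z = rotate (sigmaInv (i + 1) (rotateInv z)) := by
  rw [← sigmaInv_rotate]
  congr 1
  funext l
  simp [rotate, rotateInv]

end Dihedral

/-! ### Invariance of the `ŷ`-variables and normal forms: general lemmas -/

section General

variable {k n : ℕ}

/-- Three minors stand above and three below the fraction bar, so the powers of det A cancel. The
hypothesis `hT` says that the column scalings cancel too, the columns involved forming the same
multiset above and below. -/
lemma yHat_of_matEquiv
    (hT : ∀ (t : ZMod n → ℝ) (a b : ℕ), 1 ≤ a → a ≤ n - k - 1 → 1 ≤ b → b ≤ k - 1 →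
      (∏ s : Fin k, t (vertexEntry k (a - 1, b) s : ℕ)) *
          (∏ s : Fin k, t (vertexEntry k (a, b - 1) s : ℕ)) *
          (∏ s : Fin k, t (vertexEntry k (a + 1, b + 1) s : ℕ)) =
        (∏ s : Fin k, t (vertexEntry k (a + 1, b) s : ℕ)) *
          (∏ s : Fin k, t (vertexEntry k (a, b + 1) s : ℕ)) *
          (∏ s : Fin k, t (vertexEntry k (a - 1, b - 1) s : ℕ)))
    {z z' : Cols k n ℝ} (h : MatEquiv z z') (hne : vertexPlucker z (0, 0) ≠ 0)
    {a b : ℕ} (ha : 1 ≤ a) (ha' : a ≤ n - k - 1) (hb : 1 ≤ b) (hb' : b ≤ k - 1) :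
    yHat z' (a, b) = yHat z (a, b) := by
  obtain ⟨A, t, hA, ht, h⟩ := h
  have hX : ∀ u, vertexPlucker z' u =
      A.det * (∏ s : Fin k, t (vertexEntry k u s : ℕ)) * vertexPlucker z u :=
    fun u => minor_of_matEquiv h _
  have hP : ∀ u, (∏ s : Fin k, t (vertexEntry k u s : ℕ)) ≠ 0 :=
    fun u => Finset.prod_ne_zero_iff.mpr fun s _ => ht _
  have hne' : vertexPlucker z' (0, 0) ≠ 0 := by
    rw [hX]
    exact mul_ne_zero (mul_ne_zero hA (hP _)) hne
  rw [yHat_eq z' ha ha' hb hb' hne', yHat_eq z ha ha' hb hb' hne]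
  simp only [hX]
  have hT' := hT t a b ha ha' hb hb'
  have h1 := hP (a + 1, b)
  have h2 := hP (a, b + 1)
  have h3 := hP (a - 1, b - 1)
  set p1 := ∏ s : Fin k, t (vertexEntry k (a - 1, b) s : ℕ)
  set p2 := ∏ s : Fin k, t (vertexEntry k (a, b - 1) s : ℕ)
  set p3 := ∏ s : Fin k, t (vertexEntry k (a + 1, b + 1) s : ℕ)
  set q1 := ∏ s : Fin k, t (vertexEntry k (a + 1, b) s : ℕ)
  set q2 := ∏ s : Fin k, t (vertexEntry k (a, b + 1) s : ℕ)
  set q3 := ∏ s : Fin k, t (vertexEntry k (a - 1, b - 1) s : ℕ)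
  -- The common factor by which numerator and denominator are multiplied.
  have hc : A.det ^ 3 * (q1 * q2 * q3) ≠ 0 := by positivity
  rw [← mul_div_mul_left _ (_ * _ * vertexPlucker z (a - 1, b - 1)) hc]
  congr 1
  · rw [← hT']; ring
  · ring

/-- Given nonzero numbers `P m b` with `P 0 b = 1`, there are `χ` with partial products `P`. -/
lemma exists_partialProducts (P : ℕ → ℕ → ℝ) (N : ℕ) (h0 : ∀ b, P 0 b = 1)
    (hP : ∀ m b, m ≤ N → P m b ≠ 0) :
    ∃ χ : ℕ → ℕ → ℝ, (∀ a b, a ≤ N → χ a b ≠ 0) ∧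
      ∀ m b, m ≤ N → ∏ a ∈ Finset.Icc 1 m, χ a b = P m b := by
  refine ⟨fun a b => P a b / P (a - 1) b, fun a b ha => div_ne_zero (hP _ _ ha)
    (hP _ _ (by omega)), fun m b hm => ?_⟩
  induction m with
  | zero => simp [h0]
  | succ m ih =>
    rw [Finset.prod_Icc_succ_top (by omega), ih (by omega)]
    have := hP m b (by omega)
    simp only [Nat.add_sub_cancel]
    field_simp

end General

/-! ### The case of `3 × 9` matrices -/

section ThreeNine

/-- The determinant with columns `u`, `v`, `w`. -/
def det3 (u v w : Fin 3 → ℝ) : ℝ :=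
  u 0 * (v 1 * w 2 - v 2 * w 1) - u 1 * (v 0 * w 2 - v 2 * w 0) + u 2 * (v 0 * w 1 - v 1 * w 0)

lemma minor_three {n : ℕ} (z : Cols 3 n ℝ) (c : Fin 3 → ZMod n) :
    minor z c = det3 (z (c 0)) (z (c 1)) (z (c 2)) := by
  simp only [minor, Matrix.det_fin_three, Matrix.of_apply, det3]
  ring

lemma vertexPlucker_three (z : Cols 3 9 ℝ) (a b : ℕ) : vertexPlucker z (a, b) =
    det3 (z (vertexEntry 3 (a, b) 0 : ℕ)) (z (vertexEntry 3 (a, b) 1 : ℕ))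
      (z (vertexEntry 3 (a, b) 2 : ℕ)) := minor_three z _

lemma vertexPlucker_three_zero (z : Cols 3 9 ℝ) :
    vertexPlucker z (0, 0) = det3 (z 1) (z 2) (z 3) := by
  simp [vertexPlucker_three, vertexEntry]

lemma vertexPlucker_three_one (z : Cols 3 9 ℝ) (a : ℕ) :
    vertexPlucker z (a, 1) = det3 (z 1) (z 2) (z (3 + a)) := by
  simp [vertexPlucker_three, vertexEntry]

lemma vertexPlucker_three_two (z : Cols 3 9 ℝ) (a : ℕ) :
    vertexPlucker z (a, 2) = det3 (z 1) (z (2 + a)) (z (3 + a)) := by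
  simp [vertexPlucker_three, vertexEntry]

lemma vertexPlucker_three_three (z : Cols 3 9 ℝ) (a : ℕ) :
    vertexPlucker z (a, 3) = det3 (z (1 + a)) (z (2 + a)) (z (3 + a)) := by
  simp [vertexPlucker_three, vertexEntry]

lemma mem_vertices_three {u : ℕ × ℕ} (h : u ∈ vertices 3 9) :
    u = (0, 0) ∨ ∃ a, 1 ≤ a ∧ a ≤ 6 ∧ (u = (a, 1) ∨ u = (a, 2) ∨ u = (a, 3)) := by
  obtain ⟨a, b⟩ := u
  simp only [vertices, Finset.mem_insert, Finset.mem_product, Finset.mem_Icc] at h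
  rcases h with h | ⟨⟨h1, h2⟩, h3, h4⟩
  · exact .inl h
  · refine .inr ⟨a, h1, h2, ?_⟩
    simp only [Prod.mk.injEq, true_and]
    omega

end ThreeNine

/-! ### The columns of the 3 × 9 web matrix -/

section WebColumns

variable {K : Type*} [CommRing K]

lemma webMat_apply (k n : ℕ) (χ : ℕ → ℕ → K) (l : ZMod n) (r : Fin k) {N : ℕ}
    (hN : (if l = 0 then n else l.val) = N) : webMat k n χ l r =
      if N ≤ k then (if N = r.val + 1 then 1 else 0)
      else (-1) ^ (k + (r.val + 1)) * webSum χ (k - (r.val + 1)) 0 (N - k) := by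
  simp only [webMat, hN]

/-- The columns of the `3 × 9` web matrix. -/
lemma webMat_three (χ : ℕ → ℕ → K) :
    webMat 3 9 χ 1 = ![1, 0, 0] ∧ webMat 3 9 χ 2 = ![0, 1, 0] ∧ webMat 3 9 χ 3 = ![0, 0, 1] ∧
    ∀ m, 1 ≤ m → m ≤ 6 →
      webMat 3 9 χ ((3 + m : ℕ) : ZMod 9) = ![webSum χ 2 0 m, -webSum χ 1 0 m, 1] := by
  refine ⟨?_, ?_, ?_, fun m h1 h2 => ?_⟩
  · funext r
    rw [webMat_apply 3 9 χ 1 r (N := 1) (by decide)]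
    fin_cases r <;> simp
  · funext r
    rw [webMat_apply 3 9 χ 2 r (N := 2) (by decide)]
    fin_cases r <;> simp
  · funext r
    rw [webMat_apply 3 9 χ 3 r (N := 3) (by decide)]
    fin_cases r <;> simp
  · funext r
    rw [webMat_apply 3 9 χ _ r (N := 3 + m) (by interval_cases m <;> decide)]
    rw [if_neg (by omega), Nat.add_sub_cancel_left]
    fin_cases r
    · simp [show (-1 : K) ^ 4 = 1 by ring]
    · simp [show (-1 : K) ^ 5 = -1 by ring]
    · simp [webSum, show (-1 : K) ^ 6 = 1 by ring]

end WebColumns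

section ThreeNine

/-- Expands the sums over partitions and their inner products. -/
lemma webSum_one_succ {K : Type*} [CommRing K] (χ : ℕ → ℕ → K) (r b m : ℕ) :
    webSum χ (r + 1) b (m + 1) = webSum χ (r + 1) b m +
      (∏ a ∈ Finset.Icc 1 m, χ a (b + 1)) * webSum χ r (b + 1) (m + 1) := by
  simp [webSum, Finset.sum_range_succ]

lemma webSum_zero {K : Type*} [CommRing K] (χ : ℕ → ℕ → K) (r b : ℕ) :
    webSum χ (r + 1) b 0 = 0 := by
  simp [webSum]

/-- All minors at vertices are monomials. Up to sign, the minors with b = 2 are first differences of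
the sums over partitions, and those with b = 3 are second order determinants of such differences,
which the recursion of `webSum` reduces to products. -/
lemma vertexPlucker_web_three (χ : ℕ → ℕ → ℝ) :
    vertexPlucker (webMat 3 9 χ) (0, 0) = 1 ∧ ∀ a, 1 ≤ a → a ≤ 6 →
      vertexPlucker (webMat 3 9 χ) (a, 1) = 1 ∧
      vertexPlucker (webMat 3 9 χ) (a, 2) = ∏ i ∈ Finset.Icc 1 (a - 1), χ i 1 ∧
      vertexPlucker (webMat 3 9 χ) (a, 3) = (∏ i ∈ Finset.Icc 1 (a - 1), χ i 2) *
        (∏ i ∈ Finset.Icc 1 (a - 1), χ i 1) * ∏ i ∈ Finset.Icc 1 (a - 2), χ i 1 := by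
  obtain ⟨h1, h2, h3, h⟩ := webMat_three χ
  refine ⟨by rw [vertexPlucker_three_zero, h1, h2, h3]; simp [det3], fun a ha ha' => ?_⟩
  have e0 := h a ha ha'
  push_cast at e0
  rw [vertexPlucker_three_one, vertexPlucker_three_two, vertexPlucker_three_three, h1, h2, e0]
  refine ⟨by simp [det3], ?_⟩
  -- For small a the consecutive columns reach back into the identity block, so these values are
  -- treated apart.
  obtain rfl | ha2 := eq_or_lt_of_le ha
  · have h4 : ((1 : ZMod 9) + ((1 : ℕ) : ZMod 9)) = 2 := by decide
    have h5 : ((2 : ZMod 9) + ((1 : ℕ) : ZMod 9)) = 3 := by decide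
    rw [h4, h5, h2, h3]
    simp [det3, webSum]
  · obtain ⟨m, rfl⟩ := Nat.exists_eq_add_of_le' ha2
    have e1 := h (m + 1) (by omega) (by omega)
    change 1 ≤ m + 2 at ha
    change m + 2 ≤ 6 at ha'
    have q1 : ((2 : ZMod 9) + ((m + 2 : ℕ) : ZMod 9)) = ((3 + (m + 1) : ℕ) : ZMod 9) := by
      push_cast; ring
    have q2 : ((1 : ZMod 9) + ((m + 2 : ℕ) : ZMod 9)) = ((3 + m : ℕ) : ZMod 9) := by
      push_cast; ring
    rw [q1, q2, e1]
    have s1 := webSum_one_succ χ 1 0 (m + 1)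
    have s2 := webSum_one_succ χ 0 0 (m + 1)
    have s3 := webSum_one_succ χ 1 0 m
    have s4 := webSum_one_succ χ 0 0 m
    have s5 := webSum_one_succ χ 0 1 (m + 1)
    simp only [webSum.eq_1, zero_add, mul_one, one_add_one_eq_two] at s1 s2 s3 s4 s5
    simp only [Nat.add_sub_cancel, show m + 2 - 1 = m + 1 by omega]
    constructor
    · simp only [det3, Matrix.cons_val]
      rw [s2]; ring
    · obtain rfl | hm := Nat.eq_zero_or_pos m
      · rw [show (3 + 0 : ℕ) = 3 from rfl, Nat.cast_ofNat, h3]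
        simp only [det3, Matrix.cons_val]
        rw [s1, s2, s3, s4, s5]
        simp [webSum]
        try ring
      · rw [h m hm (by omega)]
        simp only [det3, Matrix.cons_val]
        rw [s1, s2, s3, s4, s5]
        ring

lemma vertexPlucker_web_three_ne_zero {χ : ℕ → ℕ → ℝ}
    (hχ : ∀ a b, 1 ≤ a → a ≤ 9 - 3 - 1 → 1 ≤ b → b ≤ 3 - 1 → χ a b ≠ 0) :
    ∀ u ∈ vertices 3 9, vertexPlucker (webMat 3 9 χ) u ≠ 0 := by
  intro u hu
  obtain ⟨h0, h⟩ := vertexPlucker_web_three χ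
  have hp : ∀ m b, m ≤ 5 → 1 ≤ b → b ≤ 2 → ∏ i ∈ Finset.Icc 1 m, χ i b ≠ 0 := by
    intro m b hm hb hb'
    refine Finset.prod_ne_zero_iff.mpr fun i hi => ?_
    rw [Finset.mem_Icc] at hi
    exact hχ i b hi.1 (by omega) hb hb'
  rcases mem_vertices_three hu with rfl | ⟨a, ha, ha', rfl | rfl | rfl⟩
  · rw [h0]; exact one_ne_zero
  · rw [(h a ha ha').1]; exact one_ne_zero
  · rw [(h a ha ha').2.1]; exact hp _ _ (by omega) (by omega) (by omega)
  · rw [(h a ha ha').2.2]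
    exact mul_ne_zero (mul_ne_zero (hp _ _ (by omega) (by omega) (by omega))
      (hp _ _ (by omega) (by omega) (by omega))) (hp _ _ (by omega) (by omega) (by omega))

/-- The six Plücker coordinates are products of the χ over initial segments; in their alternating
quotient only the last factor χ a b survives. -/
lemma yHat_web_three {χ : ℕ → ℕ → ℝ}
    (hχ : ∀ a b, 1 ≤ a → a ≤ 9 - 3 - 1 → 1 ≤ b → b ≤ 3 - 1 → χ a b ≠ 0) {a b : ℕ} (ha : 1 ≤ a)
    (ha' : a ≤ 9 - 3 - 1) (hb : 1 ≤ b) (hb' : b ≤ 3 - 1) :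
    yHat (webMat 3 9 χ) (a, b) = χ a b := by
  obtain ⟨h0, h⟩ := vertexPlucker_web_three χ
  have hp : ∀ m b, m ≤ 5 → 1 ≤ b → b ≤ 2 → ∏ i ∈ Finset.Icc 1 m, χ i b ≠ 0 := by
    intro m b hm hb hb'
    refine Finset.prod_ne_zero_iff.mpr fun i hi => ?_
    rw [Finset.mem_Icc] at hi
    exact hχ i b hi.1 (by omega) hb hb'
  rw [yHat_eq _ ha ha' hb hb' (by rw [h0]; exact one_ne_zero)]
  obtain ⟨m, rfl⟩ := Nat.exists_eq_add_of_le' ha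
  have e1 := h (m + 1) (by omega) (by omega)
  have e2 := h (m + 1 + 1) (by omega) (by omega)
  have hb2 : b = 1 ∨ b = 2 := by omega
  have e3 : vertexPlucker (webMat 3 9 χ) (m, 1) = 1 ∧
      vertexPlucker (webMat 3 9 χ) (m, 2) = ∏ i ∈ Finset.Icc 1 (m - 1), χ i 1 := by
    obtain rfl | hm := Nat.eq_zero_or_pos m
    · simp [vertexPlucker_zero_left, h0]
    · exact ⟨(h m hm (by omega)).1, (h m hm (by omega)).2.1⟩
  have hs : ∀ b, ∏ i ∈ Finset.Icc 1 (m + 1), χ i b = (∏ i ∈ Finset.Icc 1 m, χ i b) * χ (m + 1) b :=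
    fun b => Finset.prod_Icc_succ_top (by omega) _
  have n1 := hp m 1 (by omega) (by omega) (by omega)
  have n2 := hp m 2 (by omega) (by omega) (by omega)
  have n3 := hp (m - 1) 1 (by omega) (by omega) (by omega)
  have n4 := hχ (m + 1) 1 (by omega) (by omega) (by omega) (by omega)
  simp only [Nat.add_sub_cancel, show m + 1 + 1 - 2 = m by omega,
    show m + 1 - 2 = m - 1 by omega] at e1 e2 ⊢
  rcases hb2 with rfl | rfl
  · simp only [e1, e2, e3, h0, Nat.reduceAdd, Nat.sub_self, vertexPlucker_zero_right, hs]
    field_simp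
  · simp only [e1, e2, e3, Nat.reduceAdd, Nat.add_one_sub_one, hs]
    field_simp

end ThreeNine

/-! ### Normal forms -/

section Coordinates

variable {k n : ℕ}

lemma vertexPlucker_ne_zero_of_matEquiv {z z' : Cols k n ℝ} (h : MatEquiv z z') {u : ℕ × ℕ}
    (hu : vertexPlucker z' u ≠ 0) : vertexPlucker z u ≠ 0 := by
  obtain ⟨A, t, -, -, h⟩ := h
  rw [vertexPlucker, minor_of_matEquiv h] at hu
  exact right_ne_zero_of_mul hu

/-- Coordinates with respect to the basis given by the first `k` columns. -/
lemma exists_coordinates {z : Cols k n ℝ} (h : vertexPlucker z (0, 0) ≠ 0) :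
    ∃ x : Cols k n ℝ, MatEquiv x z ∧ ∀ s : Fin k, x ((s.val + 1 : ℕ) : ZMod n) = Pi.single s 1 := by
  set A : Matrix (Fin k) (Fin k) ℝ := Matrix.of fun r s => z ((s.val + 1 : ℕ) : ZMod n) r with hA
  have hdet : A.det ≠ 0 := by
    have : vertexPlucker z (0, 0) = A.det := by simp [vertexPlucker, minor, vertexEntry, hA]
    rwa [← this]
  have hu : IsUnit A.det := isUnit_iff_ne_zero.mpr hdet
  refine ⟨fun l => A⁻¹.mulVec (z l), ⟨A, 1, hdet, by simp, fun l => ?_⟩, fun s => ?_⟩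
  · simp [Matrix.mul_nonsing_inv A hu]
  · have : z ((s.val + 1 : ℕ) : ZMod n) = A.mulVec (Pi.single s 1) := by
      funext r
      simp [hA]
    simp only
    rw [this, Matrix.mulVec_mulVec, Matrix.nonsing_inv_mul A hu, Matrix.one_mulVec]

/-- Divided differences of `X` with respect to `Y`. -/
def divDiff (Y X : ℕ → ℝ) : ℕ → ℝ
  | 0 => 0
  | m + 1 => (X (m + 1) - X m) / (Y (m + 1) - Y m)

/-- A telescoping sum of the increments of X, each written as the increment of Y times a divided
difference. -/
lemma sum_divDiff {Y X : ℕ → ℝ} {N : ℕ} (hX : X 0 = 0) (hY : ∀ m ≤ N, Y (m + 1) - Y m ≠ 0)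
    {M : ℕ} (hM : M ≤ N + 1) :
    X M = ∑ x ∈ Finset.range M, (Y (x + 1) - Y x) * divDiff Y X (x + 1) := by
  rw [← sub_zero (X M), ← hX, ← Finset.sum_range_sub]
  refine Finset.sum_congr rfl fun x hx => ?_
  rw [Finset.mem_range] at hx
  rw [divDiff, mul_div_cancel₀ _ (hY x (by omega))]

/-- If the first differences of `Y` are multiples of partial products of `χ`, and the divided
differences of `X` are given by sums over partitions, so is `X`. -/
lemma eq_webSum_succ {χ : ℕ → ℕ → ℝ} {Y X : ℕ → ℝ} {N r b : ℕ} {c : ℝ} (hX : X 0 = 0)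
    (hY : ∀ m ≤ N, Y (m + 1) - Y m ≠ 0)
    (hχ : ∀ m ≤ N, Y (m + 1) - Y m = (Y 1 - Y 0) * ∏ a ∈ Finset.Icc 1 m, χ a (b + 1))
    (h : ∀ m ≤ N + 1, 1 ≤ m → divDiff Y X m = c * webSum χ r (b + 1) m) {M : ℕ} (hM : M ≤ N + 1) :
    X M = (Y 1 - Y 0) * c * webSum χ (r + 1) b M := by
  rw [sum_divDiff hX hY hM, webSum, Finset.mul_sum]
  refine Finset.sum_congr rfl fun x hx => ?_
  rw [Finset.mem_range] at hx
  rw [hχ x (by omega), h (x + 1) (by omega) (by omega)]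
  ring

lemma eq_webSum_one {χ : ℕ → ℕ → ℝ} {Y : ℕ → ℝ} {N b : ℕ} (hY0 : Y 0 = 0)
    (hY : ∀ m ≤ N, Y (m + 1) - Y m ≠ 0)
    (hχ : ∀ m ≤ N, Y (m + 1) - Y m = (Y 1 - Y 0) * ∏ a ∈ Finset.Icc 1 m, χ a (b + 1))
    {M : ℕ} (hM : M ≤ N + 1) : Y M = (Y 1 - Y 0) * webSum χ 1 b M := by
  have := eq_webSum_succ (X := Y) (r := 0) (c := 1) hY0 hY hχ (fun m hm hm' => ?_) hM
  · simpa using this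
  · obtain ⟨m, rfl⟩ := Nat.exists_eq_add_of_le' hm'
    rw [divDiff, div_self (hY m (by omega))]
    simp [webSum]

/-- Sequences with nonzero successive divided differences come from sums over partitions. -/
lemma exists_webSum {Y : ℕ → ℕ → ℝ} {N : ℕ}
    (hY : ∀ b, ∀ m ≤ N, Y b (m + 1) - Y b m ≠ 0) :
    ∃ χ : ℕ → ℕ → ℝ, (∀ a b, a ≤ N → χ a b ≠ 0) ∧
      ∀ b, ∀ m ≤ N, Y b (m + 1) - Y b m = (Y b 1 - Y b 0) * ∏ a ∈ Finset.Icc 1 m, χ a (b + 1) := by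
  -- The second index of χ starts at 1, so column b of χ is built from the increments of `Y (b -
  -- 1)`, normalised by their initial value.
  obtain ⟨χ, h1, h2⟩ := exists_partialProducts
    (fun m b => (Y (b - 1) (m + 1) - Y (b - 1) m) / (Y (b - 1) 1 - Y (b - 1) 0)) N
    (fun b => div_self (hY _ 0 (by omega)))
    (fun m b hm => div_ne_zero (hY _ m hm) (hY _ 0 (by omega)))
  refine ⟨χ, h1, fun b m hm => ?_⟩
  rw [h2 m _ hm, Nat.add_sub_cancel, mul_div_cancel₀ _ (hY b 0 (by omega))]

end Coordinates

/-! ### Web matrices as normal forms of 3 × 9 matrices -/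

section ThreeNine

lemma natCast_zmod_nine (l : ZMod 9) : l = 1 ∨ l = 2 ∨ ∃ m ≤ 6, l = ((3 + m : ℕ) : ZMod 9) := by
  revert l; decide

/-- In the basis of the first three columns, the last coordinates of the columns from 4 on are the
minors at the vertices (a,1). These do not vanish, so the columns can be scaled to have last
coordinate 1. -/
lemma exists_affine_three {z : Cols 3 9 ℝ} (h : ∀ u ∈ vertices 3 9, vertexPlucker z u ≠ 0) :
    ∃ (x : Cols 3 9 ℝ) (X Y : ℕ → ℝ), MatEquiv x z ∧ X 0 = 0 ∧ Y 0 = 0 ∧ x 1 = ![1, 0, 0] ∧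
      x 2 = ![0, 1, 0] ∧ ∀ m ≤ 6, x ((3 + m : ℕ) : ZMod 9) = ![X m, Y m, 1] := by
  obtain ⟨x, hx, hs⟩ := exists_coordinates (h (0, 0) (by decide))
  have h1 : x 1 = ![1, 0, 0] := by
    rw [show (1 : ZMod 9) = (((0 : Fin 3).val + 1 : ℕ) : ZMod 9) from rfl, hs 0]
    funext r; fin_cases r <;> simp
  have h2 : x 2 = ![0, 1, 0] := by
    rw [show (2 : ZMod 9) = (((1 : Fin 3).val + 1 : ℕ) : ZMod 9) from rfl, hs 1]
    funext r; fin_cases r <;> simp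
  have h3 : x 3 = ![0, 0, 1] := by
    rw [show (3 : ZMod 9) = (((2 : Fin 3).val + 1 : ℕ) : ZMod 9) from rfl, hs 2]
    funext r; fin_cases r <;> simp
  have hw : ∀ m ≤ 6, x ((3 + m : ℕ) : ZMod 9) 2 ≠ 0 := by
    intro m hm
    obtain rfl | hm' := Nat.eq_zero_or_pos m
    · simp [h3]
    · have := vertexPlucker_ne_zero_of_matEquiv hx (h (m, 1) (by simp [vertices]; omega))
      rw [vertexPlucker_three_one, h1, h2] at this
      simpa [det3] using this
  have n1 : ∀ m ≤ 6, ((3 + m : ℕ) : ZMod 9) ≠ 1 ∧ ((3 + m : ℕ) : ZMod 9) ≠ 2 := by decide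
  refine ⟨fun l => if l = 1 then x l else if l = 2 then x l else (x l 2)⁻¹ • x l,
    fun m => (x ((3 + m : ℕ) : ZMod 9) 2)⁻¹ * x ((3 + m : ℕ) : ZMod 9) 0,
    fun m => (x ((3 + m : ℕ) : ZMod 9) 2)⁻¹ * x ((3 + m : ℕ) : ZMod 9) 1, ?_,
    by simp [h3], by simp [h3], by simp [h1], ?_, fun m hm => ?_⟩
  · refine MatEquiv.trans (.of_smul (fun l => if l = 1 then 1 else if l = 2 then 1 else x l 2)
      (fun l => ?_) fun l => ?_) hx
    · rcases natCast_zmod_nine l with rfl | rfl | ⟨m, hm, rfl⟩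
      · simp
      · simp
      · simp only [n1 m hm, if_false]
        exact hw m hm
    · rcases natCast_zmod_nine l with rfl | rfl | ⟨m, hm, rfl⟩
      · simp
      · simp
      · simp only [n1 m hm, if_false, smul_smul, mul_inv_cancel₀ (hw m hm), one_smul]
  · simp only
    rw [if_neg (by decide), if_pos trivial, h2]
  · simp only [n1 m hm, if_false]
    funext r
    fin_cases r
    · simp
    · simp
    · simpa using inv_mul_cancel₀ (hw m hm)

/-- In affine coordinates (X, Y, 1), the minors with b = 2 are the increments of Y up to sign, and
the minors with b = 3 control the increments of the divided differences of X with respect to Y.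
Their non-vanishing allows χ to be defined by successive quotients, and X, Y become multiples of the
sums over partitions; these constants are removed by a diagonal row operation. -/
lemma exists_matEquiv_web_three {z : Cols 3 9 ℝ}
    (h : ∀ u ∈ vertices 3 9, vertexPlucker z u ≠ 0) :
    ∃ χ : ℕ → ℕ → ℝ, (∀ a b, 1 ≤ a → a ≤ 9 - 3 - 1 → 1 ≤ b → b ≤ 3 - 1 → χ a b ≠ 0) ∧
      MatEquiv (webMat 3 9 χ) z := by
  obtain ⟨x, X, Y, hx, hX, hY, h1, h2, h3⟩ := exists_affine_three h
  have hP : ∀ u ∈ vertices 3 9, vertexPlucker x u ≠ 0 :=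
    fun u hu => vertexPlucker_ne_zero_of_matEquiv hx (h u hu)
  have dY : ∀ m ≤ 5, Y (m + 1) - Y m ≠ 0 := by
    intro m hm
    have := hP (m + 1, 2) (by simp [vertices]; omega)
    rw [vertexPlucker_three_two, h1,
      show ((2 : ZMod 9) + ((m + 1 : ℕ) : ZMod 9)) = ((3 + m : ℕ) : ZMod 9) by push_cast; ring,
      show ((3 : ZMod 9) + ((m + 1 : ℕ) : ZMod 9)) = ((3 + (m + 1) : ℕ) : ZMod 9) by push_cast; ring,
      h3 _ (by omega), h3 _ (by omega)] at this
    intro h0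
    apply this
    simp only [det3, Matrix.cons_val]
    linear_combination -h0
  have dV : ∀ m ≤ 5, divDiff Y X (m + 1) - divDiff Y X m ≠ 0 := by
    intro m hm
    have := hP (m + 1, 3) (by simp [vertices]; omega)
    rw [vertexPlucker_three_three,
      show ((2 : ZMod 9) + ((m + 1 : ℕ) : ZMod 9)) = ((3 + m : ℕ) : ZMod 9) by push_cast; ring,
      show ((3 : ZMod 9) + ((m + 1 : ℕ) : ZMod 9)) = ((3 + (m + 1) : ℕ) : ZMod 9) by push_cast; ring,
      h3 _ (by omega), h3 _ (by omega)] at this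
    obtain rfl | hm' := Nat.eq_zero_or_pos m
    · rw [show ((1 : ZMod 9) + ((0 + 1 : ℕ) : ZMod 9)) = 2 by decide, h2] at this
      have h0 := dY 0 (by omega)
      simp only [divDiff, hX, hY, sub_zero, zero_add] at this h0 ⊢
      refine div_ne_zero (fun h0 => this ?_) h0
      simp [det3, h0]
    · obtain ⟨m, rfl⟩ := Nat.exists_eq_add_of_le' hm'
      rw [show ((1 : ZMod 9) + ((m + 1 + 1 : ℕ) : ZMod 9)) = ((3 + m : ℕ) : ZMod 9) by
        push_cast; ring, h3 _ (by omega)] at this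
      have e1 := dY m (by omega)
      have e2 := dY (m + 1) (by omega)
      simp only [divDiff]
      rw [div_sub_div _ _ e2 e1]
      refine div_ne_zero (fun h0 => this ?_) (mul_ne_zero e2 e1)
      simp only [det3, Matrix.cons_val]
      linear_combination -h0
  -- Only the rows 0 and 1 of this family are used; repeating the second one keeps all increments
  -- nonzero.
  obtain ⟨χ, hχ, hs⟩ := exists_webSum (Y := fun b => if b = 0 then Y else divDiff Y X) (N := 5)
    (fun b => by split_ifs <;> assumption)
  have s0 := hs 0
  have s1 := hs 1
  simp only [if_pos, one_ne_zero, if_false] at s0 s1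
  have eY : ∀ M ≤ 6, Y M = (Y 1 - Y 0) * webSum χ 1 0 M := fun M hM => eq_webSum_one hY dY s0 hM
  have eX : ∀ M ≤ 6, X M = (Y 1 - Y 0) * (divDiff Y X 1 - divDiff Y X 0) * webSum χ 2 0 M :=
    fun M hM => eq_webSum_succ hX dY s0
      (fun m hm _ => eq_webSum_one (Y := divDiff Y X) rfl dV s1 hm) hM
  refine ⟨χ, fun a b _ ha _ _ => hχ a b ha, MatEquiv.trans ?_ hx⟩
  have c1 := dY 0 (by omega)
  have c2 := dV 0 (by omega)
  simp only [zero_add] at c1 c2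
  -- The constants by which Y and X differ from the partition sums: β for Y and β α for X.
  set β := Y 1 - Y 0
  set α := divDiff Y X 1 - divDiff Y X 0
  obtain ⟨w1, w2, w3, w⟩ := webMat_three χ
  have key : ∀ l, ∃ t : ℝ, t ≠ 0 ∧
      x l = t • (Matrix.diagonal ![β * α, -β, 1]).mulVec (webMat 3 9 χ l) := by
    intro l
    rcases natCast_zmod_nine l with rfl | rfl | ⟨m, hm, rfl⟩
    · refine ⟨(β * α)⁻¹, inv_ne_zero (mul_ne_zero c1 c2), ?_⟩
      rw [w1, h1]
      funext r
      fin_cases r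
      · simp [Matrix.mulVec_diagonal]
        field_simp
      · simp [Matrix.mulVec_diagonal]
      · simp [Matrix.mulVec_diagonal]
    · refine ⟨(-β)⁻¹, inv_ne_zero (neg_ne_zero.mpr c1), ?_⟩
      rw [w2, h2]
      funext r
      fin_cases r <;> simp [Matrix.mulVec_diagonal, c1]
    · refine ⟨1, one_ne_zero, ?_⟩
      rw [h3 m hm, one_smul]
      obtain rfl | hm' := Nat.eq_zero_or_pos m
      · rw [show (3 + 0 : ℕ) = 3 from rfl, Nat.cast_ofNat, w3, hX, hY]
        funext r
        fin_cases r <;> simp [Matrix.mulVec_diagonal]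
      · rw [w m hm' hm, eX m hm, eY m hm]
        funext r
        fin_cases r <;> simp [Matrix.mulVec_diagonal]
  choose t ht hxt using key
  refine ⟨_, t, ?_, ht, hxt⟩
  simp [Matrix.det_diagonal, Fin.prod_univ_succ, c1, c2]

theorem yHatSpec_three : YHatSpec 3 9 where
  invariant hz hne _ _ ha ha' hb hb' := by
    refine yHat_of_matEquiv (fun t a b ha ha' hb hb' => ?_) hz (hne _ (by decide)) ha ha' hb hb'
    have : b = 1 ∨ b = 2 := by omega
    obtain ⟨a, rfl⟩ := Nat.exists_eq_add_of_le' ha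
    rcases this with rfl | rfl
    -- The index sets of the three vertices above and the three below the fraction bar contain each
    -- column equally often.
    all_goals (simp [Fin.prod_univ_succ, vertexEntry, add_comm, add_left_comm]; ring_nf)
  ne_zero h := vertexPlucker_web_three_ne_zero h
  web h _ _ ha ha' hb hb' := yHat_web_three h ha ha' hb hb'
  normalForm h := exists_matEquiv_web_three h

end ThreeNine

/-! ### The case of `4 × 8` matrices -/

section FourEight

/-- The determinant with columns `u`, `v`, `w`, `x`. -/
def det4 (u v w x : Fin 4 → ℝ) : ℝ :=
  (u 0 * v 1 - u 1 * v 0) * (w 2 * x 3 - w 3 * x 2) -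
    (u 0 * v 2 - u 2 * v 0) * (w 1 * x 3 - w 3 * x 1) +
    (u 0 * v 3 - u 3 * v 0) * (w 1 * x 2 - w 2 * x 1) +
    (u 1 * v 2 - u 2 * v 1) * (w 0 * x 3 - w 3 * x 0) -
    (u 1 * v 3 - u 3 * v 1) * (w 0 * x 2 - w 2 * x 0) +
    (u 2 * v 3 - u 3 * v 2) * (w 0 * x 1 - w 1 * x 0)

lemma minor_four {n : ℕ} (z : Cols 4 n ℝ) (c : Fin 4 → ZMod n) :
    minor z c = det4 (z (c 0)) (z (c 1)) (z (c 2)) (z (c 3)) := by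
  rw [minor, Matrix.det_succ_row_zero]
  simp only [Fin.sum_univ_succ, Matrix.det_fin_three, Matrix.submatrix_apply, Matrix.of_apply, det4]
  simp [Fin.succAbove, Fin.lt_def]
  ring

lemma vertexPlucker_four (z : Cols 4 8 ℝ) (a b : ℕ) : vertexPlucker z (a, b) =
    det4 (z (vertexEntry 4 (a, b) 0 : ℕ)) (z (vertexEntry 4 (a, b) 1 : ℕ))
      (z (vertexEntry 4 (a, b) 2 : ℕ)) (z (vertexEntry 4 (a, b) 3 : ℕ)) := minor_four z _

lemma vertexPlucker_four_zero (z : Cols 4 8 ℝ) :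
    vertexPlucker z (0, 0) = det4 (z 1) (z 2) (z 3) (z 4) := by
  simp [vertexPlucker_four, vertexEntry]

lemma vertexPlucker_four_one (z : Cols 4 8 ℝ) (a : ℕ) :
    vertexPlucker z (a, 1) = det4 (z 1) (z 2) (z 3) (z (4 + a)) := by
  simp [vertexPlucker_four, vertexEntry]

lemma vertexPlucker_four_two (z : Cols 4 8 ℝ) (a : ℕ) :
    vertexPlucker z (a, 2) = det4 (z 1) (z 2) (z (3 + a)) (z (4 + a)) := by
  simp [vertexPlucker_four, vertexEntry]

lemma vertexPlucker_four_three (z : Cols 4 8 ℝ) (a : ℕ) :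
    vertexPlucker z (a, 3) = det4 (z 1) (z (2 + a)) (z (3 + a)) (z (4 + a)) := by
  simp [vertexPlucker_four, vertexEntry]

lemma vertexPlucker_four_four (z : Cols 4 8 ℝ) (a : ℕ) :
    vertexPlucker z (a, 4) = det4 (z (1 + a)) (z (2 + a)) (z (3 + a)) (z (4 + a)) := by
  simp [vertexPlucker_four, vertexEntry]

lemma mem_vertices_four {u : ℕ × ℕ} (h : u ∈ vertices 4 8) :
    u = (0, 0) ∨ ∃ a, 1 ≤ a ∧ a ≤ 4 ∧ (u = (a, 1) ∨ u = (a, 2) ∨ u = (a, 3) ∨ u = (a, 4)) := by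
  obtain ⟨a, b⟩ := u
  simp only [vertices, Finset.mem_insert, Finset.mem_product, Finset.mem_Icc] at h
  rcases h with h | ⟨⟨h1, h2⟩, h3, h4⟩
  · exact .inl h
  · refine .inr ⟨a, h1, h2, ?_⟩
    simp only [Prod.mk.injEq, true_and]
    omega

/-- The columns of the `4 × 8` web matrix. -/
lemma webMat_four {K : Type*} [CommRing K] (χ : ℕ → ℕ → K) :
    webMat 4 8 χ 1 = ![1, 0, 0, 0] ∧ webMat 4 8 χ 2 = ![0, 1, 0, 0] ∧
    webMat 4 8 χ 3 = ![0, 0, 1, 0] ∧ webMat 4 8 χ 4 = ![0, 0, 0, 1] ∧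
    ∀ m, 1 ≤ m → m ≤ 4 → webMat 4 8 χ ((4 + m : ℕ) : ZMod 8) =
      ![-webSum χ 3 0 m, webSum χ 2 0 m, -webSum χ 1 0 m, 1] := by
  refine ⟨?_, ?_, ?_, ?_, fun m h1 h2 => ?_⟩
  · funext r
    rw [webMat_apply 4 8 χ 1 r (N := 1) (by decide)]
    fin_cases r <;> simp
  · funext r
    rw [webMat_apply 4 8 χ 2 r (N := 2) (by decide)]
    fin_cases r <;> simp
  · funext r
    rw [webMat_apply 4 8 χ 3 r (N := 3) (by decide)]
    fin_cases r <;> simp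
  · funext r
    rw [webMat_apply 4 8 χ 4 r (N := 4) (by decide)]
    fin_cases r <;> simp
  · funext r
    rw [webMat_apply 4 8 χ _ r (N := 4 + m) (by interval_cases m <;> decide)]
    rw [if_neg (by omega), Nat.add_sub_cancel_left]
    fin_cases r
    · simp [show (-1 : K) ^ 5 = -1 by ring]
    · simp [show (-1 : K) ^ 6 = 1 by ring]
    · simp [show (-1 : K) ^ 7 = -1 by ring]
    · simp [webSum, show (-1 : K) ^ 8 = 1 by ring]

/-- The mechanism is that of `vertexPlucker_web_three`, with differences of order up to three. -/
lemma vertexPlucker_web_four (χ : ℕ → ℕ → ℝ) :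
    vertexPlucker (webMat 4 8 χ) (0, 0) = 1 ∧ ∀ a, 1 ≤ a → a ≤ 4 →
      vertexPlucker (webMat 4 8 χ) (a, 1) = 1 ∧
      vertexPlucker (webMat 4 8 χ) (a, 2) = ∏ i ∈ Finset.Icc 1 (a - 1), χ i 1 ∧
      vertexPlucker (webMat 4 8 χ) (a, 3) = (∏ i ∈ Finset.Icc 1 (a - 1), χ i 2) *
        (∏ i ∈ Finset.Icc 1 (a - 1), χ i 1) * ∏ i ∈ Finset.Icc 1 (a - 2), χ i 1 ∧
      vertexPlucker (webMat 4 8 χ) (a, 4) = (∏ i ∈ Finset.Icc 1 (a - 1), χ i 3) *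
        ((∏ i ∈ Finset.Icc 1 (a - 1), χ i 2) * ∏ i ∈ Finset.Icc 1 (a - 2), χ i 2) *
        ((∏ i ∈ Finset.Icc 1 (a - 1), χ i 1) * (∏ i ∈ Finset.Icc 1 (a - 2), χ i 1) *
        ∏ i ∈ Finset.Icc 1 (a - 3), χ i 1) := by
  obtain ⟨h1, h2, h3, h4, h⟩ := webMat_four χ
  refine ⟨by rw [vertexPlucker_four_zero, h1, h2, h3, h4]; simp [det4], fun a ha ha' => ?_⟩
  have e0 := h a ha ha'
  push_cast at e0
  rw [vertexPlucker_four_one, vertexPlucker_four_two, vertexPlucker_four_three,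
    vertexPlucker_four_four, h1, h2, h3, e0]
  refine ⟨by simp [det4], ?_⟩
  obtain ⟨m, rfl⟩ := Nat.exists_eq_add_of_le' ha
  have q1 : ((3 : ZMod 8) + ((m + 1 : ℕ) : ZMod 8)) = ((4 + m : ℕ) : ZMod 8) := by
    push_cast; ring
  have q2 : ((2 : ZMod 8) + ((m + 1 : ℕ) : ZMod 8)) = ((3 + m : ℕ) : ZMod 8) := by
    push_cast; ring
  have q3 : ((1 : ZMod 8) + ((m + 1 : ℕ) : ZMod 8)) = ((2 + m : ℕ) : ZMod 8) := by
    push_cast; ring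
  rw [q1, q2, q3]
  have key : ∀ m, webSum χ 3 0 (m + 1) = webSum χ 3 0 m +
        (∏ a ∈ Finset.Icc 1 m, χ a 1) * webSum χ 2 1 (m + 1) ∧
      webSum χ 2 0 (m + 1) = webSum χ 2 0 m +
        (∏ a ∈ Finset.Icc 1 m, χ a 1) * webSum χ 1 1 (m + 1) ∧
      webSum χ 1 0 (m + 1) = webSum χ 1 0 m + ∏ a ∈ Finset.Icc 1 m, χ a 1 ∧
      webSum χ 2 1 (m + 1) = webSum χ 2 1 m +
        (∏ a ∈ Finset.Icc 1 m, χ a 2) * webSum χ 1 2 (m + 1) ∧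
      webSum χ 1 1 (m + 1) = webSum χ 1 1 m + ∏ a ∈ Finset.Icc 1 m, χ a 2 ∧
      webSum χ 1 2 (m + 1) = webSum χ 1 2 m + ∏ a ∈ Finset.Icc 1 m, χ a 3 := by
    intro m
    have s1 := webSum_one_succ χ 2 0 m
    have s2 := webSum_one_succ χ 1 0 m
    have s3 := webSum_one_succ χ 0 0 m
    have s4 := webSum_one_succ χ 1 1 m
    have s5 := webSum_one_succ χ 0 1 m
    have s6 := webSum_one_succ χ 0 2 m
    simp only [webSum.eq_1, zero_add, mul_one, Nat.reduceAdd] at s1 s2 s3 s4 s5 s6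
    exact ⟨s1, s2, s3, s4, s5, s6⟩
  obtain ⟨a1, a2, a3, a4, a5, a6⟩ := key m
  simp only [Nat.add_sub_cancel, show m + 1 - 2 = m - 1 by omega,
    show m + 1 - 3 = m - 2 by omega]
  -- The cases m = 0, 1, 2 are those in which the last block of consecutive columns starts in the
  -- identity block, at column 2, 3 or 4.
  obtain rfl | hm := Nat.eq_zero_or_pos m
  · rw [show (4 + 0 : ℕ) = 4 from rfl, show (3 + 0 : ℕ) = 3 from rfl,
      show (2 + 0 : ℕ) = 2 from rfl, Nat.cast_ofNat, Nat.cast_ofNat, Nat.cast_ofNat, h2, h3, h4]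
    simp only [det4, Matrix.cons_val, a1, a2, a3, a4, a5, a6, webSum_zero χ 2 0,
      webSum_zero χ 1 0, webSum_zero χ 0 0, webSum_zero χ 0 1, webSum_zero χ 1 1, webSum_zero χ 0 2]
    simp
  obtain ⟨m, rfl⟩ := Nat.exists_eq_add_of_le' hm
  obtain ⟨b1, b2, b3, b4, b5, b6⟩ := key m
  have e1 := h (m + 1) (by omega) (by omega)
  rw [e1, show 3 + (m + 1) = 4 + m by ring, show 2 + (m + 1) = 3 + m by ring]
  simp only [Nat.add_sub_cancel, show m + 1 - 2 = m - 1 by omega]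
  refine ⟨?_, ?_⟩
  · simp only [det4, Matrix.cons_val]
    rw [a3]; ring
  obtain rfl | hm := Nat.eq_zero_or_pos m
  · rw [show (4 + 0 : ℕ) = 4 from rfl, show (3 + 0 : ℕ) = 3 from rfl,
      Nat.cast_ofNat, Nat.cast_ofNat, h3, h4]
    simp only [det4, Matrix.cons_val, a1, a2, a3, a4, a5, a6, b1, b2, b3, b4, b5, b6,
      webSum_zero χ 2 0,
      webSum_zero χ 1 0, webSum_zero χ 0 0, webSum_zero χ 0 1, webSum_zero χ 1 1, webSum_zero χ 0 2]
    simp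
    constructor <;> ring
  obtain ⟨m, rfl⟩ := Nat.exists_eq_add_of_le' hm
  obtain ⟨c1, c2, c3, c4, c5, c6⟩ := key m
  have e2 := h (m + 1) (by omega) (by omega)
  rw [e2, show 3 + (m + 1) = 4 + m by ring]
  simp only [Nat.add_sub_cancel]
  constructor
  · simp only [det4, Matrix.cons_val]
    rw [a2, a3, b2, b3, a5]; ring
  obtain rfl | hm := Nat.eq_zero_or_pos m
  · rw [show (4 + 0 : ℕ) = 4 from rfl, Nat.cast_ofNat, h4]
    simp only [det4, Matrix.cons_val, a1, a2, a3, a4, a5, a6, b1, b2, b3, b4, b5, b6, c1, c2, c3,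
      c4, c5, c6, webSum_zero χ 2 0,
      webSum_zero χ 1 0, webSum_zero χ 0 0, webSum_zero χ 0 1, webSum_zero χ 1 1, webSum_zero χ 0 2]
    simp
    ring
  · rw [h m (by omega) (by omega)]
    simp only [det4, Matrix.cons_val]
    rw [a1, a2, a3, b1, b2, b3, c1, c2, c3, a4, a5, b4, b5, a6]
    ring

lemma vertexPlucker_web_four_ne_zero {χ : ℕ → ℕ → ℝ}
    (hχ : ∀ a b, 1 ≤ a → a ≤ 8 - 4 - 1 → 1 ≤ b → b ≤ 4 - 1 → χ a b ≠ 0) :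
    ∀ u ∈ vertices 4 8, vertexPlucker (webMat 4 8 χ) u ≠ 0 := by
  intro u hu
  obtain ⟨h0, h⟩ := vertexPlucker_web_four χ
  have hp : ∀ m b, m ≤ 3 → 1 ≤ b → b ≤ 3 → ∏ i ∈ Finset.Icc 1 m, χ i b ≠ 0 := by
    intro m b hm hb hb'
    refine Finset.prod_ne_zero_iff.mpr fun i hi => ?_
    rw [Finset.mem_Icc] at hi
    exact hχ i b hi.1 (by omega) hb hb'
  have hp1 : ∀ m, m ≤ 3 → ∏ i ∈ Finset.Icc 1 m, χ i 1 ≠ 0 := fun m hm => hp m 1 hm le_rfl (by omega)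
  have hp2 : ∀ m, m ≤ 3 → ∏ i ∈ Finset.Icc 1 m, χ i 2 ≠ 0 :=
    fun m hm => hp m 2 hm (by omega) (by omega)
  have hp3 : ∀ m, m ≤ 3 → ∏ i ∈ Finset.Icc 1 m, χ i 3 ≠ 0 := fun m hm => hp m 3 hm (by omega) le_rfl
  rcases mem_vertices_four hu with rfl | ⟨a, ha, ha', rfl | rfl | rfl | rfl⟩
  · rw [h0]; exact one_ne_zero
  · rw [(h a ha ha').1]; exact one_ne_zero
  · rw [(h a ha ha').2.1]; exact hp1 _ (by omega)
  · rw [(h a ha ha').2.2.1]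
    exact mul_ne_zero (mul_ne_zero (hp2 _ (by omega)) (hp1 _ (by omega))) (hp1 _ (by omega))
  · rw [(h a ha ha').2.2.2]
    exact mul_ne_zero (mul_ne_zero (hp3 _ (by omega))
      (mul_ne_zero (hp2 _ (by omega)) (hp2 _ (by omega))))
      (mul_ne_zero (mul_ne_zero (hp1 _ (by omega)) (hp1 _ (by omega))) (hp1 _ (by omega)))

lemma yHat_web_four {χ : ℕ → ℕ → ℝ}
    (hχ : ∀ a b, 1 ≤ a → a ≤ 8 - 4 - 1 → 1 ≤ b → b ≤ 4 - 1 → χ a b ≠ 0) {a b : ℕ} (ha : 1 ≤ a)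
    (ha' : a ≤ 8 - 4 - 1) (hb : 1 ≤ b) (hb' : b ≤ 4 - 1) :
    yHat (webMat 4 8 χ) (a, b) = χ a b := by
  obtain ⟨h0, h⟩ := vertexPlucker_web_four χ
  have hp : ∀ m b, m ≤ 3 → 1 ≤ b → b ≤ 3 → ∏ i ∈ Finset.Icc 1 m, χ i b ≠ 0 := by
    intro m b hm hb hb'
    refine Finset.prod_ne_zero_iff.mpr fun i hi => ?_
    rw [Finset.mem_Icc] at hi
    exact hχ i b hi.1 (by omega) hb hb'
  rw [yHat_eq _ ha ha' hb hb' (by rw [h0]; exact one_ne_zero)]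
  obtain ⟨m, rfl⟩ := Nat.exists_eq_add_of_le' ha
  have e1 := h (m + 1) (by omega) (by omega)
  have e2 := h (m + 1 + 1) (by omega) (by omega)
  have hb2 : b = 1 ∨ b = 2 ∨ b = 3 := by omega
  have e3 : vertexPlucker (webMat 4 8 χ) (m, 1) = 1 ∧
      vertexPlucker (webMat 4 8 χ) (m, 2) = ∏ i ∈ Finset.Icc 1 (m - 1), χ i 1 ∧
      vertexPlucker (webMat 4 8 χ) (m, 3) = (∏ i ∈ Finset.Icc 1 (m - 1), χ i 2) *
        (∏ i ∈ Finset.Icc 1 (m - 1), χ i 1) * ∏ i ∈ Finset.Icc 1 (m - 2), χ i 1 := by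
    obtain rfl | hm := Nat.eq_zero_or_pos m
    · simp [vertexPlucker_zero_left, h0]
    · exact ⟨(h m hm (by omega)).1, (h m hm (by omega)).2.1, (h m hm (by omega)).2.2.1⟩
  have hs : ∀ b, ∏ i ∈ Finset.Icc 1 (m + 1), χ i b = (∏ i ∈ Finset.Icc 1 m, χ i b) * χ (m + 1) b :=
    fun b => Finset.prod_Icc_succ_top (by omega) _
  have n1 := hp m 1 (by omega) (by omega) (by omega)
  have n2 := hp m 2 (by omega) (by omega) (by omega)
  have n3 := hp (m - 1) 1 (by omega) (by omega) (by omega)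
  have n4 := hp m 3 (by omega) (by omega) (by omega)
  have n5 := hp (m - 1) 2 (by omega) (by omega) (by omega)
  have n6 := hp (m - 2) 1 (by omega) (by omega) (by omega)
  have n7 := hχ (m + 1) 1 (by omega) (by omega) (by omega) (by omega)
  have n8 := hχ (m + 1) 2 (by omega) (by omega) (by omega) (by omega)
  simp only [Nat.add_sub_cancel, show m + 1 + 1 - 2 = m by omega, show m + 1 + 1 - 3 = m - 1 by omega,
    show m + 1 - 2 = m - 1 by omega, show m + 1 - 3 = m - 2 by omega] at e1 e2 ⊢
  rcases hb2 with rfl | rfl | rfl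
  · simp only [e1, e2, e3, h0, Nat.reduceAdd, Nat.sub_self, vertexPlucker_zero_right, hs]
    field_simp
  · simp only [e1, e2, e3, Nat.reduceAdd, Nat.add_one_sub_one, hs]
    field_simp
  · simp only [e1, e2, e3, Nat.reduceAdd, Nat.reduceSub, hs]
    field_simp

end FourEight

/-! ### Web matrices as normal forms of 4 × 8 matrices -/

section FourEight

lemma natCast_zmod_eight (l : ZMod 8) :
    l = 1 ∨ l = 2 ∨ l = 3 ∨ ∃ m ≤ 4, l = ((4 + m : ℕ) : ZMod 8) := by
  revert l; decide

/-- As in `exists_affine_three`: the last coordinates are minors at the vertices (a,1), hence can be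
scaled to 1. -/
lemma exists_affine_four {z : Cols 4 8 ℝ} (h : ∀ u ∈ vertices 4 8, vertexPlucker z u ≠ 0) :
    ∃ (x : Cols 4 8 ℝ) (U X Y : ℕ → ℝ), MatEquiv x z ∧ U 0 = 0 ∧ X 0 = 0 ∧ Y 0 = 0 ∧
      x 1 = ![1, 0, 0, 0] ∧ x 2 = ![0, 1, 0, 0] ∧ x 3 = ![0, 0, 1, 0] ∧
      ∀ m ≤ 4, x ((4 + m : ℕ) : ZMod 8) = ![U m, X m, Y m, 1] := by
  obtain ⟨x, hx, hs⟩ := exists_coordinates (h (0, 0) (by decide))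
  have h1 : x 1 = ![1, 0, 0, 0] := by
    rw [show (1 : ZMod 8) = (((0 : Fin 4).val + 1 : ℕ) : ZMod 8) from rfl, hs 0]
    funext r; fin_cases r <;> simp
  have h2 : x 2 = ![0, 1, 0, 0] := by
    rw [show (2 : ZMod 8) = (((1 : Fin 4).val + 1 : ℕ) : ZMod 8) from rfl, hs 1]
    funext r; fin_cases r <;> simp
  have h3 : x 3 = ![0, 0, 1, 0] := by
    rw [show (3 : ZMod 8) = (((2 : Fin 4).val + 1 : ℕ) : ZMod 8) from rfl, hs 2]
    funext r; fin_cases r <;> simp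
  have h4 : x 4 = ![0, 0, 0, 1] := by
    rw [show (4 : ZMod 8) = (((3 : Fin 4).val + 1 : ℕ) : ZMod 8) from rfl, hs 3]
    funext r; fin_cases r <;> simp
  have hw : ∀ m ≤ 4, x ((4 + m : ℕ) : ZMod 8) 3 ≠ 0 := by
    intro m hm
    obtain rfl | hm' := Nat.eq_zero_or_pos m
    · simp [h4]
    · have := vertexPlucker_ne_zero_of_matEquiv hx (h (m, 1) (by simp [vertices]; omega))
      rw [vertexPlucker_four_one, h1, h2, h3] at this
      simpa [det4] using this
  have n1 : ∀ m ≤ 4, ((4 + m : ℕ) : ZMod 8) ≠ 1 ∧ ((4 + m : ℕ) : ZMod 8) ≠ 2 ∧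
    ((4 + m : ℕ) : ZMod 8) ≠ 3 := by decide
  refine ⟨fun l => if l = 1 then x l else if l = 2 then x l else if l = 3 then x l
      else (x l 3)⁻¹ • x l,
    fun m => (x ((4 + m : ℕ) : ZMod 8) 3)⁻¹ * x ((4 + m : ℕ) : ZMod 8) 0,
    fun m => (x ((4 + m : ℕ) : ZMod 8) 3)⁻¹ * x ((4 + m : ℕ) : ZMod 8) 1,
    fun m => (x ((4 + m : ℕ) : ZMod 8) 3)⁻¹ * x ((4 + m : ℕ) : ZMod 8) 2, ?_,
    by simp [h4], by simp [h4], by simp [h4], by simp [h1], ?_, ?_, fun m hm => ?_⟩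
  · refine MatEquiv.trans (.of_smul (fun l => if l = 1 then 1 else if l = 2 then 1 else
      if l = 3 then 1 else x l 3) (fun l => ?_) fun l => ?_) hx
    · rcases natCast_zmod_eight l with rfl | rfl | rfl | ⟨m, hm, rfl⟩
      · simp
      · simp
      · simp
      · simp only [n1 m hm, if_false]
        exact hw m hm
    · rcases natCast_zmod_eight l with rfl | rfl | rfl | ⟨m, hm, rfl⟩
      · simp
      · simp
      · simp
      · simp only [n1 m hm, if_false, smul_smul, mul_inv_cancel₀ (hw m hm), one_smul]
  · simp only
    rw [if_neg (by decide), if_pos trivial, h2]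
  · simp only
    rw [if_neg (by decide), if_neg (by decide), if_pos trivial, h3]
  · simp only [n1 m hm, if_false]
    funext r
    fin_cases r
    · simp
    · simp
    · simp
    · simpa using inv_mul_cancel₀ (hw m hm)

lemma second_difference_ne_zero {x0 x1 y0 y1 : ℝ} (h0 : y0 ≠ 0) (h1 : y1 ≠ 0)
    (h : x1 * y0 - x0 * y1 ≠ 0) : x1 / y1 - x0 / y0 ≠ 0 := by
  rw [div_sub_div _ _ h1 h0]
  refine div_ne_zero ?_ (mul_ne_zero h1 h0)
  rwa [mul_comm y1]

/-- Over a common denominator, the difference of nested quotients has the 3 × 3 determinant of the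
vectors (u, x, y), up to the nonzero factor y1, as its numerator. -/
lemma third_difference_ne_zero {u0 u1 u2 x0 x1 x2 y0 y1 y2 : ℝ} (h0 : y0 ≠ 0) (h1 : y1 ≠ 0)
    (h2 : y2 ≠ 0) (hx : x1 / y1 - x0 / y0 ≠ 0) (hx' : x2 / y2 - x1 / y1 ≠ 0)
    (h : u2 * (x1 * y0 - x0 * y1) - u1 * (x2 * y0 - x0 * y2) + u0 * (x2 * y1 - x1 * y2) ≠ 0) :
    (u2 / y2 - u1 / y1) / (x2 / y2 - x1 / y1) - (u1 / y1 - u0 / y0) / (x1 / y1 - x0 / y0) ≠ 0 := by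
  rw [div_sub_div _ _ hx' hx]
  refine div_ne_zero (fun h3 => h ?_) (mul_ne_zero hx' hx)
  field_simp at h3
  have h4 : y1 * (u2 * (x1 * y0 - x0 * y1) - u1 * (x2 * y0 - x0 * y2) +
    u0 * (x2 * y1 - x1 * y2)) = 0 := by linear_combination h3
  exact (mul_eq_zero.mp h4).resolve_left h1

/-- With affine coordinates (U, X, Y, 1), the minors with b = 2, 3, 4 govern the increments of Y, of
the divided differences of X by Y, and of the divided differences of those of U by those of X. All
three sequences of increments are nonzero and their successive quotients define χ. -/
lemma exists_matEquiv_web_four {z : Cols 4 8 ℝ}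
    (h : ∀ u ∈ vertices 4 8, vertexPlucker z u ≠ 0) :
    ∃ χ : ℕ → ℕ → ℝ, (∀ a b, 1 ≤ a → a ≤ 8 - 4 - 1 → 1 ≤ b → b ≤ 4 - 1 → χ a b ≠ 0) ∧
      MatEquiv (webMat 4 8 χ) z := by
  obtain ⟨x, U, X, Y, hx, hU, hX, hY, h1, h2, h3, h4⟩ := exists_affine_four h
  have hP : ∀ u ∈ vertices 4 8, vertexPlucker x u ≠ 0 :=
    fun u hu => vertexPlucker_ne_zero_of_matEquiv hx (h u hu)
  have q1 : ∀ m : ℕ, ((4 : ZMod 8) + ((m + 1 : ℕ) : ZMod 8)) = ((4 + (m + 1) : ℕ) : ZMod 8) := by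
    intro m; push_cast; ring
  have q2 : ∀ m : ℕ, ((3 : ZMod 8) + ((m + 1 : ℕ) : ZMod 8)) = ((4 + m : ℕ) : ZMod 8) := by
    intro m; push_cast; ring
  have q3 : ∀ m : ℕ, ((2 : ZMod 8) + ((m + 1 + 1 : ℕ) : ZMod 8)) = ((4 + m : ℕ) : ZMod 8) := by
    intro m; push_cast; ring
  have q4 : ∀ m : ℕ, ((1 : ZMod 8) + ((m + 1 + 1 + 1 : ℕ) : ZMod 8)) = ((4 + m : ℕ) : ZMod 8) := by
    intro m; push_cast; ring
  have dY : ∀ m ≤ 3, Y (m + 1) - Y m ≠ 0 := by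
    intro m hm
    have := hP (m + 1, 2) (by simp [vertices]; omega)
    rw [vertexPlucker_four_two, h1, h2, q1, q2, h4 _ (by omega), h4 _ (by omega)] at this
    intro h0
    apply this
    simp only [det4, Matrix.cons_val]
    linear_combination -h0
  have dX : ∀ m ≤ 2, (X (m + 1 + 1) - X (m + 1)) * (Y (m + 1) - Y m) -
      (X (m + 1) - X m) * (Y (m + 1 + 1) - Y (m + 1)) ≠ 0 := by
    intro m hm
    have := hP (m + 1 + 1, 3) (by simp [vertices]; omega)
    rw [vertexPlucker_four_three, h1, q1, q2, q3, h4 _ (by omega), h4 _ (by omega),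
      h4 _ (by omega)] at this
    intro h0
    apply this
    simp only [det4, Matrix.cons_val]
    linear_combination -h0
  have dX0 : X 1 ≠ 0 := by
    have := hP (1, 3) (by decide)
    rw [vertexPlucker_four_three, h1, show (4 : ZMod 8) + (1 : ℕ) = (4 + 1 : ℕ) by decide,
      show (3 : ZMod 8) + (1 : ℕ) = (4 + 0 : ℕ) by decide,
      show (2 : ZMod 8) + (1 : ℕ) = 3 by decide, h3, h4 0 (by omega), h4 1 (by omega), hX, hY] at this
    intro h0
    apply this
    simp [det4, h0]
  have dV : ∀ m ≤ 3, divDiff Y X (m + 1) - divDiff Y X m ≠ 0 := by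
    intro m hm
    obtain rfl | hm' := Nat.eq_zero_or_pos m
    · have h0 := dY 0 (by omega)
      simp only [divDiff, hX, hY, sub_zero, zero_add] at h0 ⊢
      exact div_ne_zero dX0 h0
    · obtain ⟨m, rfl⟩ := Nat.exists_eq_add_of_le' hm'
      exact second_difference_ne_zero (dY m (by omega)) (dY (m + 1) (by omega)) (dX m (by omega))
  have dR : ∀ m ≤ 3, divDiff (divDiff Y X) (divDiff Y U) (m + 1) -
      divDiff (divDiff Y X) (divDiff Y U) m ≠ 0 := by
    intro m hm
    have hp := hP (m + 1, 4) (by simp [vertices]; omega)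
    rw [vertexPlucker_four_four, q1, q2, h4 _ (by omega), h4 _ (by omega)] at hp
    obtain rfl | hm' := Nat.eq_zero_or_pos m
    · rw [show (1 : ZMod 8) + (0 + 1 : ℕ) = 2 by decide,
        show (2 : ZMod 8) + (0 + 1 : ℕ) = 3 by decide, h2, h3] at hp
      have h0 := dY 0 (by omega)
      have h0' := dV 0 (by omega)
      simp only [divDiff, hX, hY, hU, sub_zero, zero_add] at h0 h0' hp ⊢
      refine div_ne_zero (div_ne_zero (fun h0 => hp ?_) h0) h0'
      simp [det4, h0]
    obtain ⟨m, rfl⟩ := Nat.exists_eq_add_of_le' hm'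
    rw [q3, h4 _ (by omega)] at hp
    have e1 := dY m (by omega)
    have e2 := dY (m + 1) (by omega)
    have f1 := dV m (by omega)
    have f2 := dV (m + 1) (by omega)
    obtain rfl | hm' := Nat.eq_zero_or_pos m
    · rw [show (1 : ZMod 8) + (0 + 1 + 1 : ℕ) = 3 by decide, h3] at hp
      -- The column before column 4 is the unit vector e_3, which plays the role of a difference
      -- vector with (u, x, y) = (0, 0, 1).
      have key := third_difference_ne_zero (u0 := 0) (x0 := 0) (y0 := 1) (u1 := U 1 - U 0)
        (x1 := X 1 - X 0) (u2 := U 2 - U 1) (x2 := X 2 - X 1) one_ne_zero e1 e2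
        (by simpa [divDiff] using f1) (by simpa [divDiff] using f2) (fun h0 => hp ?_)
      · simpa [divDiff] using key
      · simp only [det4, Matrix.cons_val, hU, hX, hY, zero_add, Nat.reduceAdd] at h0 ⊢
        linear_combination -h0
    · obtain ⟨m, rfl⟩ := Nat.exists_eq_add_of_le' hm'
      rw [q4, h4 _ (by omega)] at hp
      refine third_difference_ne_zero (dY m (by omega)) e1 e2 f1 f2 (fun h0 => hp ?_)
      simp only [det4, Matrix.cons_val]
      simp only [Nat.succ_eq_add_one, zero_add] at h0 ⊢
      linear_combination h0
  obtain ⟨χ, hχ, hs⟩ := exists_webSum (Y := fun b => if b = 0 then Y else if b = 1 then divDiff Y X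
    else divDiff (divDiff Y X) (divDiff Y U)) (N := 3) (fun b => by split_ifs <;> assumption)
  have s0 := hs 0
  have s1 := hs 1
  have s2 := hs 2
  simp only [if_pos, one_ne_zero, if_false, OfNat.ofNat_ne_zero, OfNat.ofNat_ne_one] at s0 s1 s2
  have eY : ∀ M ≤ 4, Y M = (Y 1 - Y 0) * webSum χ 1 0 M := fun M hM => eq_webSum_one hY dY s0 hM
  have eX : ∀ M ≤ 4, X M = (Y 1 - Y 0) * (divDiff Y X 1 - divDiff Y X 0) * webSum χ 2 0 M :=
    fun M hM => eq_webSum_succ hX dY s0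
      (fun m hm _ => eq_webSum_one (Y := divDiff Y X) rfl dV s1 hm) hM
  have eU : ∀ M ≤ 4, U M = (Y 1 - Y 0) * ((divDiff Y X 1 - divDiff Y X 0) *
      (divDiff (divDiff Y X) (divDiff Y U) 1 - divDiff (divDiff Y X) (divDiff Y U) 0)) *
      webSum χ 3 0 M :=
    fun M hM => eq_webSum_succ hU dY s0 (fun m hm _ => eq_webSum_succ (X := divDiff Y U) rfl dV s1
      (fun m hm _ => eq_webSum_one (Y := divDiff (divDiff Y X) (divDiff Y U)) rfl dR s2 hm) hm) hM
  refine ⟨χ, fun a b _ ha _ _ => hχ a b ha, MatEquiv.trans ?_ hx⟩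
  have c1 := dY 0 (by omega)
  have c2 := dV 0 (by omega)
  have c3 := dR 0 (by omega)
  simp only [zero_add] at c1 c2 c3
  set β := Y 1 - Y 0
  set α := divDiff Y X 1 - divDiff Y X 0
  -- The three constants give the diagonal row operation with entries -β α γ, β α, -β, 1 that
  -- carries partition sums to U, X, Y.
  set γ := divDiff (divDiff Y X) (divDiff Y U) 1 - divDiff (divDiff Y X) (divDiff Y U) 0
  obtain ⟨w1, w2, w3, w4, w⟩ := webMat_four χ
  have key : ∀ l, ∃ t : ℝ, t ≠ 0 ∧ x l = t •
      (Matrix.diagonal ![-(β * (α * γ)), β * α, -β, 1]).mulVec (webMat 4 8 χ l) := by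
    intro l
    rcases natCast_zmod_eight l with rfl | rfl | rfl | ⟨m, hm, rfl⟩
    · refine ⟨(-(β * (α * γ)))⁻¹, inv_ne_zero (neg_ne_zero.mpr
        (mul_ne_zero c1 (mul_ne_zero c2 c3))), ?_⟩
      rw [w1, h1]
      funext r
      fin_cases r
      · simp [Matrix.mulVec_diagonal]
        field_simp
      all_goals simp [Matrix.mulVec_diagonal]
    · refine ⟨(β * α)⁻¹, inv_ne_zero (mul_ne_zero c1 c2), ?_⟩
      rw [w2, h2]
      funext r
      fin_cases r
      · simp [Matrix.mulVec_diagonal]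
      · simp [Matrix.mulVec_diagonal]
        field_simp
      all_goals simp [Matrix.mulVec_diagonal]
    · refine ⟨(-β)⁻¹, inv_ne_zero (neg_ne_zero.mpr c1), ?_⟩
      rw [w3, h3]
      funext r
      fin_cases r
      · simp [Matrix.mulVec_diagonal]
      · simp [Matrix.mulVec_diagonal]
      · simp [Matrix.mulVec_diagonal, c1]
      · simp [Matrix.mulVec_diagonal]
    · refine ⟨1, one_ne_zero, ?_⟩
      rw [h4 m hm, one_smul]
      obtain rfl | hm' := Nat.eq_zero_or_pos m
      · rw [show (4 + 0 : ℕ) = 4 from rfl, Nat.cast_ofNat, w4, hX, hY, hU]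
        funext r
        fin_cases r <;> simp [Matrix.mulVec_diagonal]
      · rw [w m hm' hm, eX m hm, eY m hm, eU m hm]
        funext r
        fin_cases r <;> simp [Matrix.mulVec_diagonal]
  choose t ht hxt using key
  refine ⟨_, t, ?_, ht, hxt⟩
  simp [Matrix.det_diagonal, Fin.prod_univ_succ, c1, c2, c3]

theorem yHatSpec_four : YHatSpec 4 8 where
  invariant hz hne _ _ ha ha' hb hb' := by
    refine yHat_of_matEquiv (fun t a b ha ha' hb hb' => ?_) hz (hne _ (by decide)) ha ha' hb hb'
    have : b = 1 ∨ b = 2 ∨ b = 3 := by omega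
    obtain ⟨a, rfl⟩ := Nat.exists_eq_add_of_le' ha
    rcases this with rfl | rfl | rfl
    all_goals (simp [Fin.prod_univ_succ, vertexEntry, add_comm, add_left_comm]; ring_nf)
  ne_zero h := vertexPlucker_web_four_ne_zero h
  web h _ _ ha ha' hb hb' := yHat_web_four h ha ha' hb hb'
  normalForm h := exists_matEquiv_web_four h

end FourEight

/-! ### Reading off tropicalisations from Plücker coordinates -/

section Plucker

variable {k n : ℕ}

/-- Replaces the vertices `(0, b)` and `(a, 0)` by `(0, 0)`. -/
def normVertex (u : ℕ × ℕ) : ℕ × ℕ := if u.1 = 0 ∨ u.2 = 0 then (0, 0) else u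

lemma vertexPlucker_normVertex {K : Type*} [Field K] (z : Cols k n K) (u : ℕ × ℕ) :
    vertexPlucker z (normVertex u) = vertexPlucker z u := by
  obtain ⟨a, b⟩ := u
  rw [normVertex]
  split_ifs with h
  · rcases h with h | h
    · simp only at h
      rw [h]
      exact (vertexPlucker_zero_left z b).symm
    · simp only at h
      rw [h]
      exact (vertexPlucker_zero_right z a).symm
  · rfl

lemma normVertex_mem {a b : ℕ} (ha : a ≤ n - k) (hb : b ≤ k) : normVertex (a, b) ∈ vertices k n := by
  rw [normVertex]
  split_ifs with h
  · simp [vertices]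
  · simp only [vertices, Finset.mem_insert, Finset.mem_product, Finset.mem_Icc]
    simp only at h
    omega

/-- The tropical `ŷ`-variable at `(a, b)` in terms of tropical Plücker coordinates. -/
def yTrop (p : ℕ × ℕ → ℤ) (a b : ℕ) : ℤ :=
  p (normVertex (a - 1, b)) + p (normVertex (a, b - 1)) + p (normVertex (a + 1, b + 1)) -
    (p (normVertex (a + 1, b)) + p (normVertex (a, b + 1)) + p (normVertex (a - 1, b - 1)))

/-- `s` is a choice of signs of Plücker coordinates for which all `ŷ`-variables are positive. -/
def SignsCompatible (k n : ℕ) (s : ℕ × ℕ → ℝ) : Prop :=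
  (∀ u, s u * s u = 1) ∧ ∀ a b, 1 ≤ a → a ≤ n - k - 1 → 1 ≤ b → b ≤ k - 1 →
    s (normVertex (a - 1, b)) * s (normVertex (a, b - 1)) * s (normVertex (a + 1, b + 1)) =
      s (normVertex (a + 1, b)) * s (normVertex (a, b + 1)) * s (normVertex (a - 1, b - 1))

/-- The signs of the six Plücker coordinates cancel by `SignsCompatible`, so the positive numbers s
u · x_u may replace them in the quotient. -/
lemma HasTrop.yHat {v : Idx k n → ℤ} {z : Cols k n ℝ} {s : ℕ × ℕ → ℝ} {p : ℕ × ℕ → ℤ}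
    (hs : SignsCompatible k n s)
    (h : ∀ u ∈ vertices k n, HasTrop v (s u * vertexPlucker z u) (p u)) :
    HasTropPt k n v (fun a b => yHat z (a, b)) (yTrop p) := by
  intro a b ha ha' hb hb'
  have h0 : vertexPlucker z (0, 0) ≠ 0 :=
    right_ne_zero_of_mul (h (0, 0) (by simp [vertices])).pos.ne'
  simp only
  rw [yHat_eq z ha ha' hb hb' h0]
  have hm : ∀ a b, a ≤ n - k → b ≤ k → HasTrop v (s (normVertex (a, b)) *
      vertexPlucker z (a, b)) (p (normVertex (a, b))) := fun a b ha hb => by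
    have := h _ (normVertex_mem ha hb)
    rwa [vertexPlucker_normVertex] at this
  have key := (((hm (a - 1) b (by omega) (by omega)).mul (hm a (b - 1) (by omega) (by omega))).mul
    (hm (a + 1) (b + 1) (by omega) (by omega))).div
    (((hm (a + 1) b (by omega) (by omega)).mul (hm a (b + 1) (by omega) (by omega))).mul
    (hm (a - 1) (b - 1) (by omega) (by omega)))
  have hprod := hs.2 a b ha ha' hb hb'
  have hne : s (normVertex (a + 1, b)) * s (normVertex (a, b + 1)) *
      s (normVertex (a - 1, b - 1)) ≠ 0 :=
    mul_ne_zero (mul_ne_zero (left_ne_zero_of_mul_eq_one (hs.1 _))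
      (left_ne_zero_of_mul_eq_one (hs.1 _))) (left_ne_zero_of_mul_eq_one (hs.1 _))
  convert key using 1
  · rw [← mul_div_mul_left _ _ hne]
    congr 1
    · rw [← hprod]; ring
    · ring
  · rfl

/-- If the vertex coordinates of f(W) are positive up to compatible signs, they are nonzero. The
matrix then has a web normal form, whose parameters are the ŷ-variables of f(W). A tropicalisation
thus reduces to subtraction-free formulas for the vertex minors. -/
lemma YHatSpec.tropicalises_of_plucker (H : YHatSpec k n) {f : Cols k n ℝ → Cols k n ℝ}
    {p : (ℕ → ℕ → ℤ) → ℕ × ℕ → ℤ} {s : ℕ × ℕ → ℝ}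
    (hf : ∀ z z', MatEquiv z z' → MatEquiv (f z) (f z')) (hs : SignsCompatible k n s)
    (h : ∀ v χ g, HasTropPt k n v χ g → ∀ u ∈ vertices k n,
      HasTrop v (s u * vertexPlucker (f (webMat k n χ)) u) (p g u)) :
    Tropicalises f fun g => yTrop (p g) where
  equiv := hf _ _
  web {v χ g} hg := by
    obtain ⟨χ', h1, h2⟩ := H.normalForm
      (fun u hu => right_ne_zero_of_mul (h v χ g hg u hu).pos.ne')
    refine ⟨χ', fun a b ha ha' hb hb' => ?_, h2⟩
    have := HasTrop.yHat hs (h v χ g hg) a b ha ha' hb hb'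
    simp only at this
    rwa [H.invariant h2 (H.ne_zero h1) ha ha' hb hb', H.web h1 ha ha' hb hb'] at this

end Plucker

lemma HasTrop.of_eq {ι : Type} [Fintype ι] {v : ι → ℤ} {x y : ℝ} {t : ℤ} (h : HasTrop v x t)
    (e : y = x) : HasTrop v y t := e ▸ h

lemma zetaTilde_three (z : Cols 3 9 ℝ) (a : ZMod 9) : zetaTilde z a =
    (det3 (z (a - 2)) (z (a - 1)) (z (a + 1)) / det3 (z (a - 2)) (z (a - 1)) (z a)) • z a -
      z (a + 1) := by
  have e0 : a - ((3 : ℕ) : ZMod 9) + 1 + (((0 : Fin 3).val : ℕ) : ZMod 9) = a - 2 := by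
    simp; ring
  have e1 : a - ((3 : ℕ) : ZMod 9) + 1 + (((1 : Fin 3).val : ℕ) : ZMod 9) = a - 1 := by
    simp; ring
  have e2 : a - ((3 : ℕ) : ZMod 9) + 1 + (((2 : Fin 3).val : ℕ) : ZMod 9) = a := by
    simp; ring
  rw [zetaTilde, minor_three, minor_three, e0, e1, e2]
  simp

lemma zetaTilde_four (z : Cols 4 8 ℝ) (a : ZMod 8) : zetaTilde z a =
    (det4 (z (a - 3)) (z (a - 2)) (z (a - 1)) (z (a + 1)) /
      det4 (z (a - 3)) (z (a - 2)) (z (a - 1)) (z a)) • z a - z (a + 1) := by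
  have e0 : a - ((4 : ℕ) : ZMod 8) + 1 + (((0 : Fin 4).val : ℕ) : ZMod 8) = a - 3 := by
    simp; ring
  have e1 : a - ((4 : ℕ) : ZMod 8) + 1 + (((1 : Fin 4).val : ℕ) : ZMod 8) = a - 2 := by
    simp; ring
  have e2 : a - ((4 : ℕ) : ZMod 8) + 1 + (((2 : Fin 4).val : ℕ) : ZMod 8) = a - 1 := by
    simp; ring
  have e3 : a - ((4 : ℕ) : ZMod 8) + 1 + (((3 : Fin 4).val : ℕ) : ZMod 8) = a := by
    simp; ring
  rw [zetaTilde, minor_four, minor_four, e0, e1, e2, e3]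
  simp

lemma vec4_eq {R : Type*} {a b c d a' b' c' d' : R} (h0 : a = a') (h1 : b = b') (h2 : c = c')
    (h3 : d = d') : ![a, b, c, d] = ![a', b', c', d'] := by
  rw [h0, h1, h2, h3]

/-! ### Compatibility of the inverse braid generators with row operations and rescaling -/

section SigmaEquiv

variable {k n : ℕ}

/-- The two minors differ in a single column, so their quotient scales by t(a+1)/t(a). Multiplied by
the column a this scales by t(a+1), exactly as the subtracted column does. -/
lemma zetaTilde_of_matEquiv {z z' : Cols k n ℝ} {A : Matrix (Fin k) (Fin k) ℝ} {t : ZMod n → ℝ}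
    (hA : A.det ≠ 0) (ht : ∀ l, t l ≠ 0) (h : ∀ l, z' l = t l • A.mulVec (z l)) (a : ZMod n) :
    zetaTilde z' a = t (a + 1) • A.mulVec (zetaTilde z a) := by
  obtain _ | k := k
  · exact Subsingleton.elim _ _
  rw [zetaTilde, zetaTilde, minor_of_matEquiv h, minor_of_matEquiv h, h, h, Matrix.mulVec_sub,
    Matrix.mulVec_smul, smul_sub, smul_smul, smul_smul]
  congr 2
  rw [Fin.prod_univ_castSucc, Fin.prod_univ_castSucc]
  have e1 : ∀ i : Fin k, ¬ ((i.castSucc).val + 1 = k + 1) := fun i => by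
    have := i.2
    simp only [Fin.val_castSucc]
    omega
  have e2 : a - ((k + 1 : ℕ) : ZMod n) + 1 + ((Fin.last k).val : ZMod n) = a := by
    simp only [Fin.val_last]
    push_cast
    ring
  simp only [e1, if_false, Fin.val_last, if_true]
  rw [Fin.val_last] at e2
  rw [e2]
  -- The scalings of the k-1 columns common to both minors.
  set q := ∏ i : Fin k, t (a - ((k + 1 : ℕ) : ZMod n) + 1 + (i.castSucc.val : ZMod n))
  have hq : q ≠ 0 := Finset.prod_ne_zero_iff.mpr fun i _ => ht _
  have hc : A.det * q ≠ 0 := mul_ne_zero hA hq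
  rw [← mul_assoc, ← mul_assoc, mul_assoc (A.det * q) _ (minor z _),
    mul_assoc (A.det * q) (t a) (minor z _), mul_div_mul_left _ _ hc, mul_div_mul_comm,
    mul_right_comm, div_mul_cancel₀ _ (ht a)]

/-- The scaling factors are permuted along with the columns: a position in class i inherits the
factor of its successor, one in class i+1 that of its predecessor. -/
lemma MatEquiv.sigmaInv {z z' : Cols k n ℝ} (h : MatEquiv z z') (i : ℕ) :
    MatEquiv (sigmaInv i z) (GrTrop.sigmaInv i z') := by
  obtain ⟨A, t, hA, ht, h⟩ := h
  refine ⟨A, fun l => if l.val ≡ i [MOD k.gcd n] then t (l + 1)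
    else if l.val ≡ i + 1 [MOD k.gcd n] then t (l - 1) else t l, hA, fun l => ?_, fun l => ?_⟩
  · simp only
    split_ifs <;> exact ht _
  · simp only [GrTrop.sigmaInv]
    split_ifs
    · exact zetaTilde_of_matEquiv hA ht h l
    · exact h _
    · exact h _

end SigmaEquiv

/-! ### Tropicalisation of reflections and of a braid generator: `3 × 9` matrices -/

/-- Explicit columns, so that every minor below becomes a concrete polynomial identity. -/
lemma webMat_values_three (χ : ℕ → ℕ → ℝ) :
    webMat 3 9 χ 1 = ![1, 0, 0] ∧
    webMat 3 9 χ 2 = ![0, 1, 0] ∧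
    webMat 3 9 χ 3 = ![0, 0, 1] ∧
    webMat 3 9 χ 4 = ![1, -1, 1] ∧
    webMat 3 9 χ 5 = ![1 + χ 1 1 * (1 + χ 1 2), -(1 + χ 1 1), 1] ∧
    webMat 3 9 χ 6 = ![1 + χ 1 1 * (1 + χ 2 1 + χ 1 2 * (1 + χ 2 1 * (1 + χ 2 2))), -(1 + χ 1 1 *
        (1 + χ 2 1)), 1] ∧
    webMat 3 9 χ 7 = ![1 + χ 1 1 * (1 + χ 1 2 + χ 2 1 * (1 + χ 3 1 + χ 1 2 * (1 + χ 3 1 + χ 2 2 *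
        (1 + χ 3 1 * (1 + χ 3 2))))), -(1 + χ 1 1 * (1 + χ 2 1 * (1 + χ 3 1))), 1] ∧
    webMat 3 9 χ 8 = ![1 + χ 1 1 * (1 + χ 1 2 + χ 2 1 * (1 + χ 3 1 * (1 + χ 4 1) + χ 1 2 * (1 +
        χ 2 2 + χ 3 1 * (1 + χ 4 1 + χ 2 2 * (1 + χ 4 1 + χ 3 2 * (1 + χ 4 1 * (1 + χ 4 2))))))),
        -(1 + χ 1 1 * (1 + χ 2 1 * (1 + χ 3 1 * (1 + χ 4 1)))), 1] ∧
    webMat 3 9 χ 9 = ![1 + χ 1 1 * (1 + χ 1 2 + χ 2 1 * (1 + χ 3 1 * (1 + χ 4 1 * (1 + χ 5 1)) +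
        χ 1 2 * (1 + χ 2 2 + χ 3 1 * (1 + χ 4 1 * (1 + χ 5 1) + χ 2 2 * (1 + χ 3 2 + χ 4 1 * (1 +
        χ 5 1 + χ 3 2 * (1 + χ 5 1 + χ 4 2 * (1 + χ 5 1 * (1 + χ 5 2))))))))), -(1 + χ 1 1 * (1 +
        χ 2 1 * (1 + χ 3 1 * (1 + χ 4 1 * (1 + χ 5 1))))), 1] := by
  obtain ⟨w1, w2, w3, w⟩ := webMat_three χ
  have e0 : ∀ b, ∏ a ∈ Finset.Icc 1 0, χ a b = 1 := fun b => by
    simp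
  have e1 : ∀ b, ∏ a ∈ Finset.Icc 1 1, χ a b = χ 1 b := fun b => by
    simp
  have e2 : ∀ b, ∏ a ∈ Finset.Icc 1 2, χ a b = χ 1 b * χ 2 b := fun b => by
    simp [Finset.prod_Icc_succ_top]
  have e3 : ∀ b, ∏ a ∈ Finset.Icc 1 3, χ a b = χ 1 b * χ 2 b * χ 3 b := fun b => by
    simp [Finset.prod_Icc_succ_top]
  have e4 : ∀ b, ∏ a ∈ Finset.Icc 1 4, χ a b = χ 1 b * χ 2 b * χ 3 b * χ 4 b := fun b => by
    simp [Finset.prod_Icc_succ_top]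
  have e5 : ∀ b, ∏ a ∈ Finset.Icc 1 5, χ a b = χ 1 b * χ 2 b * χ 3 b * χ 4 b * χ 5 b := fun b => by
    simp [Finset.prod_Icc_succ_top]
  refine ⟨w1, w2, w3, (w 1 (by decide) (by decide)).trans ?_, (w 2 (by decide) (by decide)).trans
      ?_, (w 3 (by decide) (by decide)).trans ?_, (w 4 (by decide) (by decide)).trans ?_, (w 5
      (by decide) (by decide)).trans ?_, (w 6 (by decide) (by decide)).trans ?_⟩
  all_goals
    simp only [webSum, Finset.sum_range_succ, Finset.range_zero, Finset.sum_empty, zero_add,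
      Nat.reduceAdd, e0, e1, e2, e3, e4, e5, mul_one]
  all_goals (refine Matrix.vec3_eq ?_ ?_ ?_ <;> ring)

lemma forall_vertices_three {p : ℕ × ℕ → Prop}
    (h00 : p (0, 0))
    (h11 : p (1, 1))
    (h12 : p (1, 2))
    (h13 : p (1, 3))
    (h21 : p (2, 1))
    (h22 : p (2, 2))
    (h23 : p (2, 3))
    (h31 : p (3, 1))
    (h32 : p (3, 2))
    (h33 : p (3, 3))
    (h41 : p (4, 1))
    (h42 : p (4, 2))
    (h43 : p (4, 3))
    (h51 : p (5, 1))
    (h52 : p (5, 2))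
    (h53 : p (5, 3))
    (h61 : p (6, 1))
    (h62 : p (6, 2))
    (h63 : p (6, 3)) :
    ∀ u ∈ vertices 3 9, p u := by
  intro u hu
  rcases mem_vertices_three hu with rfl | ⟨a, ha, ha', rfl | rfl | rfl⟩
  · assumption
  all_goals (interval_cases a <;> assumption)

lemma vertexPlucker_values_three (z : Cols 3 9 ℝ) :
    vertexPlucker z (0, 0) = det3 (z 1) (z 2) (z 3) ∧
    vertexPlucker z (1, 1) = det3 (z 1) (z 2) (z 4) ∧
    vertexPlucker z (1, 2) = det3 (z 1) (z 3) (z 4) ∧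
    vertexPlucker z (1, 3) = det3 (z 2) (z 3) (z 4) ∧
    vertexPlucker z (2, 1) = det3 (z 1) (z 2) (z 5) ∧
    vertexPlucker z (2, 2) = det3 (z 1) (z 4) (z 5) ∧
    vertexPlucker z (2, 3) = det3 (z 3) (z 4) (z 5) ∧
    vertexPlucker z (3, 1) = det3 (z 1) (z 2) (z 6) ∧
    vertexPlucker z (3, 2) = det3 (z 1) (z 5) (z 6) ∧
    vertexPlucker z (3, 3) = det3 (z 4) (z 5) (z 6) ∧
    vertexPlucker z (4, 1) = det3 (z 1) (z 2) (z 7) ∧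
    vertexPlucker z (4, 2) = det3 (z 1) (z 6) (z 7) ∧
    vertexPlucker z (4, 3) = det3 (z 5) (z 6) (z 7) ∧
    vertexPlucker z (5, 1) = det3 (z 1) (z 2) (z 8) ∧
    vertexPlucker z (5, 2) = det3 (z 1) (z 7) (z 8) ∧
    vertexPlucker z (5, 3) = det3 (z 6) (z 7) (z 8) ∧
    vertexPlucker z (6, 1) = det3 (z 1) (z 2) (z 9) ∧
    vertexPlucker z (6, 2) = det3 (z 1) (z 8) (z 9) ∧
    vertexPlucker z (6, 3) = det3 (z 7) (z 8) (z 9) := by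
  refine ⟨?_, ?_, ?_, ?_, ?_, ?_, ?_, ?_, ?_, ?_, ?_, ?_, ?_, ?_, ?_, ?_, ?_, ?_, ?_⟩ <;>
    simp [vertexPlucker_three, vertexEntry]

/-- Tropical Plücker coordinates of the image of a web matrix under `reflect 2`. -/
def pluckerReflectTwoThree (g : ℕ → ℕ → ℤ) : ℕ × ℕ → ℤ
  | (0, 0) => g 1 1 + g 2 1 + g 3 1 + g 4 1 + g 5 1
  | (1, 1) => g 1 1 + g 2 1 + g 3 1 + g 4 1 + (max 0 (g 5 1))
  | (1, 2) => g 1 1 + g 2 1 + g 3 1 + g 4 1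
  | (1, 3) => g 1 1 + g 1 1 + g 1 2 + g 2 1 + g 2 1 + g 2 2 + g 3 1 + g 3 1 + g 3 2 + g 4 1 +
        g 4 1 + g 4 2 + g 5 1 + g 5 2
  | (2, 1) => g 1 1 + g 2 1 + g 3 1 + (max 0 (g 4 1 + (max 0 (g 5 1))))
  | (2, 2) => g 1 1 + g 2 1 + g 3 1
  | (2, 3) => g 1 1 + g 1 1 + g 1 2 + g 2 1 + g 2 1 + g 2 2 + g 3 1 + g 3 1 + g 3 2 + g 4 1 +
        g 4 2
  | (3, 1) => g 1 1 + g 2 1 + (max 0 (g 3 1 + (max 0 (g 4 1 + (max 0 (g 5 1))))))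
  | (3, 2) => g 1 1 + g 2 1
  | (3, 3) => g 1 1 + g 1 1 + g 1 2 + g 2 1 + g 2 1 + g 2 2 + g 3 1 + g 3 2
  | (4, 1) => g 1 1 + (max 0 (g 2 1 + (max 0 (g 3 1 + (max 0 (g 4 1 + (max 0 (g 5 1))))))))
  | (4, 2) => g 1 1
  | (4, 3) => g 1 1 + g 1 1 + g 1 2 + g 2 1 + g 2 2
  | (5, 1) => max 0 (g 1 1 + (max 0 (g 2 1 + (max 0 (g 3 1 + (max 0 (g 4 1 + (max 0
        (g 5 1)))))))))
  | (5, 2) => 0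
  | (5, 3) => g 1 1 + g 1 2
  | (6, 1) => 0
  | (6, 2) => 0
  | (6, 3) => 0
  | _ => 0

lemma tropicalises_reflect_two_three :
    Tropicalises (reflect 2 : Cols 3 9 ℝ → Cols 3 9 ℝ) fun g => yTrop (pluckerReflectTwoThree g) := by
  -- Reversing three columns is an odd permutation and a cyclic shift of three columns is even, so
  -- every minor changes sign, regardless of how its index set wraps around.
  refine yHatSpec_three.tropicalises_of_plucker (s := fun _ => -1)
    (fun _ _ h => h.reflect 2) ⟨fun u => ?_, fun a b ha ha' hb hb' => ?_⟩ fun v χ g hg => ?_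
  · norm_num
  · norm_num
  have t11 := hg 1 1 (by decide) (by decide) (by decide) (by decide)
  have t12 := hg 1 2 (by decide) (by decide) (by decide) (by decide)
  have t21 := hg 2 1 (by decide) (by decide) (by decide) (by decide)
  have t22 := hg 2 2 (by decide) (by decide) (by decide) (by decide)
  have t31 := hg 3 1 (by decide) (by decide) (by decide) (by decide)
  have t32 := hg 3 2 (by decide) (by decide) (by decide) (by decide)
  have t41 := hg 4 1 (by decide) (by decide) (by decide) (by decide)
  have t42 := hg 4 2 (by decide) (by decide) (by decide) (by decide)
  have t51 := hg 5 1 (by decide) (by decide) (by decide) (by decide)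
  have t52 := hg 5 2 (by decide) (by decide) (by decide) (by decide)
  obtain ⟨w1, w2, w3, w4, w5, w6, w7, w8, w9⟩ := webMat_values_three χ
  have c1 : reflect 2 (webMat 3 9 χ) 1 = _ :=
    (congrArg (webMat 3 9 χ) (by decide : (2 : ZMod 9) - 1 = 1)).trans w1
  have c2 : reflect 2 (webMat 3 9 χ) 2 = _ :=
    (congrArg (webMat 3 9 χ) (by decide : (2 : ZMod 9) - 2 = 9)).trans w9
  have c3 : reflect 2 (webMat 3 9 χ) 3 = _ :=
    (congrArg (webMat 3 9 χ) (by decide : (2 : ZMod 9) - 3 = 8)).trans w8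
  have c4 : reflect 2 (webMat 3 9 χ) 4 = _ :=
    (congrArg (webMat 3 9 χ) (by decide : (2 : ZMod 9) - 4 = 7)).trans w7
  have c5 : reflect 2 (webMat 3 9 χ) 5 = _ :=
    (congrArg (webMat 3 9 χ) (by decide : (2 : ZMod 9) - 5 = 6)).trans w6
  have c6 : reflect 2 (webMat 3 9 χ) 6 = _ :=
    (congrArg (webMat 3 9 χ) (by decide : (2 : ZMod 9) - 6 = 5)).trans w5
  have c7 : reflect 2 (webMat 3 9 χ) 7 = _ :=
    (congrArg (webMat 3 9 χ) (by decide : (2 : ZMod 9) - 7 = 4)).trans w4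
  have c8 : reflect 2 (webMat 3 9 χ) 8 = _ :=
    (congrArg (webMat 3 9 χ) (by decide : (2 : ZMod 9) - 8 = 3)).trans w3
  have c9 : reflect 2 (webMat 3 9 χ) 9 = _ :=
    (congrArg (webMat 3 9 χ) (by decide : (2 : ZMod 9) - 9 = 2)).trans w2
  have hp := vertexPlucker_values_three (reflect 2 (webMat 3 9 χ))
  simp only [c1, c2, c3, c4, c5, c6, c7, c8, c9] at hp
  obtain ⟨p00, p11, p12, p13, p21, p22, p23, p31, p32, p33, p41, p42, p43, p51, p52, p53, p61,
      p62, p63⟩ := hp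
  apply forall_vertices_three
  all_goals
    simp +decide only [p00, p11, p12, p13, p21, p22, p23, p31, p32, p33, p41, p42, p43, p51, p52,
        p53, p61, p62, p63, det3, Matrix.cons_val, pluckerReflectTwoThree]
    -- The real number is left as a metavariable. The tropical expression dictates its shape, sums
    -- becoming products and maxima becoming sums; `ring` then compares this polynomial with the
    -- signed minor.
    apply HasTrop.of_eq
    · repeat' first | exact HasTrop.one | assumption | apply HasTrop.mul | apply HasTrop.add
    · ring

/-- Tropical Plücker coordinates of the image of a web matrix under `reflect 3`. -/
def pluckerReflectThreeThree (g : ℕ → ℕ → ℤ) : ℕ × ℕ → ℤ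
  | (0, 0) => 0
  | (1, 1) => 0
  | (1, 2) => g 1 1 + g 2 1 + g 3 1 + g 4 1 + g 5 1 + (max 0 (g 1 2 + (max 0 (g 2 2 + (max 0
        (g 3 2 + (max 0 (g 4 2 + (max 0 (g 5 2))))))))))
  | (1, 3) => g 1 1 + g 2 1 + g 3 1 + g 4 1 + g 5 1
  | (2, 1) => 0
  | (2, 2) => g 1 1 + g 2 1 + g 3 1 + g 4 1 + (max 0 (g 1 2 + (max 0 (g 2 2 + (max 0 (g 3 2 +
        (max 0 (g 4 2))))))))
  | (2, 3) => g 1 1 + g 1 1 + g 1 2 + g 2 1 + g 2 1 + g 2 2 + g 3 1 + g 3 1 + g 3 2 + g 4 1 +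
        g 4 1 + g 4 2 + g 5 1 + g 5 2
  | (3, 1) => 0
  | (3, 2) => g 1 1 + g 2 1 + g 3 1 + (max 0 (g 1 2 + (max 0 (g 2 2 + (max 0 (g 3 2))))))
  | (3, 3) => g 1 1 + g 1 1 + g 1 2 + g 2 1 + g 2 1 + g 2 2 + g 3 1 + g 3 1 + g 3 2 + g 4 1 +
        g 4 2
  | (4, 1) => 0
  | (4, 2) => g 1 1 + g 2 1 + (max 0 (g 1 2 + (max 0 (g 2 2))))
  | (4, 3) => g 1 1 + g 1 1 + g 1 2 + g 2 1 + g 2 1 + g 2 2 + g 3 1 + g 3 2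
  | (5, 1) => 0
  | (5, 2) => g 1 1 + (max 0 (g 1 2))
  | (5, 3) => g 1 1 + g 1 1 + g 1 2 + g 2 1 + g 2 2
  | (6, 1) => 0
  | (6, 2) => 0
  | (6, 3) => g 1 1 + g 1 2
  | _ => 0

lemma tropicalises_reflect_three_three :
    Tropicalises (reflect 3 : Cols 3 9 ℝ → Cols 3 9 ℝ) fun g => yTrop (pluckerReflectThreeThree g) := by
  refine yHatSpec_three.tropicalises_of_plucker (s := fun _ => -1)
    (fun _ _ h => h.reflect 3) ⟨fun u => ?_, fun a b ha ha' hb hb' => ?_⟩ fun v χ g hg => ?_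
  · norm_num
  · norm_num
  have t11 := hg 1 1 (by decide) (by decide) (by decide) (by decide)
  have t12 := hg 1 2 (by decide) (by decide) (by decide) (by decide)
  have t21 := hg 2 1 (by decide) (by decide) (by decide) (by decide)
  have t22 := hg 2 2 (by decide) (by decide) (by decide) (by decide)
  have t31 := hg 3 1 (by decide) (by decide) (by decide) (by decide)
  have t32 := hg 3 2 (by decide) (by decide) (by decide) (by decide)
  have t41 := hg 4 1 (by decide) (by decide) (by decide) (by decide)
  have t42 := hg 4 2 (by decide) (by decide) (by decide) (by decide)
  have t51 := hg 5 1 (by decide) (by decide) (by decide) (by decide)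
  have t52 := hg 5 2 (by decide) (by decide) (by decide) (by decide)
  obtain ⟨w1, w2, w3, w4, w5, w6, w7, w8, w9⟩ := webMat_values_three χ
  have c1 : reflect 3 (webMat 3 9 χ) 1 = _ :=
    (congrArg (webMat 3 9 χ) (by decide : (3 : ZMod 9) - 1 = 2)).trans w2
  have c2 : reflect 3 (webMat 3 9 χ) 2 = _ :=
    (congrArg (webMat 3 9 χ) (by decide : (3 : ZMod 9) - 2 = 1)).trans w1
  have c3 : reflect 3 (webMat 3 9 χ) 3 = _ :=
    (congrArg (webMat 3 9 χ) (by decide : (3 : ZMod 9) - 3 = 9)).trans w9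
  have c4 : reflect 3 (webMat 3 9 χ) 4 = _ :=
    (congrArg (webMat 3 9 χ) (by decide : (3 : ZMod 9) - 4 = 8)).trans w8
  have c5 : reflect 3 (webMat 3 9 χ) 5 = _ :=
    (congrArg (webMat 3 9 χ) (by decide : (3 : ZMod 9) - 5 = 7)).trans w7
  have c6 : reflect 3 (webMat 3 9 χ) 6 = _ :=
    (congrArg (webMat 3 9 χ) (by decide : (3 : ZMod 9) - 6 = 6)).trans w6
  have c7 : reflect 3 (webMat 3 9 χ) 7 = _ :=
    (congrArg (webMat 3 9 χ) (by decide : (3 : ZMod 9) - 7 = 5)).trans w5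
  have c8 : reflect 3 (webMat 3 9 χ) 8 = _ :=
    (congrArg (webMat 3 9 χ) (by decide : (3 : ZMod 9) - 8 = 4)).trans w4
  have c9 : reflect 3 (webMat 3 9 χ) 9 = _ :=
    (congrArg (webMat 3 9 χ) (by decide : (3 : ZMod 9) - 9 = 3)).trans w3
  have hp := vertexPlucker_values_three (reflect 3 (webMat 3 9 χ))
  simp only [c1, c2, c3, c4, c5, c6, c7, c8, c9] at hp
  obtain ⟨p00, p11, p12, p13, p21, p22, p23, p31, p32, p33, p41, p42, p43, p51, p52, p53, p61,
      p62, p63⟩ := hp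
  apply forall_vertices_three
  all_goals
    simp +decide only [p00, p11, p12, p13, p21, p22, p23, p31, p32, p33, p41, p42, p43, p51, p52,
        p53, p61, p62, p63, det3, Matrix.cons_val, pluckerReflectThreeThree]
    apply HasTrop.of_eq
    · repeat' first | exact HasTrop.one | assumption | apply HasTrop.mul | apply HasTrop.add
    · ring

/-- Tropical Plücker coordinates of the image of a web matrix under `sigmaInv 2`. -/
def pluckerSigmaInvThree (g : ℕ → ℕ → ℤ) : ℕ × ℕ → ℤ
  | (0, 0) => 0
  | (1, 1) => g 1 1 + (max 0 (g 2 1 + (max 0 (g 3 1 + (max 0 (g 4 1 + (max 0 (g 5 1))))))))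
  | (1, 2) => 0
  | (1, 3) => 0
  | (2, 1) => g 1 1 + g 2 1 + (max 0 (g 2 1 + (max (max 0 (g 2 2)) (g 3 1 + (max (max 0 (g 2 2))
        (g 4 1 + (max (max 0 (g 5 1)) (g 2 2 + (max 0 (g 5 1))))))))))
  | (2, 2) => g 1 1 + g 2 1 + g 2 2
  | (2, 3) => g 1 1 + g 2 1 + g 2 2
  | (3, 1) => g 1 1 + g 2 1 + (max 0 (g 3 1 + (max 0 (g 4 1 + (max 0 (g 5 1))))))
  | (3, 2) => g 1 1 + g 2 1
  | (3, 3) => g 1 1 + g 1 1 + g 1 2 + g 2 1 + g 2 2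
  | (4, 1) => g 1 1 + g 2 1 + g 3 1 + g 4 1 + (max 0 (g 5 1))
  | (4, 2) => g 1 1 + g 2 1 + (max 0 (g 3 1))
  | (4, 3) => g 1 1 + g 1 1 + g 1 2 + g 2 1 + g 2 1 + g 2 2 + g 3 1 + g 3 2
  | (5, 1) => g 1 1 + g 2 1 + g 3 1 + g 4 1 + g 5 1 + (max 0 (g 5 1 + (max 0 (g 5 2))))
  | (5, 2) => g 1 1 + g 2 1 + g 3 1 + g 4 1 + g 5 1 + g 5 2
  | (5, 3) => g 1 1 + g 1 1 + g 1 2 + g 2 1 + g 2 1 + g 2 2 + g 3 1 + g 3 2 + g 4 1 + g 5 1 +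
        g 5 2
  | (6, 1) => g 1 1 + g 2 1 + g 3 1 + g 4 1 + g 5 1
  | (6, 2) => g 1 1 + g 2 1 + g 3 1 + g 4 1 + g 5 1
  | (6, 3) => g 1 1 + g 1 1 + g 1 2 + g 2 1 + g 2 1 + g 2 2 + g 3 1 + g 3 1 + g 3 2 + g 4 1 +
        g 4 1 + g 4 2 + g 5 1 + g 5 2
  | _ => 0

lemma tropicalises_sigmaInv_two_three :
    Tropicalises (sigmaInv 2 : Cols 3 9 ℝ → Cols 3 9 ℝ) fun g => yTrop (pluckerSigmaInvThree g) := by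
  refine yHatSpec_three.tropicalises_of_plucker (s := fun _ => 1)
    -- No signs are needed: the vertex minors of the image of a web matrix under σ_2⁻¹ are
    -- subtraction-free in χ.
    (fun _ _ h => h.sigmaInv 2) ⟨fun u => ?_, fun a b ha ha' hb hb' => ?_⟩ fun v χ g hg => ?_
  · norm_num
  · norm_num
  have t11 := hg 1 1 (by decide) (by decide) (by decide) (by decide)
  have t12 := hg 1 2 (by decide) (by decide) (by decide) (by decide)
  have t21 := hg 2 1 (by decide) (by decide) (by decide) (by decide)
  have t22 := hg 2 2 (by decide) (by decide) (by decide) (by decide)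
  have t31 := hg 3 1 (by decide) (by decide) (by decide) (by decide)
  have t32 := hg 3 2 (by decide) (by decide) (by decide) (by decide)
  have t41 := hg 4 1 (by decide) (by decide) (by decide) (by decide)
  have t42 := hg 4 2 (by decide) (by decide) (by decide) (by decide)
  have t51 := hg 5 1 (by decide) (by decide) (by decide) (by decide)
  have t52 := hg 5 2 (by decide) (by decide) (by decide) (by decide)
  have q11 := t11.pos
  have q12 := t12.pos
  have q21 := t21.pos
  have q22 := t22.pos
  have q31 := t31.pos
  have q32 := t32.pos
  have q41 := t41.pos
  have q42 := t42.pos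
  have q51 := t51.pos
  have q52 := t52.pos
  obtain ⟨w1, w2, w3, w4, w5, w6, w7, w8, w9⟩ := webMat_values_three χ
  have c1 : sigmaInv 2 (webMat 3 9 χ) 1 = _ := Eq.trans (by
    rw [sigmaInv, if_neg (by decide), if_neg (by decide)]) w1
  -- In each new column the denominator of the quotient of minors is a monomial dividing the
  -- numerator, so the coefficient is a polynomial in χ.
  have c2 : sigmaInv 2 (webMat 3 9 χ) 2 = (1 + χ 1 1 * (1 + χ 2 1 * (1 + χ 3 1 * (1 + χ 4 1 * (1
        + χ 5 1))))) • webMat 3 9 χ 2 - webMat 3 9 χ 3 := by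
    have hd : det3 (webMat 3 9 χ 9) (webMat 3 9 χ 1) (webMat 3 9 χ 2) = 1 := by
      rw [w9, w1, w2]
      simp only [det3, Matrix.cons_val]
      ring
    have hn : det3 (webMat 3 9 χ 9) (webMat 3 9 χ 1) (webMat 3 9 χ 3) = 1 * (1 + χ 1 1 * (1 +
          χ 2 1 * (1 + χ 3 1 * (1 + χ 4 1 * (1 + χ 5 1))))) := by
      rw [w9, w1, w3]
      simp only [det3, Matrix.cons_val]
      ring
    rw [sigmaInv, if_pos (by decide), zetaTilde_three, show (2 : ZMod 9) - 2 = 9 by decide, show (2 : ZMod 9) - 1 = 1 by decide,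
      show (2 : ZMod 9) + 1 = 3 by decide, hd, hn, mul_div_cancel_left₀ _ one_ne_zero]
  rw [w2, w3] at c2
  have c3 : sigmaInv 2 (webMat 3 9 χ) 3 = _ := Eq.trans (by
    rw [sigmaInv, if_neg (by decide), if_pos (by decide), show (3 : ZMod 9) - 1 = 2 by decide]) w2
  have c4 : sigmaInv 2 (webMat 3 9 χ) 4 = _ := Eq.trans (by
    rw [sigmaInv, if_neg (by decide), if_neg (by decide)]) w4
  have c5 : sigmaInv 2 (webMat 3 9 χ) 5 = (1 + χ 2 1 * (1 + χ 2 2)) • webMat 3 9 χ 5 - webMat 3 9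
        χ 6 := by
    have hd : det3 (webMat 3 9 χ 3) (webMat 3 9 χ 4) (webMat 3 9 χ 5) = χ 1 1 * χ 1 2 := by
      rw [w3, w4, w5]
      simp only [det3, Matrix.cons_val]
      ring
    have hn : det3 (webMat 3 9 χ 3) (webMat 3 9 χ 4) (webMat 3 9 χ 6) = χ 1 1 * χ 1 2 * (1 +
          χ 2 1 * (1 + χ 2 2)) := by
      rw [w3, w4, w6]
      simp only [det3, Matrix.cons_val]
      ring
    rw [sigmaInv, if_pos (by decide), zetaTilde_three, show (5 : ZMod 9) - 2 = 3 by decide, show (5 : ZMod 9) - 1 = 4 by decide,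
      show (5 : ZMod 9) + 1 = 6 by decide, hd, hn, mul_div_cancel_left₀ _ (by positivity)]
  rw [w5, w6] at c5
  have c6 : sigmaInv 2 (webMat 3 9 χ) 6 = _ := Eq.trans (by
    rw [sigmaInv, if_neg (by decide), if_pos (by decide), show (6 : ZMod 9) - 1 = 5 by decide]) w5
  have c7 : sigmaInv 2 (webMat 3 9 χ) 7 = _ := Eq.trans (by
    rw [sigmaInv, if_neg (by decide), if_neg (by decide)]) w7
  have c8 : sigmaInv 2 (webMat 3 9 χ) 8 = (1 + χ 5 1 * (1 + χ 5 2)) • webMat 3 9 χ 8 - webMat 3 9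
        χ 9 := by
    have hd : det3 (webMat 3 9 χ 6) (webMat 3 9 χ 7) (webMat 3 9 χ 8) = χ 1 1 * χ 1 1 * χ 1 2 * χ 2 1 * χ 2 1 * χ 2 2 * χ 3 1 * χ 3 1 * χ 3 2 * χ 4 1 * χ 4 2 := by
      rw [w6, w7, w8]
      simp only [det3, Matrix.cons_val]
      ring
    have hn : det3 (webMat 3 9 χ 6) (webMat 3 9 χ 7) (webMat 3 9 χ 9) = χ 1 1 * χ 1 1 * χ 1 2 *
          χ 2 1 * χ 2 1 * χ 2 2 * χ 3 1 * χ 3 1 * χ 3 2 * χ 4 1 * χ 4 2 * (1 + χ 5 1 * (1 +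
          χ 5 2)) := by
      rw [w6, w7, w9]
      simp only [det3, Matrix.cons_val]
      ring
    rw [sigmaInv, if_pos (by decide), zetaTilde_three, show (8 : ZMod 9) - 2 = 6 by decide, show (8 : ZMod 9) - 1 = 7 by decide,
      show (8 : ZMod 9) + 1 = 9 by decide, hd, hn, mul_div_cancel_left₀ _ (by positivity)]
  rw [w8, w9] at c8
  have c9 : sigmaInv 2 (webMat 3 9 χ) 9 = _ := Eq.trans (by
    rw [sigmaInv, if_neg (by decide), if_pos (by decide), show (9 : ZMod 9) - 1 = 8 by decide]) w8
  have hp := vertexPlucker_values_three (sigmaInv 2 (webMat 3 9 χ))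
  simp only [c1, c2, c3, c4, c5, c6, c7, c8, c9] at hp
  obtain ⟨p00, p11, p12, p13, p21, p22, p23, p31, p32, p33, p41, p42, p43, p51, p52, p53, p61,
      p62, p63⟩ := hp
  apply forall_vertices_three
  all_goals
    simp +decide only [p00, p11, p12, p13, p21, p22, p23, p31, p32, p33, p41, p42, p43, p51, p52,
        p53, p61, p62, p63, det3, Matrix.cons_val, Pi.sub_apply, Pi.smul_apply, smul_eq_mul,
        pluckerSigmaInvThree]
    apply HasTrop.of_eq
    · repeat' first | exact HasTrop.one | assumption | apply HasTrop.mul | apply HasTrop.add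
    · ring

/-! ### Tropicalisation of reflections and of a braid generator: `4 × 8` matrices -/

lemma webMat_values_four (χ : ℕ → ℕ → ℝ) :
    webMat 4 8 χ 1 = ![1, 0, 0, 0] ∧
    webMat 4 8 χ 2 = ![0, 1, 0, 0] ∧
    webMat 4 8 χ 3 = ![0, 0, 1, 0] ∧
    webMat 4 8 χ 4 = ![0, 0, 0, 1] ∧
    webMat 4 8 χ 5 = ![-1, 1, -1, 1] ∧
    webMat 4 8 χ 6 = ![-(1 + χ 1 1 * (1 + χ 1 2 * (1 + χ 1 3))), 1 + χ 1 1 * (1 + χ 1 2), -(1 +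
        χ 1 1), 1] ∧
    webMat 4 8 χ 7 = ![-(1 + χ 1 1 * (1 + χ 2 1 + χ 1 2 * (1 + χ 1 3 + χ 2 1 * (1 + χ 2 2 + χ 1 3
        * (1 + χ 2 2 * (1 + χ 2 3)))))), 1 + χ 1 1 * (1 + χ 2 1 + χ 1 2 * (1 + χ 2 1 * (1 +
        χ 2 2))), -(1 + χ 1 1 * (1 + χ 2 1)), 1] ∧
    webMat 4 8 χ 8 = ![-(1 + χ 1 1 * (1 + χ 2 1 * (1 + χ 3 1) + χ 1 2 * (1 + χ 1 3 + χ 2 1 * (1 +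
        χ 3 1 + χ 2 2 * (1 + χ 3 1 * (1 + χ 3 2)) + χ 1 3 * (1 + χ 3 1 + χ 2 2 * (1 + χ 2 3 +
        χ 3 1 * (1 + χ 3 2 + χ 2 3 * (1 + χ 3 2 * (1 + χ 3 3))))))))), 1 + χ 1 1 * (1 + χ 1 2 +
        χ 2 1 * (1 + χ 3 1 + χ 1 2 * (1 + χ 3 1 + χ 2 2 * (1 + χ 3 1 * (1 + χ 3 2))))), -(1 +
        χ 1 1 * (1 + χ 2 1 * (1 + χ 3 1))), 1] := by
  obtain ⟨w1, w2, w3, w4, w⟩ := webMat_four χ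
  have e0 : ∀ b, ∏ a ∈ Finset.Icc 1 0, χ a b = 1 := fun b => by
    simp
  have e1 : ∀ b, ∏ a ∈ Finset.Icc 1 1, χ a b = χ 1 b := fun b => by
    simp
  have e2 : ∀ b, ∏ a ∈ Finset.Icc 1 2, χ a b = χ 1 b * χ 2 b := fun b => by
    simp [Finset.prod_Icc_succ_top]
  have e3 : ∀ b, ∏ a ∈ Finset.Icc 1 3, χ a b = χ 1 b * χ 2 b * χ 3 b := fun b => by
    simp [Finset.prod_Icc_succ_top]
  refine ⟨w1, w2, w3, w4, (w 1 (by decide) (by decide)).trans ?_, (w 2 (by decide) (by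
      decide)).trans ?_, (w 3 (by decide) (by decide)).trans ?_, (w 4 (by decide) (by
      decide)).trans ?_⟩
  all_goals
    simp only [webSum, Finset.sum_range_succ, Finset.range_zero, Finset.sum_empty, zero_add,
      Nat.reduceAdd, e0, e1, e2, e3, mul_one]
  all_goals (refine vec4_eq ?_ ?_ ?_ ?_ <;> ring)

lemma forall_vertices_four {p : ℕ × ℕ → Prop}
    (h00 : p (0, 0))
    (h11 : p (1, 1))
    (h12 : p (1, 2))
    (h13 : p (1, 3))
    (h14 : p (1, 4))
    (h21 : p (2, 1))
    (h22 : p (2, 2))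
    (h23 : p (2, 3))
    (h24 : p (2, 4))
    (h31 : p (3, 1))
    (h32 : p (3, 2))
    (h33 : p (3, 3))
    (h34 : p (3, 4))
    (h41 : p (4, 1))
    (h42 : p (4, 2))
    (h43 : p (4, 3))
    (h44 : p (4, 4)) :
    ∀ u ∈ vertices 4 8, p u := by
  intro u hu
  rcases mem_vertices_four hu with rfl | ⟨a, ha, ha', rfl | rfl | rfl | rfl⟩
  · assumption
  all_goals (interval_cases a <;> assumption)

lemma vertexPlucker_values_four (z : Cols 4 8 ℝ) :
    vertexPlucker z (0, 0) = det4 (z 1) (z 2) (z 3) (z 4) ∧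
    vertexPlucker z (1, 1) = det4 (z 1) (z 2) (z 3) (z 5) ∧
    vertexPlucker z (1, 2) = det4 (z 1) (z 2) (z 4) (z 5) ∧
    vertexPlucker z (1, 3) = det4 (z 1) (z 3) (z 4) (z 5) ∧
    vertexPlucker z (1, 4) = det4 (z 2) (z 3) (z 4) (z 5) ∧
    vertexPlucker z (2, 1) = det4 (z 1) (z 2) (z 3) (z 6) ∧
    vertexPlucker z (2, 2) = det4 (z 1) (z 2) (z 5) (z 6) ∧
    vertexPlucker z (2, 3) = det4 (z 1) (z 4) (z 5) (z 6) ∧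
    vertexPlucker z (2, 4) = det4 (z 3) (z 4) (z 5) (z 6) ∧
    vertexPlucker z (3, 1) = det4 (z 1) (z 2) (z 3) (z 7) ∧
    vertexPlucker z (3, 2) = det4 (z 1) (z 2) (z 6) (z 7) ∧
    vertexPlucker z (3, 3) = det4 (z 1) (z 5) (z 6) (z 7) ∧
    vertexPlucker z (3, 4) = det4 (z 4) (z 5) (z 6) (z 7) ∧
    vertexPlucker z (4, 1) = det4 (z 1) (z 2) (z 3) (z 8) ∧
    vertexPlucker z (4, 2) = det4 (z 1) (z 2) (z 7) (z 8) ∧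
    vertexPlucker z (4, 3) = det4 (z 1) (z 6) (z 7) (z 8) ∧
    vertexPlucker z (4, 4) = det4 (z 5) (z 6) (z 7) (z 8) := by
  refine ⟨?_, ?_, ?_, ?_, ?_, ?_, ?_, ?_, ?_, ?_, ?_, ?_, ?_, ?_, ?_, ?_, ?_⟩ <;>
    simp [vertexPlucker_four, vertexEntry]

/-- Tropical Plücker coordinates of the image of a web matrix under `reflect 3`. -/
def pluckerReflectThreeFour (g : ℕ → ℕ → ℤ) : ℕ × ℕ → ℤ
  | (0, 0) => g 1 1 + g 2 1 + g 3 1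
  | (1, 1) => g 1 1 + g 2 1 + (max 0 (g 3 1))
  | (1, 2) => g 1 1 + g 2 1
  | (1, 3) => g 1 1 + g 1 1 + g 1 2 + g 2 1 + g 2 1 + g 2 2 + g 3 1 + g 3 2 + (max 0 (g 1 3 +
        (max 0 (g 2 3 + (max 0 (g 3 3))))))
  | (1, 4) => g 1 1 + g 1 1 + g 1 2 + g 2 1 + g 2 1 + g 2 2 + g 3 1 + g 3 2
  | (2, 1) => g 1 1 + (max 0 (g 2 1 + (max 0 (g 3 1))))
  | (2, 2) => g 1 1
  | (2, 3) => g 1 1 + g 1 1 + g 1 2 + g 2 1 + g 2 2 + (max 0 (g 1 3 + (max 0 (g 2 3))))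
  | (2, 4) => g 1 1 + g 1 1 + g 1 1 + g 1 2 + g 1 2 + g 1 3 + g 2 1 + g 2 1 + g 2 2 + g 2 2 +
        g 2 3 + g 3 1 + g 3 2 + g 3 3
  | (3, 1) => max 0 (g 1 1 + (max 0 (g 2 1 + (max 0 (g 3 1)))))
  | (3, 2) => 0
  | (3, 3) => g 1 1 + g 1 2 + (max 0 (g 1 3))
  | (3, 4) => g 1 1 + g 1 1 + g 1 2 + g 1 2 + g 1 3 + g 2 1 + g 2 2 + g 2 3
  | (4, 1) => 0
  | (4, 2) => 0
  | (4, 3) => 0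
  | (4, 4) => g 1 1 + g 1 2 + g 1 3
  | _ => 0

lemma tropicalises_reflect_three_four :
    Tropicalises (reflect 3 : Cols 4 8 ℝ → Cols 4 8 ℝ) fun g => yTrop (pluckerReflectThreeFour g) := by
  -- The sign is that of the permutation sorting the reflected column indices. Reversing four
  -- columns is even but a cyclic shift of four columns is odd, so the sign depends on where the
  -- index set wraps around.
  refine yHatSpec_four.tropicalises_of_plucker (s := fun u => if u = (1, 3) ∨ u = (1, 4) ∨ u =
        (2, 3) ∨ u = (3, 3) ∨ u = (4, 3) then -1 else 1)
    (fun _ _ h => h.reflect 3) ⟨fun u => ?_, fun a b ha ha' hb hb' => ?_⟩ fun v χ g hg => ?_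
  · simp only
    split_ifs <;> norm_num
  · change a ≤ 3 at ha'
    change b ≤ 3 at hb'
    interval_cases a <;> interval_cases b <;> norm_num [normVertex]
  have t11 := hg 1 1 (by decide) (by decide) (by decide) (by decide)
  have t12 := hg 1 2 (by decide) (by decide) (by decide) (by decide)
  have t13 := hg 1 3 (by decide) (by decide) (by decide) (by decide)
  have t21 := hg 2 1 (by decide) (by decide) (by decide) (by decide)
  have t22 := hg 2 2 (by decide) (by decide) (by decide) (by decide)
  have t23 := hg 2 3 (by decide) (by decide) (by decide) (by decide)
  have t31 := hg 3 1 (by decide) (by decide) (by decide) (by decide)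
  have t32 := hg 3 2 (by decide) (by decide) (by decide) (by decide)
  have t33 := hg 3 3 (by decide) (by decide) (by decide) (by decide)
  obtain ⟨w1, w2, w3, w4, w5, w6, w7, w8⟩ := webMat_values_four χ
  have c1 : reflect 3 (webMat 4 8 χ) 1 = _ :=
    (congrArg (webMat 4 8 χ) (by decide : (3 : ZMod 8) - 1 = 2)).trans w2
  have c2 : reflect 3 (webMat 4 8 χ) 2 = _ :=
    (congrArg (webMat 4 8 χ) (by decide : (3 : ZMod 8) - 2 = 1)).trans w1
  have c3 : reflect 3 (webMat 4 8 χ) 3 = _ :=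
    (congrArg (webMat 4 8 χ) (by decide : (3 : ZMod 8) - 3 = 8)).trans w8
  have c4 : reflect 3 (webMat 4 8 χ) 4 = _ :=
    (congrArg (webMat 4 8 χ) (by decide : (3 : ZMod 8) - 4 = 7)).trans w7
  have c5 : reflect 3 (webMat 4 8 χ) 5 = _ :=
    (congrArg (webMat 4 8 χ) (by decide : (3 : ZMod 8) - 5 = 6)).trans w6
  have c6 : reflect 3 (webMat 4 8 χ) 6 = _ :=
    (congrArg (webMat 4 8 χ) (by decide : (3 : ZMod 8) - 6 = 5)).trans w5
  have c7 : reflect 3 (webMat 4 8 χ) 7 = _ :=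
    (congrArg (webMat 4 8 χ) (by decide : (3 : ZMod 8) - 7 = 4)).trans w4
  have c8 : reflect 3 (webMat 4 8 χ) 8 = _ :=
    (congrArg (webMat 4 8 χ) (by decide : (3 : ZMod 8) - 8 = 3)).trans w3
  have hp := vertexPlucker_values_four (reflect 3 (webMat 4 8 χ))
  simp only [c1, c2, c3, c4, c5, c6, c7, c8] at hp
  obtain ⟨p00, p11, p12, p13, p14, p21, p22, p23, p24, p31, p32, p33, p34, p41, p42, p43, p44⟩ :=
      hp
  apply forall_vertices_four
  all_goals
    simp +decide only [p00, p11, p12, p13, p14, p21, p22, p23, p24, p31, p32, p33, p34, p41, p42,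
        p43, p44, det4, Matrix.cons_val, pluckerReflectThreeFour, if_true, if_false]
    apply HasTrop.of_eq
    · repeat' first | exact HasTrop.one | assumption | apply HasTrop.mul | apply HasTrop.add
    · ring

/-- Tropical Plücker coordinates of the image of a web matrix under `reflect 4`. -/
def pluckerReflectFourFour (g : ℕ → ℕ → ℤ) : ℕ × ℕ → ℤ
  | (0, 0) => 0
  | (1, 1) => 0
  | (1, 2) => g 1 1 + g 2 1 + g 3 1 + (max 0 (g 1 2 + (max (max 0 (g 1 3)) (g 2 2 + (max (max 0
        (g 3 2)) (g 1 3 + (max (max 0 (g 3 2)) (g 2 3 + (max 0 (g 3 2 + (max 0 (g 3 3))))))))))))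
  | (1, 3) => g 1 1 + g 2 1 + g 3 1 + (max 0 (g 1 2 + (max 0 (g 2 2 + (max 0 (g 3 2))))))
  | (1, 4) => g 1 1 + g 2 1 + g 3 1
  | (2, 1) => 0
  | (2, 2) => g 1 1 + g 2 1 + (max 0 (g 1 2 + (max (max 0 (g 2 2)) (g 1 3 + (max 0 (g 2 2 + (max
        0 (g 2 3))))))))
  | (2, 3) => g 1 1 + g 1 1 + g 1 2 + g 1 3 + g 2 1 + g 2 1 + g 2 2 + g 3 1 + g 3 2 + (max 0
        (g 2 3 + (max (max 0 (g 3 3)) (g 1 2 + (max (max 0 (g 3 3)) (g 2 2 + g 3 3))))))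
  | (2, 4) => g 1 1 + g 1 1 + g 1 2 + g 2 1 + g 2 1 + g 2 2 + g 3 1 + g 3 2
  | (3, 1) => 0
  | (3, 2) => g 1 1 + (max 0 (g 1 2 + (max 0 (g 1 3))))
  | (3, 3) => g 1 1 + g 1 1 + g 1 2 + g 1 3 + g 2 1 + g 2 2 + (max (max 0 (g 2 3)) (g 1 2 +
        g 2 3))
  | (3, 4) => g 1 1 + g 1 1 + g 1 1 + g 1 2 + g 1 2 + g 1 3 + g 2 1 + g 2 1 + g 2 2 + g 2 2 +
        g 2 3 + g 3 1 + g 3 2 + g 3 3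
  | (4, 1) => 0
  | (4, 2) => 0
  | (4, 3) => g 1 1 + g 1 2 + g 1 3
  | (4, 4) => g 1 1 + g 1 1 + g 1 2 + g 1 2 + g 1 3 + g 2 1 + g 2 2 + g 2 3
  | _ => 0

lemma tropicalises_reflect_four_four :
    Tropicalises (reflect 4 : Cols 4 8 ℝ → Cols 4 8 ℝ) fun g => yTrop (pluckerReflectFourFour g) := by
  refine yHatSpec_four.tropicalises_of_plucker (s := fun u => if u = (0, 0) ∨ u = (1, 1) ∨ u =
        (2, 1) ∨ u = (2, 3) ∨ u = (2, 4) ∨ u = (3, 1) ∨ u = (3, 3) ∨ u = (4, 1) ∨ u = (4, 3) then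
        -1 else 1)
    (fun _ _ h => h.reflect 4) ⟨fun u => ?_, fun a b ha ha' hb hb' => ?_⟩ fun v χ g hg => ?_
  · simp only
    split_ifs <;> norm_num
  · change a ≤ 3 at ha'
    change b ≤ 3 at hb'
    interval_cases a <;> interval_cases b <;> norm_num [normVertex]
  have t11 := hg 1 1 (by decide) (by decide) (by decide) (by decide)
  have t12 := hg 1 2 (by decide) (by decide) (by decide) (by decide)
  have t13 := hg 1 3 (by decide) (by decide) (by decide) (by decide)
  have t21 := hg 2 1 (by decide) (by decide) (by decide) (by decide)
  have t22 := hg 2 2 (by decide) (by decide) (by decide) (by decide)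
  have t23 := hg 2 3 (by decide) (by decide) (by decide) (by decide)
  have t31 := hg 3 1 (by decide) (by decide) (by decide) (by decide)
  have t32 := hg 3 2 (by decide) (by decide) (by decide) (by decide)
  have t33 := hg 3 3 (by decide) (by decide) (by decide) (by decide)
  obtain ⟨w1, w2, w3, w4, w5, w6, w7, w8⟩ := webMat_values_four χ
  have c1 : reflect 4 (webMat 4 8 χ) 1 = _ :=
    (congrArg (webMat 4 8 χ) (by decide : (4 : ZMod 8) - 1 = 3)).trans w3
  have c2 : reflect 4 (webMat 4 8 χ) 2 = _ :=
    (congrArg (webMat 4 8 χ) (by decide : (4 : ZMod 8) - 2 = 2)).trans w2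
  have c3 : reflect 4 (webMat 4 8 χ) 3 = _ :=
    (congrArg (webMat 4 8 χ) (by decide : (4 : ZMod 8) - 3 = 1)).trans w1
  have c4 : reflect 4 (webMat 4 8 χ) 4 = _ :=
    (congrArg (webMat 4 8 χ) (by decide : (4 : ZMod 8) - 4 = 8)).trans w8
  have c5 : reflect 4 (webMat 4 8 χ) 5 = _ :=
    (congrArg (webMat 4 8 χ) (by decide : (4 : ZMod 8) - 5 = 7)).trans w7
  have c6 : reflect 4 (webMat 4 8 χ) 6 = _ :=
    (congrArg (webMat 4 8 χ) (by decide : (4 : ZMod 8) - 6 = 6)).trans w6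
  have c7 : reflect 4 (webMat 4 8 χ) 7 = _ :=
    (congrArg (webMat 4 8 χ) (by decide : (4 : ZMod 8) - 7 = 5)).trans w5
  have c8 : reflect 4 (webMat 4 8 χ) 8 = _ :=
    (congrArg (webMat 4 8 χ) (by decide : (4 : ZMod 8) - 8 = 4)).trans w4
  have hp := vertexPlucker_values_four (reflect 4 (webMat 4 8 χ))
  simp only [c1, c2, c3, c4, c5, c6, c7, c8] at hp
  obtain ⟨p00, p11, p12, p13, p14, p21, p22, p23, p24, p31, p32, p33, p34, p41, p42, p43, p44⟩ :=
      hp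
  apply forall_vertices_four
  all_goals
    simp +decide only [p00, p11, p12, p13, p14, p21, p22, p23, p24, p31, p32, p33, p34, p41, p42,
        p43, p44, det4, Matrix.cons_val, pluckerReflectFourFour, if_true, if_false]
    apply HasTrop.of_eq
    · repeat' first | exact HasTrop.one | assumption | apply HasTrop.mul | apply HasTrop.add
    · ring

/-- Tropical Plücker coordinates of the image of a web matrix under `sigmaInv 2`. -/
def pluckerSigmaInvFour (g : ℕ → ℕ → ℤ) : ℕ × ℕ → ℤ
  | (0, 0) => 0
  | (1, 1) => 0
  | (1, 2) => g 1 2 + (max 0 (g 2 2 + (max 0 (g 3 2))))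
  | (1, 3) => 0
  | (1, 4) => 0
  | (2, 1) => g 2 1 + (max 0 (g 2 2 + (max 0 (g 2 3))))
  | (2, 2) => g 1 1 + g 1 2 + g 2 1 + g 2 2 + (max 0 (g 2 2 + (max (max 0 (g 3 2)) (g 2 3 + (max
        0 (g 3 2))))))
  | (2, 3) => g 1 1 + g 1 2 + g 2 1 + g 2 2 + g 2 3
  | (2, 4) => g 1 1 + g 1 2 + g 2 1 + g 2 2 + g 2 3
  | (3, 1) => 0
  | (3, 2) => g 1 1 + g 1 2 + g 2 1 + g 2 2 + g 3 2
  | (3, 3) => g 1 1 + g 1 1 + g 1 2 + g 2 1 + g 2 2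
  | (3, 4) => g 1 1 + g 1 1 + g 1 2 + g 1 2 + g 1 3 + g 2 1 + g 2 2 + g 2 3
  | (4, 1) => 0
  | (4, 2) => g 1 1 + g 1 2 + g 2 1 + g 2 2 + g 3 2
  | (4, 3) => g 1 1 + g 1 1 + g 1 2 + g 2 1 + g 2 1 + g 2 2 + g 3 1 + g 3 2
  | (4, 4) => g 1 1 + g 1 1 + g 1 1 + g 1 2 + g 1 2 + g 1 3 + g 2 1 + g 2 1 + g 2 2 + g 2 2 +
        g 2 3 + g 3 1 + g 3 2 + g 3 3
  | _ => 0

lemma tropicalises_sigmaInv_two_four :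
    Tropicalises (sigmaInv 2 : Cols 4 8 ℝ → Cols 4 8 ℝ) fun g => yTrop (pluckerSigmaInvFour g) := by
  refine yHatSpec_four.tropicalises_of_plucker (s := fun _ => 1)
    (fun _ _ h => h.sigmaInv 2) ⟨fun u => ?_, fun a b ha ha' hb hb' => ?_⟩ fun v χ g hg => ?_
  · norm_num
  · norm_num
  have t11 := hg 1 1 (by decide) (by decide) (by decide) (by decide)
  have t12 := hg 1 2 (by decide) (by decide) (by decide) (by decide)
  have t13 := hg 1 3 (by decide) (by decide) (by decide) (by decide)
  have t21 := hg 2 1 (by decide) (by decide) (by decide) (by decide)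
  have t22 := hg 2 2 (by decide) (by decide) (by decide) (by decide)
  have t23 := hg 2 3 (by decide) (by decide) (by decide) (by decide)
  have t31 := hg 3 1 (by decide) (by decide) (by decide) (by decide)
  have t32 := hg 3 2 (by decide) (by decide) (by decide) (by decide)
  have t33 := hg 3 3 (by decide) (by decide) (by decide) (by decide)
  have q11 := t11.pos
  have q12 := t12.pos
  have q13 := t13.pos
  have q21 := t21.pos
  have q22 := t22.pos
  have q23 := t23.pos
  have q31 := t31.pos
  have q32 := t32.pos
  have q33 := t33.pos
  obtain ⟨w1, w2, w3, w4, w5, w6, w7, w8⟩ := webMat_values_four χ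
  have c1 : sigmaInv 2 (webMat 4 8 χ) 1 = _ := Eq.trans (by
    rw [sigmaInv, if_neg (by decide), if_neg (by decide)]) w1
  -- The denominators are again monomials dividing the numerators.
  have c2 : sigmaInv 2 (webMat 4 8 χ) 2 = (1 + χ 1 2 * (1 + χ 2 2 * (1 + χ 3 2))) • webMat 4 8 χ
        2 - webMat 4 8 χ 3 := by
    have hd : det4 (webMat 4 8 χ 7) (webMat 4 8 χ 8) (webMat 4 8 χ 1) (webMat 4 8 χ 2) = χ 1 1 * χ 2 1 * χ 3 1 := by
      rw [w7, w8, w1, w2]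
      simp only [det4, Matrix.cons_val]
      ring
    have hn : det4 (webMat 4 8 χ 7) (webMat 4 8 χ 8) (webMat 4 8 χ 1) (webMat 4 8 χ 3) = χ 1 1 *
          χ 2 1 * χ 3 1 * (1 + χ 1 2 * (1 + χ 2 2 * (1 + χ 3 2))) := by
      rw [w7, w8, w1, w3]
      simp only [det4, Matrix.cons_val]
      ring
    rw [sigmaInv, if_pos (by decide), zetaTilde_four, show (2 : ZMod 8) - 3 = 7 by decide, show (2 : ZMod 8) - 2 = 8 by decide, show (2 : ZMod 8) - 1 = 1 by decide,
      show (2 : ZMod 8) + 1 = 3 by decide, hd, hn, mul_div_cancel_left₀ _ (by positivity)]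
  rw [w2, w3] at c2
  have c3 : sigmaInv 2 (webMat 4 8 χ) 3 = _ := Eq.trans (by
    rw [sigmaInv, if_neg (by decide), if_pos (by decide), show (3 : ZMod 8) - 1 = 2 by decide]) w2
  have c4 : sigmaInv 2 (webMat 4 8 χ) 4 = _ := Eq.trans (by
    rw [sigmaInv, if_neg (by decide), if_neg (by decide)]) w4
  have c5 : sigmaInv 2 (webMat 4 8 χ) 5 = _ := Eq.trans (by
    rw [sigmaInv, if_neg (by decide), if_neg (by decide)]) w5
  have c6 : sigmaInv 2 (webMat 4 8 χ) 6 = (1 + χ 2 1 * (1 + χ 2 2 * (1 + χ 2 3))) • webMat 4 8 χ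
        6 - webMat 4 8 χ 7 := by
    have hd : det4 (webMat 4 8 χ 3) (webMat 4 8 χ 4) (webMat 4 8 χ 5) (webMat 4 8 χ 6) = χ 1 1 * χ 1 2 * χ 1 3 := by
      rw [w3, w4, w5, w6]
      simp only [det4, Matrix.cons_val]
      ring
    have hn : det4 (webMat 4 8 χ 3) (webMat 4 8 χ 4) (webMat 4 8 χ 5) (webMat 4 8 χ 7) = χ 1 1 *
          χ 1 2 * χ 1 3 * (1 + χ 2 1 * (1 + χ 2 2 * (1 + χ 2 3))) := by
      rw [w3, w4, w5, w7]
      simp only [det4, Matrix.cons_val]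
      ring
    rw [sigmaInv, if_pos (by decide), zetaTilde_four, show (6 : ZMod 8) - 3 = 3 by decide, show (6 : ZMod 8) - 2 = 4 by decide, show (6 : ZMod 8) - 1 = 5 by decide,
      show (6 : ZMod 8) + 1 = 7 by decide, hd, hn, mul_div_cancel_left₀ _ (by positivity)]
  rw [w6, w7] at c6
  have c7 : sigmaInv 2 (webMat 4 8 χ) 7 = _ := Eq.trans (by
    rw [sigmaInv, if_neg (by decide), if_pos (by decide), show (7 : ZMod 8) - 1 = 6 by decide]) w6
  have c8 : sigmaInv 2 (webMat 4 8 χ) 8 = _ := Eq.trans (by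
    rw [sigmaInv, if_neg (by decide), if_neg (by decide)]) w8
  have hp := vertexPlucker_values_four (sigmaInv 2 (webMat 4 8 χ))
  simp only [c1, c2, c3, c4, c5, c6, c7, c8] at hp
  obtain ⟨p00, p11, p12, p13, p14, p21, p22, p23, p24, p31, p32, p33, p34, p41, p42, p43, p44⟩ :=
      hp
  apply forall_vertices_four
  all_goals
    simp +decide only [p00, p11, p12, p13, p14, p21, p22, p23, p24, p31, p32, p33, p34, p41, p42,
        p43, p44, det4, Matrix.cons_val, Pi.sub_apply, Pi.smul_apply, smul_eq_mul,
        pluckerSigmaInvFour]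
    apply HasTrop.of_eq
    · repeat' first | exact HasTrop.one | assumption | apply HasTrop.mul | apply HasTrop.add
    · ring

/-! ### Actions on truncated g-vectors -/

section Acts

variable {k n : ℕ}

lemma HasTropPt.congr {v : Idx k n → ℤ} {χ : ℕ → ℕ → ℝ} {g g' : ℕ → ℕ → ℤ}
    (h : HasTropPt k n v χ g) (hg : restrict k n g = restrict k n g') : HasTropPt k n v χ g' := by
  intro a b ha ha' hb hb'
  have := h a b ha ha' hb hb'
  rwa [← extend_restrict g ha ha' hb hb', hg, extend_restrict g' ha ha' hb hb'] at this

/-- A map on matrices acts on truncated g-vectors by `Q`. -/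
def Acts (f : Cols k n ℝ → Cols k n ℝ) (Q : (Idx k n → ℤ) → Idx k n → ℤ) : Prop :=
  Tropicalises f fun g => extend (Q (restrict k n g))

/-- The action on vectors indexed by active vertices. -/
def onIdx (q : (ℕ → ℕ → ℤ) → ℕ → ℕ → ℤ) (g : Idx k n → ℤ) : Idx k n → ℤ :=
  restrict k n (q (extend g))

lemma Tropicalises.acts {f : Cols k n ℝ → Cols k n ℝ} {q : (ℕ → ℕ → ℤ) → ℕ → ℕ → ℤ}
    (h : Tropicalises f q) : Acts f (onIdx q) where
  equiv := h.equiv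
  web hg := by
    obtain ⟨χ', h1, h2⟩ := h.web (hg.congr (restrict_extend (restrict k n _)).symm)
    exact ⟨χ', h1.congr (restrict_extend _).symm, h2⟩

namespace Acts

variable {f f' : Cols k n ℝ → Cols k n ℝ} {Q Q' : (Idx k n → ℤ) → Idx k n → ℤ}

lemma comp (h : Acts f Q) (h' : Acts f' Q') : Acts (f ∘ f') (Q ∘ Q') := by
  have := Tropicalises.comp h h'
  simpa only [Acts, Function.comp_def, restrict_extend] using this

lemma congr (h : Acts f Q) (hf : ∀ z, f' z = f z) : Acts f' Q := Tropicalises.congr h hf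

protected lemma id : Acts (id : Cols k n ℝ → Cols k n ℝ) id where
  equiv h := h
  web hg := ⟨_, hg.congr (restrict_extend _).symm, .refl _⟩

lemma tropMap_eq (H : YHatSpec k n) (hf : Acts f Q)
    {finv : Cols k n (RatFun (Idx k n)) → Cols k n (RatFun (Idx k n))}
    (hnat : ∀ z, f (mapCols (evalGen (Idx k n)) z) = mapCols (evalGen (Idx k n)) (finv z)) :
    tropMap finv = Q := by
  funext g
  rw [H.tropMap_eq hf hnat g, restrict_extend, restrict_extend]

/-- The tropical map is determined by the matrix map, since both descriptions compute `tropMap`.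
Relations between matrix maps therefore pass to the tropical maps without any case analysis. -/
lemma unique (H : YHatSpec k n) (hf : Acts f Q) (hf' : Acts f Q')
    {finv : Cols k n (RatFun (Idx k n)) → Cols k n (RatFun (Idx k n))}
    (hnat : ∀ z, f (mapCols (evalGen (Idx k n)) z) = mapCols (evalGen (Idx k n)) (finv z)) :
    Q = Q' := by
  rw [← hf.tropMap_eq H hnat, ← hf'.tropMap_eq H hnat]

lemma of_matEquiv (h : Acts f Q) (hf : ∀ z, MatEquiv (f z) (f' z))
    (hf' : ∀ z, MatEquiv (f' z) (f z)) : Acts f' Q where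
  equiv hz := ((hf' _).trans (h.equiv hz)).trans (hf _)
  web hg := by
    obtain ⟨χ', h1, h2⟩ := h.web hg
    exact ⟨χ', h1, h2.trans (hf _)⟩

end Acts

/-- A reversal of the columns squares to the identity on matrices, and uniqueness transfers this to
the piecewise linear map. -/
lemma Acts.involutive (H : YHatSpec k n) {c : ZMod n} {Q : (Idx k n → ℤ) → Idx k n → ℤ}
    (h : Acts (reflect c) Q) : Function.Involutive Q := by
  have h1 : Acts id (Q ∘ Q) := (h.comp h).congr fun z => by
    funext l
    simp [reflect]
  have := h1.unique H Acts.id (finv := id) fun z => rfl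
  exact fun g => congrFun this g

end Acts

/-! ### Dihedral relations between reflections, rotations and braid generators -/

section Relations

variable {k n : ℕ} {K : Type*}

lemma rotate_eq (c : ZMod n) (z : Cols k n K) : rotate z = reflect c (reflect (c + 1) z) := by
  funext l
  rw [reflect_reflect, rotate]
  congr 1
  ring

lemma rotateInv_eq (c : ZMod n) (z : Cols k n K) :
    rotateInv z = reflect (c + 1) (reflect c z) := by
  funext l
  rw [reflect_reflect, rotateInv]
  congr 1
  ring

variable [Field K]

lemma minor_rev (z : Cols k n K) (c : Fin k → ZMod n) :
    minor z (fun s => c s.rev) = (Equiv.Perm.sign (Fin.revPerm (n := k)) : ℤ) * minor z c := by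
  rw [minor, minor, ← Matrix.det_permute']
  rfl

/-- Reversing the columns interchanges the two quotients of minors defining `zeta` and `zetaTilde`;
numerator and denominator both acquire the sign of the reversal, which cancels. -/
lemma zetaTilde_reflect (c a : ZMod n) (z : Cols k n K) :
    zetaTilde (reflect c z) a = zeta z (c - a - 1) := by
  obtain _ | k := k
  · exact Subsingleton.elim _ _
  have hsign : ((Equiv.Perm.sign (Fin.revPerm (n := k + 1)) : ℤ) : K) ≠ 0 := by
    rcases Int.units_eq_one_or (Equiv.Perm.sign (Fin.revPerm (n := k + 1))) with h | h <;> simp [h]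
  have hrev : ∀ s : Fin (k + 1), ((s.rev.val : ℕ) : ZMod n) = (k : ZMod n) - (s.val : ZMod n) := by
    intro s
    rw [Fin.val_rev, Nat.cast_sub (by omega)]
    push_cast
    ring
  have h1 : minor (reflect c z) (fun s => a - ((k + 1 : ℕ) : ZMod n) + 1 + (s.val : ZMod n)) =
      (Equiv.Perm.sign (Fin.revPerm (n := k + 1)) : ℤ) *
        minor z (fun s => c - a - 1 + (s.val : ZMod n) + 1) := by
    rw [← minor_rev]
    simp only [minor, reflect, hrev]
    congr 3
    funext r s
    congr 1
    push_cast
    ring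
  have h2 : minor (reflect c z) (fun s => if s.val + 1 = k + 1 then a + 1
        else a - ((k + 1 : ℕ) : ZMod n) + 1 + (s.val : ZMod n)) =
      (Equiv.Perm.sign (Fin.revPerm (n := k + 1)) : ℤ) *
        minor z (fun s => if s.val = 0 then c - a - 1 else c - a - 1 + (s.val : ZMod n) + 1) := by
    rw [← minor_rev]
    simp only [minor, reflect, hrev]
    congr 3
    funext r s
    have : (s.rev.val = 0) ↔ s.val + 1 = k + 1 := by
      rw [Fin.val_rev]
      omega
    simp only [this]
    split_ifs
    · congr 1
      ring
    · congr 1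
      push_cast
      ring
  rw [zetaTilde, zeta, h1, h2, mul_div_mul_left _ _ hsign]
  simp only [reflect]
  rw [show c - a - 1 + 1 = c - a by ring, show c - (a + 1) = c - a - 1 by ring]

/-- The map l ↦ c - l with c ≡ i + j + 1 exchanges the class j with i + 1 and the class j + 1 with
i, and turns `zetaTilde` into `zeta`. A reflection thus conjugates an inverse generator to a
generator. -/
lemma sigma_eq_reflect [NeZero n] (hd : k.gcd n ≠ 1) {i j c : ℕ}
    (h : i + j + 1 ≡ c [MOD k.gcd n]) (z : Cols k n K) : sigma i z = reflect (c : ZMod n) (sigmaInv j (reflect (c : ZMod n) z)) := by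
  funext l
  have hval : ((c : ZMod n) - l).val + l.val ≡ i + j + 1 [MOD k.gcd n] := by
    refine Nat.ModEq.trans (Nat.ModEq.of_dvd (Nat.gcd_dvd_right k n) (b := c) ?_) h.symm
    rw [← ZMod.natCast_eq_natCast_iff]
    simp
  have h1 : ((c : ZMod n) - l).val ≡ j [MOD k.gcd n] ↔ l.val ≡ i + 1 [MOD k.gcd n] := by
    constructor
    · intro h'
      refine Nat.ModEq.add_left_cancel h' ?_
      rwa [show j + (i + 1) = i + j + 1 by ring]
    · intro h'
      refine Nat.ModEq.add_right_cancel h' ?_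
      rwa [show j + (i + 1) = i + j + 1 by ring]
  have h2 : ((c : ZMod n) - l).val ≡ j + 1 [MOD k.gcd n] ↔ l.val ≡ i [MOD k.gcd n] := by
    constructor
    · intro h'
      refine Nat.ModEq.add_left_cancel h' ?_
      rwa [show j + 1 + i = i + j + 1 by ring]
    · intro h'
      refine Nat.ModEq.add_right_cancel h' ?_
      rwa [show j + 1 + i = i + j + 1 by ring]
  simp only [sigma]
  rw [reflect, sigmaInv]
  simp only [h1, h2, zetaTilde_reflect]
  by_cases e1 : l.val ≡ i [MOD k.gcd n] <;> by_cases e2 : l.val ≡ i + 1 [MOD k.gcd n]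
  -- Since d ≠ 1, the classes i and i + 1 are different, so the two cases exclude each other.
  · have := (Nat.modEq_iff_dvd' (by omega)).mp (e1.symm.trans e2)
    exact absurd (by simpa using this) hd
  · simp only [e1, e2, if_true, if_false, reflect]
    congr 1
    ring
  · simp only [e1, e2, if_true, if_false]
    congr 1
    ring
  · simp [e1, e2, reflect]

/-- The sign carried by `rho` is a rescaling of one column, so it is invisible modulo equivalence.
-/
lemma matEquiv_rho (z : Cols k n ℝ) : MatEquiv (rotate z) (rho z) ∧ MatEquiv (rho z) (rotate z) := by
  have hs : ((-1 : ℝ) ^ (k - 1)) * (-1) ^ (k - 1) = 1 := by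
    rw [← mul_pow]
    simp
  constructor
  all_goals
    refine .of_smul (fun l => if l = 0 then (-1) ^ (k - 1) else 1) (fun l => ?_) fun l => ?_
  · split_ifs
    · exact left_ne_zero_of_mul_eq_one hs
    · exact one_ne_zero
  · simp only [rho, rotate]
    split_ifs with h
    · rw [h, zero_add]
    · rw [one_smul]
  · split_ifs
    · exact left_ne_zero_of_mul_eq_one hs
    · exact one_ne_zero
  · simp only [rho, rotate]
    split_ifs with h
    · rw [h, zero_add, smul_smul, hs, one_smul]
    · rw [one_smul]

lemma matEquiv_rhoInv (z : Cols k n ℝ) :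
    MatEquiv (rotateInv z) (rhoInv z) ∧ MatEquiv (rhoInv z) (rotateInv z) := by
  have hs : ((-1 : ℝ) ^ (k - 1)) * (-1) ^ (k - 1) = 1 := by
    rw [← mul_pow]
    simp
  constructor
  all_goals
    refine .of_smul (fun l => if l = 1 then (-1) ^ (k - 1) else 1) (fun l => ?_) fun l => ?_
  · split_ifs
    · exact left_ne_zero_of_mul_eq_one hs
    · exact one_ne_zero
  · simp only [rhoInv, rotateInv]
    split_ifs with h
    · rw [h, sub_self]
    · rw [one_smul]
  · split_ifs
    · exact left_ne_zero_of_mul_eq_one hs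
    · exact one_ne_zero
  · simp only [rhoInv, rotateInv]
    split_ifs with h
    · rw [h, sub_self, smul_smul, hs, one_smul]
    · rw [one_smul]

end Relations

/-! ### The tropical action of the braid generators -/

section General

variable {k n : ℕ} {c : ZMod n} {A B S : (Idx k n → ℤ) → Idx k n → ℤ}

lemma Acts.rotate (hA : Acts (reflect c) A) (hB : Acts (reflect (c + 1)) B) :
    Acts rotate (A ∘ B) := (hA.comp hB).congr (rotate_eq c)

lemma Acts.rotateInv (hA : Acts (reflect c) A) (hB : Acts (reflect (c + 1)) B) :
    Acts rotateInv (B ∘ A) := (hB.comp hA).congr (rotateInv_eq c)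

lemma Acts.rho (hA : Acts (reflect c) A) (hB : Acts (reflect (c + 1)) B) :
    Acts rho (A ∘ B) :=
  (hA.rotate hB).of_matEquiv (fun z => (matEquiv_rho z).1) fun z => (matEquiv_rho z).2

lemma Acts.rhoInv (hA : Acts (reflect c) A) (hB : Acts (reflect (c + 1)) B) :
    Acts rhoInv (B ∘ A) :=
  (hA.rotateInv hB).of_matEquiv (fun z => (matEquiv_rhoInv z).1) fun z => (matEquiv_rhoInv z).2

lemma Acts.sigmaInv_succ [NeZero n] {i : ℕ} (hA : Acts (reflect c) A)
    (hB : Acts (reflect (c + 1)) B) (hS : Acts (sigmaInv i) S) :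
    Acts (sigmaInv (i + 1)) ((B ∘ A) ∘ S ∘ A ∘ B) :=
  ((hA.rotateInv hB).comp (hS.comp (hA.rotate hB))).congr (GrTrop.sigmaInv_succ i)

lemma Acts.sigmaInv_pred [NeZero n] {i : ℕ} (hA : Acts (reflect c) A)
    (hB : Acts (reflect (c + 1)) B) (hS : Acts (sigmaInv (i + 1)) S) :
    Acts (sigmaInv i) ((A ∘ B) ∘ S ∘ B ∘ A) :=
  ((hA.rotate hB).comp (hS.comp (hA.rotateInv hB))).congr (sigmaInv_eq_succ i)

lemma Acts.sigma [NeZero n] (hd : k.gcd n ≠ 1) {i j c : ℕ} (h : i + j + 1 ≡ c [MOD k.gcd n])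
    (hA : Acts (reflect (c : ZMod n)) A) (hS : Acts (GrTrop.sigmaInv j) S) :
    Acts (GrTrop.sigma i) (A ∘ S ∘ A) := (hA.comp (hS.comp hA)).congr (sigma_eq_reflect hd h)

lemma Acts.cyclic {i : ℕ} (hi : i + 1 = k.gcd n) (hA : Acts (reflect c) A)
    (hB : Acts (reflect (c + 1)) B) (hS : Acts (GrTrop.sigmaInv i) S) :
    Acts (cyclicSigmaInv (i + 1)) ((B ∘ A) ∘ S ∘ A ∘ B) :=
  ((hA.rhoInv hB).comp (hS.comp (hA.rho hB))).congr fun z => by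
    simp only [cyclicSigmaInv, if_pos hi, Function.comp_apply]
    rw [← hi, Nat.add_sub_cancel]

lemma cyclicSigmaInv_of_ne {K : Type*} [Field K] {i : ℕ} (hi : i ≠ k.gcd n) :
    (cyclicSigmaInv i : Cols k n K → Cols k n K) = sigmaInv i := by
  funext z
  rw [cyclicSigmaInv, if_neg hi]

end General

/-! ### The generators for 3 × 9 matrices as conjugates of one of them -/

section ThreeNine

/-- The action of `reflect 2` on `ℤ^10`. -/
def reflA3 : (Idx 3 9 → ℤ) → Idx 3 9 → ℤ := onIdx fun g => yTrop (pluckerReflectTwoThree g)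

/-- The action of `reflect 3` on `ℤ^10`. -/
def reflB3 : (Idx 3 9 → ℤ) → Idx 3 9 → ℤ := onIdx fun g => yTrop (pluckerReflectThreeThree g)

/-- The action of `sigmaInv 2` on `ℤ^10`. -/
def braid3 : (Idx 3 9 → ℤ) → Idx 3 9 → ℤ := onIdx fun g => yTrop (pluckerSigmaInvThree g)

lemma acts_reflA3 : Acts (reflect 2) reflA3 := tropicalises_reflect_two_three.acts

lemma acts_reflB3 : Acts (reflect (2 + 1)) reflB3 := by
  have := tropicalises_reflect_three_three.acts
  rwa [show (3 : ZMod 9) = 2 + 1 by decide] at this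

lemma acts_braid3 : Acts (sigmaInv 2) braid3 := tropicalises_sigmaInv_two_three.acts

lemma acts_sigmaInv_one_three :
    Acts (sigmaInv 1) ((reflA3 ∘ reflB3) ∘ braid3 ∘ reflB3 ∘ reflA3) :=
  acts_reflA3.sigmaInv_pred acts_reflB3 acts_braid3

lemma reflA3_involutive : Function.Involutive reflA3 := acts_reflA3.involutive yHatSpec_three

lemma reflB3_involutive : Function.Involutive reflB3 := acts_reflB3.involutive yHatSpec_three

lemma tropMap_sigmaInv_two_three : tropMap (k := 3) (n := 9) (sigmaInv 2) = braid3 :=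
  acts_braid3.tropMap_eq yHatSpec_three (sigmaInv_mapCols _ 2)

lemma tropMap_sigmaInv_one_three : tropMap (k := 3) (n := 9) (sigmaInv 1) =
    (reflA3 ∘ reflB3) ∘ braid3 ∘ reflB3 ∘ reflA3 :=
  acts_sigmaInv_one_three.tropMap_eq yHatSpec_three (sigmaInv_mapCols _ 1)

lemma tropMap_sigma_two_three : tropMap (k := 3) (n := 9) (sigma 2) = reflA3 ∘ braid3 ∘ reflA3 :=
  Acts.tropMap_eq yHatSpec_three (Acts.sigma (by decide) (c := 2) (j := 2) (by decide)
    acts_reflA3 acts_braid3) (sigma_mapCols _ 2)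

lemma tropMap_sigma_one_three : tropMap (k := 3) (n := 9) (sigma 1) =
    reflB3 ∘ ((reflA3 ∘ reflB3) ∘ braid3 ∘ reflB3 ∘ reflA3) ∘ reflB3 :=
  Acts.tropMap_eq yHatSpec_three (Acts.sigma (by decide) (c := 3) (j := 1) (by decide)
    acts_reflB3 acts_sigmaInv_one_three) (sigma_mapCols _ 1)

lemma tropMap_cyclic_three : tropMap (k := 3) (n := 9) (cyclicSigmaInv 3) =
    (reflB3 ∘ reflA3) ∘ braid3 ∘ reflA3 ∘ reflB3 :=
  Acts.tropMap_eq yHatSpec_three (acts_reflA3.cyclic (by decide) acts_reflB3 acts_braid3)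
    (cyclicSigmaInv_mapCols _ 3)

end ThreeNine

/-! ### The generators for 4 × 8 matrices as conjugates of one of them -/

section FourEight

/-- The action of `reflect 3` on `ℤ^9`. -/
def reflA4 : (Idx 4 8 → ℤ) → Idx 4 8 → ℤ := onIdx fun g => yTrop (pluckerReflectThreeFour g)

/-- The action of `reflect 4` on `ℤ^9`. -/
def reflB4 : (Idx 4 8 → ℤ) → Idx 4 8 → ℤ := onIdx fun g => yTrop (pluckerReflectFourFour g)

/-- The action of `sigmaInv 2` on `ℤ^9`. -/
def braid4 : (Idx 4 8 → ℤ) → Idx 4 8 → ℤ := onIdx fun g => yTrop (pluckerSigmaInvFour g)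

lemma acts_reflA4 : Acts (reflect 3) reflA4 := tropicalises_reflect_three_four.acts

lemma acts_reflB4 : Acts (reflect (3 + 1)) reflB4 := by
  have := tropicalises_reflect_four_four.acts
  rwa [show (4 : ZMod 8) = 3 + 1 by decide] at this

lemma acts_braid4 : Acts (sigmaInv 2) braid4 := tropicalises_sigmaInv_two_four.acts

lemma acts_sigmaInv_one_four :
    Acts (sigmaInv 1) ((reflA4 ∘ reflB4) ∘ braid4 ∘ reflB4 ∘ reflA4) :=
  acts_reflA4.sigmaInv_pred acts_reflB4 acts_braid4

lemma acts_sigmaInv_three_four :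
    Acts (sigmaInv 3) ((reflB4 ∘ reflA4) ∘ braid4 ∘ reflA4 ∘ reflB4) :=
  acts_reflA4.sigmaInv_succ acts_reflB4 acts_braid4

lemma reflA4_involutive : Function.Involutive reflA4 := acts_reflA4.involutive yHatSpec_four

lemma reflB4_involutive : Function.Involutive reflB4 := acts_reflB4.involutive yHatSpec_four

lemma tropMap_sigmaInv_two_four : tropMap (k := 4) (n := 8) (sigmaInv 2) = braid4 :=
  acts_braid4.tropMap_eq yHatSpec_four (sigmaInv_mapCols _ 2)

lemma tropMap_sigmaInv_one_four : tropMap (k := 4) (n := 8) (sigmaInv 1) =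
    (reflA4 ∘ reflB4) ∘ braid4 ∘ reflB4 ∘ reflA4 :=
  acts_sigmaInv_one_four.tropMap_eq yHatSpec_four (sigmaInv_mapCols _ 1)

lemma tropMap_sigmaInv_three_four : tropMap (k := 4) (n := 8) (sigmaInv 3) =
    (reflB4 ∘ reflA4) ∘ braid4 ∘ reflA4 ∘ reflB4 :=
  acts_sigmaInv_three_four.tropMap_eq yHatSpec_four (sigmaInv_mapCols _ 3)

lemma tropMap_sigma_one_four : tropMap (k := 4) (n := 8) (sigma 1) = reflB4 ∘ braid4 ∘ reflB4 :=
  Acts.tropMap_eq yHatSpec_four (Acts.sigma (by decide) (c := 4) (j := 2) (by decide)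
    acts_reflB4 acts_braid4) (sigma_mapCols _ 1)

lemma tropMap_sigma_two_four : tropMap (k := 4) (n := 8) (sigma 2) =
    reflB4 ∘ ((reflA4 ∘ reflB4) ∘ braid4 ∘ reflB4 ∘ reflA4) ∘ reflB4 :=
  Acts.tropMap_eq yHatSpec_four (Acts.sigma (by decide) (c := 4) (j := 1) (by decide)
    acts_reflB4 acts_sigmaInv_one_four) (sigma_mapCols _ 2)

lemma tropMap_sigma_three_four : tropMap (k := 4) (n := 8) (sigma 3) =
    reflA4 ∘ ((reflB4 ∘ reflA4) ∘ braid4 ∘ reflA4 ∘ reflB4) ∘ reflA4 :=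
  Acts.tropMap_eq yHatSpec_four (Acts.sigma (by decide) (c := 3) (j := 3) (by decide)
    acts_reflA4 acts_sigmaInv_three_four) (sigma_mapCols _ 3)

lemma tropMap_cyclic_four : tropMap (k := 4) (n := 8) (cyclicSigmaInv 4) =
    (reflB4 ∘ reflA4) ∘ ((reflB4 ∘ reflA4) ∘ braid4 ∘ reflA4 ∘ reflB4) ∘ reflA4 ∘ reflB4 :=
  Acts.tropMap_eq yHatSpec_four (acts_reflA4.cyclic (by decide) acts_reflB4
    acts_sigmaInv_three_four) (cyclicSigmaInv_mapCols _ 4)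

end FourEight

/-! ### Piecewise linear functions -/

section PL

variable {ι κ : Type} [Fintype ι] [Fintype κ]

/-- Real vectors with integer coordinates. -/
def toReal (g : ι → ℤ) : ι → ℝ := fun i => (g i : ℝ)

/-- A function that is everywhere given by one of finitely many linear forms, and extends to a
continuous positively homogeneous function on real vectors. -/
def IsPL (f : (ι → ℤ) → ℤ) : Prop :=
  ∃ (S : Set (ι → ℤ)) (F : (ι → ℝ) → ℝ), S.Finite ∧ Continuous F ∧
    (∀ c : ℝ, 0 ≤ c → ∀ x, F (c • x) = c * F x) ∧ (∀ g, F (toReal g) = f g) ∧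
    ∀ g, ∃ s ∈ S, f g = ∑ i, s i * g i

namespace IsPL

variable {f f' : (ι → ℤ) → ℤ}

lemma zero : IsPL fun _ : ι → ℤ => 0 :=
  ⟨{0}, 0, Set.finite_singleton _, continuous_const, by simp, by simp, fun _ => ⟨0, rfl, by simp⟩⟩

lemma coord (i : ι) : IsPL fun g : ι → ℤ => g i := by
  classical
  exact ⟨{Pi.single i 1}, fun x => x i, Set.finite_singleton _, continuous_apply i, by simp,
    by simp [toReal], fun g => ⟨_, rfl, by simp [Pi.single_apply]⟩⟩

lemma add (h : IsPL f) (h' : IsPL f') : IsPL fun g => f g + f' g := by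
  obtain ⟨S, F, hS, hF, hc, hg, hs⟩ := h
  obtain ⟨S', F', hS', hF', hc', hg', hs'⟩ := h'
  refine ⟨Set.image2 (· + ·) S S', F + F', hS.image2 _ hS', hF.add hF', fun c h0 x => ?_,
    fun g => ?_, fun g => ?_⟩
  · simp [hc c h0, hc' c h0, mul_add]
  · simp [hg, hg']
  · obtain ⟨s, h1, h2⟩ := hs g
    obtain ⟨s', h1', h2'⟩ := hs' g
    exact ⟨_, ⟨s, h1, s', h1', rfl⟩, by simp [h2, h2', add_mul, Finset.sum_add_distrib]⟩

lemma neg (h : IsPL f) : IsPL fun g => -f g := by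
  obtain ⟨S, F, hS, hF, hc, hg, hs⟩ := h
  refine ⟨(- ·) '' S, -F, hS.image _, hF.neg, fun c h0 x => ?_, fun g => ?_, fun g => ?_⟩
  · simp [hc c h0]
  · simp [hg]
  · obtain ⟨s, h1, h2⟩ := hs g
    exact ⟨_, ⟨s, h1, rfl⟩, by simp [h2]⟩

lemma sub (h : IsPL f) (h' : IsPL f') : IsPL fun g => f g - f' g := by
  simpa only [sub_eq_add_neg] using h.add h'.neg

lemma max (h : IsPL f) (h' : IsPL f') : IsPL fun g => max (f g) (f' g) := by
  obtain ⟨S, F, hS, hF, hc, hg, hs⟩ := h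
  obtain ⟨S', F', hS', hF', hc', hg', hs'⟩ := h'
  refine ⟨S ∪ S', fun x => F x ⊔ F' x, hS.union hS', hF.max hF', fun c h0 x => ?_,
    fun g => ?_, fun g => ?_⟩
  · beta_reduce
    rw [hc c h0, hc' c h0, mul_max_of_nonneg _ _ h0]
  · simp [hg, hg']
  · rcases le_total (f g) (f' g) with h | h
    · obtain ⟨s', h1', h2'⟩ := hs' g
      exact ⟨s', .inr h1', by beta_reduce; rw [max_eq_right h, h2']⟩
    · obtain ⟨s, h1, h2⟩ := hs g
      exact ⟨s, .inl h1, by beta_reduce; rw [max_eq_left h, h2]⟩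

lemma comp {f : (κ → ℤ) → ℤ} {B : (ι → ℤ) → κ → ℤ} (h : IsPL f) (hB : ∀ i, IsPL fun g => B g i) :
    IsPL fun g => f (B g) := by
  obtain ⟨S, F, hS, hF, hc, hg, hs⟩ := h
  choose T G hT hG hcG hgG hsG using hB
  -- The pieces of a composite are composites of a linear form of f with a choice of one linear form
  -- for each coordinate of B.
  refine ⟨Set.image2 (fun s (t : κ → ι → ℤ) i => ∑ j, s j * t j i) S (Set.univ.pi T),
    fun x => F fun j => G j x, hS.image2 _ (Set.Finite.pi' hT |>.subset ?_),
    hF.comp (continuous_pi hG), fun c h0 x => ?_, fun g => ?_, fun g => ?_⟩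
  · intro t ht j
    exact ht j (Set.mem_univ _)
  · beta_reduce
    rw [← hc c h0]
    exact congrArg F (funext fun j => hcG j c h0 x)
  · simp only [hgG]
    exact hg (B g)
  · obtain ⟨s, h1, h2⟩ := hs (B g)
    choose t ht1 ht2 using fun j => hsG j g
    refine ⟨_, ⟨s, h1, t, fun j _ => ht1 j, rfl⟩, ?_⟩
    have ht2' : ∀ j, B g j = ∑ i, t j i * g i := ht2
    beta_reduce
    rw [h2]
    simp only [ht2', Finset.mul_sum, Finset.sum_mul]
    rw [Finset.sum_comm]
    simp only [mul_assoc]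

lemma smul (h : IsPL f) (c : ℤ) (hc0 : 0 ≤ c) (g : ι → ℤ) : f (c • g) = c * f g := by
  obtain ⟨S, F, hS, hF, hc, hg, hs⟩ := h
  have h1 := hg (c • g)
  have h2 : toReal (c • g) = (c : ℝ) • toReal g := by
    funext i
    simp [toReal]
  rw [h2, hc _ (by exact_mod_cast hc0), hg] at h1
  exact_mod_cast h1.symm

end IsPL

/-- A map between lattices with piecewise linear coordinates. -/
def IsPLMap (B : (ι → ℤ) → κ → ℤ) : Prop := ∀ i, IsPL fun g => B g i

lemma IsPLMap.comp {μ : Type} [Fintype μ] {B : (κ → ℤ) → μ → ℤ} {B' : (ι → ℤ) → κ → ℤ}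
    (h : IsPLMap B) (h' : IsPLMap B') : IsPLMap (B ∘ B') := fun i => (h i).comp h'

lemma IsPLMap.smul {μ : Type} {B : (ι → ℤ) → μ → ℤ} (h : IsPLMap B) {c : ℤ} (hc : 0 ≤ c) (g : ι → ℤ) :
    B (c • g) = c • B g := by
  funext i
  exact (h i).smul c hc g

/-- A piecewise linear map is everywhere given by one of finitely many matrices. -/
lemma IsPLMap.exists_matrix {B : (ι → ℤ) → κ → ℤ} (h : IsPLMap B) :
    ∃ MM : Finset (Matrix κ ι ℤ), ∀ g, ∃ M ∈ MM, B g = M.mulVec g := by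
  choose S F hS hF hc hg hs using h
  have hfin : (Set.univ.pi S : Set (Matrix κ ι ℤ)).Finite :=
    (Set.Finite.pi' hS).subset fun t ht j => ht j (Set.mem_univ _)
  refine ⟨hfin.toFinset, fun g => ?_⟩
  choose t ht1 ht2 using fun j => hs j g
  exact ⟨t, hfin.mem_toFinset.mpr fun j _ => ht1 j, funext fun j => ht2 j⟩

end PL

/-! ### Generic vectors and limits -/

section Generic

variable {ι : Type}

lemma exists_eval_ne_zero {F : MvPolynomial ι ℤ} (hF : F ≠ 0) :
    ∃ v : ι → ℤ, MvPolynomial.eval v F ≠ 0 := by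
  by_contra! h
  exact hF (MvPolynomial.funext fun v => by rw [h v, map_zero])

lemma ForGeneric.and {p p' : (ι → ℤ) → Prop} (h : ForGeneric p) (h' : ForGeneric p') :
    ForGeneric fun v => p v ∧ p' v := by
  obtain ⟨F, hF, h⟩ := h
  obtain ⟨F', hF', h'⟩ := h'
  refine ⟨F * F', mul_ne_zero hF hF', fun v hv => ?_⟩
  rw [map_mul] at hv
  exact ⟨h v (left_ne_zero_of_mul hv), h' v (right_ne_zero_of_mul hv)⟩

lemma ForGeneric.exists {p : (ι → ℤ) → Prop} (h : ForGeneric p) : ∃ v, p v := by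
  obtain ⟨F, hF, h⟩ := h
  obtain ⟨v, hv⟩ := exists_eval_ne_zero hF
  exact ⟨v, h v hv⟩

lemma ForGeneric.mono {p p' : (ι → ℤ) → Prop} (h : ForGeneric p) (hp : ∀ v, p v → p' v) :
    ForGeneric p' := by
  obtain ⟨F, hF, h⟩ := h
  exact ⟨F, hF, fun v hv => hp v (h v hv)⟩

variable [Fintype ι]

/-- Generic properties can be pulled back along piecewise linear bijections. -/
lemma ForGeneric.comp {p : (ι → ℤ) → Prop} (hp : ForGeneric p) {Y X : (ι → ℤ) → ι → ℤ}
    (hY : IsPLMap Y) (hX : IsPLMap X) (hXY : ∀ g, X (Y g) = g) :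
    ForGeneric fun g => p (Y g) := by
  classical
  obtain ⟨F, hF, hp⟩ := hp
  obtain ⟨MM, hMM⟩ := hY.exists_matrix
  obtain ⟨NN, hNN⟩ := hX.exists_matrix
  -- M and N are candidate linear pieces of Y at v and of X at Y v. The polynomial has to work only
  -- at those v for which they are consistent with X (Y v) = v.
  have key : ∀ M N : Matrix ι ι ℤ, ∃ P : MvPolynomial ι ℤ, P ≠ 0 ∧ ∀ v,
      N.mulVec (M.mulVec v) = v → MvPolynomial.eval v P ≠ 0 →
        MvPolynomial.eval (M.mulVec v) F ≠ 0 := by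
    intro M N
    -- If N M = 1, the polynomial F is pulled back along M. Otherwise N M v = v is a nontrivial
    -- linear condition, and one of its equations serves as polynomial.
    by_cases hNM : N * M = 1
    · have hev : ∀ v, MvPolynomial.eval v (MvPolynomial.aeval
          (fun i => ∑ j, MvPolynomial.C (M i j) * MvPolynomial.X j : ι → MvPolynomial ι ℤ) F) =
          MvPolynomial.eval (M.mulVec v) F := by
        intro v
        rw [← MvPolynomial.coe_aeval_eq_eval, RingHom.coe_coe, ← AlgHom.comp_apply,
          MvPolynomial.comp_aeval, ← MvPolynomial.coe_aeval_eq_eval, RingHom.coe_coe]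
        congr 2
        funext i
        simp [Matrix.mulVec, dotProduct]
      refine ⟨_, fun h0 => hF ?_, fun v _ hv => by rwa [hev] at hv⟩
      apply MvPolynomial.funext
      intro w
      have hMN : M * N = 1 := mul_eq_one_comm.mp hNM
      have := hev (N.mulVec w)
      rw [h0, map_zero, Matrix.mulVec_mulVec, hMN, Matrix.one_mulVec] at this
      rw [← this, map_zero]
    · obtain ⟨i, j, hij⟩ : ∃ i j, (N * M - 1) i j ≠ 0 := by
        by_contra! h
        exact hNM (sub_eq_zero.mp (Matrix.ext h))
      refine ⟨∑ j, MvPolynomial.C ((N * M - 1) i j) * MvPolynomial.X j, fun h0 => hij ?_,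
        fun v hv hne => absurd ?_ hne⟩
      · have := congrArg (MvPolynomial.eval (Pi.single j 1)) h0
        simpa [Pi.single_apply] using this
      · have h1 : ((N * M - 1).mulVec v) i = 0 := by
          rw [Matrix.sub_mulVec, ← Matrix.mulVec_mulVec, hv, Matrix.one_mulVec, sub_self]
          rfl
        simpa [Matrix.mulVec, dotProduct] using h1
  choose P hP0 hP using key
  -- There are finitely many pairs of pieces, so the product over all of them is a single nonzero
  -- polynomial.
  refine ⟨∏ M ∈ MM, ∏ N ∈ NN, P M N, Finset.prod_ne_zero_iff.mpr fun M _ =>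
    Finset.prod_ne_zero_iff.mpr fun N _ => hP0 M N, fun v hv => ?_⟩
  obtain ⟨M, hM, hMv⟩ := hMM v
  obtain ⟨N, hN, hNv⟩ := hNN (Y v)
  rw [map_prod, Finset.prod_ne_zero_iff] at hv
  have := hv M hM
  rw [map_prod, Finset.prod_ne_zero_iff] at this
  apply hp
  rw [hMv]
  refine hP M N v ?_ (this N hN)
  rw [← hMv, ← hNv, hXY]

/-- The continuous positively homogeneous extension of B carries convergence of rays to convergence
of rays. Primitivity survives because the inverse is homogeneous: a common divisor of B l divides l.
-/
lemma HasLimit.map {u : ℕ → ι → ℤ} {l : ι → ℤ} (h : HasLimit u l) {B B' : (ι → ℤ) → ι → ℤ}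
    (hB : IsPLMap B) (hB' : IsPLMap B') (hBB : ∀ g, B' (B g) = g) :
    HasLimit (fun j => B (u j)) (B l) := by
  obtain ⟨hl, c, hc, ht⟩ := h
  refine ⟨?_, c, hc, ?_⟩
  · set d := Finset.univ.gcd (B l) with hd
    have hd0 : 0 ≤ d := by
      have := Finset.normalize_gcd (s := Finset.univ) (f := B l)
      rw [← hd, ← Int.abs_eq_normalize] at this
      rw [← this]
      exact abs_nonneg _
    have hdvd : ∀ i, d ∣ B l i := fun i => Finset.gcd_dvd (Finset.mem_univ i)
    choose m hm using hdvd
    have h1 : B l = d • m := funext hm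
    have h2 : l = d • B' m := by rw [← hB'.smul hd0, ← h1, hBB]
    have h3 : d ∣ 1 := by
      rw [← hl]
      refine Finset.dvd_gcd fun i _ => ?_
      rw [h2]
      exact ⟨B' m i, rfl⟩
    exact Int.eq_one_of_dvd_one hd0 h3
  · rw [tendsto_pi_nhds]
    intro i
    obtain ⟨S, F, -, hF, hch, hg, -⟩ := hB i
    have h1 := (hF.tendsto _).comp ht
    have h2 : F (fun i => (l i : ℝ)) = (B l i : ℝ) := hg l
    rw [h2] at h1
    refine h1.congr fun j => ?_
    have h3 := hch (c j) (hc j).le (toReal (u j))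
    rw [hg] at h3
    exact h3

/-- At a coordinate where l is nonzero, the quotient of the two scalings converges, so l' is a
non-negative multiple of l. Two primitive vectors related in this way are equal. -/
lemma HasLimit.unique {u : ℕ → ι → ℤ} {l l' : ι → ℤ} (h : HasLimit u l) (h' : HasLimit u l') :
    l = l' := by
  obtain ⟨hl, c, hc, ht⟩ := h
  obtain ⟨hl', c', hc', ht'⟩ := h'
  rw [tendsto_pi_nhds] at ht ht'
  obtain ⟨i, hi⟩ : ∃ i, l i ≠ 0 := by
    by_contra! h0
    have : Finset.univ.gcd l = 0 := Finset.gcd_eq_zero_iff.mpr fun i _ => h0 i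
    rw [hl] at this
    exact one_ne_zero this
  have hi' : (l i : ℝ) ≠ 0 := by exact_mod_cast hi
  have hr : Tendsto (fun j => c' j / c j) atTop (𝓝 ((l' i : ℝ) / l i)) := by
    have h1 := (ht' i).div (ht i) hi'
    refine h1.congr' ?_
    filter_upwards [(ht i).eventually_ne hi'] with j hj
    have hu : (u j i : ℝ) ≠ 0 := right_ne_zero_of_mul hj
    have := (hc j).ne'
    simp only [Pi.div_apply]
    field_simp
  have hr0 : (0 : ℝ) ≤ (l' i : ℝ) / l i :=
    ge_of_tendsto' hr fun j => (div_pos (hc' j) (hc j)).le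
  have hprop : ∀ k, l i * l' k = l' i * l k := by
    intro k
    have h1 := hr.mul (ht k)
    have h2 : Tendsto (fun j => c' j / c j * (c j * (u j k : ℝ))) atTop (𝓝 (l' k : ℝ)) := by
      refine (ht' k).congr fun j => ?_
      have := (hc j).ne'
      field_simp
    have h3 := tendsto_nhds_unique h2 h1
    have h4 : (l i : ℝ) * l' k = l' i * l k := by
      rw [h3]
      field_simp
    exact_mod_cast h4
  -- Taking the gcd over k in `hprop` removes the primitive vectors and leaves |l i| = |l' i|.
  have hg : normalize (l i) = normalize (l' i) := by
    have h1 : Finset.univ.gcd (fun k => l i * l' k) = Finset.univ.gcd (fun k => l' i * l k) := by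
      simp only [hprop]
    rw [Finset.gcd_mul_left, Finset.gcd_mul_left] at h1
    change normalize (l i) * Finset.univ.gcd l' = normalize (l' i) * Finset.univ.gcd l at h1
    rwa [hl, hl', mul_one, mul_one] at h1
  have habs : |l i| = |l' i| := by
    rwa [← Int.abs_eq_normalize, ← Int.abs_eq_normalize] at hg
  have heq : l' i = l i := by
    rcases abs_eq_abs.mp habs with h1 | h1
    · exact h1.symm
    · exfalso
      rw [h1] at hr0 hi'
      push_cast at hr0 hi'
      rw [div_neg, div_self (by simpa using hi')] at hr0
      linarith
  funext k
  have := hprop k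
  rw [heq] at this
  exact (mul_left_cancel₀ hi this).symm

/-- Generic vectors converge to `l` under iteration of `f`. -/
def Attracts (f : (ι → ℤ) → ι → ℤ) (l : ι → ℤ) : Prop :=
  ForGeneric fun g => HasLimit (fun j => f^[j] g) l

lemma Attracts.gcd_eq_one {f : (ι → ℤ) → ι → ℤ} {l : ι → ℤ} (h : Attracts f l) :
    Finset.univ.gcd l = 1 := (ForGeneric.exists h).choose_spec.1

/-- Conjugation carries iterates to iterates, generic vectors pull back by `ForGeneric.comp`, and
limits push forward by `HasLimit.map`. -/
lemma Attracts.conj {f : (ι → ℤ) → ι → ℤ} {l : ι → ℤ} (h : Attracts f l)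
    {B B' : (ι → ℤ) → ι → ℤ} (hB : IsPLMap B) (hB' : IsPLMap B') (h1 : ∀ g, B (B' g) = g)
    (h2 : ∀ g, B' (B g) = g) : Attracts (B ∘ f ∘ B') (B l) := by
  refine (ForGeneric.comp h hB' hB h1).mono fun g hg => ?_
  have hit : ∀ j, (B ∘ f ∘ B')^[j] g = B (f^[j] (B' g)) := by
    intro j
    induction j with
    | zero => simp [h1]
    | succ j ih => rw [Function.iterate_succ_apply', ih, Function.iterate_succ_apply']; simp [h2]
  simp only [hit]
  exact hg.map hB hB' h2

lemma Attracts.isStableFixedPoint {f : (ι → ℤ) → ι → ℤ} {l : ι → ℤ} (h : Attracts f l)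
    (hl : f l = l) : IsStableFixedPoint f l := ⟨hl, 1, le_rfl, l, by simp, h⟩

/-- The primitive stable fixed point of a map is its attractor. -/
lemma Attracts.eq_of_isStableFixedPoint {f : (ι → ℤ) → ι → ℤ} {l g : ι → ℤ} (h : Attracts f l)
    (hg : IsStableFixedPoint f g) (hgcd : Finset.univ.gcd g = 1) : g = l := by
  obtain ⟨-, r, hr, l', rfl, h'⟩ := hg
  obtain ⟨v, hv, hv'⟩ := (ForGeneric.and h h').exists
  obtain rfl := hv.unique hv'
  have h1 : Finset.univ.gcd ((r : ℤ) • l) = normalize (r : ℤ) * Finset.univ.gcd l :=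
    Finset.gcd_mul_left
  rw [hgcd, hv.1, mul_one, Int.normalize_coe_nat] at h1
  rw [← h1, one_smul]

end Generic

/-! ### Mutations -/

section Mutation

variable {ι : Type}

/-- Vectors of positive reals together with their tropical values. -/
def HasTropVec [Fintype ι] (v : ι → ℤ) (x : ι → ℝ) (y : ι → ℤ) : Prop := ∀ i, HasTrop v (x i) (y i)

variable [DecidableEq ι]

/-- Tropical mutation of `y`-variables in direction `k`, where the entries of the exchange matrix
in row `k` are `1` on `P`, `-1` on `N`, and `0` elsewhere. -/
def mutTrop (k : ι) (P N : List ι) (y : ι → ℤ) : ι → ℤ := fun j =>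
  if j = k then -y k else if j ∈ P then y j + y k - max 0 (y k)
  else if j ∈ N then y j + max 0 (y k) else y j

/-- Mutation of `y`-variables. -/
def mutReal (k : ι) (P N : List ι) (x : ι → ℝ) : ι → ℝ := fun j =>
  if j = k then (x k)⁻¹ else if j ∈ P then x j * x k / (1 + x k)
  else if j ∈ N then x j * (1 + x k) else x j

lemma HasTropVec.mutTrop [Fintype ι] {v : ι → ℤ} {x : ι → ℝ} {y : ι → ℤ} (h : HasTropVec v x y)
    (k : ι) (P N : List ι) : HasTropVec v (mutReal k P N x) (mutTrop k P N y) := by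
  intro j
  simp only [mutReal, GrTrop.mutTrop]
  split_ifs
  · exact (h k).inv
  · exact ((h j).mul (h k)).div (HasTrop.one.add (h k))
  · exact (h j).mul (HasTrop.one.add (h k))
  · exact h j

/-- Mutation reverses the arrows at k, which exchanges the two lists, and replaces y k by its
negative; the two corrections of each neighbour cancel. -/
lemma mutTrop_mutTrop (k : ι) {P N : List ι} (hPN : ∀ j ∈ P, j ∉ N) (y : ι → ℤ) :
    mutTrop k N P (mutTrop k P N y) = y := by
  funext j
  have := hPN j
  simp only [mutTrop]
  split_ifs with h1 h2 h3 h3 <;> first | (subst h1; omega) | omega | skip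
  exact absurd h2 (this h3)

lemma isPLMap_mutTrop [Fintype ι] (k : ι) (P N : List ι) : IsPLMap (mutTrop k P N) := by
  intro j
  simp only [mutTrop]
  split_ifs
  · exact (IsPL.coord k).neg
  · exact ((IsPL.coord j).add (.coord k)).sub (.max .zero (.coord k))
  · exact (IsPL.coord j).add (.max .zero (.coord k))
  · exact .coord j

end Mutation

/-! ### Limits of eventually translating sequences -/

section Translate

variable {ι : Type} [Fintype ι]

/-- The deviation N u(t) - σ (t+1) l is eventually N-periodic, hence bounded. Dividing by σ (t+1)
makes it vanish in the limit. -/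
lemma HasLimit.of_translate {u : ℕ → ι → ℤ} {l : ι → ℤ} (hl : Finset.univ.gcd l = 1) {N t₀ : ℕ}
    (hN : 0 < N) {σ : ℤ} (hσ : 0 < σ) (h : ∀ t, t₀ ≤ t → ∀ i, u (t + N) i = u t i + σ * l i) :
    HasLimit u l := by
  have hN' : (0 : ℝ) < N := by exact_mod_cast hN
  have hσ' : (0 : ℝ) < σ := by exact_mod_cast hσ
  -- The inverse of the mean speed times t + 1; the shift avoids division by zero at t = 0.
  refine ⟨hl, fun t => N / (σ * (t + 1)), fun t => by positivity, ?_⟩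
  rw [tendsto_pi_nhds]
  intro i
  set w : ℕ → ℤ := fun t => N * u t i - σ * (t + 1) * l i with hw
  have hper : ∀ t, t₀ ≤ t → w (t + N) = w t := by
    intro t ht
    simp only [hw, h t ht]
    push_cast
    ring
  obtain ⟨C, hC⟩ : ∃ C : ℤ, ∀ t, |w t| ≤ C := by
    -- All values from t₀ on repeat one of the values before t₀ + N.
    refine ⟨∑ s ∈ Finset.range (t₀ + N), |w s|, fun t => ?_⟩
    induction t using Nat.strong_induction_on with
    | _ t ih =>
      by_cases ht : t < t₀ + N
      · exact Finset.single_le_sum (f := fun s => |w s|) (fun s _ => abs_nonneg _)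
          (Finset.mem_range.mpr ht)
      · have h1 := hper (t - N) (by omega)
        rw [Nat.sub_add_cancel (by omega)] at h1
        rw [h1]
        exact ih _ (by omega)
  have hlim : Tendsto (fun t : ℕ => (w t : ℝ) / (σ * (t + 1))) atTop (𝓝 0) := by
    have h1 : Tendsto (fun t : ℕ => (C / σ : ℝ) * (1 / ((t : ℝ) + 1))) atTop (𝓝 0) := by
      simpa using (tendsto_one_div_add_atTop_nhds_zero_nat (𝕜 := ℝ)).const_mul (C / σ : ℝ)
    refine squeeze_zero_norm (fun t => ?_) h1
    have h2 : |(w t : ℝ)| ≤ C := by exact_mod_cast hC t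
    have h3 : (0 : ℝ) < σ * (t + 1) := by positivity
    rw [Real.norm_eq_abs, abs_div, abs_of_pos h3, div_mul_div_comm, mul_one]
    gcongr
  have := hlim.add_const (l i : ℝ)
  rw [zero_add] at this
  refine this.congr fun t => ?_
  have h3 : (0 : ℝ) < (t : ℝ) + 1 := by positivity
  simp only [hw]
  push_cast
  field_simp
  ring

end Translate

/-- The dynamics of the tropical `y`-variables of an affine cycle: `s` is the value at the mutated
vertex, `S` the sum over the cycle. -/
lemma exists_eventually_translate {s S : ℕ → ℤ} {N : ℕ} (hN : 0 < N)
    (hS : ∀ t, S (t + 1) = S t + 2 * max 0 (-s t))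
    (hs : ∀ t, s (t + N) = s t + S t + max 0 (-s t) + ∑ i ∈ Finset.range N, max 0 (-s (t + i)))
    (h0 : S 0 ≠ 0) : ∃ t₀, ∃ σ > 0, ∀ t, t₀ ≤ t → 0 ≤ s t ∧ S t = σ := by
  have hmono : Monotone S := monotone_nat_of_le_succ fun t => by rw [hS]; omega
  have hsum : ∀ t, 0 ≤ ∑ i ∈ Finset.range N, max 0 (-s (t + i)) := fun t =>
    Finset.sum_nonneg fun i _ => le_max_left _ _
  have hconst : ∀ t₀ c, (∀ t, t₀ ≤ t → S t = c) → ∀ t, t₀ ≤ t → 0 ≤ s t := by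
    intro t₀ c hc t ht
    have h1 := hS t
    rw [hc t ht, hc (t + 1) (by omega)] at h1
    omega
  by_cases hpos : ∃ T, 0 < S T
  · obtain ⟨T, hT⟩ := hpos
    have hgrow : ∀ t, T ≤ t → s t + 1 ≤ s (t + N) := by
      intro t ht
      have h1 := hmono ht
      have h2 := hsum t
      rw [hs]
      omega
    have hmul : ∀ m t, T ≤ t → s t + m ≤ s (t + m * N) := by
      intro m
      induction m with
      | zero => simp
      | succ m ih =>
        intro t ht
        have h1 := ih t ht
        have h2 := hgrow (t + m * N) (by omega)
        rw [add_mul, one_mul, ← add_assoc]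
        push_cast
        omega
    -- Once S is positive, s grows by at least 1 in every period, so it becomes non-negative in each
    -- residue class modulo N.
    have hev : ∀ r, ∃ m : ℕ, ∀ m', m ≤ m' → 0 ≤ s (T + r + m' * N) := by
      intro r
      refine ⟨(-s (T + r)).toNat, fun m' hm => ?_⟩
      have := hmul m' (T + r) (by omega)
      omega
    choose m hm using hev
    set M := ∑ r ∈ Finset.range N, m r with hM
    have hnn : ∀ t, T + M * N ≤ t → 0 ≤ s t := by
      intro t ht
      have h1 : t = T + (t - T) % N + (t - T) / N * N := by
        have := Nat.mod_add_div' (t - T) N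
        omega
      rw [h1]
      refine hm _ _ (le_trans ?_ ((Nat.le_div_iff_mul_le hN).mpr (by omega : M * N ≤ t - T)))
      exact Finset.single_le_sum (f := m) (fun _ _ => Nat.zero_le _)
        (Finset.mem_range.mpr (Nat.mod_lt _ hN))
    have hc : ∀ j, S (T + M * N + j) = S (T + M * N) := by
      intro j
      induction j with
      | zero => rfl
      | succ j ih =>
        have h1 := hS (T + M * N + j)
        have h2 := hnn (T + M * N + j) (by omega)
        rw [← add_assoc, h1, ih]
        omega
    refine ⟨T + M * N, S (T + M * N), lt_of_lt_of_le hT (hmono (by omega)), fun t ht => ⟨hnn t ht, ?_⟩⟩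
    have := hc (t - (T + M * N))
    rwa [Nat.add_sub_cancel' ht] at this
  · exfalso
    push Not at hpos
    -- If S never exceeds 0, a non-decreasing integer sequence reaches its maximum and stays there;
    -- from then on s ≥ 0 and s changes by S over each period.
    obtain ⟨t₀, ht₀⟩ : ∃ t₀, ∀ t, S t ≤ S t₀ := by
      have hb : ∃ b : ℕ, (∃ t, S t = -(b : ℤ)) :=
        ⟨(-S 0).toNat, 0, by have := hpos 0; omega⟩
      classical
      obtain ⟨t₀, h1⟩ := Nat.find_spec hb
      refine ⟨t₀, fun t => ?_⟩
      have h2 : Nat.find hb ≤ (-S t).toNat := Nat.find_min' hb ⟨t, by have := hpos t; omega⟩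
      have := hpos t
      omega
    have hc : ∀ t, t₀ ≤ t → S t = S t₀ := fun t ht => le_antisymm (ht₀ t) (hmono ht)
    have hnn := hconst t₀ _ hc
    have hz : ∀ t, t₀ ≤ t → s (t + N) = s t + S t₀ := by
      intro t ht
      have h1 : ∑ i ∈ Finset.range N, max 0 (-s (t + i)) = 0 :=
        Finset.sum_eq_zero fun i _ => by have := hnn (t + i) (by omega); omega
      have := hnn t ht
      rw [hs, h1, hc t ht]
      omega
    rcases (hpos t₀).lt_or_eq with hlt | heq
    -- A negative final value would push s below zero.
    · have hdec : ∀ j : ℕ, s (t₀ + j * N) ≤ s t₀ - j := by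
        intro j
        induction j with
        | zero => simp
        | succ j ih =>
          have h1 := hz (t₀ + j * N) (by omega)
          rw [add_mul, one_mul, ← add_assoc, h1]
          push_cast
          omega
      have h1 := hdec ((s t₀).toNat + 1)
      have h2 := hnn (t₀ + ((s t₀).toNat + 1) * N) (by omega)
      have h3 := hnn t₀ le_rfl
      push_cast at h1
      omega
    · have hneg : ∀ t, S t = 0 → ∀ t', t ≤ t' → S t' = 0 := fun t ht t' htt =>
        le_antisymm (hpos t') (ht ▸ hmono htt)
      -- The value zero propagates backwards: the window sum reduces to its term at t, the two
      -- recursions give s(t+N) = s(t), so s(t) ≥ 0 and S does not change at t. This contradicts S 0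
      -- ≠ 0.
      have hback : ∀ t, S (t + 1) = 0 → S t = 0 := by
        intro t ht
        have hnn' := hconst (t + 1) 0 (hneg _ ht)
        have h1 : ∑ i ∈ Finset.range N, max 0 (-s (t + i)) = max 0 (-s t) := by
          obtain ⟨N', rfl⟩ : ∃ N', N = N' + 1 := ⟨N - 1, by omega⟩
          rw [Finset.sum_range_succ', add_zero, Finset.sum_eq_zero, zero_add]
          intro i _
          have := hnn' (t + (i + 1)) (by omega)
          omega
        have h2 := hs t
        rw [h1] at h2
        have h3 := hS t
        have h4 := hnn' (t + N) (by omega)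
        omega
      apply h0
      have : ∀ j, S j = 0 → S 0 = 0 := by
        intro j
        induction j with
        | zero => exact id
        | succ j ih => exact fun h => ih (hback j h)
      exact this t₀ heq

/-! ### Seeds in which the braid generator is a single mutation -/

/-- Vectors indexed by the active vertices of `Gr(4,8)`. -/
def idxVecFour {α : Type} (a11 a12 a13 a21 a22 a23 a31 a32 a33 : α) : Idx 4 8 → α := fun p =>
  ![![a11, a12, a13], ![a21, a22, a23], ![a31, a32, a33]] p.1 p.2

lemma funext_four {α : Type} {x y : Idx 4 8 → α} (h11 : x (0, 0) = y (0, 0))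
    (h12 : x (0, 1) = y (0, 1)) (h13 : x (0, 2) = y (0, 2)) (h21 : x (1, 0) = y (1, 0))
    (h22 : x (1, 1) = y (1, 1)) (h23 : x (1, 2) = y (1, 2)) (h31 : x (2, 0) = y (2, 0))
    (h32 : x (2, 1) = y (2, 1)) (h33 : x (2, 2) = y (2, 2)) : x = y := by
  funext ⟨a, b⟩
  fin_cases a <;> fin_cases b <;> assumption

/-- Vectors indexed by the active vertices of `Gr(3,9)`. -/
def idxVecThree {α : Type} (a11 a12 a21 a22 a31 a32 a41 a42 a51 a52 : α) : Idx 3 9 → α := fun p =>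
  ![![a11, a12], ![a21, a22], ![a31, a32], ![a41, a42], ![a51, a52]] p.1 p.2

lemma funext_three {α : Type} {x y : Idx 3 9 → α} (h11 : x (0, 0) = y (0, 0))
    (h12 : x (0, 1) = y (0, 1)) (h21 : x (1, 0) = y (1, 0)) (h22 : x (1, 1) = y (1, 1))
    (h31 : x (2, 0) = y (2, 0)) (h32 : x (2, 1) = y (2, 1)) (h41 : x (3, 0) = y (3, 0))
    (h42 : x (3, 1) = y (3, 1)) (h51 : x (4, 0) = y (4, 0)) (h52 : x (4, 1) = y (4, 1)) : x = y := by
  funext ⟨a, b⟩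
  fin_cases a <;> fin_cases b <;> assumption

/-- A mutation sequence to a seed in which the braid generator is a single mutation. -/
def toCycleFour : (Idx 4 8 → ℤ) → Idx 4 8 → ℤ :=
  mutTrop (1, 2) [(0, 2)] [(1, 0)] ∘ mutTrop (0, 2) [(0, 1), (1, 2)] [(1, 1)] ∘ mutTrop (0, 1)
    [(0, 2), (2, 1)] [(1, 1)] ∘ mutTrop (1, 1) [(0, 0), (1, 2), (2, 1)] [(0, 1), (1, 0), (2, 2)]

/-- The inverse mutation sequence. -/
def ofCycleFour : (Idx 4 8 → ℤ) → Idx 4 8 → ℤ :=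
  mutTrop (1, 1) [(0, 1), (1, 0), (2, 2)] [(0, 0), (1, 2), (2, 1)] ∘ mutTrop (0, 1) [(1, 1)]
    [(0, 2), (2, 1)] ∘ mutTrop (0, 2) [(1, 1)] [(0, 1), (1, 2)] ∘ mutTrop (1, 2) [(1, 0)] [(0,
    2)]

/-- The relabelling of the vertices after the mutation. -/
def cyclePermFour : Idx 4 8 → Idx 4 8 :=
  idxVecFour (0, 0) (2, 1) (0, 1) (0, 2) (1, 1) (1, 2) (1, 0) (2, 0) (2, 2)

/-- The braid generator in the mutated seed. -/
def cycleFour (y : Idx 4 8 → ℤ) : Idx 4 8 → ℤ := fun p =>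
  mutTrop (0, 2) [(1, 1), (1, 2)] [(0, 1), (1, 0)] y (cyclePermFour p)

/-- The real form of the conjugated mutation. -/
def cycleConjFour (x : Idx 4 8 → ℝ) : Idx 4 8 → ℝ :=
    (mutReal (1, 1) [(0, 1), (1, 0), (2, 2)] [(0, 0), (1, 2), (2, 1)] ∘ mutReal (0, 1) [(1, 1)]
      [(0, 2), (2, 1)] ∘ mutReal (0, 2) [(1, 1)] [(0, 1), (1, 2)] ∘ mutReal (1, 2) [(1, 0)] [(0,
      2)]) ((fun x p => mutReal (0, 2) [(1, 1), (1, 2)] [(0, 1), (1, 0)] x (cyclePermFour p))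
      ((mutReal (1, 2) [(0, 2)] [(1, 0)] ∘ mutReal (0, 2) [(0, 1), (1, 2)] [(1, 1)] ∘ mutReal
      (0, 1) [(0, 2), (2, 1)] [(1, 1)] ∘ mutReal (1, 1) [(0, 0), (1, 2), (2, 1)] [(0, 1), (1,
      0), (2, 2)]) x))

/-- Four mutations to the new seed, one mutation with relabelling, and four mutations back, followed
on positive real numbers. The polynomials f1, …, f4 of intermediate steps drop out and only f5, f6,
f7 remain, which are the ones appearing in σ_2⁻¹. -/
lemma mutReal_chain_four {c11 c12 c13 c21 c22 c23 c31 c32 c33 : ℝ} (h11 : 0 < c11) (h12 : 0 <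
  c12) (h13 : 0 < c13) (h21 : 0 < c21) (h22 : 0 < c22) (h23 : 0 < c23) (h31 : 0 < c31) (h32 : 0
  < c32) (h33 : 0 < c33)
    {f5 : ℝ} (ef5 : f5 = 1 + c22 + c22 * c23)
    {f6 : ℝ} (ef6 : f6 = 1 + c22 + c22 * c32)
    {f7 : ℝ} (ef7 : f7 = 1 + c22 + c22 * c32 + c22 * c23 + c22 * c23 * c32) :
    cycleConjFour (idxVecFour c11 c12 c13 c21 c22 c23 c31 c32 c33) =
      idxVecFour (c11 * c22 * f7 / (f5 * f6)) (c23 / f7) (c12 * f6) (c32 / f7) (f5 * f6 / (c22 *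
        c23 * c32)) (c13 * f7 / f6) (c21 * f5) (c31 * f7 / f5) (c22 * c23 * c32 * c33 / f7) :=
        by
  -- Each factor is introduced as an opaque positive number, so that `field_simp` treats it as an
  -- atom; its definition is used only in the identities e0, …, e8 expressing 1 + x at the mutated
  -- vertex.
  obtain ⟨f1, ef1⟩ : ∃ f, f = 1 + c22 := ⟨_, rfl⟩
  have pf1 : 0 < f1 := by rw [ef1]; positivity
  obtain ⟨f2, ef2⟩ : ∃ f, f = 1 + c12 + c12 * c22 := ⟨_, rfl⟩
  have pf2 : 0 < f2 := by rw [ef2]; positivity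
  obtain ⟨f3, ef3⟩ : ∃ f, f = 1 + c12 + c12 * c22 + c12 * c13 + c12 * c13 * c22 := ⟨_, rfl⟩
  have pf3 : 0 < f3 := by rw [ef3]; positivity
  obtain ⟨f4, ef4⟩ : ∃ f, f = 1 + c12 + c12 * c22 + c12 * c13 + c12 * c13 * c22 + c12 * c13 *
    c22 * c23 := ⟨_, rfl⟩
  have pf4 : 0 < f4 := by rw [ef4]; positivity
  have pf5 : 0 < f5 := by rw [ef5]; positivity
  have pf6 : 0 < f6 := by rw [ef6]; positivity
  have pf7 : 0 < f7 := by rw [ef7]; positivity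
  simp only [cycleConjFour, Function.comp_apply]
  have e0 : 1 + c22 = f1 := by
    field_simp
    simp only [ef1]
  have s0 : mutReal (1, 1) [(0, 0), (1, 2), (2, 1)] [(0, 1), (1, 0), (2, 2)] (idxVecFour c11 c12
    c13 c21 c22 c23 c31 c32 c33) =
      idxVecFour (c11 * c22 / f1) (c12 * f1) c13 (c21 * f1) (1 / c22) (c22 * c23 / f1) c31 (c22
        * c32 / f1) (c33 * f1) := by
    apply funext_four <;> simp +decide only [mutReal, idxVecFour, Matrix.cons_val, if_true,
      if_false, e0] <;> field_simp
  rw [s0]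
  have e1 : 1 + c12 * f1 = f2 := by
    field_simp
    simp only [ef1, ef2]
    ring
  have s1 : mutReal (0, 1) [(0, 2), (2, 1)] [(1, 1)] (idxVecFour (c11 * c22 / f1) (c12 * f1) c13
    (c21 * f1) (1 / c22) (c22 * c23 / f1) c31 (c22 * c32 / f1) (c33 * f1)) =
      idxVecFour (c11 * c22 / f1) (1 / (c12 * f1)) (c12 * c13 * f1 / f2) (c21 * f1) (f2 / c22)
        (c22 * c23 / f1) c31 (c12 * c22 * c32 / f2) (c33 * f1) := by
    apply funext_four <;> simp +decide only [mutReal, idxVecFour, Matrix.cons_val, if_true,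
      if_false, e1] <;> field_simp
  rw [s1]
  have e2 : 1 + c12 * c13 * f1 / f2 = f3 / f2 := by
    field_simp
    simp only [ef1, ef2, ef3]
    ring
  have s2 : mutReal (0, 2) [(0, 1), (1, 2)] [(1, 1)] (idxVecFour (c11 * c22 / f1) (1 / (c12 *
    f1)) (c12 * c13 * f1 / f2) (c21 * f1) (f2 / c22) (c22 * c23 / f1) c31 (c12 * c22 * c32 / f2)
    (c33 * f1)) =
      idxVecFour (c11 * c22 / f1) (c13 / f3) (f2 / (c12 * c13 * f1)) (c21 * f1) (f3 / c22) (c12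
        * c13 * c22 * c23 / f3) c31 (c12 * c22 * c32 / f2) (c33 * f1) := by
    apply funext_four <;> simp +decide only [mutReal, idxVecFour, Matrix.cons_val, if_true,
      if_false, e2] <;> field_simp
  rw [s2]
  have e3 : 1 + c12 * c13 * c22 * c23 / f3 = f4 / f3 := by
    field_simp
    simp only [ef3, ef4]
  have s3 : mutReal (1, 2) [(0, 2)] [(1, 0)] (idxVecFour (c11 * c22 / f1) (c13 / f3) (f2 / (c12
    * c13 * f1)) (c21 * f1) (f3 / c22) (c12 * c13 * c22 * c23 / f3) c31 (c12 * c22 * c32 / f2)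
    (c33 * f1)) =
      idxVecFour (c11 * c22 / f1) (c13 / f3) (c22 * c23 * f2 / (f1 * f4)) (c21 * f1 * f4 / f3)
        (f3 / c22) (f3 / (c12 * c13 * c22 * c23)) c31 (c12 * c22 * c32 / f2) (c33 * f1) := by
    apply funext_four <;> simp +decide only [mutReal, idxVecFour, Matrix.cons_val, if_true,
      if_false, e3] <;> field_simp
  rw [s3]
  have e4 : 1 + c22 * c23 * f2 / (f1 * f4) = f3 * f5 / (f1 * f4) := by
    field_simp
    simp only [ef1, ef2, ef3, ef4, ef5]
    ring
  have s4 : mutReal (0, 2) [(1, 1), (1, 2)] [(0, 1), (1, 0)] (idxVecFour (c11 * c22 / f1) (c13 /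
    f3) (c22 * c23 * f2 / (f1 * f4)) (c21 * f1 * f4 / f3) (f3 / c22) (f3 / (c12 * c13 * c22 *
    c23)) c31 (c12 * c22 * c32 / f2) (c33 * f1)) =
      idxVecFour (c11 * c22 / f1) (c13 * f5 / (f1 * f4)) (f1 * f4 / (c22 * c23 * f2)) (c21 * f5)
        (c23 * f2 / f5) (f2 / (c12 * c13 * f5)) c31 (c12 * c22 * c32 / f2) (c33 * f1) := by
    apply funext_four <;> simp +decide only [mutReal, idxVecFour, Matrix.cons_val, if_true,
      if_false, e4] <;> field_simp
  rw [s4]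
  have r : (fun p => (idxVecFour (c11 * c22 / f1) (c13 * f5 / (f1 * f4)) (f1 * f4 / (c22 * c23 *
    f2)) (c21 * f5) (c23 * f2 / f5) (f2 / (c12 * c13 * f5)) c31 (c12 * c22 * c32 / f2) (c33 *
    f1)) (cyclePermFour p)) = idxVecFour (c11 * c22 / f1) (c12 * c22 * c32 / f2) (c13 * f5 / (f1
    * f4)) (f1 * f4 / (c22 * c23 * f2)) (c23 * f2 / f5) (f2 / (c12 * c13 * f5)) (c21 * f5) c31
    (c33 * f1) := by
    apply funext_four <;> rfl
  rw [r]
  have e5 : 1 + f2 / (c12 * c13 * f5) = f4 / (c12 * c13 * f5) := by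
    field_simp
    simp only [ef2, ef4, ef5]
    ring
  have s5 : mutReal (1, 2) [(1, 0)] [(0, 2)] (idxVecFour (c11 * c22 / f1) (c12 * c22 * c32 / f2)
    (c13 * f5 / (f1 * f4)) (f1 * f4 / (c22 * c23 * f2)) (c23 * f2 / f5) (f2 / (c12 * c13 * f5))
    (c21 * f5) c31 (c33 * f1)) =
      idxVecFour (c11 * c22 / f1) (c12 * c22 * c32 / f2) (1 / (c12 * f1)) (f1 / (c22 * c23))
        (c23 * f2 / f5) (c12 * c13 * f5 / f2) (c21 * f5) c31 (c33 * f1) := by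
    apply funext_four <;> simp +decide only [mutReal, idxVecFour, Matrix.cons_val, if_true,
      if_false, e5] <;> field_simp
  rw [s5]
  have e6 : 1 + 1 / (c12 * f1) = f2 / (c12 * f1) := by
    field_simp
    simp only [ef1, ef2]
    ring
  have s6 : mutReal (0, 2) [(1, 1)] [(0, 1), (1, 2)] (idxVecFour (c11 * c22 / f1) (c12 * c22 *
    c32 / f2) (1 / (c12 * f1)) (f1 / (c22 * c23)) (c23 * f2 / f5) (c12 * c13 * f5 / f2) (c21 *
    f5) c31 (c33 * f1)) =
      idxVecFour (c11 * c22 / f1) (c22 * c32 / f1) (c12 * f1) (f1 / (c22 * c23)) (c23 / f5) (c13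
        * f5 / f1) (c21 * f5) c31 (c33 * f1) := by
    apply funext_four <;> simp +decide only [mutReal, idxVecFour, Matrix.cons_val, if_true,
      if_false, e6] <;> field_simp
  rw [s6]
  have e7 : 1 + c22 * c32 / f1 = f6 / f1 := by
    field_simp
    simp only [ef1, ef6]
  have s7 : mutReal (0, 1) [(1, 1)] [(0, 2), (2, 1)] (idxVecFour (c11 * c22 / f1) (c22 * c32 /
    f1) (c12 * f1) (f1 / (c22 * c23)) (c23 / f5) (c13 * f5 / f1) (c21 * f5) c31 (c33 * f1)) =
      idxVecFour (c11 * c22 / f1) (f1 / (c22 * c32)) (c12 * f6) (f1 / (c22 * c23)) (c22 * c23 *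
        c32 / (f5 * f6)) (c13 * f5 / f1) (c21 * f5) (c31 * f6 / f1) (c33 * f1) := by
    apply funext_four <;> simp +decide only [mutReal, idxVecFour, Matrix.cons_val, if_true,
      if_false, e7] <;> field_simp
  rw [s7]
  have e8 : 1 + c22 * c23 * c32 / (f5 * f6) = f1 * f7 / (f5 * f6) := by
    field_simp
    simp only [ef1, ef5, ef6, ef7]
    ring
  have s8 : mutReal (1, 1) [(0, 1), (1, 0), (2, 2)] [(0, 0), (1, 2), (2, 1)] (idxVecFour (c11 *
    c22 / f1) (f1 / (c22 * c32)) (c12 * f6) (f1 / (c22 * c23)) (c22 * c23 * c32 / (f5 * f6))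
    (c13 * f5 / f1) (c21 * f5) (c31 * f6 / f1) (c33 * f1)) =
      idxVecFour (c11 * c22 * f7 / (f5 * f6)) (c23 / f7) (c12 * f6) (c32 / f7) (f5 * f6 / (c22 *
        c23 * c32)) (c13 * f7 / f6) (c21 * f5) (c31 * f7 / f5) (c22 * c23 * c32 * c33 / f7) :=
        by
    apply funext_four <;> simp +decide only [mutReal, idxVecFour, Matrix.cons_val, if_true,
      if_false, e8] <;> field_simp
  rw [s8]

/-- A mutation sequence to a seed in which the braid generator is a single mutation. -/
def toCycleThree : (Idx 3 9 → ℤ) → Idx 3 9 → ℤ :=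
  mutTrop (4, 1) [(3, 1)] [(2, 1), (3, 0)] ∘ mutTrop (4, 0) [(3, 0)] [(0, 0)] ∘ mutTrop (3, 1)
    [(1, 0), (4, 1)] [(2, 0), (2, 1)] ∘ mutTrop (3, 0) [(2, 0), (4, 0)] [(0, 0), (4, 1)] ∘
    mutTrop (2, 0) [(1, 0), (3, 0)] [(0, 0), (3, 1)] ∘ mutTrop (1, 0) [(1, 1), (2, 0)] [(0, 0),
    (2, 1)]

/-- The inverse mutation sequence. -/
def ofCycleThree : (Idx 3 9 → ℤ) → Idx 3 9 → ℤ :=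
  mutTrop (1, 0) [(0, 0), (2, 1)] [(1, 1), (2, 0)] ∘ mutTrop (2, 0) [(0, 0), (3, 1)] [(1, 0),
    (3, 0)] ∘ mutTrop (3, 0) [(0, 0), (4, 1)] [(2, 0), (4, 0)] ∘ mutTrop (3, 1) [(2, 0), (2, 1)]
    [(1, 0), (4, 1)] ∘ mutTrop (4, 0) [(0, 0)] [(3, 0)] ∘ mutTrop (4, 1) [(2, 1), (3, 0)] [(3,
    1)]

/-- The relabelling of the vertices after the mutation. -/
def cyclePermThree : Idx 3 9 → Idx 3 9 :=
  idxVecThree (4, 0) (0, 0) (1, 1) (0, 1) (2, 0) (2, 1) (3, 1) (1, 0) (3, 0) (4, 1)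

/-- The braid generator in the mutated seed. -/
def cycleThree (y : Idx 3 9 → ℤ) : Idx 3 9 → ℤ := fun p =>
  mutTrop (3, 1) [(2, 0), (4, 1)] [(1, 0), (3, 0)] y (cyclePermThree p)

/-- The real form of the conjugated mutation. -/
def cycleConjThree (x : Idx 3 9 → ℝ) : Idx 3 9 → ℝ :=
    (mutReal (1, 0) [(0, 0), (2, 1)] [(1, 1), (2, 0)] ∘ mutReal (2, 0) [(0, 0), (3, 1)] [(1, 0),
      (3, 0)] ∘ mutReal (3, 0) [(0, 0), (4, 1)] [(2, 0), (4, 0)] ∘ mutReal (3, 1) [(2, 0), (2,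
      1)] [(1, 0), (4, 1)] ∘ mutReal (4, 0) [(0, 0)] [(3, 0)] ∘ mutReal (4, 1) [(2, 1), (3, 0)]
      [(3, 1)]) ((fun x p => mutReal (3, 1) [(2, 0), (4, 1)] [(1, 0), (3, 0)] x (cyclePermThree
      p)) ((mutReal (4, 1) [(3, 1)] [(2, 1), (3, 0)] ∘ mutReal (4, 0) [(3, 0)] [(0, 0)] ∘
      mutReal (3, 1) [(1, 0), (4, 1)] [(2, 0), (2, 1)] ∘ mutReal (3, 0) [(2, 0), (4, 0)] [(0,
      0), (4, 1)] ∘ mutReal (2, 0) [(1, 0), (3, 0)] [(0, 0), (3, 1)] ∘ mutReal (1, 0) [(1, 1),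
      (2, 0)] [(0, 0), (2, 1)]) x))

/-- The analogous computation with six mutations on either side. The surviving factors are f5 and
f8, …, f12. -/
lemma mutReal_chain_three {c11 c12 c21 c22 c31 c32 c41 c42 c51 c52 : ℝ} (h11 : 0 < c11) (h12 : 0
  < c12) (h21 : 0 < c21) (h22 : 0 < c22) (h31 : 0 < c31) (h32 : 0 < c32) (h41 : 0 < c41) (h42 :
  0 < c42) (h51 : 0 < c51) (h52 : 0 < c52)
    {f5 : ℝ} (ef5 : f5 = 1 + c21 + c21 * c31 + c21 * c31 * c41 + c21 * c31 * c41 * c51)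
    {f8 : ℝ} (ef8 : f8 = 1 + c51 + c51 * c52)
    {f9 : ℝ} (ef9 : f9 = 1 + c31)
    {f10 : ℝ} (ef10 : f10 = 1 + c51)
    {f11 : ℝ} (ef11 : f11 = 1 + c31 + c31 * c41 + c31 * c41 * c51)
    {f12 : ℝ} (ef12 : f12 = 1 + c21 + c21 * c31 + c21 * c22 + c21 * c31 * c41 + c21 * c22 * c31
      + c21 * c31 * c41 * c51 + c21 * c22 * c31 * c41 + c21 * c22 * c31 * c41 * c51) :
    cycleConjThree (idxVecThree c11 c12 c21 c22 c31 c32 c41 c42 c51 c52) =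
      idxVecThree (c22 / f12) (c11 * f5) (f5 / (c21 * c22 * f11)) (c12 * f12 / f5) (f9 * f12 /
        (c31 * c41 * f10)) (c21 * c22 * c31 * c32 * f11 / (f9 * f12)) (c52 * f11 / (f8 * f9))
        (c41 * f10 / f11) (f10 / (c51 * c52)) (c42 * f8 * f9 / f10) := by
  obtain ⟨f1, ef1⟩ : ∃ f, f = 1 + c21 := ⟨_, rfl⟩
  have pf1 : 0 < f1 := by rw [ef1]; positivity
  obtain ⟨f2, ef2⟩ : ∃ f, f = 1 + c21 + c21 * c31 := ⟨_, rfl⟩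
  have pf2 : 0 < f2 := by rw [ef2]; positivity
  obtain ⟨f3, ef3⟩ : ∃ f, f = 1 + c21 + c21 * c31 + c21 * c31 * c41 := ⟨_, rfl⟩
  have pf3 : 0 < f3 := by rw [ef3]; positivity
  obtain ⟨f4, ef4⟩ : ∃ f, f = 1 + c42 + c21 + c21 * c42 + c21 * c31 * c42 := ⟨_, rfl⟩
  have pf4 : 0 < f4 := by rw [ef4]; positivity
  have pf5 : 0 < f5 := by rw [ef5]; positivity
  obtain ⟨f6, ef6⟩ : ∃ f, f = 1 + c42 + c21 + c42 * c52 + c21 * c42 + c21 * c42 * c52 + c21 *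
    c31 * c42 + c21 * c31 * c42 * c52 + c21 * c31 * c41 * c42 * c52 := ⟨_, rfl⟩
  have pf6 : 0 < f6 := by rw [ef6]; positivity
  obtain ⟨f7, ef7⟩ : ∃ f, f = 1 + c52 + c21 + c21 * c52 + c21 * c31 + c21 * c31 * c52 + c21 *
    c31 * c41 * c52 := ⟨_, rfl⟩
  have pf7 : 0 < f7 := by rw [ef7]; positivity
  have pf8 : 0 < f8 := by rw [ef8]; positivity
  have pf9 : 0 < f9 := by rw [ef9]; positivity
  have pf10 : 0 < f10 := by rw [ef10]; positivity
  have pf11 : 0 < f11 := by rw [ef11]; positivity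
  have pf12 : 0 < f12 := by rw [ef12]; positivity
  simp only [cycleConjThree, Function.comp_apply]
  have e0 : 1 + c21 = f1 := by
    field_simp
    simp only [ef1]
  have s0 : mutReal (1, 0) [(1, 1), (2, 0)] [(0, 0), (2, 1)] (idxVecThree c11 c12 c21 c22 c31
    c32 c41 c42 c51 c52) =
      idxVecThree (c11 * f1) c12 (1 / c21) (c21 * c22 / f1) (c21 * c31 / f1) (c32 * f1) c41 c42
        c51 c52 := by
    apply funext_three <;> simp +decide only [mutReal, idxVecThree, Matrix.cons_val, if_true,
      if_false, e0] <;> field_simp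
  rw [s0]
  have e1 : 1 + c21 * c31 / f1 = f2 / f1 := by
    field_simp
    simp only [ef1, ef2]
  have s1 : mutReal (2, 0) [(1, 0), (3, 0)] [(0, 0), (3, 1)] (idxVecThree (c11 * f1) c12 (1 /
    c21) (c21 * c22 / f1) (c21 * c31 / f1) (c32 * f1) c41 c42 c51 c52) =
      idxVecThree (c11 * f2) c12 (c31 / f2) (c21 * c22 / f1) (f1 / (c21 * c31)) (c32 * f1) (c21
        * c31 * c41 / f2) (c42 * f2 / f1) c51 c52 := by
    apply funext_three <;> simp +decide only [mutReal, idxVecThree, Matrix.cons_val, if_true,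
      if_false, e1] <;> field_simp
  rw [s1]
  have e2 : 1 + c21 * c31 * c41 / f2 = f3 / f2 := by
    field_simp
    simp only [ef2, ef3]
  have s2 : mutReal (3, 0) [(2, 0), (4, 0)] [(0, 0), (4, 1)] (idxVecThree (c11 * f2) c12 (c31 /
    f2) (c21 * c22 / f1) (f1 / (c21 * c31)) (c32 * f1) (c21 * c31 * c41 / f2) (c42 * f2 / f1)
    c51 c52) =
      idxVecThree (c11 * f3) c12 (c31 / f2) (c21 * c22 / f1) (c41 * f1 / f3) (c32 * f1) (f2 /
        (c21 * c31 * c41)) (c42 * f2 / f1) (c21 * c31 * c41 * c51 / f3) (c52 * f3 / f2) := by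
    apply funext_three <;> simp +decide only [mutReal, idxVecThree, Matrix.cons_val, if_true,
      if_false, e2] <;> field_simp
  rw [s2]
  have e3 : 1 + c42 * f2 / f1 = f4 / f1 := by
    field_simp
    simp only [ef1, ef2, ef4]
    ring
  have s3 : mutReal (3, 1) [(1, 0), (4, 1)] [(2, 0), (2, 1)] (idxVecThree (c11 * f3) c12 (c31 /
    f2) (c21 * c22 / f1) (c41 * f1 / f3) (c32 * f1) (f2 / (c21 * c31 * c41)) (c42 * f2 / f1)
    (c21 * c31 * c41 * c51 / f3) (c52 * f3 / f2)) =
      idxVecThree (c11 * f3) c12 (c31 * c42 / f4) (c21 * c22 / f1) (c41 * f4 / f3) (c32 * f4)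
        (f2 / (c21 * c31 * c41)) (f1 / (c42 * f2)) (c21 * c31 * c41 * c51 / f3) (c42 * c52 * f3
        / f4) := by
    apply funext_three <;> simp +decide only [mutReal, idxVecThree, Matrix.cons_val, if_true,
      if_false, e3] <;> field_simp
  rw [s3]
  have e4 : 1 + c21 * c31 * c41 * c51 / f3 = f5 / f3 := by
    field_simp
    simp only [ef3, ef5]
  have s4 : mutReal (4, 0) [(3, 0)] [(0, 0)] (idxVecThree (c11 * f3) c12 (c31 * c42 / f4) (c21 *
    c22 / f1) (c41 * f4 / f3) (c32 * f4) (f2 / (c21 * c31 * c41)) (f1 / (c42 * f2)) (c21 * c31 *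
    c41 * c51 / f3) (c42 * c52 * f3 / f4)) =
      idxVecThree (c11 * f5) c12 (c31 * c42 / f4) (c21 * c22 / f1) (c41 * f4 / f3) (c32 * f4)
        (c51 * f2 / f5) (f1 / (c42 * f2)) (f3 / (c21 * c31 * c41 * c51)) (c42 * c52 * f3 / f4)
        := by
    apply funext_three <;> simp +decide only [mutReal, idxVecThree, Matrix.cons_val, if_true,
      if_false, e4] <;> field_simp
  rw [s4]
  have e5 : 1 + c42 * c52 * f3 / f4 = f6 / f4 := by
    field_simp
    simp only [ef3, ef4, ef6]
    ring
  have s5 : mutReal (4, 1) [(3, 1)] [(2, 1), (3, 0)] (idxVecThree (c11 * f5) c12 (c31 * c42 /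
    f4) (c21 * c22 / f1) (c41 * f4 / f3) (c32 * f4) (c51 * f2 / f5) (f1 / (c42 * f2)) (f3 / (c21
    * c31 * c41 * c51)) (c42 * c52 * f3 / f4)) =
      idxVecThree (c11 * f5) c12 (c31 * c42 / f4) (c21 * c22 / f1) (c41 * f4 / f3) (c32 * f6)
        (c51 * f2 * f6 / (f4 * f5)) (c52 * f1 * f3 / (f2 * f6)) (f3 / (c21 * c31 * c41 * c51))
        (f4 / (c42 * c52 * f3)) := by
    apply funext_three <;> simp +decide only [mutReal, idxVecThree, Matrix.cons_val, if_true,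
      if_false, e5] <;> field_simp
  rw [s5]
  have e6 : 1 + c52 * f1 * f3 / (f2 * f6) = f4 * f7 / (f2 * f6) := by
    field_simp
    simp only [ef1, ef2, ef3, ef4, ef6, ef7]
    ring
  have s6 : mutReal (3, 1) [(2, 0), (4, 1)] [(1, 0), (3, 0)] (idxVecThree (c11 * f5) c12 (c31 *
    c42 / f4) (c21 * c22 / f1) (c41 * f4 / f3) (c32 * f6) (c51 * f2 * f6 / (f4 * f5)) (c52 * f1
    * f3 / (f2 * f6)) (f3 / (c21 * c31 * c41 * c51)) (f4 / (c42 * c52 * f3))) =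
      idxVecThree (c11 * f5) c12 (c31 * c42 * f7 / (f2 * f6)) (c21 * c22 / f1) (c41 * c52 * f1 /
        f7) (c32 * f6) (c51 * f7 / f5) (f2 * f6 / (c52 * f1 * f3)) (f3 / (c21 * c31 * c41 *
        c51)) (f1 / (c42 * f7)) := by
    apply funext_three <;> simp +decide only [mutReal, idxVecThree, Matrix.cons_val, if_true,
      if_false, e6] <;> field_simp
  rw [s6]
  have r : (fun p => (idxVecThree (c11 * f5) c12 (c31 * c42 * f7 / (f2 * f6)) (c21 * c22 / f1)
    (c41 * c52 * f1 / f7) (c32 * f6) (c51 * f7 / f5) (f2 * f6 / (c52 * f1 * f3)) (f3 / (c21 *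
    c31 * c41 * c51)) (f1 / (c42 * f7))) (cyclePermThree p)) = idxVecThree (f3 / (c21 * c31 *
    c41 * c51)) (c11 * f5) (c21 * c22 / f1) c12 (c41 * c52 * f1 / f7) (c32 * f6) (f2 * f6 / (c52
    * f1 * f3)) (c31 * c42 * f7 / (f2 * f6)) (c51 * f7 / f5) (f1 / (c42 * f7)) := by
    apply funext_three <;> rfl
  rw [r]
  have e7 : 1 + f1 / (c42 * f7) = f6 / (c42 * f7) := by
    field_simp
    simp only [ef1, ef6, ef7]
    ring
  have s7 : mutReal (4, 1) [(2, 1), (3, 0)] [(3, 1)] (idxVecThree (f3 / (c21 * c31 * c41 * c51))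
    (c11 * f5) (c21 * c22 / f1) c12 (c41 * c52 * f1 / f7) (c32 * f6) (f2 * f6 / (c52 * f1 * f3))
    (c31 * c42 * f7 / (f2 * f6)) (c51 * f7 / f5) (f1 / (c42 * f7))) =
      idxVecThree (f3 / (c21 * c31 * c41 * c51)) (c11 * f5) (c21 * c22 / f1) c12 (c41 * c52 * f1
        / f7) (c32 * f1) (f2 / (c52 * f3)) (c31 / f2) (c51 * f7 / f5) (c42 * f7 / f1) := by
    apply funext_three <;> simp +decide only [mutReal, idxVecThree, Matrix.cons_val, if_true,
      if_false, e7] <;> field_simp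
  rw [s7]
  have e8 : 1 + c51 * f7 / f5 = f3 * f8 / f5 := by
    field_simp
    simp only [ef3, ef5, ef7, ef8]
    ring
  have s8 : mutReal (4, 0) [(0, 0)] [(3, 0)] (idxVecThree (f3 / (c21 * c31 * c41 * c51)) (c11 *
    f5) (c21 * c22 / f1) c12 (c41 * c52 * f1 / f7) (c32 * f1) (f2 / (c52 * f3)) (c31 / f2) (c51
    * f7 / f5) (c42 * f7 / f1)) =
      idxVecThree (f7 / (c21 * c31 * c41 * f8)) (c11 * f5) (c21 * c22 / f1) c12 (c41 * c52 * f1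
        / f7) (c32 * f1) (f2 * f8 / (c52 * f5)) (c31 / f2) (f5 / (c51 * f7)) (c42 * f7 / f1) :=
        by
    apply funext_three <;> simp +decide only [mutReal, idxVecThree, Matrix.cons_val, if_true,
      if_false, e8] <;> field_simp
  rw [s8]
  have e9 : 1 + c31 / f2 = f1 * f9 / f2 := by
    field_simp
    simp only [ef1, ef2, ef9]
    ring
  have s9 : mutReal (3, 1) [(2, 0), (2, 1)] [(1, 0), (4, 1)] (idxVecThree (f7 / (c21 * c31 * c41
    * f8)) (c11 * f5) (c21 * c22 / f1) c12 (c41 * c52 * f1 / f7) (c32 * f1) (f2 * f8 / (c52 *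
    f5)) (c31 / f2) (f5 / (c51 * f7)) (c42 * f7 / f1)) =
      idxVecThree (f7 / (c21 * c31 * c41 * f8)) (c11 * f5) (c21 * c22 * f9 / f2) c12 (c31 * c41
        * c52 / (f7 * f9)) (c31 * c32 / f9) (f2 * f8 / (c52 * f5)) (f2 / c31) (f5 / (c51 * f7))
        (c42 * f7 * f9 / f2) := by
    apply funext_three <;> simp +decide only [mutReal, idxVecThree, Matrix.cons_val, if_true,
      if_false, e9] <;> field_simp
  rw [s9]
  have e10 : 1 + f2 * f8 / (c52 * f5) = f7 * f10 / (c52 * f5) := by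
    field_simp
    simp only [ef2, ef5, ef7, ef8, ef10]
    ring
  have s10 : mutReal (3, 0) [(0, 0), (4, 1)] [(2, 0), (4, 0)] (idxVecThree (f7 / (c21 * c31 *
    c41 * f8)) (c11 * f5) (c21 * c22 * f9 / f2) c12 (c31 * c41 * c52 / (f7 * f9)) (c31 * c32 /
    f9) (f2 * f8 / (c52 * f5)) (f2 / c31) (f5 / (c51 * f7)) (c42 * f7 * f9 / f2)) =
      idxVecThree (f2 / (c21 * c31 * c41 * f10)) (c11 * f5) (c21 * c22 * f9 / f2) c12 (c31 * c41
        * f10 / (f5 * f9)) (c31 * c32 / f9) (c52 * f5 / (f2 * f8)) (f2 / c31) (f10 / (c51 *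
        c52)) (c42 * f8 * f9 / f10) := by
    apply funext_three <;> simp +decide only [mutReal, idxVecThree, Matrix.cons_val, if_true,
      if_false, e10] <;> field_simp
  rw [s10]
  have e11 : 1 + c31 * c41 * f10 / (f5 * f9) = f2 * f11 / (f5 * f9) := by
    field_simp
    simp only [ef2, ef5, ef9, ef10, ef11]
    ring
  have s11 : mutReal (2, 0) [(0, 0), (3, 1)] [(1, 0), (3, 0)] (idxVecThree (f2 / (c21 * c31 *
    c41 * f10)) (c11 * f5) (c21 * c22 * f9 / f2) c12 (c31 * c41 * f10 / (f5 * f9)) (c31 * c32 /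
    f9) (c52 * f5 / (f2 * f8)) (f2 / c31) (f10 / (c51 * c52)) (c42 * f8 * f9 / f10)) =
      idxVecThree (1 / (c21 * f11)) (c11 * f5) (c21 * c22 * f11 / f5) c12 (f5 * f9 / (c31 * c41
        * f10)) (c31 * c32 / f9) (c52 * f11 / (f8 * f9)) (c41 * f10 / f11) (f10 / (c51 * c52))
        (c42 * f8 * f9 / f10) := by
    apply funext_three <;> simp +decide only [mutReal, idxVecThree, Matrix.cons_val, if_true,
      if_false, e11] <;> field_simp
  rw [s11]
  have e12 : 1 + c21 * c22 * f11 / f5 = f12 / f5 := by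
    field_simp
    simp only [ef5, ef11, ef12]
    ring
  have s12 : mutReal (1, 0) [(0, 0), (2, 1)] [(1, 1), (2, 0)] (idxVecThree (1 / (c21 * f11))
    (c11 * f5) (c21 * c22 * f11 / f5) c12 (f5 * f9 / (c31 * c41 * f10)) (c31 * c32 / f9) (c52 *
    f11 / (f8 * f9)) (c41 * f10 / f11) (f10 / (c51 * c52)) (c42 * f8 * f9 / f10)) =
      idxVecThree (c22 / f12) (c11 * f5) (f5 / (c21 * c22 * f11)) (c12 * f12 / f5) (f9 * f12 /
        (c31 * c41 * f10)) (c21 * c22 * c31 * c32 * f11 / (f9 * f12)) (c52 * f11 / (f8 * f9))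
        (c41 * f10 / f11) (f10 / (c51 * c52)) (c42 * f8 * f9 / f10) := by
    apply funext_three <;> simp +decide only [mutReal, idxVecThree, Matrix.cons_val, if_true,
      if_false, e12] <;> field_simp
  rw [s12]

/-! ### Piecewise linearity of the tropical actions -/

section

variable {k n : ℕ}

lemma isPL_extend (a b : ℕ) : IsPL fun g : Idx k n → ℤ => extend g a b := by
  simp only [extend]
  split_ifs with h
  · exact .coord _
  · exact .zero

/-- The tropical ŷ-variables are signed sums of six tropical Plücker coordinates, so piecewise
linearity has to be checked only for the latter. -/
lemma isPLMap_onIdx_yTrop {q : (ℕ → ℕ → ℤ) → ℕ × ℕ → ℤ}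
    (h : ∀ u, IsPL fun g : Idx k n → ℤ => q (extend g) u) :
    IsPLMap (onIdx (k := k) (n := n) fun g => yTrop (q g)) := fun _ =>
  (((h _).add (h _)).add (h _)).sub (((h _).add (h _)).add (h _))

end

lemma isPLMap_reflA3 : IsPLMap reflA3 := by
  refine isPLMap_onIdx_yTrop fun u => ?_
  unfold pluckerReflectTwoThree
  split <;> repeat' with_reducible
    first | exact IsPL.zero | exact isPL_extend _ _ | apply IsPL.add | apply IsPL.max

lemma isPLMap_reflB3 : IsPLMap reflB3 := by
  refine isPLMap_onIdx_yTrop fun u => ?_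
  unfold pluckerReflectThreeThree
  split <;> repeat' with_reducible
    first | exact IsPL.zero | exact isPL_extend _ _ | apply IsPL.add | apply IsPL.max

lemma isPLMap_reflA4 : IsPLMap reflA4 := by
  refine isPLMap_onIdx_yTrop fun u => ?_
  unfold pluckerReflectThreeFour
  split <;> repeat' with_reducible
    first | exact IsPL.zero | exact isPL_extend _ _ | apply IsPL.add | apply IsPL.max

lemma isPLMap_reflB4 : IsPLMap reflB4 := by
  refine isPLMap_onIdx_yTrop fun u => ?_
  unfold pluckerReflectFourFour
  split <;> repeat' with_reducible
    first | exact IsPL.zero | exact isPL_extend _ _ | apply IsPL.add | apply IsPL.max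

/-! ### The braid generator as a mutation -/

lemma restrict_yTrop_four (P : ℕ × ℕ → ℤ) : restrict 4 8 (yTrop P) =
    idxVecFour
      (P (0, 0) + P (0, 0) + P (2, 2) - (P (2, 1) + P (1, 2) + P (0, 0)))
      (P (0, 0) + P (1, 1) + P (2, 3) - (P (2, 2) + P (1, 3) + P (0, 0)))
      (P (0, 0) + P (1, 2) + P (2, 4) - (P (2, 3) + P (1, 4) + P (0, 0)))
      (P (1, 1) + P (0, 0) + P (3, 2) - (P (3, 1) + P (2, 2) + P (0, 0)))
      (P (1, 2) + P (2, 1) + P (3, 3) - (P (3, 2) + P (2, 3) + P (1, 1)))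
      (P (1, 3) + P (2, 2) + P (3, 4) - (P (3, 3) + P (2, 4) + P (1, 2)))
      (P (2, 1) + P (0, 0) + P (4, 2) - (P (4, 1) + P (3, 2) + P (0, 0)))
      (P (2, 2) + P (3, 1) + P (4, 3) - (P (4, 2) + P (3, 3) + P (2, 1)))
      (P (2, 3) + P (3, 2) + P (4, 4) - (P (4, 3) + P (3, 4) + P (2, 2))) := by
  apply funext_four <;> rfl

lemma extend_four (g : Idx 4 8 → ℤ) :
    extend g 1 1 = g (0, 0) ∧ extend g 1 2 = g (0, 1) ∧ extend g 1 3 = g (0, 2) ∧ extend g 2 1 =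
    g (1, 0) ∧ extend g 2 2 = g (1, 1) ∧ extend g 2 3 = g (1, 2) ∧ extend g 3 1 = g (2, 0) ∧
    extend g 3 2 = g (2, 1) ∧ extend g 3 3 = g (2, 2) :=
  ⟨rfl, rfl, rfl, rfl, rfl, rfl, rfl, rfl, rfl⟩

lemma restrict_yTrop_three (P : ℕ × ℕ → ℤ) : restrict 3 9 (yTrop P) =
    idxVecThree
      (P (0, 0) + P (0, 0) + P (2, 2) - (P (2, 1) + P (1, 2) + P (0, 0)))
      (P (0, 0) + P (1, 1) + P (2, 3) - (P (2, 2) + P (1, 3) + P (0, 0)))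
      (P (1, 1) + P (0, 0) + P (3, 2) - (P (3, 1) + P (2, 2) + P (0, 0)))
      (P (1, 2) + P (2, 1) + P (3, 3) - (P (3, 2) + P (2, 3) + P (1, 1)))
      (P (2, 1) + P (0, 0) + P (4, 2) - (P (4, 1) + P (3, 2) + P (0, 0)))
      (P (2, 2) + P (3, 1) + P (4, 3) - (P (4, 2) + P (3, 3) + P (2, 1)))
      (P (3, 1) + P (0, 0) + P (5, 2) - (P (5, 1) + P (4, 2) + P (0, 0)))
      (P (3, 2) + P (4, 1) + P (5, 3) - (P (5, 2) + P (4, 3) + P (3, 1)))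
      (P (4, 1) + P (0, 0) + P (6, 2) - (P (6, 1) + P (5, 2) + P (0, 0)))
      (P (4, 2) + P (5, 1) + P (6, 3) - (P (6, 2) + P (5, 3) + P (4, 1))) := by
  apply funext_three <;> rfl

lemma extend_three (g : Idx 3 9 → ℤ) :
    extend g 1 1 = g (0, 0) ∧ extend g 1 2 = g (0, 1) ∧ extend g 2 1 = g (1, 0) ∧ extend g 2 2 =
    g (1, 1) ∧ extend g 3 1 = g (2, 0) ∧ extend g 3 2 = g (2, 1) ∧ extend g 4 1 = g (3, 0) ∧
    extend g 4 2 = g (3, 1) ∧ extend g 5 1 = g (4, 0) ∧ extend g 5 2 = g (4, 1) :=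
  ⟨rfl, rfl, rfl, rfl, rfl, rfl, rfl, rfl, rfl, rfl⟩

/-- The numbers t5, t6, t7 are the tropical counterparts of f5, f6, f7 in `mutReal_chain_four`,
which makes the two formulas comparable term by term. -/
lemma braid4_apply (g : Idx 4 8 → ℤ) {t5 t6 t7 : ℤ}
    (e5 : t5 = max 0 (g (1, 1) + max 0 (g (1, 2)))) (e6 : t6 = max 0 (g (1, 1) + max 0 (g (2, 1))))
    (e7 : t7 = max 0 (g (1, 1) + max (max 0 (g (2, 1))) (g (1, 2) + max 0 (g (2, 1))))) :
    braid4 g = idxVecFour (g (0, 0) + g (1, 1) + t7 - (t5 + t6)) (g (1, 2) - t7) (g (0, 1) + t6)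
      (g (2, 1) - t7) (t5 + t6 - (g (1, 1) + g (1, 2) + g (2, 1))) (g (0, 2) + t7 - t6)
      (g (1, 0) + t5) (g (2, 0) + t7 - t5) (g (1, 1) + g (1, 2) + g (2, 1) + g (2, 2) - t7) := by
  simp only [braid4, onIdx, restrict_yTrop_four, pluckerSigmaInvFour, extend_four, ← e5, ← e6, ← e7]
  congr 1 <;> ring

lemma HasTropVec.cycleConjFour {v g : Idx 4 8 → ℤ} {x : Idx 4 8 → ℝ} (hx : HasTropVec v x g) :
    HasTropVec v (GrTrop.cycleConjFour x) (ofCycleFour (cycleFour (toCycleFour g))) := by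
  have hcycle : ∀ {x' g'}, HasTropVec v x' g' →
      HasTropVec v (fun p => mutReal (0, 2) _ _ x' (cyclePermFour p)) (cycleFour g') :=
    fun h p => h.mutTrop _ _ _ (cyclePermFour p)
  simp only [GrTrop.cycleConjFour, ofCycleFour, toCycleFour, Function.comp_apply]
  iterate 4 refine HasTropVec.mutTrop ?_ _ _ _
  apply hcycle
  iterate 4 refine HasTropVec.mutTrop ?_ _ _ _
  exact hx

/-- Both sides are tropical values of the same positive real numbers, by the chain of mutations over
ℝ, and tropical values are unique. No comparison of linearity domains is needed. -/
lemma braid4_eq (g : Idx 4 8 → ℤ) : braid4 g = ofCycleFour (cycleFour (toCycleFour g)) := by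
  obtain ⟨x, hx⟩ : ∃ x, HasTropVec g x g := ⟨genPt _, fun p => HasTrop.genPt p⟩
  have hp : ∀ p, 0 < x p := fun p => (hx p).pos
  have hv : x = idxVecFour (x (0, 0)) (x (0, 1)) (x (0, 2)) (x (1, 0)) (x (1, 1)) (x (1, 2))
      (x (2, 0)) (x (2, 1)) (x (2, 2)) := by apply funext_four <;> rfl
  obtain ⟨f5, e5⟩ : ∃ f, f = 1 + x (1, 1) + x (1, 1) * x (1, 2) := ⟨_, rfl⟩
  obtain ⟨f6, e6⟩ : ∃ f, f = 1 + x (1, 1) + x (1, 1) * x (2, 1) := ⟨_, rfl⟩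
  obtain ⟨f7, e7⟩ : ∃ f, f = 1 + x (1, 1) + x (1, 1) * x (2, 1) + x (1, 1) * x (1, 2) +
    x (1, 1) * x (1, 2) * x (2, 1) := ⟨_, rfl⟩
  have T5 : HasTrop g f5 _ :=
    (HasTrop.one.add ((hx (1, 1)).mul (HasTrop.one.add (hx (1, 2))))).of_eq
    (by rw [e5]; ring)
  have T6 : HasTrop g f6 _ :=
    (HasTrop.one.add ((hx (1, 1)).mul (HasTrop.one.add (hx (2, 1))))).of_eq
    (by rw [e6]; ring)
  have T7 : HasTrop g f7 _ :=
    (HasTrop.one.add ((hx (1, 1)).mul ((HasTrop.one.add (hx (2, 1))).add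
      ((hx (1, 2)).mul (HasTrop.one.add (hx (2, 1))))))).of_eq
    (by rw [e7]; ring)
  have key := mutReal_chain_four (hp (0, 0)) (hp (0, 1)) (hp (0, 2)) (hp (1, 0)) (hp (1, 1))
    (hp (1, 2)) (hp (2, 0)) (hp (2, 1)) (hp (2, 2)) e5 e6 e7
  rw [← hv] at key
  -- The closed form of the chain inherits the tropical values of the mutation sequence.
  have h5 : ∀ p, HasTrop g (idxVecFour _ _ _ _ _ _ _ _ _ p) (ofCycleFour (cycleFour (toCycleFour g)) p) :=
    fun p => (hx.cycleConjFour p).of_eq (congrFun key.symm p)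
  have h6 := braid4_apply g rfl rfl rfl
  rw [h6]
  apply funext_four
  · exact ((((hx (0, 0)).mul (hx (1, 1))).mul T7).div (T5.mul T6)).unique (h5 (0, 0))
  · exact ((hx (1, 2)).div T7).unique (h5 (0, 1))
  · exact ((hx (0, 1)).mul T6).unique (h5 (0, 2))
  · exact ((hx (2, 1)).div T7).unique (h5 (1, 0))
  · exact ((T5.mul T6).div (((hx (1, 1)).mul (hx (1, 2))).mul (hx (2, 1)))).unique (h5 (1, 1))
  · exact (((hx (0, 2)).mul T7).div T6).unique (h5 (1, 2))
  · exact ((hx (1, 0)).mul T5).unique (h5 (2, 0))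
  · exact (((hx (2, 0)).mul T7).div T5).unique (h5 (2, 1))
  · exact (((((hx (1, 1)).mul (hx (1, 2))).mul (hx (2, 1))).mul (hx (2, 2))).div T7).unique
      (h5 (2, 2))

/-- The numbers t5, t8, …, t12 are the tropical counterparts of the surviving factors in
`mutReal_chain_three`. -/
lemma braid3_apply (g : Idx 3 9 → ℤ) {t5 t8 t9 t10 t11 t12 : ℤ}
    (e5 : t5 = max 0 (g (1, 0) + max 0 (g (2, 0) + max 0 (g (3, 0) + max 0 (g (4, 0))))))
    (e8 : t8 = max 0 (g (4, 0) + max 0 (g (4, 1)))) (e9 : t9 = max 0 (g (2, 0)))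
    (e10 : t10 = max 0 (g (4, 0)))
    (e11 : t11 = max 0 (g (2, 0) + max 0 (g (3, 0) + max 0 (g (4, 0)))))
    (e12 : t12 = max 0 (g (1, 0) + max (max 0 (g (1, 1))) (g (2, 0) + max (max 0 (g (1, 1)))
      (g (3, 0) + max (max 0 (g (4, 0))) (g (1, 1) + max 0 (g (4, 0))))))) :
    braid3 g = idxVecThree (g (1, 1) - t12) (g (0, 0) + t5) (t5 - (g (1, 0) + g (1, 1) + t11))
      (g (0, 1) + t12 - t5) (t9 + t12 - (g (2, 0) + g (3, 0) + t10))
      (g (1, 0) + g (1, 1) + g (2, 0) + g (2, 1) + t11 - (t9 + t12)) (g (4, 1) + t11 - (t8 + t9))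
      (g (3, 0) + t10 - t11) (t10 - (g (4, 0) + g (4, 1))) (g (3, 1) + t8 + t9 - t10) := by
  subst e5 e8 e9 e10 e11 e12
  simp only [braid3, onIdx, restrict_yTrop_three, pluckerSigmaInvThree, extend_three]
  congr 1 <;> ring

lemma HasTropVec.cycleConjThree {v g : Idx 3 9 → ℤ} {x : Idx 3 9 → ℝ} (hx : HasTropVec v x g) :
    HasTropVec v (GrTrop.cycleConjThree x) (ofCycleThree (cycleThree (toCycleThree g))) := by
  have hcycle : ∀ {x' g'}, HasTropVec v x' g' →
      HasTropVec v (fun p => mutReal (3, 1) _ _ x' (cyclePermThree p)) (cycleThree g') :=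
    fun h p => h.mutTrop _ _ _ (cyclePermThree p)
  simp only [GrTrop.cycleConjThree, ofCycleThree, toCycleThree, Function.comp_apply]
  iterate 6 refine HasTropVec.mutTrop ?_ _ _ _
  apply hcycle
  iterate 6 refine HasTropVec.mutTrop ?_ _ _ _
  exact hx

/-- As for `braid4_eq`: the real mutation chain and uniqueness of tropical values. -/
lemma braid3_eq (g : Idx 3 9 → ℤ) : braid3 g = ofCycleThree (cycleThree (toCycleThree g)) := by
  obtain ⟨x, hx⟩ : ∃ x, HasTropVec g x g := ⟨genPt _, fun p => HasTrop.genPt p⟩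
  have hp : ∀ p, 0 < x p := fun p => (hx p).pos
  have hv : x = idxVecThree (x (0, 0)) (x (0, 1)) (x (1, 0)) (x (1, 1)) (x (2, 0)) (x (2, 1))
      (x (3, 0)) (x (3, 1)) (x (4, 0)) (x (4, 1)) := by apply funext_three <;> rfl
  obtain ⟨f5, e5⟩ : ∃ f, f = 1 + x (1, 0) + x (1, 0) * x (2, 0) + x (1, 0) * x (2, 0) * x (3, 0)
    + x (1, 0) * x (2, 0) * x (3, 0) * x (4, 0) := ⟨_, rfl⟩
  obtain ⟨f8, e8⟩ : ∃ f, f = 1 + x (4, 0) + x (4, 0) * x (4, 1) := ⟨_, rfl⟩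
  obtain ⟨f9, e9⟩ : ∃ f, f = 1 + x (2, 0) := ⟨_, rfl⟩
  obtain ⟨f10, e10⟩ : ∃ f, f = 1 + x (4, 0) := ⟨_, rfl⟩
  obtain ⟨f11, e11⟩ : ∃ f, f = 1 + x (2, 0) + x (2, 0) * x (3, 0) + x (2, 0) * x (3, 0) * x (4,
    0) := ⟨_, rfl⟩
  obtain ⟨f12, e12⟩ : ∃ f, f = 1 + x (1, 0) + x (1, 0) * x (2, 0) + x (1, 0) * x (1, 1) + x (1,
    0) * x (2, 0) * x (3, 0) + x (1, 0) * x (1, 1) * x (2, 0) + x (1, 0) * x (2, 0) * x (3, 0) *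
    x (4, 0) + x (1, 0) * x (1, 1) * x (2, 0) * x (3, 0) + x (1, 0) * x (1, 1) * x (2, 0) * x
    (3, 0) * x (4, 0) := ⟨_, rfl⟩
  have T5 : HasTrop g f5 _ := (HasTrop.one.add ((hx (1, 0)).mul (HasTrop.one.add ((hx (2,
    0)).mul (HasTrop.one.add ((hx (3, 0)).mul (HasTrop.one.add (hx (4, 0))))))))).of_eq
    (by rw [e5]; ring)
  have T8 : HasTrop g f8 _ := (HasTrop.one.add ((hx (4, 0)).mul (HasTrop.one.add (hx (4,
    1))))).of_eq
    (by rw [e8]; ring)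
  have T9 : HasTrop g f9 _ := (HasTrop.one.add (hx (2, 0))).of_eq
    e9
  have T10 : HasTrop g f10 _ := (HasTrop.one.add (hx (4, 0))).of_eq
    e10
  have T11 : HasTrop g f11 _ := (HasTrop.one.add ((hx (2, 0)).mul (HasTrop.one.add ((hx (3,
    0)).mul (HasTrop.one.add (hx (4, 0))))))).of_eq
    (by rw [e11]; ring)
  have T12 : HasTrop g f12 _ := (HasTrop.one.add ((hx (1, 0)).mul ((HasTrop.one.add (hx (1,
    1))).add ((hx (2, 0)).mul ((HasTrop.one.add (hx (1, 1))).add ((hx (3, 0)).mul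
    ((HasTrop.one.add (hx (4, 0))).add ((hx (1, 1)).mul (HasTrop.one.add (hx (4,
    0))))))))))).of_eq
    (by rw [e12]; ring)
  have key := mutReal_chain_three (hp (0, 0)) (hp (0, 1)) (hp (1, 0)) (hp (1, 1)) (hp (2, 0))
    (hp (2, 1)) (hp (3, 0)) (hp (3, 1)) (hp (4, 0)) (hp (4, 1)) e5 e8 e9 e10 e11 e12
  rw [← hv] at key
  have h5 : ∀ p, HasTrop g (idxVecThree _ _ _ _ _ _ _ _ _ _ p) (ofCycleThree (cycleThree (toCycleThree g)) p) :=
    fun p => (hx.cycleConjThree p).of_eq (congrFun key.symm p)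
  rw [braid3_apply g rfl rfl rfl rfl rfl rfl]
  apply funext_three
  · exact ((hx (1, 1)).div T12).unique (h5 (0, 0))
  · exact ((hx (0, 0)).mul T5).unique (h5 (0, 1))
  · exact (T5.div (((hx (1, 0)).mul (hx (1, 1))).mul T11)).unique (h5 (1, 0))
  · exact (((hx (0, 1)).mul T12).div T5).unique (h5 (1, 1))
  · exact ((T9.mul T12).div (((hx (2, 0)).mul (hx (3, 0))).mul T10)).unique (h5 (2, 0))
  · exact ((((((hx (1, 0)).mul (hx (1, 1))).mul (hx (2, 0))).mul (hx (2, 1))).mul T11).div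
    (T9.mul T12)).unique (h5 (2, 1))
  · exact (((hx (4, 1)).mul T11).div (T8.mul T9)).unique (h5 (3, 0))
  · exact (((hx (3, 0)).mul T10).div T11).unique (h5 (3, 1))
  · exact (T10.div ((hx (4, 0)).mul (hx (4, 1)))).unique (h5 (4, 0))
  · exact ((((hx (3, 1)).mul T8).mul T9).div T10).unique (h5 (4, 1))

/-! ### The attractors of the braid generators -/

lemma max_zero_neg (x : ℤ) : max 0 (-x) = max 0 x - x := by omega

lemma gcd_eq_one_of_unit {ι : Type} [Fintype ι] {l : ι → ℤ} {i : ι} (h : l i = 1) :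
    Finset.univ.gcd l = 1 := by
  have h1 : Finset.univ.gcd l ∣ 1 := h ▸ Finset.gcd_dvd (Finset.mem_univ i)
  have h2 := Finset.normalize_gcd (s := Finset.univ) (f := l)
  rw [← h2]
  exact normalize_eq_one.mpr (isUnit_of_dvd_one h1)

lemma forGeneric_sum_ne_zero {ι : Type} [DecidableEq ι] {s : Finset ι} (hs : s.Nonempty) :
    ForGeneric fun g : ι → ℤ => ∑ i ∈ s, g i ≠ 0 := by
  refine ⟨∑ i ∈ s, MvPolynomial.X i, fun h => ?_, fun v hv => by simpa using hv⟩
  obtain ⟨i, hi⟩ := hs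
  have := congrArg (MvPolynomial.eval (Pi.single i 1)) h
  simp [Pi.single_apply, hi] at this

lemma cycleFour_apply (y : Idx 4 8 → ℤ) {s : ℤ} (hs : y (0, 2) = s) :
    cycleFour y = idxVecFour (y (0, 0)) (y (2, 1)) (y (0, 1) + max 0 s) (-s) (y (1, 1) + s - max
        0 s) (y (1, 2) + s - max 0 s) (y (1, 0) + max 0 s) (y (2, 0)) (y (2, 2)) := by
  subst hs
  apply funext_four <;> rfl

/-- The attractor of `cycleFour`. -/
def cycleLimitFour : Idx 4 8 → ℤ := idxVecFour 0 0 1 (-1) 0 0 0 0 0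

/-- The cycle consists of (0,1), (0,2), (1,0), (2,0), (2,1), and (0,2) is mutated. The sum over the
cycle must not vanish, which is the generic condition. Off the cycle the coordinates are fixed or
change by min(0, s), which vanishes once s ≥ 0; thereafter four steps add the constant σ at (0,2)
and subtract it at (1,0). -/
lemma attracts_cycleFour : Attracts cycleFour cycleLimitFour := by
  refine (forGeneric_sum_ne_zero (s := {(0, 1), (0, 2), (1, 0), (2, 0), (2, 1)}) ⟨(0, 1), by
      decide⟩).mono fun g hg => ?_
  have step : ∀ t, cycleFour^[t + 1] g = cycleFour (cycleFour^[t] g) := fun t =>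
    Function.iterate_succ_apply' _ _ _
  obtain ⟨y, hy⟩ : ∃ y : ℕ → Idx 4 8 → ℤ, y = fun t => cycleFour^[t] g := ⟨_, rfl⟩
  have h0 : y 0 = g := by rw [hy]; rfl
  have hstep : ∀ t, y (t + 1) = _ := fun t =>
    (by rw [hy]; exact step t : y (t + 1) = cycleFour (y t)).trans (cycleFour_apply (y t) rfl)
  have h11 : ∀ t, y (t + 1) (0, 0) = y t (0, 0) := fun t => congrFun (hstep t) (0, 0)
  have h12 : ∀ t, y (t + 1) (0, 1) = y t (2, 1) := fun t => congrFun (hstep t) (0, 1)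
  have h13 : ∀ t, y (t + 1) (0, 2) = y t (0, 1) + max 0 (y t (0, 2)) := fun t => congrFun (hstep
      t) (0, 2)
  have h21 : ∀ t, y (t + 1) (1, 0) = -y t (0, 2) := fun t => congrFun (hstep t) (1, 0)
  have h22 : ∀ t, y (t + 1) (1, 1) = y t (1, 1) + y t (0, 2) - max 0 (y t (0, 2)) := fun t =>
      congrFun (hstep t) (1, 1)
  have h23 : ∀ t, y (t + 1) (1, 2) = y t (1, 2) + y t (0, 2) - max 0 (y t (0, 2)) := fun t =>
      congrFun (hstep t) (1, 2)
  have h31 : ∀ t, y (t + 1) (2, 0) = y t (1, 0) + max 0 (y t (0, 2)) := fun t => congrFun (hstep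
      t) (2, 0)
  have h32 : ∀ t, y (t + 1) (2, 1) = y t (2, 0) := fun t => congrFun (hstep t) (2, 1)
  have h33 : ∀ t, y (t + 1) (2, 2) = y t (2, 2) := fun t => congrFun (hstep t) (2, 2)
  -- The coordinates pass along (1,0), (2,0), (2,1), (0,1) before entering (0,2); unrolling this
  -- shift register gives the next four values at the mutated vertex.
  have hs : ∀ t,
      y (t + 1) (0, 2) = y t (0, 1) + max 0 (y t (0, 2)) ∧ y (t + 2) (0, 2) = y t (2, 1) + max 0
          (y (t + 1) (0, 2)) ∧ y (t + 3) (0, 2) = y t (2, 0) + max 0 (y (t + 2) (0, 2)) ∧ y (t +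
          4) (0, 2) = y t (1, 0) + max 0 (y t (0, 2)) + max 0 (y (t + 3) (0, 2)) := by
    intro t
    have e1 : y (t + 1) (0, 2) = y t (0, 1) + max 0 (y t (0, 2)) := by
      exact h13 t
    have e2 : y (t + 2) (0, 2) = y t (2, 1) + max 0 (y (t + 1) (0, 2)) := by
      refine (h13 (t + 1)).trans ?_
      simp only [h12, h21, h31, h32]
    have e3 : y (t + 3) (0, 2) = y t (2, 0) + max 0 (y (t + 2) (0, 2)) := by
      refine (h13 (t + 2)).trans ?_
      simp only [h12, h21, h31, h32]
    have e4 : y (t + 4) (0, 2) = y t (1, 0) + max 0 (y t (0, 2)) + max 0 (y (t + 3) (0, 2)) :=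
        by
      refine (h13 (t + 3)).trans ?_
      simp only [h12, h21, h31, h32]
    exact ⟨e1, e2, e3, e4⟩
  -- The period is the number of cycle vertices other than the mutated one.
  obtain ⟨t₀, σ, hσ, h⟩ := exists_eventually_translate (s := fun t => y t (0, 2))
    (S := fun t => y t (0, 1) + y t (0, 2) + y t (1, 0) + y t (2, 0) + y t (2, 1)) (N := 4) (by
        decide)
    (fun t => by simp only [h12, h13, h21, h31, h32, max_zero_neg]; ring)
    (fun t => by
      obtain ⟨e1, e2, e3, e4⟩ := hs t
      simp only [Finset.sum_range_succ, Finset.range_zero, Finset.sum_empty, add_zero,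
        max_zero_neg]
      linarith)
    (by simpa [add_assoc, h0] using hg)
  refine HasLimit.of_translate (gcd_eq_one_of_unit (i := (0, 2)) rfl) (N := 4) (by decide) hσ
    (t₀ := t₀) fun t ht => ?_
  obtain ⟨e1, e2, e3, e4⟩ := hs t
  obtain ⟨p0, q⟩ := h t ht
  have p1 := (h (t + 1) (by omega)).1
  have p2 := (h (t + 2) (by omega)).1
  have p3 := (h (t + 3) (by omega)).1
  beta_reduce at q p0 p1 p2 p3
  simp only [max_eq_right p0, max_eq_right p1, max_eq_right p2, max_eq_right p3] at e1 e2 e3 e4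
  suffices H : y (t + 4) = fun i => y t i + σ * cycleLimitFour i by
    rw [hy] at H
    exact congrFun H
  apply funext_four
  · have e : y (t + 4) (0, 0) = y t (0, 0) := by
      simp only [h11, h12, h13, h21, h22, h23, h31, h32, h33]
    have e' : cycleLimitFour (0, 0) = 0 := rfl
    rw [e, e']
    linarith
  · have e : y (t + 4) (0, 1) = -y t (0, 2) + max 0 (y (t + 1) (0, 2)) := by
      simp only [h11, h12, h13, h21, h22, h23, h31, h32, h33]
    have e' : cycleLimitFour (0, 1) = 0 := rfl
    rw [e, e']
    simp only [max_eq_right p0, max_eq_right p1, max_eq_right p2, max_eq_right p3]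
    linarith
  · have e' : cycleLimitFour (0, 2) = 1 := rfl
    rw [e4, e']
    linarith
  · have e : y (t + 4) (1, 0) = -y (t + 3) (0, 2) := by
      simp only [h11, h12, h13, h21, h22, h23, h31, h32, h33]
    have e' : cycleLimitFour (1, 0) = -1 := rfl
    rw [e, e']
    linarith
  · have e : y (t + 4) (1, 1) = y t (1, 1) + y t (0, 2) - max 0 (y t (0, 2)) + y (t + 1) (0, 2)
      - max 0 (y (t + 1) (0, 2)) + y (t + 2) (0, 2) - max 0 (y (t + 2) (0, 2)) + y (t + 3) (0,
      2) - max 0 (y (t + 3) (0, 2)) := by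
      simp only [h11, h12, h13, h21, h22, h23, h31, h32, h33]
    have e' : cycleLimitFour (1, 1) = 0 := rfl
    rw [e, e']
    simp only [max_eq_right p0, max_eq_right p1, max_eq_right p2, max_eq_right p3]
    linarith
  · have e : y (t + 4) (1, 2) = y t (1, 2) + y t (0, 2) - max 0 (y t (0, 2)) + y (t + 1) (0, 2)
      - max 0 (y (t + 1) (0, 2)) + y (t + 2) (0, 2) - max 0 (y (t + 2) (0, 2)) + y (t + 3) (0,
      2) - max 0 (y (t + 3) (0, 2)) := by
      simp only [h11, h12, h13, h21, h22, h23, h31, h32, h33]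
    have e' : cycleLimitFour (1, 2) = 0 := rfl
    rw [e, e']
    simp only [max_eq_right p0, max_eq_right p1, max_eq_right p2, max_eq_right p3]
    linarith
  · have e : y (t + 4) (2, 0) = -y (t + 2) (0, 2) + max 0 (y (t + 3) (0, 2)) := by
      simp only [h11, h12, h13, h21, h22, h23, h31, h32, h33]
    have e' : cycleLimitFour (2, 0) = 0 := rfl
    rw [e, e']
    simp only [max_eq_right p0, max_eq_right p1, max_eq_right p2, max_eq_right p3]
    linarith
  · have e : y (t + 4) (2, 1) = -y (t + 1) (0, 2) + max 0 (y (t + 2) (0, 2)) := by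
      simp only [h11, h12, h13, h21, h22, h23, h31, h32, h33]
    have e' : cycleLimitFour (2, 1) = 0 := rfl
    rw [e, e']
    simp only [max_eq_right p0, max_eq_right p1, max_eq_right p2, max_eq_right p3]
    linarith
  · have e : y (t + 4) (2, 2) = y t (2, 2) := by
      simp only [h11, h12, h13, h21, h22, h23, h31, h32, h33]
    have e' : cycleLimitFour (2, 2) = 0 := rfl
    rw [e, e']
    linarith

lemma cycleThree_apply (y : Idx 3 9 → ℤ) {s : ℤ} (hs : y (3, 1) = s) :
    cycleThree y = idxVecThree (y (4, 0)) (y (0, 0)) (y (1, 1)) (y (0, 1)) (y (2, 0) + s - max 0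
        s) (y (2, 1)) (-s) (y (1, 0) + max 0 s) (y (3, 0) + max 0 s) (y (4, 1) + s - max 0 s) :=
        by
  subst hs
  apply funext_three <;> rfl

/-- The attractor of `cycleThree`. -/
def cycleLimitThree : Idx 3 9 → ℤ := idxVecThree 0 0 0 0 0 0 (-1) 1 0 0

/-- The cycle now has seven vertices, with (3,1) mutated and period six; (2,0), (2,1) and (4,1) lie
outside it and become stationary. -/
lemma attracts_cycleThree : Attracts cycleThree cycleLimitThree := by
  refine (forGeneric_sum_ne_zero (s := {(0, 0), (0, 1), (1, 0), (1, 1), (3, 0), (3, 1), (4, 0)})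
      ⟨(0, 0), by decide⟩).mono fun g hg => ?_
  have step : ∀ t, cycleThree^[t + 1] g = cycleThree (cycleThree^[t] g) := fun t =>
    Function.iterate_succ_apply' _ _ _
  obtain ⟨y, hy⟩ : ∃ y : ℕ → Idx 3 9 → ℤ, y = fun t => cycleThree^[t] g := ⟨_, rfl⟩
  have h0 : y 0 = g := by rw [hy]; rfl
  have hstep : ∀ t, y (t + 1) = _ := fun t =>
    (by rw [hy]; exact step t : y (t + 1) = cycleThree (y t)).trans (cycleThree_apply (y t) rfl)
  have h11 : ∀ t, y (t + 1) (0, 0) = y t (4, 0) := fun t => congrFun (hstep t) (0, 0)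
  have h12 : ∀ t, y (t + 1) (0, 1) = y t (0, 0) := fun t => congrFun (hstep t) (0, 1)
  have h21 : ∀ t, y (t + 1) (1, 0) = y t (1, 1) := fun t => congrFun (hstep t) (1, 0)
  have h22 : ∀ t, y (t + 1) (1, 1) = y t (0, 1) := fun t => congrFun (hstep t) (1, 1)
  have h31 : ∀ t, y (t + 1) (2, 0) = y t (2, 0) + y t (3, 1) - max 0 (y t (3, 1)) := fun t =>
      congrFun (hstep t) (2, 0)
  have h32 : ∀ t, y (t + 1) (2, 1) = y t (2, 1) := fun t => congrFun (hstep t) (2, 1)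
  have h41 : ∀ t, y (t + 1) (3, 0) = -y t (3, 1) := fun t => congrFun (hstep t) (3, 0)
  have h42 : ∀ t, y (t + 1) (3, 1) = y t (1, 0) + max 0 (y t (3, 1)) := fun t => congrFun (hstep
      t) (3, 1)
  have h51 : ∀ t, y (t + 1) (4, 0) = y t (3, 0) + max 0 (y t (3, 1)) := fun t => congrFun (hstep
      t) (4, 0)
  have h52 : ∀ t, y (t + 1) (4, 1) = y t (4, 1) + y t (3, 1) - max 0 (y t (3, 1)) := fun t =>
      congrFun (hstep t) (4, 1)
  -- Values pass along (3,0), (4,0), (0,0), (0,1), (1,1), (1,0) before entering (3,1).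
  have hs : ∀ t,
      y (t + 1) (3, 1) = y t (1, 0) + max 0 (y t (3, 1)) ∧ y (t + 2) (3, 1) = y t (1, 1) + max 0
          (y (t + 1) (3, 1)) ∧ y (t + 3) (3, 1) = y t (0, 1) + max 0 (y (t + 2) (3, 1)) ∧ y (t +
          4) (3, 1) = y t (0, 0) + max 0 (y (t + 3) (3, 1)) ∧ y (t + 5) (3, 1) = y t (4, 0) +
          max 0 (y (t + 4) (3, 1)) ∧ y (t + 6) (3, 1) = y t (3, 0) + max 0 (y t (3, 1)) + max 0
          (y (t + 5) (3, 1)) := by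
    intro t
    have e1 : y (t + 1) (3, 1) = y t (1, 0) + max 0 (y t (3, 1)) := by
      exact h42 t
    have e2 : y (t + 2) (3, 1) = y t (1, 1) + max 0 (y (t + 1) (3, 1)) := by
      refine (h42 (t + 1)).trans ?_
      simp only [h11, h12, h21, h22, h41, h51]
    have e3 : y (t + 3) (3, 1) = y t (0, 1) + max 0 (y (t + 2) (3, 1)) := by
      refine (h42 (t + 2)).trans ?_
      simp only [h11, h12, h21, h22, h41, h51]
    have e4 : y (t + 4) (3, 1) = y t (0, 0) + max 0 (y (t + 3) (3, 1)) := by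
      refine (h42 (t + 3)).trans ?_
      simp only [h11, h12, h21, h22, h41, h51]
    have e5 : y (t + 5) (3, 1) = y t (4, 0) + max 0 (y (t + 4) (3, 1)) := by
      refine (h42 (t + 4)).trans ?_
      simp only [h11, h12, h21, h22, h41, h51]
    have e6 : y (t + 6) (3, 1) = y t (3, 0) + max 0 (y t (3, 1)) + max 0 (y (t + 5) (3, 1)) :=
        by
      refine (h42 (t + 5)).trans ?_
      simp only [h11, h12, h21, h22, h41, h51]
    exact ⟨e1, e2, e3, e4, e5, e6⟩
  obtain ⟨t₀, σ, hσ, h⟩ := exists_eventually_translate (s := fun t => y t (3, 1))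
    (S := fun t => y t (0, 0) + y t (0, 1) + y t (1, 0) + y t (1, 1) + y t (3, 0) + y t (3, 1) +
        y t (4, 0)) (N := 6) (by decide)
    (fun t => by simp only [h11, h12, h21, h22, h41, h42, h51, max_zero_neg]; ring)
    (fun t => by
      obtain ⟨e1, e2, e3, e4, e5, e6⟩ := hs t
      simp only [Finset.sum_range_succ, Finset.range_zero, Finset.sum_empty, add_zero,
        max_zero_neg]
      linarith)
    (by simpa [add_assoc, h0] using hg)
  refine HasLimit.of_translate (gcd_eq_one_of_unit (i := (3, 1)) rfl) (N := 6) (by decide) hσ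
    (t₀ := t₀) fun t ht => ?_
  obtain ⟨e1, e2, e3, e4, e5, e6⟩ := hs t
  obtain ⟨p0, q⟩ := h t ht
  have p1 := (h (t + 1) (by omega)).1
  have p2 := (h (t + 2) (by omega)).1
  have p3 := (h (t + 3) (by omega)).1
  have p4 := (h (t + 4) (by omega)).1
  have p5 := (h (t + 5) (by omega)).1
  beta_reduce at q p0 p1 p2 p3 p4 p5
  simp only [max_eq_right p0, max_eq_right p1, max_eq_right p2, max_eq_right p3, max_eq_right
      p4, max_eq_right p5] at e1 e2 e3 e4 e5 e6
  suffices H : y (t + 6) = fun i => y t i + σ * cycleLimitThree i by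
    rw [hy] at H
    exact congrFun H
  apply funext_three
  · have e : y (t + 6) (0, 0) = -y (t + 3) (3, 1) + max 0 (y (t + 4) (3, 1)) := by
      simp only [h11, h12, h21, h22, h31, h32, h41, h42, h51, h52]
    have e' : cycleLimitThree (0, 0) = 0 := rfl
    rw [e, e']
    simp only [max_eq_right p0, max_eq_right p1, max_eq_right p2, max_eq_right p3, max_eq_right p4, max_eq_right p5]
    linarith
  · have e : y (t + 6) (0, 1) = -y (t + 2) (3, 1) + max 0 (y (t + 3) (3, 1)) := by
      simp only [h11, h12, h21, h22, h31, h32, h41, h42, h51, h52]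
    have e' : cycleLimitThree (0, 1) = 0 := rfl
    rw [e, e']
    simp only [max_eq_right p0, max_eq_right p1, max_eq_right p2, max_eq_right p3, max_eq_right p4, max_eq_right p5]
    linarith
  · have e : y (t + 6) (1, 0) = -y t (3, 1) + max 0 (y (t + 1) (3, 1)) := by
      simp only [h11, h12, h21, h22, h31, h32, h41, h42, h51, h52]
    have e' : cycleLimitThree (1, 0) = 0 := rfl
    rw [e, e']
    simp only [max_eq_right p0, max_eq_right p1, max_eq_right p2, max_eq_right p3, max_eq_right p4, max_eq_right p5]
    linarith
  · have e : y (t + 6) (1, 1) = -y (t + 1) (3, 1) + max 0 (y (t + 2) (3, 1)) := by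
      simp only [h11, h12, h21, h22, h31, h32, h41, h42, h51, h52]
    have e' : cycleLimitThree (1, 1) = 0 := rfl
    rw [e, e']
    simp only [max_eq_right p0, max_eq_right p1, max_eq_right p2, max_eq_right p3, max_eq_right p4, max_eq_right p5]
    linarith
  · have e : y (t + 6) (2, 0) = y t (2, 0) + y t (3, 1) - max 0 (y t (3, 1)) + y (t + 1) (3, 1)
      - max 0 (y (t + 1) (3, 1)) + y (t + 2) (3, 1) - max 0 (y (t + 2) (3, 1)) + y (t + 3) (3,
      1) - max 0 (y (t + 3) (3, 1)) + y (t + 4) (3, 1) - max 0 (y (t + 4) (3, 1)) + y (t + 5)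
      (3, 1) - max 0 (y (t + 5) (3, 1)) := by
      simp only [h11, h12, h21, h22, h31, h32, h41, h42, h51, h52]
    have e' : cycleLimitThree (2, 0) = 0 := rfl
    rw [e, e']
    simp only [max_eq_right p0, max_eq_right p1, max_eq_right p2, max_eq_right p3, max_eq_right p4, max_eq_right p5]
    linarith
  · have e : y (t + 6) (2, 1) = y t (2, 1) := by
      simp only [h11, h12, h21, h22, h31, h32, h41, h42, h51, h52]
    have e' : cycleLimitThree (2, 1) = 0 := rfl
    rw [e, e']
    linarith
  · have e : y (t + 6) (3, 0) = -y (t + 5) (3, 1) := by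
      simp only [h11, h12, h21, h22, h31, h32, h41, h42, h51, h52]
    have e' : cycleLimitThree (3, 0) = -1 := rfl
    rw [e, e']
    linarith
  · have e' : cycleLimitThree (3, 1) = 1 := rfl
    rw [e6, e']
    linarith
  · have e : y (t + 6) (4, 0) = -y (t + 4) (3, 1) + max 0 (y (t + 5) (3, 1)) := by
      simp only [h11, h12, h21, h22, h31, h32, h41, h42, h51, h52]
    have e' : cycleLimitThree (4, 0) = 0 := rfl
    rw [e, e']
    simp only [max_eq_right p0, max_eq_right p1, max_eq_right p2, max_eq_right p3, max_eq_right p4, max_eq_right p5]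
    linarith
  · have e : y (t + 6) (4, 1) = y t (4, 1) + y t (3, 1) - max 0 (y t (3, 1)) + y (t + 1) (3, 1)
      - max 0 (y (t + 1) (3, 1)) + y (t + 2) (3, 1) - max 0 (y (t + 2) (3, 1)) + y (t + 3) (3,
      1) - max 0 (y (t + 3) (3, 1)) + y (t + 4) (3, 1) - max 0 (y (t + 4) (3, 1)) + y (t + 5)
      (3, 1) - max 0 (y (t + 5) (3, 1)) := by
      simp only [h11, h12, h21, h22, h31, h32, h41, h42, h51, h52]
    have e' : cycleLimitThree (4, 1) = 0 := rfl
    rw [e, e']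
    simp only [max_eq_right p0, max_eq_right p1, max_eq_right p2, max_eq_right p3, max_eq_right p4, max_eq_right p5]
    linarith

lemma ofCycleFour_toCycleFour (g : Idx 4 8 → ℤ) : ofCycleFour (toCycleFour g) = g := by
  simp only [ofCycleFour, toCycleFour, Function.comp_apply]
  iterate 4 rw [mutTrop_mutTrop _ (by decide)]

lemma toCycleFour_ofCycleFour (g : Idx 4 8 → ℤ) : toCycleFour (ofCycleFour g) = g := by
  simp only [ofCycleFour, toCycleFour, Function.comp_apply]
  iterate 4 rw [mutTrop_mutTrop _ (by decide)]

lemma isPLMap_ofCycleFour : IsPLMap ofCycleFour := by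
  unfold ofCycleFour
  iterate 3 refine IsPLMap.comp (isPLMap_mutTrop _ _ _) ?_
  exact isPLMap_mutTrop _ _ _

lemma isPLMap_toCycleFour : IsPLMap toCycleFour := by
  unfold toCycleFour
  iterate 3 refine IsPLMap.comp (isPLMap_mutTrop _ _ _) ?_
  exact isPLMap_mutTrop _ _ _

lemma attracts_braid4 : Attracts braid4 (ofCycleFour cycleLimitFour) := by
  have := attracts_cycleFour.conj isPLMap_ofCycleFour isPLMap_toCycleFour
    ofCycleFour_toCycleFour toCycleFour_ofCycleFour
  rwa [show braid4 = ofCycleFour ∘ cycleFour ∘ toCycleFour from funext braid4_eq]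

lemma ofCycleThree_toCycleThree (g : Idx 3 9 → ℤ) : ofCycleThree (toCycleThree g) = g := by
  simp only [ofCycleThree, toCycleThree, Function.comp_apply]
  iterate 6 rw [mutTrop_mutTrop _ (by decide)]

lemma toCycleThree_ofCycleThree (g : Idx 3 9 → ℤ) : toCycleThree (ofCycleThree g) = g := by
  simp only [ofCycleThree, toCycleThree, Function.comp_apply]
  iterate 6 rw [mutTrop_mutTrop _ (by decide)]

lemma isPLMap_ofCycleThree : IsPLMap ofCycleThree := by
  unfold ofCycleThree
  iterate 5 refine IsPLMap.comp (isPLMap_mutTrop _ _ _) ?_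
  exact isPLMap_mutTrop _ _ _

lemma isPLMap_toCycleThree : IsPLMap toCycleThree := by
  unfold toCycleThree
  iterate 5 refine IsPLMap.comp (isPLMap_mutTrop _ _ _) ?_
  exact isPLMap_mutTrop _ _ _

lemma attracts_braid3 : Attracts braid3 (ofCycleThree cycleLimitThree) := by
  have := attracts_cycleThree.conj isPLMap_ofCycleThree isPLMap_toCycleThree
    ofCycleThree_toCycleThree toCycleThree_ofCycleThree
  rwa [show braid3 = ofCycleThree ∘ cycleThree ∘ toCycleThree from funext braid3_eq]

/-! ### The truncated g-vectors attached to slopes -/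

lemma idxVecFour_apply {α : Type} (a11 a12 a13 a21 a22 a23 a31 a32 a33 : α) :
    idxVecFour a11 a12 a13 a21 a22 a23 a31 a32 a33 (0, 0) = a11 ∧ idxVecFour a11 a12 a13 a21 a22
        a23 a31 a32 a33 (0, 1) = a12 ∧ idxVecFour a11 a12 a13 a21 a22 a23 a31 a32 a33 (0, 2) =
        a13 ∧ idxVecFour a11 a12 a13 a21 a22 a23 a31 a32 a33 (1, 0) = a21 ∧ idxVecFour a11 a12
        a13 a21 a22 a23 a31 a32 a33 (1, 1) = a22 ∧ idxVecFour a11 a12 a13 a21 a22 a23 a31 a32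
        a33 (1, 2) = a23 ∧ idxVecFour a11 a12 a13 a21 a22 a23 a31 a32 a33 (2, 0) = a31 ∧
        idxVecFour a11 a12 a13 a21 a22 a23 a31 a32 a33 (2, 1) = a32 ∧ idxVecFour a11 a12 a13 a21
        a22 a23 a31 a32 a33 (2, 2) = a33 :=
  ⟨rfl, rfl, rfl, rfl, rfl, rfl, rfl, rfl, rfl⟩

/-- The truncated g-vectors attached to slopes, for `Gr(4,8)`. -/
def slopeVecFour (a b : ℤ) : Idx 4 8 → ℤ :=
  idxVecFour (2 * max 0 b - 2 * max 0 (b - a) - a) (-3 * max 0 b + max 0 (-a) + max 0 (b + a) +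
      b) (max 0 (b - a) - max 0 (b + a) + a) (-3 * max 0 b + max 0 (-a) + max 0 (b + a) + b) (2
      * max 0 (b - a) - 2 * max 0 (b + a) + 2 * a) (3 * max 0 b - max 0 (b - a) - max 0 (-a) - a
      - b) (max 0 (b - a) - max 0 (b + a) + a) (3 * max 0 b - max 0 (b - a) - max 0 (-a) - a -
      b) (-2 * max 0 b + 2 * max 0 (b + a) - a)

/-- Because of this symmetry only the half plane b ≥ 0 has to be examined. -/
lemma slopeVecFour_neg (a b : ℤ) : slopeVecFour (-a) (-b) = slopeVecFour a b := by
  simp only [slopeVecFour]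
  congr 1 <;> omega

/-- The half plane b ≥ 0 is cut along b = a, a = 0 and b = -a; on each of the four cones the vector
is linear in (a, b). -/
lemma slopeVecFour_cone0 {a b : ℤ} (h : 0 ≤ b ∧ b - a ≤ 0) : slopeVecFour a b =
    idxVecFour (-a + 2 * b) (a - b) (-b) (a - b) (-2 * b) (-a + 2 * b) (-b) (-a + 2 * b) a := by
  simp only [slopeVecFour, max_eq_right (by omega : 0 ≤ b), max_eq_left (by omega : b - a ≤ 0),
      max_eq_left (by omega : -a ≤ 0), max_eq_right (by omega : 0 ≤ b + a)]
  congr 1 <;> ring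

lemma slopeVecFour_cone1 {a b : ℤ} (h : 0 ≤ b - a ∧ -a ≤ 0) : slopeVecFour a b =
    idxVecFour a (a - b) (-a) (a - b) (-2 * a) b (-a) b a := by
  simp only [slopeVecFour, max_eq_right (by omega : 0 ≤ b), max_eq_right (by omega : 0 ≤ b - a),
      max_eq_left (by omega : -a ≤ 0), max_eq_right (by omega : 0 ≤ b + a)]
  congr 1 <;> ring

lemma slopeVecFour_cone2 {a b : ℤ} (h : 0 ≤ -a ∧ -b - a ≤ 0) : slopeVecFour a b =
    idxVecFour a (-b) (-a) (-b) (-2 * a) (a + b) (-a) (a + b) a := by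
  simp only [slopeVecFour, max_eq_right (by omega : 0 ≤ b), max_eq_right (by omega : 0 ≤ b - a),
      max_eq_right (by omega : 0 ≤ -a), max_eq_right (by omega : 0 ≤ b + a)]
  congr 1 <;> ring

lemma slopeVecFour_cone3 {a b : ℤ} (h : 0 ≤ -b - a ∧ -b ≤ 0) : slopeVecFour a b =
    idxVecFour a (-a - 2 * b) b (-a - 2 * b) (2 * b) (a + b) b (a + b) (-a - 2 * b) := by
  simp only [slopeVecFour, max_eq_right (by omega : 0 ≤ b), max_eq_right (by omega : 0 ≤ b - a),
      max_eq_right (by omega : 0 ≤ -a), max_eq_left (by omega : b + a ≤ 0)]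
  congr 1 <;> ring

/-- After a subdivision of the half plane, (a,b) and, up to sign, (a,b-a) each lie in a single
linear cone, and every maximum in the formula for `braid4` has a known winner. What remains is
linear algebra. -/
lemma braid4_slopeVecFour (a b : ℤ) : braid4 (slopeVecFour a b) = slopeVecFour a (b - a) := by
  wlog hb : 0 ≤ b
  · have := this (-a) (-b) (by omega)
    rwa [slopeVecFour_neg, show -b - -a = -(b - a) by ring, slopeVecFour_neg] at this
  -- The additional cut b = 2a is the preimage of the wall b = a under (a,b) ↦ (a,b-a).
  have h : 0 ≤ b ∧ b - a ≤ 0 ∨ 0 ≤ b - a ∧ b - 2 * a ≤ 0 ∨ 0 ≤ b - 2 * a ∧ -a ≤ 0 ∨ 0 ≤ -a ∧ -b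
      - a ≤ 0 ∨ 0 ≤ -b - a ∧ -b ≤ 0 := by omega
  rcases h with h | h | h | h | h
  · rw [slopeVecFour_cone0 (by omega), ← slopeVecFour_neg, slopeVecFour_cone3 (by omega),
      braid4_apply _ rfl rfl rfl]
    simp only [idxVecFour_apply]
    simp (disch := omega) only [max_eq_left]
    congr 1 <;> ring
  · rw [slopeVecFour_cone1 (by omega), slopeVecFour_cone0 (by omega),
      braid4_apply _ rfl rfl rfl]
    simp only [idxVecFour_apply]
    simp (disch := omega) only [max_eq_left, max_eq_right]
    congr 1 <;> ring
  · rw [slopeVecFour_cone1 (by omega), slopeVecFour_cone1 (by omega),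
      braid4_apply _ rfl rfl rfl]
    simp only [idxVecFour_apply]
    simp (disch := omega) only [max_eq_right]
    congr 1 <;> ring
  · rw [slopeVecFour_cone2 (by omega), slopeVecFour_cone2 (by omega),
      braid4_apply _ rfl rfl rfl]
    simp only [idxVecFour_apply]
    simp (disch := omega) only [max_eq_right]
    congr 1 <;> ring
  · rw [slopeVecFour_cone3 (by omega), slopeVecFour_cone2 (by omega),
      braid4_apply _ rfl rfl rfl]
    simp only [idxVecFour_apply]
    simp (disch := omega) only [max_eq_left, max_eq_right]
    congr 1 <;> ring

/-- The reflections act on slopes by a sign change of b and, for `reflB4`, by exchanging a and b.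
Together with the action of `braid4` this determines the action of all generators on slopes. -/
lemma reflA4_slopeVecFour (a b : ℤ) : reflA4 (slopeVecFour a b) = slopeVecFour a (-b) := by
  wlog hb : 0 ≤ b
  · have := this (-a) (-b) (by omega)
    rwa [slopeVecFour_neg, slopeVecFour_neg] at this
  have h : 0 ≤ b ∧ b - a ≤ 0 ∨ 0 ≤ b - a ∧ -a ≤ 0 ∨ 0 ≤ -a ∧ -b - a ≤ 0 ∨ 0 ≤ -b - a ∧ -b ≤ 0 :=
      by omega
  rcases h with h | h | h | h
  · rw [slopeVecFour_cone0 (by omega), ← slopeVecFour_neg, slopeVecFour_cone3 (by omega)]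
    simp only [reflA4, onIdx, restrict_yTrop_four, pluckerReflectThreeFour, extend_four,
      idxVecFour_apply]
    simp (disch := omega) only [max_eq_left, max_eq_right]
    congr 1 <;> ring
  · rw [slopeVecFour_cone1 (by omega), ← slopeVecFour_neg, slopeVecFour_cone2 (by omega)]
    simp only [reflA4, onIdx, restrict_yTrop_four, pluckerReflectThreeFour, extend_four,
      idxVecFour_apply]
    simp (disch := omega) only [max_eq_left, max_eq_right]
    congr 1 <;> ring
  · rw [slopeVecFour_cone2 (by omega), ← slopeVecFour_neg, slopeVecFour_cone1 (by omega)]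
    simp only [reflA4, onIdx, restrict_yTrop_four, pluckerReflectThreeFour, extend_four,
      idxVecFour_apply]
    simp (disch := omega) only [max_eq_left, max_eq_right]
    congr 1 <;> ring
  · rw [slopeVecFour_cone3 (by omega), ← slopeVecFour_neg, slopeVecFour_cone0 (by omega)]
    simp only [reflA4, onIdx, restrict_yTrop_four, pluckerReflectThreeFour, extend_four,
      idxVecFour_apply]
    simp (disch := omega) only [max_eq_left, max_eq_right]
    congr 1 <;> ring

lemma reflB4_slopeVecFour (a b : ℤ) : reflB4 (slopeVecFour a b) = slopeVecFour b a := by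
  wlog hb : 0 ≤ b
  · have := this (-a) (-b) (by omega)
    rwa [slopeVecFour_neg, slopeVecFour_neg] at this
  have h : 0 ≤ b ∧ b - a ≤ 0 ∨ 0 ≤ b - a ∧ -a ≤ 0 ∨ 0 ≤ -a ∧ -b - a ≤ 0 ∨ 0 ≤ -b - a ∧ -b ≤ 0 :=
      by omega
  rcases h with h | h | h | h
  · rw [slopeVecFour_cone0 (by omega), slopeVecFour_cone1 (by omega)]
    simp only [reflB4, onIdx, restrict_yTrop_four, pluckerReflectFourFour, extend_four,
      idxVecFour_apply]
    simp (disch := omega) only [max_eq_left, max_eq_right]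
    congr 1 <;> ring
  · rw [slopeVecFour_cone1 (by omega), slopeVecFour_cone0 (by omega)]
    simp only [reflB4, onIdx, restrict_yTrop_four, pluckerReflectFourFour, extend_four,
      idxVecFour_apply]
    simp (disch := omega) only [max_eq_left, max_eq_right]
    congr 1 <;> ring
  · rw [slopeVecFour_cone2 (by omega), ← slopeVecFour_neg, slopeVecFour_cone3 (by omega)]
    simp only [reflB4, onIdx, restrict_yTrop_four, pluckerReflectFourFour, extend_four,
      idxVecFour_apply]
    simp (disch := omega) only [max_eq_left, max_eq_right]
    congr 1 <;> ring
  · rw [slopeVecFour_cone3 (by omega), ← slopeVecFour_neg, slopeVecFour_cone2 (by omega)]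
    simp only [reflB4, onIdx, restrict_yTrop_four, pluckerReflectFourFour, extend_four,
      idxVecFour_apply]
    simp (disch := omega) only [max_eq_left, max_eq_right]
    congr 1 <;> ring

/-! ### Slopes for Gr(3,9) -/

lemma idxVecThree_apply {α : Type} (a11 a12 a21 a22 a31 a32 a41 a42 a51 a52 : α) :
    idxVecThree a11 a12 a21 a22 a31 a32 a41 a42 a51 a52 (0, 0) = a11 ∧ idxVecThree a11 a12 a21
        a22 a31 a32 a41 a42 a51 a52 (0, 1) = a12 ∧ idxVecThree a11 a12 a21 a22 a31 a32 a41 a42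
        a51 a52 (1, 0) = a21 ∧ idxVecThree a11 a12 a21 a22 a31 a32 a41 a42 a51 a52 (1, 1) = a22
        ∧ idxVecThree a11 a12 a21 a22 a31 a32 a41 a42 a51 a52 (2, 0) = a31 ∧ idxVecThree a11 a12
        a21 a22 a31 a32 a41 a42 a51 a52 (2, 1) = a32 ∧ idxVecThree a11 a12 a21 a22 a31 a32 a41
        a42 a51 a52 (3, 0) = a41 ∧ idxVecThree a11 a12 a21 a22 a31 a32 a41 a42 a51 a52 (3, 1) =
        a42 ∧ idxVecThree a11 a12 a21 a22 a31 a32 a41 a42 a51 a52 (4, 0) = a51 ∧ idxVecThree a11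
        a12 a21 a22 a31 a32 a41 a42 a51 a52 (4, 1) = a52 :=
  ⟨rfl, rfl, rfl, rfl, rfl, rfl, rfl, rfl, rfl, rfl⟩

/-- The truncated g-vectors attached to slopes, for `Gr(3,9)`. -/
def slopeVecThree (a b : ℤ) : Idx 3 9 → ℤ :=
  idxVecThree (-max 0 b - max 0 (2 * b - a) + max 0 (b + a) - a + b) (max 0 (b - a) - max 0 (b +
      a) + a) (-2 * max 0 b + max 0 (b - a) + 2 * max 0 (-a) - max 0 (b + a) + 2 * a + b) (max 0
      b + max 0 (2 * b - a) - max 0 (b - a) - 2 * max 0 (-a) - a - b) (max 0 (2 * b - a) + max 0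
      (b - 2 * a) - 2 * max 0 (-a) - max 0 (b + a) + a - b) (2 * max 0 b - max 0 (2 * b - a) -
      max 0 (b - 2 * a) + max 0 (b + a) - 2 * a) (2 * max 0 b + max 0 (b - a) - max 0 (b - 2 *
      a) - max 0 (-a) - a - b) (-2 * max 0 b - max 0 (b - a) + 2 * max 0 (-a) + max 0 (b + a) +
      b) (-max 0 (b - a) + max 0 (b + a) - a) (max 0 (b - 2 * a) + max 0 (-a) - max 0 (b + a) +
      2 * a)

lemma slopeVecThree_neg (a b : ℤ) : slopeVecThree (-a) (-b) = slopeVecThree a b := by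
  simp only [slopeVecThree]
  congr 1 <;> omega

/-- Here the walls in the half plane b ≥ 0 are a = 2b, a = b, b = 2a, a = 0 and b = -a. -/
lemma slopeVecThree_cone0 {a b : ℤ} (h : 0 ≤ b ∧ 2 * b - a ≤ 0) : slopeVecThree a b =
    idxVecThree b (-b) (a - 2 * b) (-a) (-2 * b) (-a + 3 * b) (-a + b) a b (a - b) := by
  simp only [slopeVecThree, max_eq_right (by omega : 0 ≤ b), max_eq_left (by omega : 2 * b - a ≤
      0), max_eq_left (by omega : b - a ≤ 0), max_eq_left (by omega : b - 2 * a ≤ 0),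
      max_eq_left (by omega : -a ≤ 0), max_eq_right (by omega : 0 ≤ b + a)]
  congr 1 <;> ring

lemma slopeVecThree_cone1 {a b : ℤ} (h : 0 ≤ 2 * b - a ∧ b - a ≤ 0) : slopeVecThree a b =
    idxVecThree (a - b) (-b) (a - 2 * b) (-2 * a + 2 * b) (-a) b (-a + b) a b (a - b) := by
  simp only [slopeVecThree, max_eq_right (by omega : 0 ≤ b), max_eq_right (by omega : 0 ≤ 2 * b
      - a), max_eq_left (by omega : b - a ≤ 0), max_eq_left (by omega : b - 2 * a ≤ 0),
      max_eq_left (by omega : -a ≤ 0), max_eq_right (by omega : 0 ≤ b + a)]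
  congr 1 <;> ring

lemma slopeVecThree_cone2 {a b : ℤ} (h : 0 ≤ b - a ∧ b - 2 * a ≤ 0) : slopeVecThree a b =
    idxVecThree (a - b) (-a) (-b) (-a + b) (-a) b (-2 * a + 2 * b) (2 * a - b) a (a - b) := by
  simp only [slopeVecThree, max_eq_right (by omega : 0 ≤ b), max_eq_right (by omega : 0 ≤ 2 * b
      - a), max_eq_right (by omega : 0 ≤ b - a), max_eq_left (by omega : b - 2 * a ≤ 0),
      max_eq_left (by omega : -a ≤ 0), max_eq_right (by omega : 0 ≤ b + a)]
  congr 1 <;> ring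

lemma slopeVecThree_cone3 {a b : ℤ} (h : 0 ≤ b - 2 * a ∧ -a ≤ 0) : slopeVecThree a b =
    idxVecThree (a - b) (-a) (-b) (-a + b) (-3 * a + b) (2 * a) b (2 * a - b) a (-a) := by
  simp only [slopeVecThree, max_eq_right (by omega : 0 ≤ b), max_eq_right (by omega : 0 ≤ 2 * b
      - a), max_eq_right (by omega : 0 ≤ b - a), max_eq_right (by omega : 0 ≤ b - 2 * a),
      max_eq_left (by omega : -a ≤ 0), max_eq_right (by omega : 0 ≤ b + a)]
  congr 1 <;> ring

lemma slopeVecThree_cone4 {a b : ℤ} (h : 0 ≤ -a ∧ -b - a ≤ 0) : slopeVecThree a b =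
    idxVecThree (a - b) (-a) (-2 * a - b) (a + b) (-a + b) (2 * a) (a + b) (-b) a (-2 * a) := by
  simp only [slopeVecThree, max_eq_right (by omega : 0 ≤ b), max_eq_right (by omega : 0 ≤ 2 * b
      - a), max_eq_right (by omega : 0 ≤ b - a), max_eq_right (by omega : 0 ≤ b - 2 * a),
      max_eq_right (by omega : 0 ≤ -a), max_eq_right (by omega : 0 ≤ b + a)]
  congr 1 <;> ring

lemma slopeVecThree_cone5 {a b : ℤ} (h : 0 ≤ -b - a ∧ -b ≤ 0) : slopeVecThree a b =
    idxVecThree (-2 * b) b (-a) (a + b) (2 * b) (a - b) (a + b) (-a - 2 * b) (-b) (-a + b) := by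
  simp only [slopeVecThree, max_eq_right (by omega : 0 ≤ b), max_eq_right (by omega : 0 ≤ 2 * b
      - a), max_eq_right (by omega : 0 ≤ b - a), max_eq_right (by omega : 0 ≤ b - 2 * a),
      max_eq_right (by omega : 0 ≤ -a), max_eq_left (by omega : b + a ≤ 0)]
  congr 1 <;> ring

/-- The half plane is subdivided further along 2b = 3a and b = 3a, the preimages of the walls a = 2b
and b = 2a, so that source and image both lie in linear cones. -/
lemma braid3_slopeVecThree (a b : ℤ) : braid3 (slopeVecThree a b) = slopeVecThree a (b - a) := by
  wlog hb : 0 ≤ b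
  · have := this (-a) (-b) (by omega)
    rwa [slopeVecThree_neg, show -b - -a = -(b - a) by ring, slopeVecThree_neg] at this
  have h : 0 ≤ b ∧ 2 * b - a ≤ 0 ∨ 0 ≤ 2 * b - a ∧ b - a ≤ 0 ∨ 0 ≤ b - a ∧ 2 * b - 3 * a ≤ 0 ∨ 0
      ≤ 2 * b - 3 * a ∧ b - 2 * a ≤ 0 ∨ 0 ≤ b - 2 * a ∧ b - 3 * a ≤ 0 ∨ 0 ≤ b - 3 * a ∧ -a ≤ 0 ∨
      0 ≤ -a ∧ -b - a ≤ 0 ∨ 0 ≤ -b - a ∧ -b ≤ 0 := by omega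
  rcases h with h | h | h | h | h | h | h | h
  · rw [slopeVecThree_cone0 (by omega), ← slopeVecThree_neg, slopeVecThree_cone5 (by omega),
      braid3_apply _ rfl rfl rfl rfl rfl rfl]
    simp only [idxVecThree_apply]
    simp (disch := omega) only [max_eq_left, max_eq_right]
    congr 1 <;> ring
  · rw [slopeVecThree_cone1 (by omega), ← slopeVecThree_neg, slopeVecThree_cone5 (by omega),
      braid3_apply _ rfl rfl rfl rfl rfl rfl]
    simp only [idxVecThree_apply]
    simp (disch := omega) only [max_eq_left, max_eq_right]
    congr 1 <;> ring
  · rw [slopeVecThree_cone2 (by omega), slopeVecThree_cone0 (by omega),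
      braid3_apply _ rfl rfl rfl rfl rfl rfl]
    simp only [idxVecThree_apply]
    simp (disch := omega) only [max_eq_left, max_eq_right]
    congr 1 <;> ring
  · rw [slopeVecThree_cone2 (by omega), slopeVecThree_cone1 (by omega),
      braid3_apply _ rfl rfl rfl rfl rfl rfl]
    simp only [idxVecThree_apply]
    simp (disch := omega) only [max_eq_left, max_eq_right]
    congr 1 <;> ring
  · rw [slopeVecThree_cone3 (by omega), slopeVecThree_cone2 (by omega),
      braid3_apply _ rfl rfl rfl rfl rfl rfl]
    simp only [idxVecThree_apply]
    simp (disch := omega) only [max_eq_left, max_eq_right]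
    congr 1 <;> ring
  · rw [slopeVecThree_cone3 (by omega), slopeVecThree_cone3 (by omega),
      braid3_apply _ rfl rfl rfl rfl rfl rfl]
    simp only [idxVecThree_apply]
    simp (disch := omega) only [max_eq_left, max_eq_right]
    congr 1 <;> ring
  · rw [slopeVecThree_cone4 (by omega), slopeVecThree_cone4 (by omega),
      braid3_apply _ rfl rfl rfl rfl rfl rfl]
    simp only [idxVecThree_apply]
    simp (disch := omega) only [max_eq_left, max_eq_right]
    congr 1 <;> ring
  · rw [slopeVecThree_cone5 (by omega), slopeVecThree_cone4 (by omega),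
      braid3_apply _ rfl rfl rfl rfl rfl rfl]
    simp only [idxVecThree_apply]
    simp (disch := omega) only [max_eq_left, max_eq_right]
    congr 1 <;> ring

lemma reflA3_slopeVecThree (a b : ℤ) : reflA3 (slopeVecThree a b) = slopeVecThree a (a - b) := by
  wlog hb : 0 ≤ b
  · have := this (-a) (-b) (by omega)
    rwa [slopeVecThree_neg, show -a - -b = -(a - b) by ring, slopeVecThree_neg] at this
  have h : 0 ≤ b ∧ 2 * b - a ≤ 0 ∨ 0 ≤ 2 * b - a ∧ b - a ≤ 0 ∨ 0 ≤ b - a ∧ b - 2 * a ≤ 0 ∨ 0 ≤ b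
      - 2 * a ∧ -a ≤ 0 ∨ 0 ≤ -a ∧ -b - a ≤ 0 ∨ 0 ≤ -b - a ∧ -b ≤ 0 := by omega
  rcases h with h | h | h | h | h | h
  · rw [slopeVecThree_cone0 (by omega), slopeVecThree_cone1 (by omega)]
    simp only [reflA3, onIdx, restrict_yTrop_three, pluckerReflectTwoThree, extend_three,
      idxVecThree_apply]
    simp (disch := omega) only [max_eq_left, max_eq_right]
    congr 1 <;> ring
  · rw [slopeVecThree_cone1 (by omega), slopeVecThree_cone0 (by omega)]
    simp only [reflA3, onIdx, restrict_yTrop_three, pluckerReflectTwoThree, extend_three,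
      idxVecThree_apply]
    simp (disch := omega) only [max_eq_left, max_eq_right]
    congr 1 <;> ring
  · rw [slopeVecThree_cone2 (by omega), ← slopeVecThree_neg, slopeVecThree_cone5 (by omega)]
    simp only [reflA3, onIdx, restrict_yTrop_three, pluckerReflectTwoThree, extend_three,
      idxVecThree_apply]
    simp (disch := omega) only [max_eq_left, max_eq_right]
    congr 1 <;> ring
  · rw [slopeVecThree_cone3 (by omega), ← slopeVecThree_neg, slopeVecThree_cone4 (by omega)]
    simp only [reflA3, onIdx, restrict_yTrop_three, pluckerReflectTwoThree, extend_three,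
      idxVecThree_apply]
    simp (disch := omega) only [max_eq_left, max_eq_right]
    congr 1 <;> ring
  · rw [slopeVecThree_cone4 (by omega), ← slopeVecThree_neg, slopeVecThree_cone3 (by omega)]
    simp only [reflA3, onIdx, restrict_yTrop_three, pluckerReflectTwoThree, extend_three,
      idxVecThree_apply]
    simp (disch := omega) only [max_eq_left, max_eq_right]
    congr 1 <;> ring
  · rw [slopeVecThree_cone5 (by omega), ← slopeVecThree_neg, slopeVecThree_cone2 (by omega)]
    simp only [reflA3, onIdx, restrict_yTrop_three, pluckerReflectTwoThree, extend_three,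
      idxVecThree_apply]
    simp (disch := omega) only [max_eq_left, max_eq_right]
    congr 1 <;> ring

lemma reflB3_slopeVecThree (a b : ℤ) : reflB3 (slopeVecThree a b) = slopeVecThree (a - b) (-b) := by
  wlog hb : 0 ≤ b
  · have := this (-a) (-b) (by omega)
    rwa [slopeVecThree_neg, show -a - -b = -(a - b) by ring, slopeVecThree_neg] at this
  have h : 0 ≤ b ∧ 2 * b - a ≤ 0 ∨ 0 ≤ 2 * b - a ∧ b - a ≤ 0 ∨ 0 ≤ b - a ∧ b - 2 * a ≤ 0 ∨ 0 ≤ b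
      - 2 * a ∧ -a ≤ 0 ∨ 0 ≤ -a ∧ -b - a ≤ 0 ∨ 0 ≤ -b - a ∧ -b ≤ 0 := by omega
  rcases h with h | h | h | h | h | h
  · rw [slopeVecThree_cone0 (by omega), ← slopeVecThree_neg, slopeVecThree_cone5 (by omega)]
    simp only [reflB3, onIdx, restrict_yTrop_three, pluckerReflectThreeThree, extend_three,
      idxVecThree_apply]
    simp (disch := omega) only [max_eq_left, max_eq_right]
    congr 1 <;> ring
  · rw [slopeVecThree_cone1 (by omega), ← slopeVecThree_neg, slopeVecThree_cone4 (by omega)]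
    simp only [reflB3, onIdx, restrict_yTrop_three, pluckerReflectThreeThree, extend_three,
      idxVecThree_apply]
    simp (disch := omega) only [max_eq_left, max_eq_right]
    congr 1 <;> ring
  · rw [slopeVecThree_cone2 (by omega), ← slopeVecThree_neg, slopeVecThree_cone3 (by omega)]
    simp only [reflB3, onIdx, restrict_yTrop_three, pluckerReflectThreeThree, extend_three,
      idxVecThree_apply]
    simp (disch := omega) only [max_eq_left, max_eq_right]
    congr 1 <;> ring
  · rw [slopeVecThree_cone3 (by omega), ← slopeVecThree_neg, slopeVecThree_cone2 (by omega)]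
    simp only [reflB3, onIdx, restrict_yTrop_three, pluckerReflectThreeThree, extend_three,
      idxVecThree_apply]
    simp (disch := omega) only [max_eq_left, max_eq_right]
    congr 1 <;> ring
  · rw [slopeVecThree_cone4 (by omega), ← slopeVecThree_neg, slopeVecThree_cone1 (by omega)]
    simp only [reflB3, onIdx, restrict_yTrop_three, pluckerReflectThreeThree, extend_three,
      idxVecThree_apply]
    simp (disch := omega) only [max_eq_left, max_eq_right]
    congr 1 <;> ring
  · rw [slopeVecThree_cone5 (by omega), ← slopeVecThree_neg, slopeVecThree_cone0 (by omega)]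
    simp only [reflB3, onIdx, restrict_yTrop_three, pluckerReflectThreeThree, extend_three,
      idxVecThree_apply]
    simp (disch := omega) only [max_eq_left, max_eq_right]
    congr 1 <;> ring

/-! ### The braid group action on slopes -/

/-- Truncated g-vectors `G a b` attached to slopes, on which the braid generators act through
integral matrices, and among which the primitive stable fixed points are found. -/
structure SlopeModel (k n : ℕ) (G : ℤ → ℤ → Idx k n → ℤ) : Prop where
  neg : ∀ a b, G (-a) (-b) = G a b
  two_lt : 2 < k.gcd n
  stable : ∀ i, 1 ≤ i → i ≤ k.gcd n → ∀ g, Finset.univ.gcd g = 1 →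
    IsStableFixedPoint (tropMap (cyclicSigmaInv i)) g → ∃ a b, IsCoprime a b ∧ g = G a b
  base : IsStableFixedPoint (tropMap (cyclicSigmaInv 2)) (G 0 1) ∧ Finset.univ.gcd (G 0 1) = 1
  sigmaInv : ∀ i, 1 ≤ i → i < k.gcd n → ∀ a b, IsCoprime a b →
    ∃ a' b', IsCoprime a' b' ∧ tropMap (sigmaInv i) (G a b) = G a' b'
  sigma : ∀ i, 1 ≤ i → i < k.gcd n → ∀ a b, IsCoprime a b →
    ∃ a' b', IsCoprime a' b' ∧ tropMap (sigma i) (G a b) = G a' b'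
  sigmaInv_one : ∀ a b, tropMap (GrTrop.sigmaInv 1) (G a b) = G (a + b) b
  sigmaInv_two : ∀ a b, tropMap (GrTrop.sigmaInv 2) (G a b) = G a (b - a)
  sigma_one : ∀ a b, tropMap (GrTrop.sigma 1) (G a b) = G (a - b) b
  sigma_two : ∀ a b, tropMap (GrTrop.sigma 2) (G a b) = G a (b + a)

/-- A Bézout relation for (a, b) becomes one for (a', b') as soon as a and b are integral
combinations of a' and b'. For a unimodular action the coefficients are those of the inverse matrix.
-/
lemma isCoprime_of_det {a b : ℤ} (h : IsCoprime a b) {a' b' : ℤ} (x y z w : ℤ)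
    (ha : a = x * a' + y * b') (hb : b = z * a' + w * b') : IsCoprime a' b' := by
  obtain ⟨u, v, h⟩ := h
  refine ⟨u * x + v * z, u * y + v * w, ?_⟩
  rw [← h, ha, hb]
  ring

lemma attractor_four : ofCycleFour cycleLimitFour = slopeVecFour 0 1 := by
  apply funext_four <;> decide

lemma attractor_three : ofCycleThree cycleLimitThree = slopeVecThree 0 1 := by
  apply funext_three <;> decide

lemma attracts_braid4' : Attracts braid4 (slopeVecFour 0 1) := attractor_four ▸ attracts_braid4

lemma attracts_braid3' : Attracts braid3 (slopeVecThree 0 1) := attractor_three ▸ attracts_braid3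

/-- Conjugation of an attractor by an involutive piecewise linear map. -/
lemma Attracts.conj_involutive {ι : Type} [Fintype ι] {f B : (ι → ℤ) → ι → ℤ} {l : ι → ℤ}
    (h : Attracts f l) (hB : IsPLMap B) (hB' : Function.Involutive B) :
    Attracts (B ∘ f ∘ B) (B l) := h.conj hB hB hB' hB'

/-- Every generator is a conjugate of `braid4` by the reflections, so its attractor is the reflected
image of G(0,1), and its action on slopes is the conjugated matrix. The attractors of σ_1, …, σ_4
lie at (1,0), (0,1), (-1,0), (0,-1). -/
lemma slopeModel_four : SlopeModel 4 8 slopeVecFour where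
  neg := slopeVecFour_neg
  two_lt := by decide
  stable i hi hi' g hg hf := by
    have hS := attracts_braid4'
    have h1 : Attracts ((reflA4 ∘ reflB4) ∘ braid4 ∘ reflB4 ∘ reflA4)
        (slopeVecFour 1 0) := by
      have := (hS.conj_involutive isPLMap_reflB4 reflB4_involutive).conj_involutive
        isPLMap_reflA4 reflA4_involutive
      simpa only [reflA4_slopeVecFour, reflB4_slopeVecFour, neg_zero, Function.comp_assoc] using this
    have h3 : Attracts ((reflB4 ∘ reflA4) ∘ braid4 ∘ reflA4 ∘ reflB4)
        (slopeVecFour (-1) 0) := by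
      have := (hS.conj_involutive isPLMap_reflA4 reflA4_involutive).conj_involutive
        isPLMap_reflB4 reflB4_involutive
      simpa only [reflA4_slopeVecFour, reflB4_slopeVecFour, neg_zero, Function.comp_assoc] using this
    have h4 := (h3.conj_involutive isPLMap_reflA4 reflA4_involutive).conj_involutive
        isPLMap_reflB4 reflB4_involutive
    simp only [reflA4_slopeVecFour, reflB4_slopeVecFour, neg_zero] at h4
    have hd : Nat.gcd 4 8 = 4 := by decide
    rw [hd] at hi'
    interval_cases i
    · rw [cyclicSigmaInv_of_ne (by decide), tropMap_sigmaInv_one_four] at hf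
      exact ⟨1, 0, isCoprime_one_left, h1.eq_of_isStableFixedPoint hf hg⟩
    · rw [cyclicSigmaInv_of_ne (by decide), tropMap_sigmaInv_two_four] at hf
      exact ⟨0, 1, isCoprime_one_right, hS.eq_of_isStableFixedPoint hf hg⟩
    · rw [cyclicSigmaInv_of_ne (by decide), tropMap_sigmaInv_three_four] at hf
      exact ⟨-1, 0, isCoprime_one_left.neg_left, h3.eq_of_isStableFixedPoint hf hg⟩
    · rw [tropMap_cyclic_four] at hf
      exact ⟨0, -1, isCoprime_one_right.neg_right, h4.eq_of_isStableFixedPoint hf hg⟩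
  base := by
    refine ⟨?_, attracts_braid4'.gcd_eq_one⟩
    rw [cyclicSigmaInv_of_ne (by decide), tropMap_sigmaInv_two_four]
    exact attracts_braid4'.isStableFixedPoint (by rw [braid4_slopeVecFour, sub_zero])
  sigmaInv i hi hi' a b h := by
    have hd : Nat.gcd 4 8 = 4 := by decide
    rw [hd] at hi'
    interval_cases i <;>
      simp only [tropMap_sigmaInv_one_four, tropMap_sigmaInv_two_four,
        tropMap_sigmaInv_three_four, Function.comp_apply, reflA4_slopeVecFour,
        reflB4_slopeVecFour, braid4_slopeVecFour]
    · exact ⟨_, _, isCoprime_of_det h 1 (-1) 0 1 (by ring) (by ring), rfl⟩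
    · exact ⟨_, _, isCoprime_of_det h 1 0 1 1 (by ring) (by ring), rfl⟩
    · exact ⟨_, _, isCoprime_of_det h 1 (-1) 0 1 (by ring) (by ring), rfl⟩
  sigma i hi hi' a b h := by
    have hd : Nat.gcd 4 8 = 4 := by decide
    rw [hd] at hi'
    interval_cases i <;>
      simp only [tropMap_sigma_one_four, tropMap_sigma_two_four,
        tropMap_sigma_three_four, Function.comp_apply, reflA4_slopeVecFour,
        reflB4_slopeVecFour, braid4_slopeVecFour]
    · exact ⟨_, _, isCoprime_of_det h 1 1 0 1 (by ring) (by ring), rfl⟩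
    · exact ⟨_, _, isCoprime_of_det h 1 0 (-1) 1 (by ring) (by ring), rfl⟩
    · exact ⟨_, _, isCoprime_of_det h 1 1 0 1 (by ring) (by ring), rfl⟩
  sigmaInv_one a b := by
    simp only [tropMap_sigmaInv_one_four, Function.comp_apply, reflA4_slopeVecFour,
        reflB4_slopeVecFour, braid4_slopeVecFour]
    congr 1 <;> ring
  sigmaInv_two a b := by rw [tropMap_sigmaInv_two_four, braid4_slopeVecFour]
  sigma_one a b := by
    simp only [tropMap_sigma_one_four, Function.comp_apply, reflB4_slopeVecFour,
      braid4_slopeVecFour]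
  sigma_two a b := by
    simp only [tropMap_sigma_two_four, Function.comp_apply, reflA4_slopeVecFour,
        reflB4_slopeVecFour, braid4_slopeVecFour]
    congr 1 <;> ring

/-- The same argument with the reflections (a,b) ↦ (a,a-b) and (a,b) ↦ (a-b,-b); the attractors of
σ_1, σ_2, σ_3 are at (1,0), (0,1) and (1,1) up to sign. -/
lemma slopeModel_three : SlopeModel 3 9 slopeVecThree where
  neg := slopeVecThree_neg
  two_lt := by decide
  stable i hi hi' g hg hf := by
    have hS := attracts_braid3'
    have h1 := (hS.conj_involutive isPLMap_reflB3 reflB3_involutive).conj_involutive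
      isPLMap_reflA3 reflA3_involutive
    have h3 := (hS.conj_involutive isPLMap_reflA3 reflA3_involutive).conj_involutive
      isPLMap_reflB3 reflB3_involutive
    simp only [reflA3_slopeVecThree, reflB3_slopeVecThree] at h1 h3
    have hd : Nat.gcd 3 9 = 3 := by decide
    rw [hd] at hi'
    interval_cases i
    · rw [cyclicSigmaInv_of_ne (by decide), tropMap_sigmaInv_one_three] at hf
      exact ⟨_, _, isCoprime_one_left.neg_left, h1.eq_of_isStableFixedPoint hf hg⟩
    · rw [cyclicSigmaInv_of_ne (by decide), tropMap_sigmaInv_two_three] at hf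
      exact ⟨0, 1, isCoprime_one_right, hS.eq_of_isStableFixedPoint hf hg⟩
    · rw [tropMap_cyclic_three] at hf
      exact ⟨1, 1, isCoprime_one_right, h3.eq_of_isStableFixedPoint hf hg⟩
  base := by
    refine ⟨?_, attracts_braid3'.gcd_eq_one⟩
    rw [cyclicSigmaInv_of_ne (by decide), tropMap_sigmaInv_two_three]
    exact attracts_braid3'.isStableFixedPoint (by rw [braid3_slopeVecThree, sub_zero])
  sigmaInv i hi hi' a b h := by
    have hd : Nat.gcd 3 9 = 3 := by decide
    rw [hd] at hi'
    interval_cases i <;>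
      simp only [tropMap_sigmaInv_one_three, tropMap_sigmaInv_two_three, Function.comp_apply,
        reflA3_slopeVecThree, reflB3_slopeVecThree, braid3_slopeVecThree]
    · exact ⟨_, _, isCoprime_of_det h 1 (-1) 0 1 (by ring) (by ring), rfl⟩
    · exact ⟨_, _, isCoprime_of_det h 1 0 1 1 (by ring) (by ring), rfl⟩
  sigma i hi hi' a b h := by
    have hd : Nat.gcd 3 9 = 3 := by decide
    rw [hd] at hi'
    interval_cases i <;>
      simp only [tropMap_sigma_one_three, tropMap_sigma_two_three, Function.comp_apply,
        reflA3_slopeVecThree, reflB3_slopeVecThree, braid3_slopeVecThree]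
    · exact ⟨_, _, isCoprime_of_det h 1 1 0 1 (by ring) (by ring), rfl⟩
    · exact ⟨_, _, isCoprime_of_det h 1 0 (-1) 1 (by ring) (by ring), rfl⟩
  sigmaInv_one a b := by
    simp only [tropMap_sigmaInv_one_three, Function.comp_apply, reflA3_slopeVecThree,
      reflB3_slopeVecThree, braid3_slopeVecThree]
    congr 1 <;> ring
  sigmaInv_two a b := by rw [tropMap_sigmaInv_two_three, braid3_slopeVecThree]
  sigma_one a b := by
    simp only [tropMap_sigma_one_three, Function.comp_apply, reflA3_slopeVecThree,
      reflB3_slopeVecThree, braid3_slopeVecThree]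
    congr 1 <;> ring
  sigma_two a b := by
    simp only [tropMap_sigma_two_three, Function.comp_apply, reflA3_slopeVecThree,
      braid3_slopeVecThree]
    congr 1
    ring

/-! ### Rectangular tableaux as arrays of row lengths -/

/-- A property closed under passing to smaller indices holds on an initial segment, so its size
decides membership. -/
lemma lt_card_filter_range_iff {P : ℕ → Prop} [DecidablePred P] {r j : ℕ}
    (hP : ∀ x y, x ≤ y → y < r → P y → P x) (hj : j < r) :
    j < ((Finset.range r).filter P).card ↔ P j := by
  constructor
  · intro h
    by_contra hn
    have hsub : (Finset.range r).filter P ⊆ Finset.range j := by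
      intro x hx
      rw [Finset.mem_filter, Finset.mem_range] at hx
      rw [Finset.mem_range]
      by_contra hx'
      exact hn (hP j x (not_lt.mp hx') hx.1 hx.2)
    have := Finset.card_le_card hsub
    rw [Finset.card_range] at this
    omega
  · intro h
    have hsub : Finset.range (j + 1) ⊆ (Finset.range r).filter P := by
      intro x hx
      rw [Finset.mem_range] at hx
      rw [Finset.mem_filter, Finset.mem_range]
      exact ⟨by omega, hP x j (by omega) hj h⟩
    have := Finset.card_le_card hsub
    rw [Finset.card_range] at this
    omega

lemma mem_rect {k r i j : ℕ} : (i, j) ∈ rect k r ↔ i < k ∧ j < r := by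
  rw [← YoungDiagram.mem_cells]
  simp [rect]

/-- `C i a` is the number of entries `≤ i + 1 + a` in row `i` of a `k × r` tableau with entries
in `{1, …, k + N}`; rows with index at least `k` are empty. -/
structure IsLowArray (k N r : ℕ) (C : ℕ → ℕ → ℕ) : Prop where
  zero : ∀ i a, k ≤ i → C i a = 0
  top : ∀ i, i < k → C i N = r
  mono : ∀ i a, a < N → C i a ≤ C i (a + 1)
  anti : ∀ i a, a ≤ N → C (i + 1) a ≤ C i a

namespace IsLowArray

variable {k N r : ℕ} {C : ℕ → ℕ → ℕ}

lemma mono_le (h : IsLowArray k N r C) (i : ℕ) {a a' : ℕ} (haa : a ≤ a') (ha' : a' ≤ N) :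
    C i a ≤ C i a' := by
  induction a', haa using Nat.le_induction with
  | base => exact le_rfl
  | succ b _ ih => exact (ih (by omega)).trans (h.mono i b (by omega))

lemma anti_le (h : IsLowArray k N r C) {i i' : ℕ} (hi : i ≤ i') {a : ℕ} (ha : a ≤ N) :
    C i' a ≤ C i a := by
  induction i', hi using Nat.le_induction with
  | base => exact le_rfl
  | succ b _ ih => exact (h.anti b a ha).trans ih

lemma le_top (h : IsLowArray k N r C) {i a : ℕ} (hi : i < k) (ha : a ≤ N) : C i a ≤ r :=
  h.top i hi ▸ h.mono_le i ha le_rfl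

end IsLowArray

namespace Tableau

variable {k n : ℕ}

/-- The number of entries `≤ i + 1 + a` in row `i`. -/
def low (T : Tableau k n) (i a : ℕ) : ℕ :=
  if i < k then ((Finset.range T.cols).filter fun j => T.tab i j ≤ i + 1 + a).card else 0

lemma row_mono (T : Tableau k n) {i j j' : ℕ} (hj : j ≤ j') (hi : i < k) (hj' : j' < T.cols) :
    T.tab i j ≤ T.tab i j' :=
  T.tab.row_weak_of_le hj (mem_rect.mpr ⟨hi, hj'⟩)

lemma tab_lt_tab_succ (T : Tableau k n) {i j : ℕ} (hi : i + 1 < k) (hj : j < T.cols) :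
    T.tab i j < T.tab (i + 1) j :=
  T.tab.col_strict (Nat.lt_succ_self i) (mem_rect.mpr ⟨hi, hj⟩)

lemma succ_le_tab (T : Tableau k n) {i j : ℕ} (hi : i < k) (hj : j < T.cols) :
    i + 1 ≤ T.tab i j := by
  induction i with
  | zero => exact (Finset.mem_Icc.mp (T.entries_mem 0 j (mem_rect.mpr ⟨hi, hj⟩))).1
  | succ i ih =>
    have := ih (by omega)
    have := T.tab_lt_tab_succ hi hj
    omega

/-- Below an entry of row i there are k - 1 - i strictly larger entries of its column, all at most
n. -/
lemma tab_add_le (T : Tableau k n) {i j : ℕ} (hi : i < k) (hj : j < T.cols) :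
    T.tab i j + k ≤ n + i + 1 := by
  have key : ∀ s i, i + s + 1 = k → T.tab i j + k ≤ n + i + 1 := by
    intro s
    induction s with
    | zero =>
      intro i hi
      have := (Finset.mem_Icc.mp (T.entries_mem i j (mem_rect.mpr ⟨by omega, hj⟩))).2
      omega
    | succ s ih =>
      intro i hi
      have := ih (i + 1) (by omega)
      have := T.tab_lt_tab_succ (i := i) (by omega) hj
      omega
  exact key (k - 1 - i) i (by omega)

lemma lt_low_iff (T : Tableau k n) {i j : ℕ} (hi : i < k) (hj : j < T.cols) (a : ℕ) :
    j < T.low i a ↔ T.tab i j ≤ i + 1 + a := by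
  rw [low, if_pos hi]
  exact lt_card_filter_range_iff (fun x y hxy hy h => (T.row_mono hxy hi hy).trans h) hj

/-- Comparing rows uses the shift by i + 1 in `low`: column strictness gives tab i j ≤ tab (i+1) j -
1, so the count with the shifted bound can only decrease downwards. -/
lemma isLowArray_low (T : Tableau k n) (hkn : k ≤ n) : IsLowArray k (n - k) T.cols T.low where
  zero i a hi := by rw [low, if_neg (by omega)]
  top i hi := by
    rw [low, if_pos hi, Finset.filter_true_of_mem, Finset.card_range]
    intro j hj
    have := T.tab_add_le hi (Finset.mem_range.mp hj)
    omega
  mono i a _ := by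
    unfold low
    split_ifs
    · exact Finset.card_le_card (Finset.monotone_filter_right _ fun j _ hj => by omega)
    · exact le_rfl
  anti i a _ := by
    unfold low
    by_cases hi : i + 1 < k
    · rw [if_pos hi, if_pos (by omega)]
      apply Finset.card_le_card
      intro j hj
      rw [Finset.mem_filter, Finset.mem_range] at hj ⊢
      have := T.tab_lt_tab_succ hi hj.1
      exact ⟨hj.1, by omega⟩
    · rw [if_neg hi]
      exact Nat.zero_le _

/-- Within a row the counts `low i a` and the entries are conjugate to each other: an entry exceeds
its minimum i + 1 by the number of a with low i a ≤ j. -/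
lemma tab_eq (T : Tableau k n) {i j : ℕ} (hi : i < k) (hj : j < T.cols) :
    T.tab i j = i + 1 + ((Finset.range (n - k)).filter fun a => T.low i a ≤ j).card := by
  have h1 := T.succ_le_tab hi hj
  have h2 := T.tab_add_le hi hj
  have : ((Finset.range (n - k)).filter fun a => T.low i a ≤ j) =
      Finset.range (T.tab i j - (i + 1)) := by
    ext a
    have := T.lt_low_iff hi hj a
    rw [Finset.mem_filter, Finset.mem_range, Finset.mem_range]
    omega
  rw [this, Finset.card_range]
  omega

lemma ext_low {T T' : Tableau k n} (hc : T.cols = T'.cols)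
    (h : ∀ i < k, ∀ a < n - k, T.low i a = T'.low i a) : T = T' := by
  have key : ∀ i j, T.tab i j = T'.tab i j := by
    intro i j
    by_cases hij : i < k ∧ j < T.cols
    · rw [T.tab_eq hij.1 hij.2, T'.tab_eq hij.1 (hc ▸ hij.2)]
      congr 2
      apply Finset.filter_congr
      intro a ha
      rw [h i hij.1 a (Finset.mem_range.mp ha)]
    · rw [T.tab.zeros (by rwa [mem_rect]), T'.tab.zeros (by rwa [mem_rect, ← hc])]
  obtain ⟨r, t, ht⟩ := T
  obtain ⟨r', t', ht'⟩ := T'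
  obtain rfl : r = r' := hc
  obtain rfl : t = t' := SemistandardYoungTableau.ext key
  rfl

/-- The tableau with a given array of row lengths. -/
def ofLow {r : ℕ} {C : ℕ → ℕ → ℕ} (hkn : k ≤ n) (h : IsLowArray k (n - k) r C) :
    Tableau k n where
  cols := r
  tab :=
    { entry := fun i j => if i < k ∧ j < r then
        i + 1 + ((Finset.range (n - k)).filter fun a => C i a ≤ j).card else 0
      row_weak' := by
        intro i j1 j2 hj hm
        rw [mem_rect] at hm
        rw [if_pos ⟨hm.1, by omega⟩, if_pos hm]
        exact Nat.add_le_add_left (Finset.card_le_card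
          (Finset.monotone_filter_right _ fun a _ ha => by omega)) _
      col_strict' := by
        intro i1 i2 j hi hm
        rw [mem_rect] at hm
        rw [if_pos ⟨by omega, hm.2⟩, if_pos hm]
        have := Finset.card_le_card (s := (Finset.range (n - k)).filter fun a => C i1 a ≤ j)
          (t := (Finset.range (n - k)).filter fun a => C i2 a ≤ j) (by
            intro a ha
            rw [Finset.mem_filter, Finset.mem_range] at ha ⊢
            exact ⟨ha.1, (h.anti_le hi.le ha.1.le).trans ha.2⟩)
        omega
      zeros' := by
        intro i j hm
        rw [mem_rect] at hm
        rw [if_neg hm] }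
  entries_mem := by
    intro i j hm
    rw [mem_rect] at hm
    change (if i < k ∧ j < r then
        i + 1 + ((Finset.range (n - k)).filter fun a => C i a ≤ j).card else 0) ∈ Finset.Icc 1 n
    have := Finset.card_filter_le (Finset.range (n - k)) fun a => C i a ≤ j
    rw [Finset.card_range] at this
    rw [if_pos hm, Finset.mem_Icc]
    omega

/-- Conjugating a monotone array twice returns it; the value a = n - k is separate, since there the
count is the full row. -/
lemma ofLow_low {r : ℕ} {C : ℕ → ℕ → ℕ} (hkn : k ≤ n) (h : IsLowArray k (n - k) r C)
    (i : ℕ) {a : ℕ} (ha : a ≤ n - k) : (ofLow hkn h).low i a = C i a := by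
  by_cases hi : i < k
  swap
  · rw [h.zero i a (by omega), low, if_neg hi]
  rw [low, if_pos hi]
  have key : ((Finset.range r).filter fun j => (if i < k ∧ j < r then
      i + 1 + ((Finset.range (n - k)).filter fun a => C i a ≤ j).card else 0) ≤ i + 1 + a) =
      Finset.range (C i a) := by
    ext j
    rw [Finset.mem_filter, Finset.mem_range, Finset.mem_range]
    have hle := h.le_top hi ha
    constructor
    · rintro ⟨hj, hjc⟩
      rw [if_pos ⟨hi, hj⟩] at hjc
      rcases ha.eq_or_lt with rfl | ha
      · rwa [h.top i hi]
      · have := lt_card_filter_range_iff (P := fun a => C i a ≤ j) (r := n - k) (j := a)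
          (fun x y hxy hy hyj => (h.mono_le i hxy hy.le).trans hyj) ha
        omega
    · intro hj
      refine ⟨by omega, ?_⟩
      rw [if_pos ⟨hi, by omega⟩]
      rcases ha.eq_or_lt with rfl | ha
      · have := Finset.card_filter_le (Finset.range (n - k)) fun a => C i a ≤ j
        rw [Finset.card_range] at this
        omega
      · have := lt_card_filter_range_iff (P := fun a => C i a ≤ j) (r := n - k) (j := a)
          (fun x y hxy hy hyj => (h.mono_le i hxy hy.le).trans hyj) ha
        omega
  exact (congrArg Finset.card key).trans (Finset.card_range _)

/-! ### Row multiplicities and unions -/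

lemma rowMult_zero (T : Tableau k n) {i : ℕ} (hi : i < k) : T.rowMult i (i + 1) = T.low i 0 := by
  rw [low, if_pos hi, rowMult]
  congr 1
  apply Finset.filter_congr
  intro j hj
  have := T.succ_le_tab hi (Finset.mem_range.mp hj)
  omega

lemma low_add_rowMult (T : Tableau k n) {i : ℕ} (hi : i < k) (a : ℕ) :
    T.low i a + T.rowMult i (i + 1 + (a + 1)) = T.low i (a + 1) := by
  rw [low, if_pos hi, low, if_pos hi, rowMult, ← Finset.card_union_of_disjoint]
  · rw [← Finset.filter_or]
    congr 1
    apply Finset.filter_congr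
    intro j _
    omega
  · rw [Finset.disjoint_filter]
    intro j _ h
    omega

lemma rowMult_eq_zero (T : Tableau k n) {i x : ℕ} (hi : i < k) (hx : x ≤ i ∨ n + i + 1 < x + k) :
    T.rowMult i x = 0 := by
  rw [rowMult, Finset.card_eq_zero, Finset.filter_eq_empty_iff]
  intro j hj
  have := T.succ_le_tab hi (Finset.mem_range.mp hj)
  have := T.tab_add_le hi (Finset.mem_range.mp hj)
  omega

/-- The numbers `low i a` are the partial sums of the row multiplicities, so additivity of either is
equivalent to that of the other. -/
lemma isUnion_iff {T S U : Tableau k n} (hkn : k ≤ n) :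
    T.IsUnion S U ↔ ∀ i < k, ∀ a ≤ n - k, T.low i a = S.low i a + U.low i a := by
  constructor
  · intro h i hi a ha
    induction a with
    | zero =>
      have := h i hi (i + 1)
      rwa [rowMult_zero _ hi, rowMult_zero _ hi, rowMult_zero _ hi] at this
    | succ a ih =>
      have := ih (by omega)
      have := h i hi (i + 1 + (a + 1))
      have := T.low_add_rowMult hi a
      have := S.low_add_rowMult hi a
      have := U.low_add_rowMult hi a
      omega
  · intro h i hi x
    by_cases hx : x ≤ i ∨ n + i + 1 < x + k
    · rw [T.rowMult_eq_zero hi hx, S.rowMult_eq_zero hi hx, U.rowMult_eq_zero hi hx]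
    · obtain ⟨a, rfl⟩ : ∃ a, x = i + 1 + a := ⟨x - (i + 1), by omega⟩
      cases a with
      | zero =>
        have := h i hi 0 (Nat.zero_le _)
        rwa [← rowMult_zero _ hi, ← rowMult_zero _ hi, ← rowMult_zero _ hi] at this
      | succ a =>
        have := h i hi a (by omega)
        have := h i hi (a + 1) (by omega)
        have := T.low_add_rowMult hi a
        have := S.low_add_rowMult hi a
        have := U.low_add_rowMult hi a
        omega

lemma IsVertexTableau.low_eq {S : Tableau k n} {u : ℕ × ℕ} (hS : S.IsVertexTableau u)
    (i a : ℕ) : S.low i a = if i < k ∧ vertexEntry k u i ≤ i + 1 + a then 1 else 0 := by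
  unfold low
  by_cases hi : i < k
  · rw [if_pos hi, show Finset.range S.cols = {0} by rw [hS.1, Finset.range_one],
      Finset.filter_singleton, hS.2 i hi]
    simp only [hi, true_and]
    split_ifs <;> simp
  · rw [if_neg hi, if_neg (by tauto)]

end Tableau

/-! ### Tableaux without frozen factors -/

/-- The slack conditions on an array which say that no frozen vertex can be split off. -/
structure IsTight (k N : ℕ) (C : ℕ → ℕ → ℕ) : Prop where
  row : ∀ i < k, ∃ a < N, C i a = C (i + 1) a
  col : ∀ a < N, ∃ i < k, C i (a + 1) = C i a

/-- The array of the one-column tableau at the vertex `(p, b)`, or at `(0, 0)` if `b = 0`. -/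
def vertexLow (k p b : ℕ) (i a : ℕ) : ℕ := if i < k ∧ (i < k - b ∨ p ≤ a) then 1 else 0

lemma isLowArray_vertexLow {k N p b : ℕ} (hp : p ≤ N) : IsLowArray k N 1 (vertexLow k p b) where
  zero i a hi := if_neg (by omega)
  top i hi := if_pos (by omega)
  mono i a _ := by unfold vertexLow; split_ifs <;> omega
  anti i a _ := by unfold vertexLow; split_ifs <;> omega

namespace Tableau

variable {k n : ℕ}

lemma mem_frozenVertices_iff {u : ℕ × ℕ} (hk : 1 ≤ k) (hkn : k < n) :
    u ∈ frozenVertices k n ↔ u = (0, 0) ∨ (u.2 = k ∧ 1 ≤ u.1 ∧ u.1 ≤ n - k) ∨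
      (u.1 = n - k ∧ 1 ≤ u.2 ∧ u.2 < k) := by
  obtain ⟨a, b⟩ := u
  simp only [frozenVertices, vertices, activeVertices, Finset.mem_sdiff, Finset.mem_insert,
    Finset.mem_product, Finset.mem_Icc, Prod.mk.injEq]
  omega

/-- Splitting off a vertex from the array of a tableau. -/
lemma exists_isUnion {T : Tableau k n} (hkn : k ≤ n) {u : ℕ × ℕ} {p b : ℕ} (hp : p ≤ n - k)
    (hu : ∀ i < k, vertexEntry k u i = if i < k - b then i + 1 else i + 1 + p)
    {r : ℕ} (h : IsLowArray k (n - k) r fun i a => T.low i a - vertexLow k p b i a)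
    (hle : ∀ i a, a ≤ n - k → vertexLow k p b i a ≤ T.low i a) :
    ∃ S U : Tableau k n, S.IsVertexTableau u ∧ T.IsUnion S U := by
  have hS := isLowArray_vertexLow (k := k) (b := b) hp
  refine ⟨ofLow hkn hS, ofLow hkn h, ⟨rfl, ?_⟩, ?_⟩
  · intro i hi
    have h1 := (ofLow hkn hS).lt_low_iff hi (j := 0) Nat.one_pos
    have h2 := (ofLow hkn hS).succ_le_tab hi (j := 0) Nat.one_pos
    have h3 := (ofLow hkn hS).tab_add_le hi (j := 0) Nat.one_pos
    have h4 : ∀ a ≤ n - k, (ofLow hkn hS).tab i 0 ≤ i + 1 + a ↔ vertexEntry k u i ≤ i + 1 + a := by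
      intro a ha
      rw [← h1 a, ofLow_low hkn hS i ha, vertexLow, hu i hi]
      split_ifs <;> omega
    have h5 : i + 1 ≤ vertexEntry k u i ∧ vertexEntry k u i ≤ i + 1 + (n - k) := by
      rw [hu i hi]
      split_ifs <;> omega
    obtain ⟨x, hx⟩ : ∃ x, (ofLow hkn hS).tab i 0 = i + 1 + x := ⟨_, (Nat.add_sub_of_le h2).symm⟩
    obtain ⟨y, hy⟩ : ∃ y, vertexEntry k u i = i + 1 + y := ⟨_, (Nat.add_sub_of_le h5.1).symm⟩
    have h6 := h4 x (by omega)
    have h7 := h4 y (by omega)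
    omega
  · rw [isUnion_iff hkn]
    intro i _ a ha
    rw [ofLow_low hkn hS i ha, ofLow_low hkn h i ha]
    have := hle i a ha
    omega

/-- If row i of the array exceeds row i + 1 strictly at every a < n - k, the one-column tableau with
rows up to i as small as possible and later rows as large as possible can be split off. If every row
increases strictly at step a, the tableau at the vertex (a+1,k) can be split off. Both vertices are
frozen. -/
lemma NoFrozenFactor.isTight {T : Tableau k n} (hk : 1 ≤ k) (hkn : k < n)
    (hT : T.NoFrozenFactor) : IsTight k (n - k) T.low := by
  have hC := T.isLowArray_low hkn.le
  constructor
  · intro i hi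
    by_contra! hne
    have hlt : ∀ a < n - k, T.low (i + 1) a < T.low i a := fun a ha =>
      lt_of_le_of_ne (hC.anti i a ha.le) (hne a ha).symm
    have hpos : ∀ i' ≤ i, ∀ a ≤ n - k, 1 ≤ T.low i' a := fun i' hi' a ha =>
      calc 1 ≤ T.low i 0 := Nat.one_le_of_lt (hlt 0 (by omega))
        _ ≤ T.low i' 0 := hC.anti_le hi' (Nat.zero_le _)
        _ ≤ T.low i' a := hC.mono_le i' (Nat.zero_le _) ha
    have hr : 1 ≤ T.cols := hC.top i hi ▸ hpos i le_rfl _ le_rfl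
    have hle : ∀ i' a, a ≤ n - k → vertexLow k (n - k) (k - 1 - i) i' a ≤ T.low i' a := by
      intro i' a ha
      unfold vertexLow
      split_ifs with h
      · by_cases hi' : i' ≤ i
        · exact hpos i' hi' a ha
        · obtain rfl : a = n - k := by omega
          rwa [hC.top i' h.1]
      · exact Nat.zero_le _
    have hlast : ∀ i', i < i' → i' < k → T.low i' (n - k - 1) < T.cols := by
      intro i' hi' _
      exact (hC.anti_le hi' (Nat.sub_le _ _)).trans_lt
        ((hlt _ (by omega)).trans_le (hC.le_top hi (Nat.sub_le _ _)))
    -- For i = k - 1 no row is taken as large as possible, and the index set is {1, …, k}.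
    refine hT ⟨if i + 1 = k then (0, 0) else (n - k, k - 1 - i), ?_,
      exists_isUnion hkn.le (p := n - k) (b := k - 1 - i) le_rfl ?_ (r := T.cols - 1) ⟨?_, ?_, ?_, ?_⟩
        hle⟩
    · rw [mem_frozenVertices_iff hk hkn]
      split_ifs
      · exact Or.inl rfl
      · exact Or.inr (Or.inr ⟨rfl, by dsimp only; omega, by dsimp only; omega⟩)
    · intro i' hi'
      unfold vertexEntry
      split_ifs <;> dsimp only at * <;> omega
    · intro i' a hi'
      rw [hC.zero i' a hi', Nat.zero_sub]
    · intro i' hi'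
      rw [hC.top i' hi', vertexLow, if_pos ⟨hi', Or.inr le_rfl⟩]
    · intro i' a ha
      have h1 := hC.mono i' a ha
      have h2 := hle i' (a + 1) ha
      have h3 := hle i' a ha.le
      by_cases hi' : i < i' ∧ i' < k ∧ a + 1 = n - k
      · have h4 := hlast i' hi'.1 hi'.2.1
        rw [← hi'.2.2, Nat.add_sub_cancel] at h4
        have h5 := hC.top i' hi'.2.1
        rw [← hi'.2.2] at h5
        unfold vertexLow at *
        split_ifs at * <;> omega
      · unfold vertexLow at *
        split_ifs at * <;> omega
    · intro i' a ha
      have h1 := hC.anti i' a ha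
      have h2 := hle i' a ha
      by_cases hi' : i' = i ∧ a < n - k
      · obtain ⟨rfl, ha'⟩ := hi'
        have := hlt a ha'
        unfold vertexLow at *
        split_ifs at * <;> omega
      · by_cases hi'' : i' + 1 < k
        · unfold vertexLow at *
          split_ifs at * <;> omega
        · rw [hC.zero (i' + 1) a (by omega), Nat.zero_sub]
          exact Nat.zero_le _
  · intro a ha
    by_contra! hne
    have hlt : ∀ i < k, T.low i a < T.low i (a + 1) := fun i hi =>
      lt_of_le_of_ne (hC.mono i a ha) (hne i hi).symm
    have hle : ∀ i' a', a' ≤ n - k → vertexLow k (a + 1) k i' a' ≤ T.low i' a' := by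
      intro i' a' ha'
      unfold vertexLow
      split_ifs with h
      · have := hC.mono_le i' (show a + 1 ≤ a' by omega) ha'
        have := hlt i' h.1
        omega
      · exact Nat.zero_le _
    refine hT ⟨(a + 1, k), ?_,
      exists_isUnion hkn.le (p := a + 1) (b := k) ha ?_ (r := T.cols - 1) ⟨?_, ?_, ?_, ?_⟩ hle⟩
    · rw [mem_frozenVertices_iff hk hkn]
      exact Or.inr (Or.inl ⟨rfl, by dsimp only; omega, by dsimp only; omega⟩)
    · intro i' _
      rfl
    · intro i' a' hi'
      rw [hC.zero i' a' hi', Nat.zero_sub]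
    · intro i' hi'
      rw [hC.top i' hi', vertexLow, if_pos ⟨hi', Or.inr ha⟩]
    · intro i' a' ha'
      have h1 := hC.mono i' a' ha'
      by_cases h : i' < k ∧ a' = a
      · obtain ⟨hi', rfl⟩ := h
        have := hlt i' hi'
        unfold vertexLow
        split_ifs <;> omega
      · unfold vertexLow
        split_ifs <;> omega
    · intro i' a' ha'
      have h1 := hC.anti i' a' ha'
      have h2 := hle i' a' ha'
      have h3 := hle (i' + 1) a' ha'
      by_cases h : i' + 1 < k
      · unfold vertexLow
        split_ifs <;> omega
      · rw [hC.zero (i' + 1) a' (by omega), Nat.zero_sub]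
        exact Nat.zero_le _

/-- Splitting off a frozen vertex lowers one first difference of the array by 1 at every position;
where that difference is zero, the rest would violate monotonicity. -/
lemma noFrozenFactor_of_isTight {T : Tableau k n} (hk : 1 ≤ k) (hkn : k < n)
    (hT : IsTight k (n - k) T.low) : T.NoFrozenFactor := by
  rintro ⟨u, hu, S, U, hS, hU⟩
  rw [mem_frozenVertices_iff hk hkn] at hu
  rw [isUnion_iff hkn.le] at hU
  have hUC := U.isLowArray_low hkn.le
  have hTC := T.isLowArray_low hkn.le
  have key : u.2 < k → (u.1 = n - k ∨ u.2 = 0) → False := by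
    intro hb hu'
    obtain ⟨a, ha, h⟩ := hT.row (k - 1 - u.2) (by omega)
    have h1 := hU (k - 1 - u.2) (by omega) a ha.le
    rw [hS.low_eq, if_pos ⟨by omega, by unfold vertexEntry; split_ifs <;> omega⟩] at h1
    have h3 := hUC.anti (k - 1 - u.2) a ha.le
    by_cases hb0 : u.2 = 0
    · rw [hTC.zero (k - 1 - u.2 + 1) a (by omega)] at h
      omega
    · have h2 := hU (k - 1 - u.2 + 1) (by omega) a ha.le
      rw [hS.low_eq, if_neg (by unfold vertexEntry; split_ifs <;> omega)] at h2
      omega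
  rcases hu with rfl | ⟨hb, ha, ha'⟩ | ⟨ha, _, hb⟩
  · exact key (by dsimp only; omega) (Or.inr rfl)
  · obtain ⟨i, hi, h⟩ := hT.col (u.1 - 1) (by omega)
    have h1 := hU i hi (u.1 - 1) (by omega)
    have h2 := hU i hi (u.1 - 1 + 1) (by omega)
    rw [hS.low_eq, if_neg (by unfold vertexEntry; split_ifs <;> omega)] at h1
    rw [hS.low_eq, if_pos ⟨hi, by unfold vertexEntry; split_ifs <;> omega⟩] at h2
    have h3 := hUC.mono i (u.1 - 1) (by omega)
    omega
  · exact key hb (Or.inl ha)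

end Tableau

/-! ### Truncated g-vectors in terms of row lengths -/

/-- Reindexing by j = k - b turns the shift condition of `vertexEntry` in row i into j ≤ i, so sums
over shifted vertices become sums over initial ranges. -/
lemma sum_vertices {k n : ℕ} (F : ℕ × ℕ → ℤ) :
    ∑ u ∈ vertices k n, F u =
      F (0, 0) + ∑ a ∈ Finset.range (n - k), ∑ j ∈ Finset.range k, F (a + 1, k - j) := by
  have h0 : (0, 0) ∉ Finset.Icc 1 (n - k) ×ˢ Finset.Icc 1 k := by simp
  have hIcc : ∀ (m : ℕ) (f : ℕ → ℤ), ∑ a ∈ Finset.Icc 1 m, f a = ∑ a ∈ Finset.range m, f (a + 1) := by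
    intro m f
    induction m with
    | zero => rfl
    | succ m ih => rw [Finset.sum_Icc_succ_top (by omega), Finset.sum_range_succ, ih]
  rw [vertices, Finset.sum_insert h0, Finset.sum_product, hIcc]
  congr 1
  refine Finset.sum_congr rfl fun a _ => ?_
  rw [hIcc, ← Finset.sum_range_reflect]
  refine Finset.sum_congr rfl fun j hj => ?_
  rw [Finset.mem_range] at hj
  congr 2
  omega

lemma sum_range_indicator {k i : ℕ} (hi : i < k) (f : ℕ → ℤ) :
    ∑ j ∈ Finset.range k, f j * (if j ≤ i then 1 else 0) = ∑ j ∈ Finset.range (i + 1), f j := by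
  rw [← Finset.sum_subset (Finset.range_subset_range.mpr hi)]
  · refine Finset.sum_congr rfl fun j hj => ?_
    rw [Finset.mem_range] at hj
    rw [if_pos (by omega), mul_one]
  · intro j _ hj
    rw [Finset.mem_range] at hj
    rw [if_neg (by omega), mul_zero]

lemma vertexEntry_rev {k i j a : ℕ} (hj : j < k) :
    vertexEntry k (a + 1, k - j) i = if j ≤ i then i + 1 + (a + 1) else i + 1 := by
  unfold vertexEntry
  split_ifs <;> dsimp only at * <;> omega

lemma sum_vertexEntry {k n i x : ℕ} (e : ℕ × ℕ → ℤ) :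
    ∑ u ∈ vertices k n, e u * (if vertexEntry k u i = x then 1 else 0) =
      e (0, 0) * (if i + 1 = x then 1 else 0) + ∑ a ∈ Finset.range (n - k),
        ∑ j ∈ Finset.range k, e (a + 1, k - j) *
          (if (if j ≤ i then i + 1 + (a + 1) else i + 1) = x then 1 else 0) := by
  rw [sum_vertices]
  congr 1
  · congr 2
    unfold vertexEntry
    split_ifs <;> simp
  · refine Finset.sum_congr rfl fun a _ => Finset.sum_congr rfl fun j hj => ?_
    rw [vertexEntry_rev (Finset.mem_range.mp hj)]

lemma sum_vertexEntry_succ {k n i a : ℕ} (hi : i < k) (ha : a < n - k) (e : ℕ × ℕ → ℤ) :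
    ∑ u ∈ vertices k n, e u * (if vertexEntry k u i = i + 1 + (a + 1) then 1 else 0) =
      ∑ j ∈ Finset.range (i + 1), e (a + 1, k - j) := by
  rw [sum_vertexEntry, if_neg (by omega), mul_zero, zero_add, Finset.sum_eq_single a]
  · rw [← sum_range_indicator hi]
    refine Finset.sum_congr rfl fun j _ => ?_
    congr 2
    rw [eq_iff_iff]
    split_ifs <;> omega
  · intro a' _ ha'
    refine Finset.sum_eq_zero fun j _ => ?_
    rw [if_neg (by split_ifs <;> omega), mul_zero]
  · intro h
    exact absurd (Finset.mem_range.mpr ha) h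

namespace Tableau

variable {k n : ℕ}

/-- The g-vector of a tableau in terms of its row lengths. -/
def lowGVector (T : Tableau k n) (u : ℕ × ℕ) : ℤ :=
  if u = (0, 0) then T.low (k - 1) 0 else
    ((T.low (k - u.2) u.1 : ℤ) - T.low (k - u.2) (u.1 - 1)) -
      if k - u.2 = 0 then 0 else
        ((T.low (k - u.2 - 1) u.1 : ℤ) - T.low (k - u.2 - 1) (u.1 - 1))

/-- `lowGVector` is a difference over adjacent rows, so its sum telescopes. -/
lemma sum_lowGVector (T : Tableau k n) {i a : ℕ} (hi : i < k) :
    ∑ j ∈ Finset.range (i + 1), T.lowGVector (a + 1, k - j) =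
      (T.low i (a + 1) : ℤ) - T.low i a := by
  induction i with
  | zero => simp [lowGVector]
  | succ i ih =>
    rw [Finset.sum_range_succ, ih (by omega), lowGVector, if_neg (by simp)]
    simp only [Nat.sub_sub_self hi.le, Nat.add_sub_cancel, if_neg (Nat.succ_ne_zero i)]
    ring

/-- For a shifted entry i + 1 + (a+1) only the vertices of column a + 1 contribute and the row
telescopes. The smallest entry i + 1 collects contributions of all columns, and these telescope a
second time. -/
lemma isGVector_lowGVector (T : Tableau k n) (hkn : k ≤ n) : T.IsGVector T.lowGVector := by
  have hC := T.isLowArray_low hkn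
  intro i hi x
  by_cases hx : x ≤ i ∨ n + i + 1 < x + k
  · rw [T.rowMult_eq_zero hi hx, sum_vertexEntry, if_neg (by omega), mul_zero, zero_add,
      Finset.sum_eq_zero, Nat.cast_zero]
    intro a ha
    rw [Finset.mem_range] at ha
    refine Finset.sum_eq_zero fun j _ => ?_
    rw [if_neg (by split_ifs <;> omega), mul_zero]
  obtain ⟨a, rfl⟩ : ∃ a, x = i + 1 + a := ⟨x - (i + 1), by omega⟩
  cases a with
  | zero =>
    have key : ∀ a ∈ Finset.range (n - k), ∑ j ∈ Finset.range k, T.lowGVector (a + 1, k - j) *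
          (if (if j ≤ i then i + 1 + (a + 1) else i + 1) = i + 1 + 0 then 1 else 0) =
        ((T.low (k - 1) (a + 1) : ℤ) - T.low i (a + 1)) - (T.low (k - 1) a - T.low i a) := by
      intro a _
      have h1 := T.sum_lowGVector (i := k - 1) (a := a) (by omega)
      have h2 := T.sum_lowGVector (a := a) hi
      rw [← sum_range_indicator hi] at h2
      rw [show k - 1 + 1 = k by omega] at h1
      have h3 : ∑ j ∈ Finset.range k, T.lowGVector (a + 1, k - j) *
          (if (if j ≤ i then i + 1 + (a + 1) else i + 1) = i + 1 + 0 then 1 else 0) =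
          ∑ j ∈ Finset.range k, T.lowGVector (a + 1, k - j) -
          ∑ j ∈ Finset.range k, T.lowGVector (a + 1, k - j) * (if j ≤ i then 1 else 0) := by
        rw [← Finset.sum_sub_distrib]
        refine Finset.sum_congr rfl fun j _ => ?_
        by_cases hj : j ≤ i
        · rw [if_pos hj, if_pos hj, if_neg (by omega)]
          ring
        · rw [if_neg hj, if_neg hj, if_pos (by omega)]
          ring
      rw [h3, h1, h2]
      ring
    rw [sum_vertexEntry, Finset.sum_congr rfl key, Finset.sum_range_sub (fun a =>
      (T.low (k - 1) a : ℤ) - T.low i a), hC.top i hi, hC.top (k - 1) (by omega), Nat.add_zero,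
      if_pos rfl, T.rowMult_zero hi, lowGVector, if_pos rfl]
    ring
  | succ a =>
    rw [sum_vertexEntry_succ hi (by omega), T.sum_lowGVector hi]
    have := T.low_add_rowMult hi a
    omega

/-- Comparing the multiplicities of one entry shift in two adjacent rows isolates a single e_u, so
the truncated g-vector is forced to be the mixed second difference of `low`. -/
lemma isTruncatedGVector_iff {T : Tableau k n} (hkn : k ≤ n) {g : Idx k n → ℤ} :
    T.IsTruncatedGVector g ↔ ∀ p : Idx k n, g p =
      ((T.low (k - 2 - p.2) p.1 : ℤ) - T.low (k - 2 - p.2 + 1) p.1) -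
        (T.low (k - 2 - p.2) (p.1 + 1) - T.low (k - 2 - p.2 + 1) (p.1 + 1)) := by
  have key : ∀ e, T.IsGVector e → ∀ p : Idx k n, e p.vertex =
      ((T.low (k - 2 - p.2) p.1 : ℤ) - T.low (k - 2 - p.2 + 1) p.1) -
        (T.low (k - 2 - p.2) (p.1 + 1) - T.low (k - 2 - p.2 + 1) (p.1 + 1)) := by
    rintro e he ⟨⟨a, ha⟩, ⟨b, hb⟩⟩
    obtain ⟨i, hi⟩ : ∃ i, i = k - 2 - b := ⟨_, rfl⟩
    have h1 := he i (by omega) (i + 1 + (a + 1))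
    have h2 := he (i + 1) (by omega) (i + 1 + 1 + (a + 1))
    rw [sum_vertexEntry_succ (by omega) (by omega)] at h1 h2
    rw [Finset.sum_range_succ, ← h1, show k - (i + 1) = b + 1 by omega] at h2
    have h3 := T.low_add_rowMult (i := i) (by omega) a
    have h4 := T.low_add_rowMult (i := i + 1) (by omega) a
    simp only [Idx.vertex, ← hi]
    omega
  constructor
  · rintro ⟨e, he, h⟩ p
    rw [h p, key e he p]
  · intro h
    exact ⟨_, T.isGVector_lowGVector hkn,
      fun p => (h p).trans (key _ (T.isGVector_lowGVector hkn) p).symm⟩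

lemma IsTruncatedGVector.unique {T : Tableau k n} (hkn : k ≤ n) {g g' : Idx k n → ℤ}
    (h : T.IsTruncatedGVector g) (h' : T.IsTruncatedGVector g') : g = g' := by
  funext p
  rw [(isTruncatedGVector_iff hkn).mp h p, (isTruncatedGVector_iff hkn).mp h' p]

end Tableau

/-! ### Reconstruction of the row lengths from the truncated g-vector -/

/-- The maximum of the partial sums `∑ x < j, f x` with `j ≤ L`. -/
def maxPartial (f : ℕ → ℤ) : ℕ → ℤ
  | 0 => 0
  | L + 1 => max (maxPartial f L) (∑ x ∈ Finset.range (L + 1), f x)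

lemma sum_le_maxPartial (f : ℕ → ℤ) {j L : ℕ} (hj : j ≤ L) :
    ∑ x ∈ Finset.range j, f x ≤ maxPartial f L := by
  induction L with
  | zero =>
    obtain rfl : j = 0 := by omega
    exact le_rfl
  | succ L ih =>
    rcases hj.eq_or_lt with rfl | hj
    · exact le_max_right _ _
    · exact (ih (by omega)).trans (le_max_left _ _)

lemma exists_sum_eq_maxPartial (f : ℕ → ℤ) (L : ℕ) :
    ∃ j ≤ L, ∑ x ∈ Finset.range j, f x = maxPartial f L := by
  induction L with
  | zero => exact ⟨0, le_rfl, rfl⟩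
  | succ L ih =>
    rcases max_choice (maxPartial f L) (∑ x ∈ Finset.range (L + 1), f x) with h | h
    · obtain ⟨j, hj, hj'⟩ := ih
      exact ⟨j, by omega, by rw [hj', maxPartial, h]⟩
    · exact ⟨L + 1, le_rfl, by rw [maxPartial, h]⟩

/-- The non-negative sequence with increments `-f` and minimum zero. -/
def slack (f : ℕ → ℤ) (L j : ℕ) : ℤ := maxPartial f L - ∑ x ∈ Finset.range j, f x

lemma slack_nonneg (f : ℕ → ℤ) {j L : ℕ} (hj : j ≤ L) : 0 ≤ slack f L j :=
  sub_nonneg.mpr (sum_le_maxPartial f hj)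

lemma exists_slack_eq_zero (f : ℕ → ℤ) (L : ℕ) : ∃ j ≤ L, slack f L j = 0 := by
  obtain ⟨j, hj, h⟩ := exists_sum_eq_maxPartial f L
  exact ⟨j, hj, sub_eq_zero.mpr h.symm⟩

lemma slack_succ (f : ℕ → ℤ) (L j : ℕ) : slack f L (j + 1) = slack f L j - f j := by
  rw [slack, slack, Finset.sum_range_succ]
  ring

/-- Two sequences with equal increments differ by a constant, and two non-negative sequences that
both attain zero have the same minimum. -/
lemma eq_slack {f d : ℕ → ℤ} {L : ℕ} (hd : ∀ j < L, d (j + 1) = d j - f j)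
    (h0 : ∀ j ≤ L, 0 ≤ d j) (hz : ∃ j ≤ L, d j = 0) : ∀ j ≤ L, d j = slack f L j := by
  have key : ∀ j ≤ L, d j - slack f L j = d 0 - slack f L 0 := by
    intro j
    induction j with
    | zero => intro _; rfl
    | succ j ih =>
      intro hj
      rw [hd j hj, slack_succ, ← ih (by omega)]
      ring
  obtain ⟨j, hj, hdj⟩ := hz
  obtain ⟨j', hj', hsj⟩ := exists_slack_eq_zero f L
  intro i hi
  have h1 := key j hj
  have h2 := key j' hj'
  have h3 := key i hi
  have h4 := h0 j' hj'
  have h5 := slack_nonneg f hj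
  omega

section Reconstruction

variable {k n : ℕ}

/-- The entry of a truncated g-vector in column `a + 1` of the row `i` of the quiver, counted
from the last active one. -/
def gRow (k : ℕ) {n : ℕ} (g : Idx k n → ℤ) (i a : ℕ) : ℤ := extend g (a + 1) (k - 1 - i)

/-- The difference of consecutive rows in the array of the tableau without frozen factors with
truncated g-vector `g`. -/
def rowSlack (k n : ℕ) (g : Idx k n → ℤ) (i a : ℕ) : ℤ := slack (gRow k g i) (n - k - 1) a

/-- The difference of consecutive columns in the array of the tableau without frozen factors
with truncated g-vector `g`. -/
def colSlack (k n : ℕ) (g : Idx k n → ℤ) (a i : ℕ) : ℤ :=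
  slack (fun i => -gRow k g i a) (k - 1) i

/-- The array of the tableau without frozen factors with truncated g-vector `g`. -/
def lowOf (k n : ℕ) (g : Idx k n → ℤ) (i a : ℕ) : ℤ :=
  ∑ i' ∈ Finset.Ico i (k - 1), rowSlack k n g i' 0 +
    ∑ a' ∈ Finset.range a, colSlack k n g a' i

/-- The number of columns of the tableau without frozen factors with truncated g-vector `g`. -/
def size (k n : ℕ) (g : Idx k n → ℤ) : ℤ := lowOf k n g 0 (n - k - 1)

lemma lowOf_succ (g : Idx k n → ℤ) (i a : ℕ) :
    lowOf k n g i (a + 1) = lowOf k n g i a + colSlack k n g a i := by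
  rw [lowOf, lowOf, Finset.sum_range_succ, add_assoc]

/-- `lowOf` is built along the first column and then along rows. The row and column slacks have the
same mixed difference `gRow`, so integrating in the other order gives the same array. -/
lemma lowOf_sub (g : Idx k n → ℤ) {i : ℕ} (hi : i < k - 1) (a : ℕ) :
    lowOf k n g i a - lowOf k n g (i + 1) a = rowSlack k n g i a := by
  induction a with
  | zero =>
    rw [lowOf, lowOf, Finset.sum_eq_sum_Ico_succ_bot hi]
    simp
  | succ a ih =>
    rw [lowOf_succ, lowOf_succ, rowSlack, slack_succ, ← rowSlack, ← ih, colSlack, colSlack,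
      slack_succ]
    ring

lemma lowOf_last (g : Idx k n → ℤ) : lowOf k n g (k - 1) 0 = 0 := by
  simp [lowOf]

lemma lowOf_nonneg (g : Idx k n → ℤ) {i a : ℕ} (hi : i < k) (_ha : a ≤ n - k - 1) :
    0 ≤ lowOf k n g i a :=
  add_nonneg (Finset.sum_nonneg fun i' _ => slack_nonneg _ (Nat.zero_le _))
    (Finset.sum_nonneg fun a' _ => slack_nonneg _ (by omega))

lemma lowOf_anti (g : Idx k n → ℤ) {i a : ℕ} (hi : i < k) (ha : a ≤ n - k - 1) :
    lowOf k n g i a ≤ lowOf k n g 0 a := by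
  induction i with
  | zero => exact le_rfl
  | succ i ih =>
    have h1 := ih (by omega)
    have h2 := lowOf_sub g (i := i) (by omega) a
    have h3 : 0 ≤ rowSlack k n g i a := slack_nonneg _ ha
    omega

lemma gRow_eq (g : Idx k n → ℤ) {i a : ℕ} (p : Idx k n) (ha : p.1.val = a)
    (hi : p.2.val + i = k - 2) : gRow k g i a = g p := by
  obtain ⟨⟨a', ha'⟩, ⟨b, hb⟩⟩ := p
  dsimp only at ha hi
  subst ha
  obtain rfl : b = k - 2 - i := by omega
  simp only [gRow, extend]
  rw [dif_pos (by omega)]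
  congr 2
  simp only [Fin.mk.injEq]
  omega

namespace Tableau

/-- The tableau without frozen factors with a given truncated g-vector is unique. -/
lemma NoFrozenFactor.low_eq {T : Tableau k n} (hk : 1 ≤ k) (hkn : k < n) (hT : T.NoFrozenFactor)
    {g : Idx k n → ℤ} (hg : T.IsTruncatedGVector g) :
    (∀ i < k, ∀ a ≤ n - k - 1, (T.low i a : ℤ) = lowOf k n g i a) ∧ (T.cols : ℤ) = size k n g := by
  have ht := hT.isTight hk hkn
  have hC := T.isLowArray_low hkn.le
  rw [isTruncatedGVector_iff hkn.le] at hg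
  have hG : ∀ i < k - 1, ∀ a < n - k - 1, gRow k g i a =
      ((T.low i a : ℤ) - T.low (i + 1) a) - (T.low i (a + 1) - T.low (i + 1) (a + 1)) := by
    intro i hi a ha
    rw [gRow_eq g (⟨a, ha⟩, ⟨k - 2 - i, by omega⟩) rfl (by dsimp only; omega), hg]
    dsimp only
    rw [show k - 2 - (k - 2 - i) = i by omega]
  have hrow : ∀ i < k - 1, ∀ a ≤ n - k - 1,
      (T.low i a : ℤ) - T.low (i + 1) a = rowSlack k n g i a := by
    intro i hi
    apply eq_slack (d := fun a => (T.low i a : ℤ) - T.low (i + 1) a)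
    · intro a ha
      rw [hG i hi a ha]
      ring
    · intro a ha
      have := hC.anti i a (by omega)
      omega
    · obtain ⟨a, ha, h⟩ := ht.row i (by omega)
      exact ⟨a, by omega, by omega⟩
  have hcol : ∀ a < n - k - 1, ∀ i ≤ k - 1,
      (T.low i (a + 1) : ℤ) - T.low i a = colSlack k n g a i := by
    intro a ha
    apply eq_slack (d := fun i => (T.low i (a + 1) : ℤ) - T.low i a)
    · intro i hi
      rw [hG i hi a ha]
      ring
    · intro i _
      have := hC.mono i a (by omega)
      omega
    · obtain ⟨i, hi, h⟩ := ht.col a (by omega)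
      exact ⟨i, by omega, by omega⟩
  -- Tightness of the last row compares it with the empty row k, so some entry of it is zero, and
  -- the first one with it.
  have hlast : T.low (k - 1) 0 = 0 := by
    obtain ⟨a, ha, h⟩ := ht.row (k - 1) (by omega)
    rw [hC.zero (k - 1 + 1) a (by omega)] at h
    have := hC.mono_le (k - 1) (Nat.zero_le a) ha.le
    omega
  have h0 : ∀ s i, i + s = k - 1 → (T.low i 0 : ℤ) = lowOf k n g i 0 := by
    intro s
    induction s with
    | zero =>
      intro i hi
      obtain rfl : i = k - 1 := by omega
      rw [hlast, lowOf_last, Nat.cast_zero]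
    | succ s ih =>
      intro i hi
      have h1 := ih (i + 1) (by omega)
      have h2 := hrow i (by omega) 0 (Nat.zero_le _)
      have h3 := lowOf_sub g (i := i) (by omega) 0
      omega
  have hall : ∀ i < k, ∀ a ≤ n - k - 1, (T.low i a : ℤ) = lowOf k n g i a := by
    intro i hi a
    induction a with
    | zero => exact fun _ => h0 (k - 1 - i) i (by omega)
    | succ a ih =>
      intro ha
      rw [lowOf_succ, ← ih (by omega), ← hcol a ha i (by omega)]
      ring
  refine ⟨hall, ?_⟩
  rw [size, ← hall 0 hk _ le_rfl]
  -- Tightness of the last column: some row is already full at n - k - 1, and then so is row 0.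
  obtain ⟨i, hi, h⟩ := ht.col (n - k - 1) (by omega)
  have h1 := hC.anti_le (Nat.zero_le i) (a := n - k - 1) (by omega)
  have h2 := hC.le_top (i := 0) hk (a := n - k - 1) (by omega)
  rw [show n - k - 1 + 1 = n - k by omega, hC.top i hi] at h
  omega

lemma NoFrozenFactor.ext {T T' : Tableau k n} (hk : 1 ≤ k) (hkn : k < n)
    (hT : T.NoFrozenFactor) (hT' : T'.NoFrozenFactor) {g : Idx k n → ℤ}
    (hg : T.IsTruncatedGVector g) (hg' : T'.IsTruncatedGVector g) : T = T' := by
  obtain ⟨h1, h2⟩ := hT.low_eq hk hkn hg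
  obtain ⟨h1', h2'⟩ := hT'.low_eq hk hkn hg'
  apply ext_low
  · omega
  · intro i hi a ha
    have := h1 i hi a (by omega)
    have := h1' i hi a (by omega)
    omega

/-- Every vector is the truncated g-vector of a tableau without frozen factors. -/
lemma exists_noFrozenFactor (hk : 1 ≤ k) (hkn : k < n) (g : Idx k n → ℤ) :
    ∃ T : Tableau k n, T.NoFrozenFactor ∧ T.IsTruncatedGVector g := by
  -- At a = n - k all rows take the value `size`, which is the value of row 0 at n - k - 1; this
  -- makes the last column tight with witness 0.
  set C : ℕ → ℕ → ℕ := fun i a =>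
    if i < k then (lowOf k n g (if a ≤ n - k - 1 then i else 0)
      (if a ≤ n - k - 1 then a else n - k - 1)).toNat else 0 with hCdef
  have hCZ : ∀ i < k, ∀ a ≤ n - k - 1, (C i a : ℤ) = lowOf k n g i a := by
    intro i hi a ha
    simp only [hCdef, if_pos hi, if_pos ha]
    exact Int.toNat_of_nonneg (lowOf_nonneg g hi ha)
  have hCtop : ∀ i < k, (C i (n - k) : ℤ) = size k n g := by
    intro i hi
    simp only [hCdef, if_pos hi, if_neg (show ¬ n - k ≤ n - k - 1 by omega)]
    exact Int.toNat_of_nonneg (lowOf_nonneg g hk le_rfl)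
  have hC0 : ∀ i a, k ≤ i → C i a = 0 := fun i a hi => if_neg (by omega)
  have hC : IsLowArray k (n - k) (size k n g).toNat C := by
    constructor
    · exact hC0
    · intro i hi
      have := hCtop i hi
      omega
    · intro i a ha
      by_cases hi : i < k
      · by_cases ha' : a + 1 ≤ n - k - 1
        · have h1 := hCZ i hi a (by omega)
          have h2 := hCZ i hi (a + 1) ha'
          have h3 : 0 ≤ colSlack k n g a i := slack_nonneg _ (by omega)
          rw [lowOf_succ] at h2
          omega
        · obtain rfl : a = n - k - 1 := by omega
          have h1 := hCZ i hi _ le_rfl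
          have h2 := hCtop i hi
          have h3 := lowOf_anti g hi le_rfl
          rw [show n - k - 1 + 1 = n - k by omega]
          rw [size] at h2
          omega
      · rw [hC0 i a (by omega)]
        exact Nat.zero_le _
    · intro i a ha
      by_cases hi : i + 1 < k
      · by_cases ha' : a ≤ n - k - 1
        · have h1 := hCZ i (by omega) a ha'
          have h2 := hCZ (i + 1) hi a ha'
          have h3 : 0 ≤ rowSlack k n g i a := slack_nonneg _ ha'
          rw [← lowOf_sub g (by omega) a] at h3
          omega
        · obtain rfl : a = n - k := by omega
          have h1 := hCtop i (by omega)
          have h2 := hCtop (i + 1) hi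
          omega
      · rw [hC0 (i + 1) a (by omega)]
        exact Nat.zero_le _
  have hlow := ofLow_low hkn.le hC
  refine ⟨ofLow hkn.le hC, noFrozenFactor_of_isTight hk hkn ⟨?_, ?_⟩, ?_⟩
  · intro i hi
    by_cases hi' : i + 1 < k
    · obtain ⟨a, ha, h⟩ := exists_slack_eq_zero (gRow k g i) (n - k - 1)
      have h1 := lowOf_sub g (i := i) (by omega) a
      have h2 := hCZ i hi a ha
      have h3 := hCZ (i + 1) hi' a ha
      refine ⟨a, by omega, ?_⟩
      rw [hlow _ (by omega), hlow _ (by omega)]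
      rw [rowSlack, h] at h1
      omega
    · refine ⟨0, by omega, ?_⟩
      rw [hlow _ (by omega), hlow _ (by omega), hC0 (i + 1) 0 (by omega)]
      obtain rfl : i = k - 1 := by omega
      have h2 := hCZ (k - 1) hi 0 (Nat.zero_le _)
      rw [lowOf_last] at h2
      omega
  · intro a ha
    by_cases ha' : a + 1 ≤ n - k - 1
    · obtain ⟨i, hi, h⟩ := exists_slack_eq_zero (fun i => -gRow k g i a) (k - 1)
      have h1 := lowOf_succ g i a
      have h2 := hCZ i (by omega) a (by omega)
      have h3 := hCZ i (by omega) (a + 1) ha'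
      refine ⟨i, by omega, ?_⟩
      rw [hlow _ (by omega), hlow _ (by omega)]
      rw [colSlack, h] at h1
      omega
    · obtain rfl : a = n - k - 1 := by omega
      refine ⟨0, hk, ?_⟩
      rw [hlow _ (by omega), hlow _ (by omega), show n - k - 1 + 1 = n - k by omega]
      have h1 := hCZ 0 hk _ le_rfl
      have h2 := hCtop 0 hk
      rw [size] at h2
      omega
  · rw [isTruncatedGVector_iff hkn.le]
    rintro ⟨⟨a, ha⟩, ⟨b, hb⟩⟩
    obtain ⟨i, hi⟩ : ∃ i, i = k - 2 - b := ⟨_, rfl⟩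
    simp only [← hi]
    rw [hlow _ (by omega), hlow _ (by omega), hlow _ (by omega), hlow _ (by omega),
      hCZ i (by omega) a (by omega), hCZ (i + 1) (by omega) a (by omega),
      hCZ i (by omega) (a + 1) (by omega), hCZ (i + 1) (by omega) (a + 1) (by omega),
      lowOf_sub g (by omega), lowOf_sub g (by omega), rowSlack, rowSlack, slack_succ,
      gRow_eq g (⟨a, ha⟩, ⟨b, hb⟩) rfl (by dsimp only; omega)]
    ring

end Tableau

end Reconstruction

/-! ### The braid group orbit of the stable fixed points -/

section Orbit

variable {k n : ℕ} {G : ℤ → ℤ → Idx k n → ℤ}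

/-- Euclid's algorithm: the generators σ_1, σ_2 and their inverses add or subtract one coordinate of
the slope to or from the other. The induction runs over |a| + |b| and ends at (0,±1) or (±1,0). -/
lemma SlopeModel.inBraidOrbit_of_isCoprime (M : SlopeModel k n G) (hk : 1 ≤ k) (hkn : k < n) :
    ∀ (m : ℕ) (a b : ℤ), a.natAbs + b.natAbs ≤ m → IsCoprime a b → ∀ T : Tableau k n,
      T.NoFrozenFactor → T.IsTruncatedGVector (G a b) → T.InBraidOrbit := by
  have h2 := M.two_lt
  set P : ℤ → ℤ → Prop := fun a b => ∀ T : Tableau k n,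
    T.NoFrozenFactor → T.IsTruncatedGVector (G a b) → T.InBraidOrbit with hP
  have hneg : ∀ a b, P (-a) (-b) → P a b := by
    intro a b h
    rwa [hP, M.neg] at h
  have hbase : P 0 1 := fun T hT hg =>
    .base ⟨hT, _, hg, M.base.2, 2, by omega, by omega, M.base.1⟩
  have hsigma : ∀ i, 1 ≤ i → i < k.gcd n → ∀ {a b a' b'},
      tropMap (GrTrop.sigmaInv i) (G a b) = G a' b' → P a b → P a' b' := by
    intro i hi hi' a b a' b' h hab T hT hg
    obtain ⟨T₀, hT₀, hg₀⟩ := Tableau.exists_noFrozenFactor hk hkn (G a b)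
    exact .sigma i hi hi' (hab T₀ hT₀ hg₀) ⟨hT, _, hg₀, h ▸ hg⟩
  have hsigmaInv : ∀ i, 1 ≤ i → i < k.gcd n → ∀ {a b a' b'},
      tropMap (GrTrop.sigma i) (G a b) = G a' b' → P a b → P a' b' := by
    intro i hi hi' a b a' b' h hab T hT hg
    obtain ⟨T₀, hT₀, hg₀⟩ := Tableau.exists_noFrozenFactor hk hkn (G a b)
    exact .sigmaInv i hi hi' (hab T₀ hT₀ hg₀) ⟨hT, _, hg₀, h ▸ hg⟩
  have s1 : ∀ a b, P a b → P (a + b) b := fun a b =>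
    hsigma 1 le_rfl (by omega) (M.sigmaInv_one a b)
  have s2 : ∀ a b, P a b → P a (b - a) := fun a b =>
    hsigma 2 (by omega) h2 (M.sigmaInv_two a b)
  have t1 : ∀ a b, P a b → P (a - b) b := fun a b =>
    hsigmaInv 1 le_rfl (by omega) (M.sigma_one a b)
  have t2 : ∀ a b, P a b → P a (b + a) := fun a b =>
    hsigmaInv 2 (by omega) h2 (M.sigma_two a b)
  -- The slope (1,0) is reached from (0,1) through (1,1).
  have hbase' : P 1 0 := s2 1 1 (s1 0 1 hbase)
  intro m
  induction m with
  | zero =>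
    intro a b hm h
    obtain ⟨rfl, rfl⟩ : a = 0 ∧ b = 0 := by omega
    exact absurd h not_isCoprime_zero_zero
  | succ m ih =>
    intro a b hm h
    by_cases ha : a = 0
    · subst ha
      rcases Int.isUnit_iff.mp (isCoprime_zero_left.mp h) with rfl | rfl
      · exact hbase
      · exact hneg 0 (-1) hbase
    by_cases hb : b = 0
    · subst hb
      rcases Int.isUnit_iff.mp (isCoprime_zero_right.mp h) with rfl | rfl
      · exact hbase'
      · exact hneg (-1) 0 hbase'
    by_cases hab : b.natAbs ≤ a.natAbs
    -- The larger coordinate is reduced by subtracting the smaller one if the signs agree and by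
    -- adding it otherwise.
    · by_cases hs : 0 < a ↔ 0 < b
      · have := s1 _ _ (ih (a - b) b (by omega)
          (isCoprime_of_det h 1 1 0 1 (by ring) (by ring)))
        rwa [sub_add_cancel] at this
      · have := t1 _ _ (ih (a + b) b (by omega)
          (isCoprime_of_det h 1 (-1) 0 1 (by ring) (by ring)))
        rwa [add_sub_cancel_right] at this
    · by_cases hs : 0 < a ↔ 0 < b
      · have := t2 _ _ (ih a (b - a) (by omega)
          (isCoprime_of_det h 1 0 1 1 (by ring) (by ring)))
        rwa [sub_add_cancel] at this
      · have := s2 _ _ (ih a (b + a) (by omega)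
          (isCoprime_of_det h 1 0 (-1) 1 (by ring) (by ring)))
        rwa [add_sub_cancel_right] at this

/-- Truncated g-vectors are unique, so the g-vector in each step of the orbit is the slope vector
found before, and the generators preserve coprime slopes. -/
lemma SlopeModel.exists_isCoprime (M : SlopeModel k n G) (hkn : k ≤ n) {T : Tableau k n}
    (hT : T.InBraidOrbit) :
    T.NoFrozenFactor ∧ ∃ a b, IsCoprime a b ∧ T.IsTruncatedGVector (G a b) := by
  induction hT with
  | base h =>
    obtain ⟨hT, g, hg, hgcd, i, hi, hi', hf⟩ := h
    obtain ⟨a, b, hab, rfl⟩ := M.stable i hi hi' g hgcd hf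
    exact ⟨hT, a, b, hab, hg⟩
  | sigma i hi hi' _ h ih =>
    obtain ⟨-, a, b, hab, hg⟩ := ih
    obtain ⟨hT, g, hg', hF⟩ := h
    obtain rfl := hg.unique hkn hg'
    obtain ⟨a', b', hab', h⟩ := M.sigmaInv i hi hi' a b hab
    exact ⟨hT, a', b', hab', h ▸ hF⟩
  | sigmaInv i hi hi' _ h ih =>
    obtain ⟨-, a, b, hab, hg⟩ := ih
    obtain ⟨hT, g, hg', hF⟩ := h
    obtain rfl := hg.unique hkn hg'
    obtain ⟨a', b', hab', h⟩ := M.sigma i hi hi' a b hab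
    exact ⟨hT, a', b', hab', h ▸ hF⟩

/-- Tableaux in the orbit correspond to coprime slopes up to sign. -/
lemma SlopeModel.encard_inBraidOrbit (M : SlopeModel k n G) (hk : 1 ≤ k) (hkn : k < n) {r : ℕ}
    {α : Type} (I : Finset α) (f : α → ℤ × ℤ)
    (hI : ∀ x ∈ I, IsCoprime (f x).1 (f x).2 ∧ size k n (G (f x).1 (f x).2) = r)
    (hcov : ∀ a b, IsCoprime a b → size k n (G a b) = r →
      ∃ x ∈ I, f x = (a, b) ∨ f x = (-a, -b))
    (hinj : ∀ x ∈ I, ∀ y ∈ I, G (f x).1 (f x).2 = G (f y).1 (f y).2 → x = y) :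
    {T : Tableau k n | T.cols = r ∧ T.InBraidOrbit}.encard = I.card := by
  choose τ hτ hτ' using fun x => Tableau.exists_noFrozenFactor hk hkn (G (f x).1 (f x).2)
  have hset : {T : Tableau k n | T.cols = r ∧ T.InBraidOrbit} = τ '' (I : Set α) := by
    ext T
    simp only [Set.mem_ofPred_eq, Set.mem_image, Finset.mem_coe]
    constructor
    · rintro ⟨hr, hT⟩
      obtain ⟨hT, a, b, hab, hg⟩ := M.exists_isCoprime hkn.le hT
      obtain ⟨x, hx, hfx⟩ := hcov a b hab (by rw [← (hT.low_eq hk hkn hg).2, hr])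
      refine ⟨x, hx, (hτ x).ext hk hkn hT (hτ' x) ?_⟩
      rcases hfx with hfx | hfx
      · rwa [hfx]
      · rwa [hfx, M.neg]
    · rintro ⟨x, hx, rfl⟩
      obtain ⟨hab, hr⟩ := hI x hx
      refine ⟨?_, M.inBraidOrbit_of_isCoprime hk hkn _ _ _ le_rfl hab _ (hτ x) (hτ' x)⟩
      have := ((hτ x).low_eq hk hkn (hτ' x)).2
      omega
  rw [hset, Set.InjOn.encard_image, Set.encard_coe_eq_coe_finsetCard]
  intro x hx y hy hxy
  refine hinj x hx y hy ((hτ' x).unique hkn.le ?_)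
  rw [hxy]
  exact hτ' y

end Orbit

/-! ### Slopes with a given number of columns -/

/-- The slack at position zero is the maximum of the partial sums. Each row and each column of the
g-vector contributes one such maximum, with the sign reversed for columns. -/
lemma size_eq {k n : ℕ} (g : Idx k n → ℤ) : size k n g =
    ∑ i ∈ Finset.range (k - 1), maxPartial (gRow k g i) (n - k - 1) +
      ∑ a ∈ Finset.range (n - k - 1), maxPartial (fun i => -gRow k g i a) (k - 1) := by
  simp [size, lowOf, rowSlack, colSlack, slack]

lemma size_idxVecFour {x11 x12 x13 x21 x22 x23 x31 x32 x33 e1 e2 e3 e4 e5 e6 : ℤ}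
    (h1 : max (max (max 0 x13) (x13 + x23)) (x13 + x23 + x33) = e1)
    (h2 : max (max (max 0 x12) (x12 + x22)) (x12 + x22 + x32) = e2)
    (h3 : max (max (max 0 x11) (x11 + x21)) (x11 + x21 + x31) = e3)
    (h4 : max (max (max 0 (-x13)) ((-x13) + (-x12))) ((-x13) + (-x12) + (-x11)) = e4)
    (h5 : max (max (max 0 (-x23)) ((-x23) + (-x22))) ((-x23) + (-x22) + (-x21)) = e5)
    (h6 : max (max (max 0 (-x33)) ((-x33) + (-x32))) ((-x33) + (-x32) + (-x31)) = e6) :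
    size 4 8 (idxVecFour x11 x12 x13 x21 x22 x23 x31 x32 x33) =
      (e1 + e2 + e3) + (e4 + e5 + e6) := by
  rw [size_eq, ← h1, ← h2, ← h3, ← h4, ← h5, ← h6]
  simp only [Nat.reduceSub, Finset.sum_range_succ, Finset.sum_range_zero, zero_add, maxPartial]
  rfl

lemma size_idxVecThree {x11 x12 x21 x22 x31 x32 x41 x42 x51 x52 e1 e2 e3 e4 e5 e6 e7 : ℤ}
    (h1 : max (max (max (max (max 0 x12) (x12 + x22)) (x12 + x22 + x32)) (x12 + x22 + x32 + x42))
      (x12 + x22 + x32 + x42 + x52) = e1)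
    (h2 : max (max (max (max (max 0 x11) (x11 + x21)) (x11 + x21 + x31)) (x11 + x21 + x31 + x41))
      (x11 + x21 + x31 + x41 + x51) = e2)
    (h3 : max (max 0 (-x12)) ((-x12) + (-x11)) = e3)
    (h4 : max (max 0 (-x22)) ((-x22) + (-x21)) = e4)
    (h5 : max (max 0 (-x32)) ((-x32) + (-x31)) = e5)
    (h6 : max (max 0 (-x42)) ((-x42) + (-x41)) = e6)
    (h7 : max (max 0 (-x52)) ((-x52) + (-x51)) = e7) :
    size 3 9 (idxVecThree x11 x12 x21 x22 x31 x32 x41 x42 x51 x52) =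
      (e1 + e2) + (e3 + e4 + e5 + e6 + e7) := by
  rw [size_eq, ← h1, ← h2, ← h3, ← h4, ← h5, ← h6, ← h7]
  simp only [Nat.reduceSub, Finset.sum_range_succ, Finset.sum_range_zero, zero_add, maxPartial]
  rfl

/-- On each cone the maxima of partial sums are linear in (a, b); the values e1, …, e6 are the
winning partial sums of the three rows and the three columns. -/
lemma size_slopeVecFour (a b : ℤ) : size 4 8 (slopeVecFour a b) = 2 * (|a| + |b|) := by
  have key : ∀ a b : ℤ, 0 ≤ b → size 4 8 (slopeVecFour a b) = 2 * (|a| + |b|) := by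
    intro a b hb
    rw [abs_of_nonneg hb]
    have h : (0 ≤ b ∧ b - a ≤ 0) ∨ (0 ≤ b - a ∧ -a ≤ 0) ∨ (0 ≤ -a ∧ -b - a ≤ 0) ∨
      (0 ≤ -b - a ∧ -b ≤ 0) := by omega
    rcases h with h | h | h | h
    · rw [slopeVecFour_cone0 h, size_idxVecFour (e1 := b) (e2 := a - b) (e3 := b) (e4 := b) (e5 := a) (e6 := 0) (by omega)
          (by omega) (by omega) (by omega) (by omega) (by omega), abs_of_nonneg (by omega : 0 ≤
          a)]
      omega
    · rw [slopeVecFour_cone1 h, size_idxVecFour (e1 := b) (e2 := 0) (e3 := a) (e4 := b) (e5 := a) (e6 := 0) (by omega) (by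
          omega) (by omega) (by omega) (by omega) (by omega), abs_of_nonneg (by omega : 0 ≤ a)]
      omega
    · rw [slopeVecFour_cone2 h, size_idxVecFour (e1 := b) (e2 := -a) (e3 := 0) (e4 := b) (e5 := 0) (e6 := -a) (by omega)
          (by omega) (by omega) (by omega) (by omega) (by omega), abs_of_nonpos (by omega : a ≤
          0)]
      omega
    · rw [slopeVecFour_cone3 h, size_idxVecFour (e1 := b) (e2 := -a) (e3 := 0) (e4 := b) (e5 := -a - b) (e6 := b) (by
          omega) (by omega) (by omega) (by omega) (by omega) (by omega), abs_of_nonpos (by omega :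
          a ≤ 0)]
      omega
  rcases le_total 0 b with hb | hb
  · exact key a b hb
  · rw [← slopeVecFour_neg, key _ _ (by omega), abs_neg, abs_neg]

/-- The same reading of maxima cone by cone, with two rows and five columns; their sum is three
times the hexagonal norm. -/
lemma size_slopeVecThree (a b : ℤ) :
    size 3 9 (slopeVecThree a b) = 3 * max (max |a| |b|) |a - b| := by
  have key : ∀ a b : ℤ, 0 ≤ b → size 3 9 (slopeVecThree a b) = 3 * max (max |a| |b|) |a - b| := by
    intro a b hb
    rw [abs_of_nonneg hb]
    have h : (0 ≤ b ∧ 2 * b - a ≤ 0) ∨ (0 ≤ 2 * b - a ∧ b - a ≤ 0) ∨ (0 ≤ b - a ∧ b - 2 * a ≤ 0) ∨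
      (0 ≤ b - 2 * a ∧ -a ≤ 0) ∨ (0 ≤ -a ∧ -b - a ≤ 0) ∨ (0 ≤ -b - a ∧ -b ≤ 0) := by omega
    rcases h with h | h | h | h | h | h
    · rw [slopeVecThree_cone0 h, size_idxVecThree (e1 := b) (e2 := a - b) (e3 := b) (e4 := a) (e5 := a - b) (e6 := 0) (e7
          := 0) (by omega) (by omega) (by omega) (by omega) (by omega) (by omega) (by omega),
          abs_of_nonneg (by omega : 0 ≤ a), abs_of_nonneg (by omega : 0 ≤ a - b)]
      omega
    · rw [slopeVecThree_cone1 h, size_idxVecThree (e1 := b) (e2 := a - b) (e3 := b) (e4 := a) (e5 := a - b) (e6 := 0) (e7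
          := 0) (by omega) (by omega) (by omega) (by omega) (by omega) (by omega) (by omega),
          abs_of_nonneg (by omega : 0 ≤ a), abs_of_nonneg (by omega : 0 ≤ a - b)]
      omega
    · rw [slopeVecThree_cone2 h, size_idxVecThree (e1 := b) (e2 := 0) (e3 := b) (e4 := a) (e5 := 0) (e6 := 0) (e7 := b - a)
          (by omega) (by omega) (by omega) (by omega) (by omega) (by omega) (by omega),
          abs_of_nonneg (by omega : 0 ≤ a), abs_of_nonpos (by omega : a - b ≤ 0)]
      omega
    · rw [slopeVecThree_cone3 h, size_idxVecThree (e1 := b) (e2 := 0) (e3 := b) (e4 := a) (e5 := 0) (e6 := b - 2 * a) (e7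
          := a) (by omega) (by omega) (by omega) (by omega) (by omega) (by omega) (by omega),
          abs_of_nonneg (by omega : 0 ≤ a), abs_of_nonpos (by omega : a - b ≤ 0)]
      omega
    · rw [slopeVecThree_cone4 h, size_idxVecThree (e1 := b) (e2 := -a) (e3 := b) (e4 := 0) (e5 := -2 * a) (e6 := b) (e7 :=
          0) (by omega) (by omega) (by omega) (by omega) (by omega) (by omega) (by omega),
          abs_of_nonpos (by omega : a ≤ 0), abs_of_nonpos (by omega : a - b ≤ 0)]
      omega
    · rw [slopeVecThree_cone5 h, size_idxVecThree (e1 := b) (e2 := -a) (e3 := b) (e4 := -a - b) (e5 := b - a) (e6 := b) (e7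
          := 0) (by omega) (by omega) (by omega) (by omega) (by omega) (by omega) (by omega),
          abs_of_nonpos (by omega : a ≤ 0), abs_of_nonpos (by omega : a - b ≤ 0)]
      omega
  rcases le_total 0 b with hb | hb
  · exact key a b hb
  · rw [← slopeVecThree_neg, key _ _ (by omega), abs_neg, abs_neg, neg_sub_neg, abs_sub_comm]

lemma idxVecFour_inj {x1 x2 x3 x4 x5 x6 x7 x8 x9 y1 y2 y3 y4 y5 y6 y7 y8 y9 : ℤ}
    (h : idxVecFour x1 x2 x3 x4 x5 x6 x7 x8 x9 = idxVecFour y1 y2 y3 y4 y5 y6 y7 y8 y9) :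
    x1 = y1 ∧ x2 = y2 ∧ x3 = y3 ∧ x4 = y4 ∧ x5 = y5 ∧ x6 = y6 ∧ x7 = y7 ∧ x8 = y8 ∧ x9 = y9 :=
  ⟨congrFun h (0, 0), congrFun h (0, 1), congrFun h (0, 2), congrFun h (1, 0), congrFun h (1, 1),
    congrFun h (1, 2), congrFun h (2, 0), congrFun h (2, 1), congrFun h (2, 2)⟩

lemma idxVecThree_inj {x1 x2 x3 x4 x5 x6 x7 x8 x9 x10 y1 y2 y3 y4 y5 y6 y7 y8 y9 y10 : ℤ}
    (h : idxVecThree x1 x2 x3 x4 x5 x6 x7 x8 x9 x10 =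
      idxVecThree y1 y2 y3 y4 y5 y6 y7 y8 y9 y10) :
    x1 = y1 ∧ x2 = y2 ∧ x3 = y3 ∧ x4 = y4 ∧ x5 = y5 ∧ x6 = y6 ∧ x7 = y7 ∧ x8 = y8 ∧ x9 = y9 ∧
      x10 = y10 :=
  ⟨congrFun h (0, 0), congrFun h (0, 1), congrFun h (1, 0), congrFun h (1, 1), congrFun h (2, 0),
    congrFun h (2, 1), congrFun h (3, 0), congrFun h (3, 1), congrFun h (4, 0),
    congrFun h (4, 1)⟩

/-- On every pair of cones the equality is a linear system; its solutions are equality of slopes or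
the pair (a,0), (-a,0) on the boundary line of the half plane. -/
lemma slopeVecFour_inj {a b a' b' : ℤ} (hb : 0 ≤ b) (hb' : 0 ≤ b')
    (h : slopeVecFour a b = slopeVecFour a' b') :
    (a = a' ∧ b = b') ∨ (b = 0 ∧ b' = 0 ∧ a' = -a) := by
  have hc : ∀ a b : ℤ, 0 ≤ b → (0 ≤ b ∧ b - a ≤ 0) ∨ (0 ≤ b - a ∧ -a ≤ 0) ∨
    (0 ≤ -a ∧ -b - a ≤ 0) ∨ (0 ≤ -b - a ∧ -b ≤ 0) := by omega
  rcases hc a b hb with c | c | c | c <;> rcases hc a' b' hb' with c' | c' | c' | c' <;>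
  · first
      | rw [slopeVecFour_cone0 c] at h
      | rw [slopeVecFour_cone1 c] at h
      | rw [slopeVecFour_cone2 c] at h
      | rw [slopeVecFour_cone3 c] at h
    first
      | rw [slopeVecFour_cone0 c'] at h
      | rw [slopeVecFour_cone1 c'] at h
      | rw [slopeVecFour_cone2 c'] at h
      | rw [slopeVecFour_cone3 c'] at h
    have := idxVecFour_inj h
    omega

lemma slopeVecThree_inj {a b a' b' : ℤ} (hb : 0 ≤ b) (hb' : 0 ≤ b')
    (h : slopeVecThree a b = slopeVecThree a' b') :
    (a = a' ∧ b = b') ∨ (b = 0 ∧ b' = 0 ∧ a' = -a) := by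
  have hc : ∀ a b : ℤ, 0 ≤ b → (0 ≤ b ∧ 2 * b - a ≤ 0) ∨ (0 ≤ 2 * b - a ∧ b - a ≤ 0) ∨
    (0 ≤ b - a ∧ b - 2 * a ≤ 0) ∨ (0 ≤ b - 2 * a ∧ -a ≤ 0) ∨ (0 ≤ -a ∧ -b - a ≤ 0) ∨
    (0 ≤ -b - a ∧ -b ≤ 0) := by omega
  rcases hc a b hb with c | c | c | c | c | c <;>
  rcases hc a' b' hb' with c' | c' | c' | c' | c' | c' <;>
  · first
      | rw [slopeVecThree_cone0 c] at h
      | rw [slopeVecThree_cone1 c] at h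
      | rw [slopeVecThree_cone2 c] at h
      | rw [slopeVecThree_cone3 c] at h
      | rw [slopeVecThree_cone4 c] at h
      | rw [slopeVecThree_cone5 c] at h
    first
      | rw [slopeVecThree_cone0 c'] at h
      | rw [slopeVecThree_cone1 c'] at h
      | rw [slopeVecThree_cone2 c'] at h
      | rw [slopeVecThree_cone3 c'] at h
      | rw [slopeVecThree_cone4 c'] at h
      | rw [slopeVecThree_cone5 c'] at h
    have := idxVecThree_inj h
    omega

/-! ### Counting coprime slopes on the square and the hexagon -/

/-- Residues coprime to `s` in `m` sectors. -/
def sectorResidues (m s : ℕ) : Finset (Fin m × ℕ) :=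
  Finset.univ ×ˢ (Finset.range s).filter s.Coprime

lemma card_sectorResidues (m s : ℕ) : (sectorResidues m s).card = m * s.totient := by
  rw [sectorResidues, Finset.card_product, Finset.card_univ, Fintype.card_fin, Nat.totient]

lemma mem_sectorResidues {m s : ℕ} {i : Fin m} {x : ℕ} :
    (i, x) ∈ sectorResidues m s ↔ x < s ∧ IsCoprime (s : ℤ) (x : ℤ) := by
  simp [sectorResidues, Nat.isCoprime_iff_coprime]

/-- Coprime slopes up to sign on the boundary of the square `|a| + |b| = s`. -/
def sectorFour (s : ℕ) (p : Fin 2 × ℕ) : ℤ × ℤ :=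
  if p.1 = 0 then (p.2, s - p.2) else (p.2 - s, p.2)

/-- Coprime slopes up to sign on the boundary of the hexagon `max |a| |b| |a - b| = s`. -/
def sectorThree (s : ℕ) (p : Fin 3 × ℕ) : ℤ × ℤ :=
  if p.1 = 0 then (s, p.2) else if p.1 = 1 then (s - p.2, s) else (-p.2, s - p.2)

lemma encard_orbit_four {r : ℕ} (hr : 1 ≤ r) :
    {T : Tableau 4 8 | T.cols = r ∧ T.InBraidOrbit}.encard =
      if 2 ∣ r then ((2 * Nat.totient (r / 2) : ℕ) : ℕ∞) else 0 := by
  have hsize : ∀ a b : ℤ, size 4 8 (slopeVecFour a b) = 2 * (max a (-a) + max b (-b)) :=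
    size_slopeVecFour
  split_ifs with h
  · obtain ⟨s, rfl⟩ := h
    rw [Nat.mul_div_cancel_left s two_pos, ← card_sectorResidues]
    -- Half of the square consists of two half-open sides, starting at (0,s) and (-s,0); this is why
    -- (-s,0) rather than (s,0) represents its class. On a side the remaining coordinate x is
    -- coprime to s exactly when the slope is primitive.
    have hcov : ∀ a b, 0 < b ∨ b = 0 ∧ a < 0 → IsCoprime a b →
        size 4 8 (slopeVecFour a b) = (2 * s : ℕ) →
        ∃ x ∈ sectorResidues 2 s, sectorFour s x = (a, b) := by
      intro a b hb hab h
      rw [hsize] at h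
      by_cases ha : 0 ≤ a
      · obtain ⟨x, rfl⟩ : ∃ x : ℕ, a = x := ⟨a.toNat, by omega⟩
        exact ⟨(0, x), mem_sectorResidues.mpr ⟨by omega,
          isCoprime_of_det hab 0 1 1 (-1) (by ring) (by omega)⟩,
          Prod.ext rfl (by change (s : ℤ) - x = b; omega)⟩
      · obtain ⟨x, rfl⟩ : ∃ x : ℕ, b = x := ⟨b.toNat, by omega⟩
        exact ⟨(1, x), mem_sectorResidues.mpr ⟨by omega,
          isCoprime_of_det hab (-1) 1 0 1 (by omega) (by ring)⟩,
          Prod.ext (by change (x : ℤ) - s = a; omega) rfl⟩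
    refine slopeModel_four.encard_inBraidOrbit (by norm_num) (by norm_num) _ (sectorFour s)
      ?_ ?_ ?_
    · rintro ⟨i, x⟩ hx
      obtain ⟨hx, hc⟩ := mem_sectorResidues.mp hx
      rw [hsize]
      fin_cases i
      · change IsCoprime (x : ℤ) (s - x) ∧
          2 * (max (x : ℤ) (-x) + max ((s : ℤ) - x) (-(s - x))) = _
        exact ⟨isCoprime_of_det hc 1 1 1 0 (by ring) (by ring), by omega⟩
      · change IsCoprime ((x : ℤ) - s) x ∧
          2 * (max ((x : ℤ) - s) (-(x - s)) + max (x : ℤ) (-x)) = _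
        exact ⟨isCoprime_of_det hc (-1) 1 0 1 (by ring) (by ring), by omega⟩
    · intro a b hab h
      by_cases hb : 0 < b ∨ b = 0 ∧ a < 0
      · obtain ⟨x, hx, hfx⟩ := hcov a b hb hab h
        exact ⟨x, hx, Or.inl hfx⟩
      -- The size formula with r ≥ 1 excludes (a, b) = (0, 0), so one of the two opposite slopes
      -- lies in the chosen half.
      · have h' := h
        rw [hsize] at h'
        obtain ⟨x, hx, hfx⟩ := hcov (-a) (-b) (by omega) hab.neg_neg
          (by rw [slopeVecFour_neg, h])
        exact ⟨x, hx, Or.inr hfx⟩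
    -- Inside the closed half plane the only coincidences are (a,0) and (-a,0), and just one of
    -- these is listed.
    · rintro ⟨i, x⟩ hx ⟨j, y⟩ hy h
      have hx := (mem_sectorResidues.mp hx).1
      have hy := (mem_sectorResidues.mp hy).1
      fin_cases i <;> fin_cases j <;> simp [sectorFour] at h ⊢ <;>
        have := slopeVecFour_inj (by omega) (by omega) h <;> omega
  · rw [Set.encard_eq_zero, Set.eq_empty_iff_forall_notMem]
    rintro T ⟨hr', hT⟩
    obtain ⟨hT, a, b, -, hg⟩ := slopeModel_four.exists_isCoprime (by norm_num) hT
    have := (hT.low_eq (by norm_num) (by norm_num) hg).2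
    rw [hsize] at this
    omega

lemma encard_orbit_three {r : ℕ} (hr : 1 ≤ r) :
    {T : Tableau 3 9 | T.cols = r ∧ T.InBraidOrbit}.encard =
      if 3 ∣ r then ((3 * Nat.totient (r / 3) : ℕ) : ℕ∞) else 0 := by
  have hsize : ∀ a b : ℤ, size 3 9 (slopeVecThree a b) =
      3 * max (max (max a (-a)) (max b (-b))) (max (a - b) (-(a - b))) :=
    size_slopeVecThree
  split_ifs with h
  · obtain ⟨s, rfl⟩ := h
    rw [Nat.mul_div_cancel_left s three_pos, ← card_sectorResidues]
    -- Half of the hexagon consists of three half-open sides starting at (s,0), (s,s) and (0,s), so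
    -- here (s,0) represents its class.
    have hcov : ∀ a b, 0 < b ∨ b = 0 ∧ 0 < a → IsCoprime a b →
        size 3 9 (slopeVecThree a b) = (3 * s : ℕ) →
        ∃ x ∈ sectorResidues 3 s, sectorThree s x = (a, b) := by
      intro a b hb hab h
      rw [hsize] at h
      by_cases ha : a ≤ 0
      · obtain ⟨x, rfl⟩ : ∃ x : ℕ, a = -x := ⟨(-a).toNat, by omega⟩
        exact ⟨(2, x), mem_sectorResidues.mpr ⟨by omega,
          isCoprime_of_det hab 0 (-1) 1 (-1) (by ring) (by omega)⟩,
          Prod.ext rfl (by change (s : ℤ) - x = b; omega)⟩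
      · by_cases hba : b < a
        · obtain ⟨x, rfl⟩ : ∃ x : ℕ, b = x := ⟨b.toNat, by omega⟩
          exact ⟨(0, x), mem_sectorResidues.mpr ⟨by omega,
            isCoprime_of_det hab 1 0 0 1 (by omega) (by ring)⟩,
            Prod.ext (by change (s : ℤ) = a; omega) rfl⟩
        · obtain ⟨x, rfl⟩ : ∃ x : ℕ, a = s - x := ⟨(s - a).toNat, by omega⟩
          exact ⟨(1, x), mem_sectorResidues.mpr ⟨by omega,
            isCoprime_of_det hab 1 (-1) 1 0 (by ring) (by omega)⟩,
            Prod.ext rfl (by change (s : ℤ) = b; omega)⟩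
    refine slopeModel_three.encard_inBraidOrbit (by norm_num) (by norm_num) _ (sectorThree s)
      ?_ ?_ ?_
    · rintro ⟨i, x⟩ hx
      obtain ⟨hx, hc⟩ := mem_sectorResidues.mp hx
      rw [hsize]
      fin_cases i
      · change IsCoprime (s : ℤ) x ∧ 3 * max (max (max (s : ℤ) (-s)) (max (x : ℤ) (-x)))
          (max ((s : ℤ) - x) (-(s - x))) = _
        exact ⟨hc, by omega⟩
      · change IsCoprime ((s : ℤ) - x) s ∧ 3 * max (max (max ((s : ℤ) - x) (-(s - x)))
          (max (s : ℤ) (-s))) (max ((s : ℤ) - x - s) (-(s - x - s))) = _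
        exact ⟨isCoprime_of_det hc 0 1 (-1) 1 (by ring) (by ring), by omega⟩
      · change IsCoprime (-(x : ℤ)) (s - x) ∧ 3 * max (max (max (-(x : ℤ)) (-(-x)))
          (max ((s : ℤ) - x) (-(s - x)))) (max (-(x : ℤ) - (s - x)) (-(-x - (s - x)))) = _
        exact ⟨isCoprime_of_det hc (-1) 1 (-1) 0 (by ring) (by ring), by omega⟩
    · intro a b hab h
      by_cases hb : 0 < b ∨ b = 0 ∧ 0 < a
      · obtain ⟨x, hx, hfx⟩ := hcov a b hb hab h
        exact ⟨x, hx, Or.inl hfx⟩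
      · have h' := h
        rw [hsize] at h'
        obtain ⟨x, hx, hfx⟩ := hcov (-a) (-b) (by omega) hab.neg_neg
          (by rw [slopeVecThree_neg, h])
        exact ⟨x, hx, Or.inr hfx⟩
    · rintro ⟨i, x⟩ hx ⟨j, y⟩ hy h
      have hx := (mem_sectorResidues.mp hx).1
      have hy := (mem_sectorResidues.mp hy).1
      fin_cases i <;> fin_cases j <;> simp [sectorThree] at h ⊢ <;>
        have := slopeVecThree_inj (by omega) (by omega) h <;> omega
  -- Every tableau in the orbit has a number of columns divisible by 3, by the size formula.
  · rw [Set.encard_eq_zero, Set.eq_empty_iff_forall_notMem]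
    rintro T ⟨hr', hT⟩
    obtain ⟨hT, a, b, -, hg⟩ := slopeModel_three.exists_isCoprime (by norm_num) hT
    have := (hT.low_eq (by norm_num) (by norm_num) hg).2
    rw [hsize] at this
    omega

end GrTrop

end

theorem mainTheorem5 :
    (∀ r : ℕ, 1 ≤ r →
      {T : GrTrop.Tableau 3 9 | T.cols = r ∧ T.InBraidOrbit}.encard =
        if 3 ∣ r then ((3 * Nat.totient (r / 3) : ℕ) : ℕ∞) else 0) ∧
    (∀ r : ℕ, 1 ≤ r →
      {T : GrTrop.Tableau 4 8 | T.cols = r ∧ T.InBraidOrbit}.encard =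
        if 2 ∣ r then ((2 * Nat.totient (r / 2) : ℕ) : ℕ∞) else 0) :=
  ⟨fun _ hr => GrTrop.encard_orbit_three hr, fun _ hr => GrTrop.encard_orbit_four hr⟩
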